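/- **Setting.** Let $\mathcal S\subseteq\mathbb R^n$ be closed, $\mathcal A$ finite, $\gamma\in(0,1)$, $r:\mathcal S\times\mathcal A\to[0,1]$ continuous in the state, $K\ge 2$, $\mathcal K=\{1,\dots,K\}$, and let $P_k(\cdot\,|\,s,a)$, $k\in\mathcal K$, be Markov kernels on $\mathcal S$ that are weakly continuous in $s$ for every $a$. Let $W\subseteq\Delta_{\mathcal K}$ be nonempty, closed and convex, and let the ambiguity set $\mathcal P$ consist of all Markov kernels $P$ such that for every $s$ there is $\mathrm w\in W$ with $P(\cdot|s,a)=\sum_k \mathrm w_kP_k(\cdot|s,a)$ for all $a$. Let $\Omega$ be the set of measurable maps $\omega:\mathcal S\to W$, and $P^\omega(\cdot|s,a)=\sum_k\omega(k|s)P_k(\cdot|s,a)$. Fix a measurable policy $\pi:\mathcal S\to\Delta_{\mathcal A}$. Let $V^P_\pi(s)=\mathbb E^P_\pi[\sum_{t\ge0}\gamma^tr(S_t,A_t)\,|\,S_0=s]$, $V_\pi=\inf_{P\in\mathcal P}V_\pi^P$, $V_\pi^\omega=V_\pi^{P^\omega}$, $Q_\pi^\omega(s,a,k)=r(s,a)+\gamma\int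 V_\pi^\omega\,dP_k(\cdot|s,a)$ and $Q_\pi=\inf_{\omega\in\Omega}Q_\pi^\omega$. Let $\phi:\mathcal Z=\mathcal S\times\mathcal A\times\mathcal K\to\mathbb R^d$, $d\ge1$, be measurable with $\|\phi\|_2\le1$, and $Q_\theta=\phi^\top\theta$. For $\omega\in\Omega$ let $\nu^\omega_\pi$ be the stationary law of the state process under $(\pi,\omega)$, and also of $Z=(S,A,k)$ with $S\sim\nu_\pi^\omega$ and, given $S$, independent $A\sim\pi(\cdot|S)$, $k\sim\omega(\cdot|S)$. Let $\Sigma^\omega=\int\phi\phi^\top d\nu^\omega_\pi$, and let $\theta_\pi^\omega$ solve the projected Bellman equation $\Pi_{L^2(\nu_\pi^\omega)}T_\pi^\omega Q_\theta=Q_\theta$, where $T^\omega_\pi Q(s,a,k)=r(s,a)+\gamma\int\sum_{a',k'}\pi(a'|s')\omega(k'|s')Q(s',a',k')P_k(ds'|s,a)$ and the projection is onto the span of the features. **Assumption.** There are $C>0$, $\rho\in(0,1)$ with $|\mathbb P_\pi^\omega(S_{t+1}\in\mathcal B\,|\,S_0=s)-\nu_\pi^\omega(\mathcal B)|\le C\rho^t$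 for all $\omega\in\Omega$, $s\in\mathcal S$, Borel $\mathcal B\subseteq\mathcal S$ and $t\ge0$; and $\Sigma^\omega\succ0$ for every $\omega\in\Omega$. **TD learning** (input $\omega$, start state $s_0$, parameters $\eta,T,\tau$). The sampler, started at a state $S_0$, draws for $i=0,\dots,\tau$: $K_i\sim\omega(\cdot|S_i)$, $A_i\sim\pi(\cdot|S_i)$, $S_{i+1}\sim P_{K_i}(\cdot|S_i,A_i)$, and returns $(Z_{\tau-1},Z_\tau)$ with $Z_i=(S_i,A_i,K_i)$. TD learning first draws a pair $\xi_{-1}=(Z_0,Z_1)$ with $S_0=s_0$ and sets $\theta_0=0$. For $t=0,\dots,T$ it starts the sampler at the state of the first component of $\xi_{t-1}$, obtains $\xi_t=(z_t,z_t')$ with $z_t=(s_t,a_t,k_t)$, and sets $$\theta_{t+1}=\theta_t-\eta\big(\phi(z_t)^\top\theta_t-r(s_t,a_t)-\gamma\phi(z_t')^\top\theta_t\big)\phi(z_t).$$ It returns $\phi^\top\theta_{T+1}$. **Dual averaging** (input $\omega^{(0)}\in\Omega$, $s_0$, $M$). For $m=0,\dots,M$: run TD learning with $\omega^{(m)}$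 and fresh samples to get $\hat Q_m$; put $\hat V_m(s)=\sum_{a,k}\omega^{(m)}(k|s)\pi(a|s)\hat Q_m(s,a,k)$, $\hat H_m(s,k)=\sum_a\pi(a|s)\hat Q_m(s,a,k)$ and $$\omega^{(m+1)}(\cdot|s)=\operatorname*{argmin}_{\mathrm w\in W}\ \sum_{i=0}^m\alpha_i\sum_k\mathrm w_k\hat H_i(s,k)+\lambda_m\sum_k\mathrm w_k\log\mathrm w_k .$$ Return $\hat V_\pi=\sum_{m=1}^M\vartheta_m\hat V_m$ and $\hat Q_\pi=\sum_{m=1}^M\vartheta_m\hat Q_m$ with $\vartheta_m=\alpha_m/\sum_{j=1}^M\alpha_j$. **Constants.** Let $R=\sup_{\omega\in\Omega}\|\theta_\pi^\omega\|_2$, $\varepsilon_{\rm approx}=\sup_{\omega\in\Omega}\|Q_{\theta_\pi^\omega}-Q_\pi^\omega\|_\infty$, $U=2R+1$, $B=R+1+\varepsilon_{\rm approx}$, $\bar B=B+\frac1{1-\gamma}$, $\mu=(1-\gamma)\inf_{\omega}\lambda_{\min}(\Sigma^\omega)$, $L=(1+\gamma)\sup_\omega\lambda_{\max}(\Sigma^\omega)$,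 $\tilde\mu=\mu-(1+\gamma)C\rho^\tau$, $J=R^2+U^2\tilde\mu^2/64+\varepsilon_{\rm approx}^2$, $$G=\max\Big\{2(1+\gamma)C(R^2+1),\ 4\sqrt{\log(8MT/\delta)}\,\big[(L+2)(R^2+1)+U(R+1)\big]\Big\},\qquad \nu=\min\Big\{\frac{\tilde\mu}{L^2+8},\frac1{2U},\frac1{4G}\Big\},$$ $$\mathcal C=\frac1{\tilde\mu^2\nu^2}\left(1+\Big(\frac{\bar B^2\log K}{(1-\gamma)^2}\log\Big(e+\frac{\bar B^2}{\delta(1-\gamma)^2\varepsilon^2}\Big)+J\delta\Big)\frac1{\varepsilon^2}\right),\qquad \Lambda=\log\Big(e+K+\bar B+\frac1\delta+\frac1\varepsilon+\frac1{\tilde\mu\nu}\Big).$$ **Theorem.** There are universal constants $c>0$ and $p\in\mathbb N$ such that in every such setting, for all $\delta\in(0,1)$ and all $\varepsilon>0$ with $\varepsilon\ge 8\varepsilon_{\rm approx}/(1-\gamma)$, there are positive integers $M,T,\tau_0$ with the following properties. (a) With $\tau=\tau_0$, the number of TD updates satisfies $(M+1)(T+1)\le c\,\Lambda^p\,\mathcal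 C$, and the number of samples that the algorithm draws from the generating kernels satisfies $$(M+1)\big(1+(T+1)(\tau_0+1)\big)\ \le\ c\,\Lambda^p\,\mathcal C/(1-\rho).$$ In particular the number of samples is $\widetilde{\mathcal O}(1/\varepsilon^2)$. (b) For every integer $\tau\ge\tau_0$ one has $\tau>-\log(\sqrt T)/\log\rho$, $\tau>(\log\mu-\log(C(1+\gamma)))/\log\rho$ and $T\le c\,\log^2\!\big(e+\frac{\bar B}{(1-\gamma)\varepsilon}\big)/(\nu^2\tilde\mu^2)$; and if dual averaging is run with $\alpha_m=\sqrt m$, $\lambda_m=\frac{(m+1)B}{2\sqrt{\log K}}$ and with TD learning with parameters $T$, $\tau$ and $\eta=\nu/\sqrt T$, then for every $\omega^{(0)}\in\Omega$ and every $s_0\in\mathcal S$, with probability at least $1-\delta$, $$|\hat V_\pi(s)-V_\pi(s)|\le\varepsilon\quad\text{and}\quad|\hat Q_\pi(s,a,k)-Q_\pi(s,a,k)|\le\varepsilon\qquad\text{for all }(s,a,k)\in\mathcal S\times\mathcal A\times\mathcal K .$$ -/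

import Mathlib

open MeasureTheory ProbabilityTheory
open scoped BigOperators

namespace RobustMDP

/-! ### Mixtures of kernels and randomized policies -/

section Mixtures

variable {X Y ι : Type*} [MeasurableSpace X] [MeasurableSpace Y] [Fintype ι]

/-- The kernel `x ↦ ∑ i, w x i • κ i x`. -/
noncomputable def mix (w : X → ι → ℝ) (hw : Measurable w) (κ : ι → Kernel X Y) : Kernel X Y where
  toFun x := ∑ i, ENNReal.ofReal (w x i) • κ i x
  measurable' := by
    refine Measure.measurable_of_measurable_coe _ fun B hB => ?_
    simp only [Measure.coe_finsetSum, Finset.sum_apply, Measure.smul_apply, smul_eq_mul]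
    refine Finset.measurable_sum _ fun i _ => ?_
    exact (((measurable_pi_apply i).comp hw).ennreal_ofReal).mul ((κ i).measurable_coe hB)

lemma mix_apply (w : X → ι → ℝ) (hw : Measurable w) (κ : ι → Kernel X Y) (x : X) :
    mix w hw κ x = ∑ i, ENNReal.ofReal (w x i) • κ i x := rfl

lemma isMarkovKernel_mix (w : X → ι → ℝ) (hw : Measurable w) (κ : ι → Kernel X Y)
    (hκ : ∀ i, IsMarkovKernel (κ i)) (h : ∀ x, w x ∈ stdSimplex ℝ ι) :
    IsMarkovKernel (mix w hw κ) := by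
  refine ⟨fun x => ⟨?_⟩⟩
  rw [mix_apply]
  simp only [Measure.coe_finsetSum, Finset.sum_apply, Measure.smul_apply, smul_eq_mul,
    measure_univ, mul_one]
  rw [← ENNReal.ofReal_sum_of_nonneg (fun i _ => (h x).1 i), (h x).2, ENNReal.ofReal_one]

/-- A Borel measurable randomized policy: a measurable map from `X` to a set `W` of weight
vectors on the finite set `ι`. -/
structure Policy (X ι : Type*) [MeasurableSpace X] (W : Set (ι → ℝ)) where
  prob : X → ι → ℝ
  measurable_prob : Measurable prob
  prob_mem : ∀ x, prob x ∈ W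

end Mixtures

/-! ### The entropy-regularized argmin -/

section Argmin

variable {K : ℕ}

/-- The regularized linear objective `⟨v, w⟩ + lam * h(w)`, where `h(w) = ∑ k, w k * log (w k)` is
the negative entropy. -/
noncomputable def regObjective (v : Fin K → ℝ) (lam : ℝ) (w : Fin K → ℝ) : ℝ :=
  ∑ k, w k * v k + lam * ∑ k, w k * Real.log (w k)

/-- The minimizer over `W` of `regObjective v lam`. -/
noncomputable def regArgmin (W : Set (Fin K → ℝ)) (v : Fin K → ℝ) (lam : ℝ) : Fin K → ℝ :=
  Classical.epsilon fun w => w ∈ W ∧ ∀ u ∈ W, regObjective v lam w ≤ regObjective v lam u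

lemma continuous_regObjective (lam : ℝ) :
    Continuous fun p : (Fin K → ℝ) × (Fin K → ℝ) => regObjective p.1 lam p.2 := by
  unfold regObjective
  refine Continuous.add (by fun_prop) (continuous_const.mul (continuous_finsetSum _ fun k _ => ?_))
  exact Real.continuous_mul_log.comp ((continuous_apply k).comp continuous_snd)

lemma isCompact_of_closed_simplex {W : Set (Fin K → ℝ)} (hc : IsClosed W)
    (hs : W ⊆ stdSimplex ℝ (Fin K)) : IsCompact W :=
  (isCompact_stdSimplex ℝ (Fin K)).of_isClosed_subset hc hs

lemma regArgmin_spec {W : Set (Fin K → ℝ)} (hc : IsClosed W) (hne : W.Nonempty)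
    (hs : W ⊆ stdSimplex ℝ (Fin K)) (v : Fin K → ℝ) (lam : ℝ) :
    regArgmin W v lam ∈ W ∧
      ∀ u ∈ W, regObjective v lam (regArgmin W v lam) ≤ regObjective v lam u := by
  have hex : ∃ w, w ∈ W ∧ ∀ u ∈ W, regObjective v lam w ≤ regObjective v lam u := by
    have hcont : Continuous (regObjective v lam) :=
      (continuous_regObjective lam).comp (Continuous.prodMk continuous_const continuous_id)
    obtain ⟨w, hw, hmin⟩ :=
      (isCompact_of_closed_simplex hc hs).exists_isMinOn hne hcont.continuousOn
    exact ⟨w, hw, fun u hu => hmin hu⟩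
  exact Classical.epsilon_spec hex

lemma regObjective_min_unique {W : Set (Fin K → ℝ)} (hconv : Convex ℝ W)
    (hs : W ⊆ stdSimplex ℝ (Fin K)) (v : Fin K → ℝ) {lam : ℝ} (hlam : 0 < lam)
    {w w' : Fin K → ℝ} (hw : w ∈ W) (hw' : w' ∈ W)
    (hm : ∀ u ∈ W, regObjective v lam w ≤ regObjective v lam u)
    (hm' : ∀ u ∈ W, regObjective v lam w' ≤ regObjective v lam u) : w = w' := by
  by_contra hne
  obtain ⟨j, hj⟩ : ∃ j, w j ≠ w' j := by
    by_contra hcon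
    push Not at hcon
    exact hne (funext hcon)
  set m : Fin K → ℝ := (1 / 2 : ℝ) • w + (1 / 2 : ℝ) • w' with hmdef
  have hmW : m ∈ W := hconv hw hw' (by norm_num) (by norm_num) (by norm_num)
  have hent : ∑ k, m k * Real.log (m k) <
      ∑ k, ((1 / 2 : ℝ) * (w k * Real.log (w k)) + (1 / 2 : ℝ) * (w' k * Real.log (w' k))) := by
    refine Finset.sum_lt_sum (fun k _ => ?_) ⟨j, Finset.mem_univ j, ?_⟩
    · have := Real.convexOn_mul_log.2 (show w k ∈ Set.Ici (0 : ℝ) from (hs hw).1 k)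
        (show w' k ∈ Set.Ici (0 : ℝ) from (hs hw').1 k)
        (show (0 : ℝ) ≤ 1 / 2 by norm_num) (show (0 : ℝ) ≤ 1 / 2 by norm_num) (by norm_num)
      simpa [hmdef, smul_eq_mul] using this
    · have := Real.strictConvexOn_mul_log.2 (show w j ∈ Set.Ici (0 : ℝ) from (hs hw).1 j)
        (show w' j ∈ Set.Ici (0 : ℝ) from (hs hw').1 j) hj
        (show (0 : ℝ) < 1 / 2 by norm_num) (show (0 : ℝ) < 1 / 2 by norm_num) (by norm_num)
      simpa [hmdef, smul_eq_mul] using this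
  have hlin : ∑ k, m k * v k = (1 / 2 : ℝ) * ∑ k, w k * v k + (1 / 2 : ℝ) * ∑ k, w' k * v k := by
    rw [Finset.mul_sum, Finset.mul_sum, ← Finset.sum_add_distrib]
    refine Finset.sum_congr rfl fun k _ => ?_
    simp only [hmdef, Pi.add_apply, Pi.smul_apply, smul_eq_mul]
    ring
  rw [Finset.sum_add_distrib, ← Finset.mul_sum, ← Finset.mul_sum] at hent
  have h1 := hm m hmW
  have h2 := hm' m hmW
  unfold regObjective at h1 h2
  have h3 := mul_lt_mul_of_pos_left hent hlam
  nlinarith [h1, h2, h3, hlin]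

lemma continuous_regArgmin {W : Set (Fin K → ℝ)} (hc : IsClosed W) (hconv : Convex ℝ W)
    (hne : W.Nonempty) (hs : W ⊆ stdSimplex ℝ (Fin K)) {lam : ℝ} (hlam : 0 < lam) :
    Continuous fun v => regArgmin W v lam := by
  have hcomp : CompactSpace W :=
    isCompact_iff_compactSpace.mp (isCompact_of_closed_simplex hc hs)
  rw [continuous_iff_isClosed]
  intro D hD
  set G : Set ((Fin K → ℝ) × W) :=
    {p | (p.2 : Fin K → ℝ) ∈ D ∧ ∀ u ∈ W, regObjective p.1 lam p.2 ≤ regObjective p.1 lam u}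
    with hG
  have hGc : IsClosed G := by
    have h1 : IsClosed {p : (Fin K → ℝ) × W | (p.2 : Fin K → ℝ) ∈ D} :=
      hD.preimage (continuous_subtype_val.comp continuous_snd)
    have h2 : IsClosed {p : (Fin K → ℝ) × W |
        ∀ u ∈ W, regObjective p.1 lam p.2 ≤ regObjective p.1 lam u} := by
      simp only [Set.ofPred_forall]
      refine isClosed_biInter fun u _ => isClosed_le ?_ ?_
      · exact (continuous_regObjective lam).comp
          (continuous_fst.prodMk (continuous_subtype_val.comp continuous_snd))
      · exact (continuous_regObjective lam).comp (continuous_fst.prodMk continuous_const)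
    exact h1.inter h2
  have himg : (fun v => regArgmin W v lam) ⁻¹' D = Prod.fst '' G := by
    ext v
    have hv := regArgmin_spec hc hne hs v lam
    constructor
    · intro hvD
      exact ⟨(v, ⟨_, hv.1⟩), ⟨hvD, hv.2⟩, rfl⟩
    · rintro ⟨⟨v', w⟩, ⟨hwD, hwm⟩, rfl⟩
      have : regArgmin W v' lam = w :=
        regObjective_min_unique hconv hs v' hlam hv.1 w.2 hv.2 hwm
      simpa [Set.mem_preimage, this] using hwD
  rw [himg]
  exact isClosedMap_fst_of_compactSpace G hGc

end Argmin

/-! ### Robust Markov decision processes with a mixture ambiguity set -/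

/-- A discounted MDP with reward `reward`, discount factor `discount`, generating kernels
`kernel k a = P_k(· | ·, a)` (Markov and weakly continuous in the state), and a closed convex
nonempty set `weights` of mixture weights. -/
structure Model (S A : Type*) (K : ℕ) [TopologicalSpace S] [MeasurableSpace S] where
  reward : S → A → ℝ
  discount : ℝ
  kernel : Fin K → A → Kernel S S
  weights : Set (Fin K → ℝ)
  reward_continuous : ∀ a, Continuous fun s => reward s a
  reward_mem : ∀ s a, reward s a ∈ Set.Icc (0 : ℝ) 1
  discount_pos : 0 < discount
  discount_lt_one : discount < 1
  kernel_markov : ∀ k a, IsMarkovKernel (kernel k a)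
  kernel_weakly_continuous : ∀ k a (f : BoundedContinuousFunction S ℝ),
    Continuous fun s => ∫ x, f x ∂(kernel k a s)
  weights_closed : IsClosed weights
  weights_convex : Convex ℝ weights
  weights_nonempty : weights.Nonempty
  weights_subset : weights ⊆ stdSimplex ℝ (Fin K)

section Values

variable {S A : Type*} {K : ℕ} [TopologicalSpace S] [MeasurableSpace S] [Fintype A]

/-- Controller's policies. -/
abbrev ControlPolicy (S A : Type*) [MeasurableSpace S] [Fintype A] := Policy S A (stdSimplex ℝ A)

/-- Nature's policies. -/
abbrev NaturePolicy (𝓜 : Model S A K) := Policy S (Fin K) 𝓜.weights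

/-- The transition kernel of the states `S_t` when the controller follows `π` and the transition
kernel of the MDP is `P`, with `P a s = P(· | s, a)`. -/
noncomputable def stateKernel (π : ControlPolicy S A) (P : A → Kernel S S) : Kernel S S :=
  mix π.prob π.measurable_prob P

/-- The value function `V_π^P(s) = ∑ t, γ ^ t * E[r(S_t, A_t) | S_0 = s]`. The law of `S_t` is the
`t`-th power of `stateKernel π P`, and `A_t` has law `π(· | S_t)` given `S_t`. -/
noncomputable def value (𝓜 : Model S A K) (π : ControlPolicy S A) (P : A → Kernel S S) (s : S) :
    ℝ :=
  ∑' t : ℕ, 𝓜.discount ^ t *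
    ∫ x, ∑ a, π.prob x a * 𝓜.reward x a ∂((stateKernel π P ^ t : Kernel S S) s)

/-- The mixture ambiguity set: the Markov kernels `P` such that for every state `s` there is a weight
vector `w ∈ W`, common to all actions, with `P(· | s, a) = ∑ k, w k * P_k(· | s, a)`. -/
def ambiguitySet (𝓜 : Model S A K) : Set (A → Kernel S S) :=
  {P | (∀ a, IsMarkovKernel (P a)) ∧
    ∀ s, ∃ w ∈ 𝓜.weights, ∀ a, P a s = ∑ k, ENNReal.ofReal (w k) • 𝓜.kernel k a s}

/-- The robust value function `V_π(s) = inf_{P ∈ 𝓟} V_π^P(s)`. -/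
noncomputable def robustValue (𝓜 : Model S A K) (π : ControlPolicy S A) (s : S) : ℝ :=
  ⨅ P : ambiguitySet 𝓜, value 𝓜 π P.1 s

/-- The kernel `P^ω(· | s, a) = ∑ k, ω(k | s) * P_k(· | s, a)`. -/
noncomputable def natureKernel (𝓜 : Model S A K) (ω : NaturePolicy 𝓜) (a : A) : Kernel S S :=
  mix ω.prob ω.measurable_prob fun k => 𝓜.kernel k a

/-- The joint action-value function `Q_π^ω`. -/
noncomputable def jointQ (𝓜 : Model S A K) (π : ControlPolicy S A) (ω : NaturePolicy 𝓜)
    (z : S × A × Fin K) : ℝ :=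
  𝓜.reward z.1 z.2.1 + 𝓜.discount *
    ∫ x, value 𝓜 π (natureKernel 𝓜 ω) x ∂(𝓜.kernel z.2.2 z.2.1 z.1)

/-- The robust joint action-value function `Q_π(z) = inf_ω Q_π^ω(z)`. -/
noncomputable def robustQ (𝓜 : Model S A K) (π : ControlPolicy S A) (z : S × A × Fin K) : ℝ :=
  ⨅ ω : NaturePolicy 𝓜, jointQ 𝓜 π ω z

/-- Uniform geometric ergodicity of the state process under all joint policies `(π, ω)`, where
`ν ω` is the stationary distribution of the states under `(π, ω)`. -/
def GeometricallyErgodic (𝓜 : Model S A K) (π : ControlPolicy S A) (C ρ : ℝ)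
    (ν : NaturePolicy 𝓜 → Measure S) : Prop :=
  ∀ ω : NaturePolicy 𝓜, IsProbabilityMeasure (ν ω) ∧
    Kernel.Invariant (stateKernel π (natureKernel 𝓜 ω)) (ν ω) ∧
    ∀ (s : S) (B : Set S), MeasurableSet B → ∀ t : ℕ,
      |((stateKernel π (natureKernel 𝓜 ω) ^ (t + 1) : Kernel S S) s).real B - (ν ω).real B|
        ≤ C * ρ ^ t

end Values

/-! ### Linear features and the projected Bellman equation -/

section Features

variable {S A : Type*} {K d : ℕ} [TopologicalSpace S] [MeasurableSpace S]
  [Fintype A] [MeasurableSpace A]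

/-- A measurable feature map `φ : S × A × [K] → ℝ^d` with Euclidean norm at most one. -/
structure FeatureMap (S A : Type*) (K d : ℕ) [MeasurableSpace S] [MeasurableSpace A] where
  feat : S × A × Fin K → EuclideanSpace ℝ (Fin d)
  measurable_feat : Measurable feat
  norm_feat_le : ∀ z, ‖feat z‖ ≤ 1

/-- `Q_θ(z) = φ(z)ᵀ θ`. -/
noncomputable def linQ (φ : FeatureMap S A K d) (θ : EuclideanSpace ℝ (Fin d))
    (z : S × A × Fin K) : ℝ :=
  inner ℝ (φ.feat z) θ

/-- Given `x` with state `g x`, draw independently `a ∼ π(· | g x)` and `k ∼ ω(· | x)` and return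
`(g x, a, k)`. -/
noncomputable def drawZ {X : Type*} [MeasurableSpace X] {W : Set (Fin K → ℝ)} (g : X → S)
    (hg : Measurable g) (π : ControlPolicy S A) (ω : Policy X (Fin K) W) :
    Kernel X (S × A × Fin K) :=
  mix (fun x (i : A × Fin K) => π.prob (g x) i.1 * ω.prob x i.2)
    (measurable_pi_lambda _ fun i =>
      ((measurable_pi_apply i.1).comp (π.measurable_prob.comp hg)).mul
        ((measurable_pi_apply i.2).comp ω.measurable_prob))
    fun i => Kernel.deterministic (fun x => (g x, i.1, i.2)) (hg.prodMk measurable_const)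

/-- The stationary measure of `Z_t = (S_t, A_t, K_t)` under `(π, ω)`, with state marginal `ν`. -/
noncomputable def stationaryZ (𝓜 : Model S A K) (π : ControlPolicy S A) (ω : NaturePolicy 𝓜)
    (ν : Measure S) : Measure (S × A × Fin K) :=
  ν.bind (drawZ id measurable_id π ω)

/-- The Bellman operator `T_π^ω`. -/
noncomputable def bellman (𝓜 : Model S A K) (π : ControlPolicy S A) (ω : NaturePolicy 𝓜)
    (Q : S × A × Fin K → ℝ) (z : S × A × Fin K) : ℝ :=
  𝓜.reward z.1 z.2.1 + 𝓜.discount *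
    ∫ x, ∑ a, ∑ k, π.prob x a * ω.prob x k * Q (x, a, k) ∂(𝓜.kernel z.2.2 z.2.1 z.1)

/-- `θ` solves the projected Bellman equation: `Q_θ` is the orthogonal projection in `L²(νZ)` of
`T_π^ω Q_θ` onto the span of the features. -/
def IsProjectedSolution (𝓜 : Model S A K) (φ : FeatureMap S A K d) (π : ControlPolicy S A)
    (ω : NaturePolicy 𝓜) (νZ : Measure (S × A × Fin K)) (θ : EuclideanSpace ℝ (Fin d)) : Prop :=
  ∀ θ' : EuclideanSpace ℝ (Fin d),
    ∫ z, (bellman 𝓜 π ω (linQ φ θ) z - linQ φ θ z) ^ 2 ∂νZ ≤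
      ∫ z, (bellman 𝓜 π ω (linQ φ θ) z - linQ φ θ' z) ^ 2 ∂νZ

/-- The solution `θ_π^ω` of the projected Bellman equation. -/
noncomputable def tdTarget (𝓜 : Model S A K) (φ : FeatureMap S A K d) (π : ControlPolicy S A)
    (ν : NaturePolicy 𝓜 → Measure S) (ω : NaturePolicy 𝓜) : EuclideanSpace ℝ (Fin d) :=
  Classical.epsilon (IsProjectedSolution 𝓜 φ π ω (stationaryZ 𝓜 π ω (ν ω)))

/-- The feature covariance matrix `Σ = ∫ φ(z) φ(z)ᵀ dν_π^ω(z)`. -/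
noncomputable def covariance (𝓜 : Model S A K) (φ : FeatureMap S A K d) (π : ControlPolicy S A)
    (ν : NaturePolicy 𝓜 → Measure S) (ω : NaturePolicy 𝓜) : Matrix (Fin d) (Fin d) ℝ :=
  Matrix.of fun i j => ∫ z, φ.feat z i * φ.feat z j ∂(stationaryZ 𝓜 π ω (ν ω))

end Features

/-! ### The constants -/

/-- The dual averaging stepsizes `α_m`. -/
noncomputable def alpha (m : ℕ) : ℝ := Real.sqrt m

/-- The numerical constants of a policy evaluation problem. -/
structure Consts where
  /-- number of generating kernels -/
  K : ℕ
  /-- discount factor -/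
  γ : ℝ
  /-- ergodicity constant -/
  C : ℝ
  /-- ergodicity rate -/
  ρ : ℝ
  /-- bound on the norms of the solutions of the projected Bellman equations -/
  R : ℝ
  /-- approximation error -/
  εapprox : ℝ
  /-- smallest eigenvalue of the covariances -/
  lamMin : ℝ
  /-- largest eigenvalue of the covariances -/
  lamMax : ℝ
  two_le_K : 2 ≤ K
  R_nonneg : 0 ≤ R
  εapprox_nonneg : 0 ≤ εapprox

namespace Consts

variable (q : Consts)

noncomputable def U : ℝ := 2 * q.R + 1

noncomputable def B : ℝ := q.R + 1 + q.εapprox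

noncomputable def Bbar : ℝ := q.B + 1 / (1 - q.γ)

noncomputable def mu : ℝ := q.lamMin * (1 - q.γ)

noncomputable def L : ℝ := q.lamMax * (1 + q.γ)

noncomputable def muTilde (τ : ℕ) : ℝ := q.mu - (1 + q.γ) * q.C * q.ρ ^ τ

noncomputable def G (M T : ℕ) (δ : ℝ) : ℝ :=
  max (2 * (1 + q.γ) * q.C * (q.R ^ 2 + 1))
    (4 * Real.sqrt (Real.log (8 * M * T / δ)) *
      ((q.L + 2) * (q.R ^ 2 + 1) + q.U * (q.R + 1)))

noncomputable def nu (M T τ : ℕ) (δ : ℝ) : ℝ :=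
  min (q.muTilde τ / (q.L ^ 2 + 8)) (min (1 / (2 * q.U)) (1 / (4 * q.G M T δ)))

/-- The TD stepsize `η`. -/
noncomputable def eta (M T τ : ℕ) (δ : ℝ) : ℝ := q.nu M T τ δ / Real.sqrt T

/-- The second moment bound `J` for the TD estimator. -/
noncomputable def J (τ : ℕ) : ℝ := q.R ^ 2 + q.U ^ 2 * q.muTilde τ ^ 2 / 64 + q.εapprox ^ 2

/-- The regularization parameters `λ_m`. -/
noncomputable def lam (m : ℕ) : ℝ := (m + 1) * q.B / (2 * Real.sqrt (Real.log q.K))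

lemma lam_pos (m : ℕ) : 0 < q.lam m := by
  have hK : (1 : ℝ) < q.K := by exact_mod_cast q.two_le_K
  have hB : 0 < q.B := by
    have h1 := q.R_nonneg
    have h2 := q.εapprox_nonneg
    unfold B
    linarith
  have hs : 0 < Real.sqrt (Real.log q.K) := Real.sqrt_pos.mpr (Real.log_pos hK)
  unfold lam
  positivity

/-- The leading term of the sample complexity. -/
noncomputable def complexity (M T τ : ℕ) (δ ε : ℝ) : ℝ :=
  (1 + (q.Bbar ^ 2 * Real.log q.K / (1 - q.γ) ^ 2 *
      Real.log (Real.exp 1 + q.Bbar ^ 2 / (δ * (1 - q.γ) ^ 2 * ε ^ 2)) + q.J τ * δ) / ε ^ 2) /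
    (q.muTilde τ ^ 2 * q.nu M T τ δ ^ 2)

/-- The logarithmic factor. -/
noncomputable def logFactor (M T τ : ℕ) (δ ε : ℝ) : ℝ :=
  Real.log (Real.exp 1 + q.K + q.Bbar + 1 / δ + 1 / ε + 1 / (q.muTilde τ * q.nu M T τ δ))

end Consts

/-- The constants attached to the evaluation of `π`. -/
noncomputable def evalConsts {S A : Type*} {K d : ℕ} [TopologicalSpace S] [MeasurableSpace S]
    [Fintype A] [MeasurableSpace A] (𝓜 : Model S A K) (φ : FeatureMap S A K d)
    (π : ControlPolicy S A) (ν : NaturePolicy 𝓜 → Measure S) (C ρ : ℝ) (hK : 2 ≤ K) : Consts where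
  K := K
  γ := 𝓜.discount
  C := C
  ρ := ρ
  R := ⨆ ω : NaturePolicy 𝓜, ‖tdTarget 𝓜 φ π ν ω‖
  εapprox := ⨆ ω : NaturePolicy 𝓜, ⨆ z : S × A × Fin K,
    |linQ φ (tdTarget 𝓜 φ π ν ω) z - jointQ 𝓜 π ω z|
  lamMin := ⨅ ω : NaturePolicy 𝓜, sInf (spectrum ℝ (covariance 𝓜 φ π ν ω))
  lamMax := ⨆ ω : NaturePolicy 𝓜, sSup (spectrum ℝ (covariance 𝓜 φ π ν ω))
  two_le_K := hK
  R_nonneg := Real.iSup_nonneg fun _ => norm_nonneg _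
  εapprox_nonneg := Real.iSup_nonneg fun _ => Real.iSup_nonneg fun _ => abs_nonneg _

/-! ### Temporal difference learning

All kernels below carry a parameter in a measurable space `H`; in stochastic dual averaging this is
the history of the earlier estimates, on which nature's current policy depends. -/

section TD

variable {S A : Type*} {K d : ℕ} [TopologicalSpace S] [MeasurableSpace S]
  [Fintype A] [MeasurableSpace A] {H : Type*} [MeasurableSpace H]

/-- The kernel `(s, a, k) ↦ P_k(· | s, a)`: one sample from a generating kernel. -/
noncomputable def transition [DiscreteMeasurableSpace A] (𝓜 : Model S A K) :
    Kernel (S × A × Fin K) S where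
  toFun z := 𝓜.kernel z.2.2 z.2.1 z.1
  measurable' :=
    measurable_from_prod_countable_left fun i => (𝓜.kernel i.2 i.1).measurable

variable [DiscreteMeasurableSpace A]

/-- From `(h, s)` draw `a ∼ π(· | s)` and `k ∼ ω(· | h, s)`, and return `(h, (s, a, k))`. -/
noncomputable def chainInit (𝓜 : Model S A K) (π : ControlPolicy S A)
    (ω : Policy (H × S) (Fin K) 𝓜.weights) : Kernel (H × S) (H × (S × A × Fin K)) :=
  Kernel.deterministic Prod.fst measurable_fst ×ₖ drawZ Prod.snd measurable_snd π ω

/-- One step `Z_i ↦ Z_{i+1}` of the Markov process `Z_i = (S_i, A_i, K_i)`. -/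
noncomputable def chainStep (𝓜 : Model S A K) (π : ControlPolicy S A)
    (ω : Policy (H × S) (Fin K) 𝓜.weights) :
    Kernel (H × (S × A × Fin K)) (H × (S × A × Fin K)) :=
  chainInit 𝓜 π ω ∘ₖ (Kernel.id ∥ₖ transition 𝓜)

/-- The law of the pair `(Z_{τ-1}, Z_τ)` returned by the Markov sampler started at the state `s`. -/
noncomputable def markovSampler (𝓜 : Model S A K) (π : ControlPolicy S A)
    (ω : Policy (H × S) (Fin K) 𝓜.weights) (τ : ℕ) :
    Kernel (H × S) ((S × A × Fin K) × (S × A × Fin K)) :=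
  (Kernel.deterministic Prod.snd measurable_snd ×ₖ
      (chainStep 𝓜 π ω).map Prod.snd) ∘ₖ
    ((chainStep 𝓜 π ω ^ (τ - 1) : Kernel _ _) ∘ₖ chainInit 𝓜 π ω)

/-- The stochastic operator `F̂(θ, (z, z'))`. -/
noncomputable def tdOperator (𝓜 : Model S A K) (φ : FeatureMap S A K d)
    (θ : EuclideanSpace ℝ (Fin d)) (ξ : (S × A × Fin K) × (S × A × Fin K)) :
    EuclideanSpace ℝ (Fin d) :=
  (linQ φ θ ξ.1 - 𝓜.reward ξ.1.1 ξ.1.2.1 - 𝓜.discount * linQ φ θ ξ.2) • φ.feat ξ.1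

/-- One TD iteration on `(h, (ξ, θ))`: run the Markov sampler from the state of the first
component of `ξ` to obtain the new pair `ξ'`, and set `θ' = θ - η F̂(θ, ξ')`. -/
noncomputable def tdStep (𝓜 : Model S A K) (φ : FeatureMap S A K d) (π : ControlPolicy S A)
    (ω : Policy (H × S) (Fin K) 𝓜.weights) (η : ℝ) (τ : ℕ) :
    Kernel (H × ((S × A × Fin K) × (S × A × Fin K)) × EuclideanSpace ℝ (Fin d))
      (H × ((S × A × Fin K) × (S × A × Fin K)) × EuclideanSpace ℝ (Fin d)) :=
  (Kernel.id ×ₖ ((markovSampler 𝓜 π ω τ).comap (fun x => (x.1, x.2.1.1.1)) (by fun_prop))).map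
    fun y => (y.1.1, y.2, y.1.2.2 - η • tdOperator 𝓜 φ y.1.2.2 y.2)

/-- TD learning started at the state `s₀` with `θ₀ = 0`: the law of `θ_{T+1}`, where the initial
pair is `(Z_0, Z_1)` with `S_0 = s₀` and the iterations are `t = 0, …, T`. -/
noncomputable def tdKernel (𝓜 : Model S A K) (φ : FeatureMap S A K d) (π : ControlPolicy S A)
    (ω : Policy (H × S) (Fin K) 𝓜.weights) (s₀ : S) (η : ℝ) (T τ : ℕ) :
    Kernel H (EuclideanSpace ℝ (Fin d)) :=
  ((tdStep 𝓜 φ π ω η τ ^ (T + 1) : Kernel _ _) ∘ₖ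
    (Kernel.id ×ₖ ((markovSampler 𝓜 π ω 1).comap (fun h => (h, s₀)) (by fun_prop))).map
      fun y => (y.1, y.2, (0 : EuclideanSpace ℝ (Fin d)))).map fun x => x.2.2

end TD

/-! ### Stochastic dual averaging -/

section SPDA

variable {S A : Type*} {K d : ℕ} [MeasurableSpace S] [Fintype A] [MeasurableSpace A]

/-- The history of the estimates: `h m` is the parameter of `Q̂_m = φᵀ (h m)`. -/
abbrev History (d : ℕ) := ℕ → EuclideanSpace ℝ (Fin d)

/-- `Ĥ_m(s, k) = ∑ a, π(a | s) Q̂_m(s, a, k)`. -/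
noncomputable def hHat (φ : FeatureMap S A K d) (π : ControlPolicy S A) (h : History d) (m : ℕ)
    (s : S) (k : Fin K) : ℝ :=
  ∑ a, π.prob s a * linQ φ (h m) (s, a, k)

lemma measurable_hHat (φ : FeatureMap S A K d) (π : ControlPolicy S A) (m : ℕ) (k : Fin K) :
    Measurable fun x : History d × S => hHat φ π x.1 m x.2 k := by
  unfold hHat linQ
  refine Finset.measurable_sum _ fun a _ => Measurable.mul ?_ ?_
  · exact (measurable_pi_apply a).comp (π.measurable_prob.comp measurable_snd)
  · refine Measurable.inner ?_ ?_
    · exact φ.measurable_feat.comp (measurable_snd.prodMk measurable_const)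
    · exact (measurable_pi_apply m).comp measurable_fst

variable [TopologicalSpace S]

/-- Nature's iterates: `ω⁽⁰⁾ = ω₀`, and `ω⁽ᵐ⁺¹⁾(· | s)` is the minimizer over `w ∈ W` of
`∑_{i ≤ m} α_i ∑ k, w k * Ĥ_i(s, k) + λ_m ∑ k, w k * log (w k)`. -/
noncomputable def spdaPolicy (𝓜 : Model S A K) (φ : FeatureMap S A K d) (π : ControlPolicy S A)
    (ω₀ : NaturePolicy 𝓜) (α lam : ℕ → ℝ) (hlam : ∀ m, 0 < lam m) :
    ℕ → Policy (History d × S) (Fin K) 𝓜.weights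
  | 0 =>
    { prob := fun x => ω₀.prob x.2
      measurable_prob := ω₀.measurable_prob.comp measurable_snd
      prob_mem := fun x => ω₀.prob_mem x.2 }
  | m + 1 =>
    { prob := fun x => regArgmin 𝓜.weights
        (fun k => ∑ i ∈ Finset.range (m + 1), α i * hHat φ π x.1 i x.2 k) (lam m)
      measurable_prob := by
        refine (continuous_regArgmin 𝓜.weights_closed 𝓜.weights_convex 𝓜.weights_nonempty
          𝓜.weights_subset (hlam m)).measurable.comp (measurable_pi_lambda _ fun k => ?_)
        exact Finset.measurable_sum _ fun i _ => (measurable_hHat φ π i k).const_mul (α i)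
      prob_mem := fun x => (regArgmin_spec 𝓜.weights_closed 𝓜.weights_nonempty
        𝓜.weights_subset _ _).1 }

/-- The normalized averaging weights `ϑ_m`. -/
noncomputable def avgWeight (α : ℕ → ℝ) (M m : ℕ) : ℝ := α m / ∑ j ∈ Finset.Icc 1 M, α j

/-- The output `V̂_π = ∑_{m=1}^M ϑ_m V̂_m`. -/
noncomputable def vHat (𝓜 : Model S A K) (φ : FeatureMap S A K d) (π : ControlPolicy S A)
    (ω₀ : NaturePolicy 𝓜) (α lam : ℕ → ℝ) (hlam : ∀ m, 0 < lam m) (M : ℕ) (h : History d)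
    (s : S) : ℝ :=
  ∑ m ∈ Finset.Icc 1 M, avgWeight α M m *
    ∑ a, ∑ k, (spdaPolicy 𝓜 φ π ω₀ α lam hlam m).prob (h, s) k * π.prob s a *
      linQ φ (h m) (s, a, k)

/-- The output `Q̂_π = ∑_{m=1}^M ϑ_m Q̂_m`. -/
noncomputable def qHat (φ : FeatureMap S A K d) (α : ℕ → ℝ) (M : ℕ) (h : History d)
    (z : S × A × Fin K) : ℝ :=
  ∑ m ∈ Finset.Icc 1 M, avgWeight α M m * linQ φ (h m) z

variable [DiscreteMeasurableSpace A]

/-- Iteration `m`: run TD learning for `(π, ω⁽ᵐ⁾)` with fresh samples and record its output. -/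
noncomputable def spdaStep (𝓜 : Model S A K) (φ : FeatureMap S A K d) (π : ControlPolicy S A)
    (ω₀ : NaturePolicy 𝓜) (α lam : ℕ → ℝ) (hlam : ∀ m, 0 < lam m) (s₀ : S) (η : ℝ) (T τ : ℕ)
    (m : ℕ) : Kernel (History d) (History d) :=
  (Kernel.id ×ₖ tdKernel 𝓜 φ π (spdaPolicy 𝓜 φ π ω₀ α lam hlam m) s₀ η T τ).map
    fun y => Function.update y.1 m y.2

/-- The law of the estimates produced in the iterations `0, …, M`. -/
noncomputable def spdaLaw (𝓜 : Model S A K) (φ : FeatureMap S A K d) (π : ControlPolicy S A)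
    (ω₀ : NaturePolicy 𝓜) (α lam : ℕ → ℝ) (hlam : ∀ m, 0 < lam m) (s₀ : S) (η : ℝ) (T τ : ℕ) :
    ℕ → Measure (History d)
  | 0 => (Measure.dirac 0).bind (spdaStep 𝓜 φ π ω₀ α lam hlam s₀ η T τ 0)
  | m + 1 => (spdaLaw 𝓜 φ π ω₀ α lam hlam s₀ η T τ m).bind
      (spdaStep 𝓜 φ π ω₀ α lam hlam s₀ η T τ (m + 1))

/-- Samples drawn from the generating kernels by one call of the Markov sampler: one in each pass
of its loop `i = 0, …, τ`. -/
def samplerDraws (τ : ℕ) : ℕ := ∑ _i ∈ Finset.range (τ + 1), 1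

/-- Samples drawn by TD learning: one for the initial pair, then one call of the Markov sampler in
each iteration `t = 0, …, T`. -/
def tdDraws (T τ : ℕ) : ℕ := 1 + ∑ _t ∈ Finset.range (T + 1), samplerDraws τ

/-- Samples drawn by stochastic dual averaging: one run of TD learning in each iteration
`m = 0, …, M`. -/
def spdaDraws (M T τ : ℕ) : ℕ := ∑ _m ∈ Finset.range (M + 1), tdDraws T τ

end SPDA

end RobustMDP

/-! Nature faces a discounted control problem whose one-step cost is linear in the weight vector,
and the ambiguity set constrains each state separately. Hence a measurable policy `ω'` of nature
solves the robust Bellman equation (`exists_isOptimalNature`), and `V_π`, `Q_π` are its ordinary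
value functions. The performance difference identity `jointQ_sub_jointQ` writes `Q^{ω_m} - Q^{ω'}`
as the integral of `∑ k, (ω_m - ω')(k|s) H^{ω_m}(s,k)` against the discounted occupation measure of
`ω'`. That measure does not depend on `m`, so the average over `m` can be taken under the integral,
state by state, where it is the regret of entropic dual averaging, of order `B √(log K) / √M`
(`dualAveraging_regret`, `spda_regret`).

Regret is measured with the estimates and not with the true action values. The errors `h_m -
θ^{ω_m}` of the TD runs enter only through weighted averages over `m` of inner products with vectors
that are known before run `m`. So no single run has to be accurate. Given the past, its error needs
a very small bias and a subgaussian exponential moment of moderate size; the averaging over `M` runs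
does the rest (`spdaPrefix_exists_lt_average_le`). The bias decays geometrically along a run, so `T`
is a squared logarithm over `(μ̃ν)²`, while `M` is of order `1/ε²` up to logarithms. The product has
the claimed order.

For one run, the mean TD operator is affine with a strongly monotone linear part, so a mean step
contracts the distance to `θ^ω` by `√(1 - ημ)`. With stationary samples, and with the noise switched
off outside a ball of radius `R + 1`, exponential moments propagate by induction
(`lintegral_exp_perturbedKernel_pow`). A dimension-free inequality for `cosh` of the norm shows that
the ball is hardly ever left. Actual samples differ from stationary ones by `C ρ^(τ-2)` in total
variation. Both replacements are charged to the failure probability (`lintegral_tdStep_pow_le`).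

Uniformity over `z` comes from a net of `(N+1)^d` cells in feature space. The factor `d` in its
logarithm is harmless, because the stepsize is of order at most `μ` and `d μ ≤ 1`, a trace bound
(`dim_mul_variance_le`). Between net points, `Q̂` is Lipschitz in the features and `Q_π` is within
`ε_approx` of a function that is.

The constants also need care. Each `Σ^ω` is positive definite, but a bound uniform in `ω` is
required. It follows from the existence of a policy of nature that minimizes a long run average
(`exists_min_average`) and from compactness of the sphere. Measurability in the history of the
stationary laws and of `θ^ω` is obtained by writing both as limits. -/

namespace RobustMDP

/-! ### Negative entropy on the simplex and measurable linear minimizers -/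

section Entropy

variable {K : ℕ}

lemma entropy_nonpos {w : Fin K → ℝ} (hw : w ∈ stdSimplex ℝ (Fin K)) :
    ∑ k, w k * Real.log (w k) ≤ 0 := by
  refine Finset.sum_nonpos fun k _ => ?_
  have h1 : w k ≤ 1 := by
    rw [← hw.2]
    exact Finset.single_le_sum (fun i _ => hw.1 i) (Finset.mem_univ k)
  exact mul_nonpos_of_nonneg_of_nonpos (hw.1 k) (Real.log_nonpos (hw.1 k) h1)

lemma neg_log_le_entropy {w : Fin K → ℝ} (hw : w ∈ stdSimplex ℝ (Fin K)) :
    -Real.log K ≤ ∑ k, w k * Real.log (w k) := by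
  rcases Nat.eq_zero_or_pos K with rfl | hK
  · simp
  have hK' : (0 : ℝ) < K := by exact_mod_cast hK
  -- This is `1 - 1/x ≤ log x` at `x = K * w k`. The left sides sum to zero.
  have key : ∀ k, w k - 1 / K ≤ w k * Real.log (w k) + w k * Real.log K := by
    intro k
    rcases (hw.1 k).eq_or_lt with h | h
    · rw [← h]; simp
    · have := Real.one_sub_inv_le_log_of_pos (mul_pos h hK')
      rw [Real.log_mul h.ne' hK'.ne'] at this
      have h2 := mul_le_mul_of_nonneg_left this h.le
      have h3 : w k * (1 - (w k * K)⁻¹) = w k - 1 / K := by field_simp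
      rw [h3] at h2
      linarith
  have := Finset.sum_le_sum fun k (_ : k ∈ Finset.univ) => key k
  rw [Finset.sum_sub_distrib, Finset.sum_add_distrib, ← Finset.sum_mul, hw.2] at this
  simp only [Finset.sum_const, Finset.card_univ, Fintype.card_fin, nsmul_eq_mul] at this
  have h4 : (K : ℝ) * (1 / K) = 1 := by field_simp
  linarith

/-- A lower bound of the relative entropy by the squared `ℓ¹` distance. -/
lemma sq_sum_abs_sub_le_relEntropy {p m : Fin K → ℝ} (hp : p ∈ stdSimplex ℝ (Fin K))
    (hm : m ∈ stdSimplex ℝ (Fin K)) (hac : ∀ k, m k = 0 → p k = 0) :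
    (∑ k, |p k - m k|) ^ 2 ≤ 4 * ∑ k, (p k * Real.log (p k) - p k * Real.log (m k)) := by
  -- The relative entropy dominates the squared Hellinger distance, by `log x ≤ x - 1` at `x =
  -- √m/√p`. Cauchy-Schwarz on `|p - m| = |√p - √m| (√p + √m)` then reaches `ℓ¹`, with twice the
  -- constant of Pinsker's inequality.
  have h1 : ∀ k, (Real.sqrt (p k) - Real.sqrt (m k)) ^ 2 ≤
      p k * Real.log (p k) - p k * Real.log (m k) + (m k - p k) := by
    intro k
    have hpk := Real.sq_sqrt (hp.1 k)
    have hmk := Real.sq_sqrt (hm.1 k)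
    rcases (hp.1 k).eq_or_lt with h | h
    · rw [← h]; simp [hmk]
    · have hm0 : 0 < m k := lt_of_le_of_ne (hm.1 k) fun h0 => h.ne' (hac k h0.symm)
      have hx : 0 < Real.sqrt (m k) / Real.sqrt (p k) :=
        div_pos (Real.sqrt_pos.2 hm0) (Real.sqrt_pos.2 h)
      have hlog := Real.log_le_sub_one_of_pos hx
      rw [Real.log_div (Real.sqrt_pos.2 hm0).ne' (Real.sqrt_pos.2 h).ne', Real.log_sqrt hm0.le,
        Real.log_sqrt h.le] at hlog
      have h2 := mul_le_mul_of_nonneg_left hlog (hp.1 k)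
      have h3 : p k * (Real.sqrt (m k) / Real.sqrt (p k) - 1) =
          Real.sqrt (p k) * Real.sqrt (m k) - p k := by
        have hs := (Real.sqrt_pos.2 h).ne'
        field_simp
        linear_combination (-Real.sqrt (m k)) * hpk
      rw [h3] at h2
      nlinarith
  have h2 : ∑ k, (Real.sqrt (p k) - Real.sqrt (m k)) ^ 2 ≤
      ∑ k, (p k * Real.log (p k) - p k * Real.log (m k)) := by
    have := Finset.sum_le_sum fun k (_ : k ∈ Finset.univ) => h1 k
    rw [Finset.sum_add_distrib, Finset.sum_sub_distrib (f := m), hp.2, hm.2] at this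
    linarith
  have h3 : ∑ k, (Real.sqrt (p k) + Real.sqrt (m k)) ^ 2 ≤ 4 := by
    have : ∀ k, (Real.sqrt (p k) + Real.sqrt (m k)) ^ 2 ≤ 2 * p k + 2 * m k := fun k => by
      nlinarith [Real.sq_sqrt (hp.1 k), Real.sq_sqrt (hm.1 k),
        sq_nonneg (Real.sqrt (p k) - Real.sqrt (m k))]
    refine (Finset.sum_le_sum fun k _ => this k).trans ?_
    rw [Finset.sum_add_distrib, ← Finset.mul_sum, ← Finset.mul_sum, hp.2, hm.2]
    norm_num
  have h4 : ∀ k, |p k - m k| =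
      |Real.sqrt (p k) - Real.sqrt (m k)| * (Real.sqrt (p k) + Real.sqrt (m k)) := by
    intro k
    rw [← abs_of_nonneg (add_nonneg (Real.sqrt_nonneg (p k)) (Real.sqrt_nonneg (m k))), ← abs_mul]
    congr 1
    nlinarith [Real.sq_sqrt (hp.1 k), Real.sq_sqrt (hm.1 k)]
  calc (∑ k, |p k - m k|) ^ 2
      ≤ (∑ k, |Real.sqrt (p k) - Real.sqrt (m k)| ^ 2) *
          ∑ k, (Real.sqrt (p k) + Real.sqrt (m k)) ^ 2 := by
        simp only [h4]; exact Finset.sum_mul_sq_le_sq_mul_sq _ _ _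
    _ ≤ (∑ k, |Real.sqrt (p k) - Real.sqrt (m k)| ^ 2) * 4 :=
        mul_le_mul_of_nonneg_left h3 (Finset.sum_nonneg fun _ _ => sq_nonneg _)
    _ ≤ _ := by simp only [sq_abs]; linarith

/-- The Jensen gap at the midpoint is the mean of the relative entropies of `p` and `q` with respect
to `m`, and each has `ℓ¹` distance `‖p - q‖₁ / 2` to `m`. This form of strong convexity needs no
derivative at the boundary of the simplex. -/
lemma entropy_midpoint_le {p q : Fin K → ℝ} (hp : p ∈ stdSimplex ℝ (Fin K))
    (hq : q ∈ stdSimplex ℝ (Fin K)) :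
    let m : Fin K → ℝ := (1 / 2 : ℝ) • p + (1 / 2 : ℝ) • q
    ∑ k, m k * Real.log (m k) + (∑ k, |p k - q k|) ^ 2 / 16 ≤
      (1 / 2 : ℝ) * ∑ k, p k * Real.log (p k) + (1 / 2 : ℝ) * ∑ k, q k * Real.log (q k) := by
  intro m
  have hm : m ∈ stdSimplex ℝ (Fin K) :=
    convex_stdSimplex ℝ (Fin K) hp hq (by norm_num) (by norm_num) (by norm_num)
  have hmk : ∀ k, m k = (1 / 2) * p k + (1 / 2) * q k := fun k => rfl
  have h1 := sq_sum_abs_sub_le_relEntropy hp hm fun k hk => by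
    have := hp.1 k; have := hq.1 k; have := hmk k; linarith
  have h2 := sq_sum_abs_sub_le_relEntropy hq hm fun k hk => by
    have := hp.1 k; have := hq.1 k; have := hmk k; linarith
  have e1 : ∀ k, |p k - m k| = (1 / 2) * |p k - q k| := fun k => by
    rw [hmk, ← abs_of_pos (show (0 : ℝ) < 1 / 2 by norm_num), ← abs_mul]
    congr 1; rw [abs_of_pos (show (0 : ℝ) < 1 / 2 by norm_num)]; ring
  have e2 : ∀ k, |q k - m k| = (1 / 2) * |p k - q k| := fun k => by
    rw [abs_sub_comm (p k), hmk, ← abs_of_pos (show (0 : ℝ) < 1 / 2 by norm_num), ← abs_mul]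
    congr 1; rw [abs_of_pos (show (0 : ℝ) < 1 / 2 by norm_num)]; ring
  simp only [e1, e2, ← Finset.mul_sum, Finset.sum_sub_distrib] at h1 h2
  have h3 : ∑ k, m k * Real.log (m k) =
      (1 / 2) * ∑ k, p k * Real.log (m k) + (1 / 2) * ∑ k, q k * Real.log (m k) := by
    rw [Finset.mul_sum, Finset.mul_sum, ← Finset.sum_add_distrib]
    exact Finset.sum_congr rfl fun k _ => by rw [hmk k]; ring
  rw [h3]
  nlinarith

variable {W : Set (Fin K → ℝ)}

/-- Quadratic growth of the regularized objective around its minimizer. -/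
lemma regArgmin_growth (hc : IsClosed W) (hconv : Convex ℝ W) (hne : W.Nonempty)
    (hs : W ⊆ stdSimplex ℝ (Fin K)) (v : Fin K → ℝ) {lam : ℝ} (hlam : 0 ≤ lam) {u : Fin K → ℝ}
    (hu : u ∈ W) :
    regObjective v lam (regArgmin W v lam) +
      lam / 8 * (∑ k, |u k - regArgmin W v lam k|) ^ 2 ≤ regObjective v lam u := by
  obtain ⟨hw, hmin⟩ := regArgmin_spec hc hne hs v lam
  set w := regArgmin W v lam
  -- Minimality is tested at the midpoint of `u` and `w`. The gap `lam / 16` there doubles to `lam /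
  -- 8`.
  have h1 := hmin _ (hconv hu hw (a := 1 / 2) (b := 1 / 2) (by norm_num) (by norm_num) (by norm_num))
  have h2 := mul_le_mul_of_nonneg_left (entropy_midpoint_le (hs hu) (hs hw)) hlam
  have hlin : ∑ k, ((1 / 2 : ℝ) • u + (1 / 2 : ℝ) • w) k * v k =
      (1 / 2 : ℝ) * ∑ k, u k * v k + (1 / 2 : ℝ) * ∑ k, w k * v k := by
    rw [Finset.mul_sum, Finset.mul_sum, ← Finset.sum_add_distrib]
    refine Finset.sum_congr rfl fun k _ => ?_
    simp only [Pi.add_apply, Pi.smul_apply, smul_eq_mul]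
    ring
  unfold regObjective at h1 ⊢
  rw [hlin] at h1
  nlinarith

/-- A Borel measurable selector of the minimizers of linear functions over `W`. -/
lemma exists_measurable_linear_argmin (hc : IsClosed W) (hconv : Convex ℝ W) (hne : W.Nonempty)
    (hs : W ⊆ stdSimplex ℝ (Fin K)) :
    ∃ sel : (Fin K → ℝ) → Fin K → ℝ, Measurable sel ∧ ∀ v, sel v ∈ W ∧
      ∀ u ∈ W, ∑ k, sel v k * v k ≤ ∑ k, u k * v k := by
  have hcpt := isCompact_of_closed_simplex hc hs
  have hreg0 : ∀ v w : Fin K → ℝ, regObjective v 0 w = ∑ k, w k * v k := fun v w => by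
    simp [regObjective]
  -- With entropic weight `1/(n+1)` the minimizer is continuous in `v`. As the weight vanishes it
  -- tends to the minimizer of `∑ w log w` on the optimal face, so the selector is a pointwise limit
  -- of continuous maps.
  let g : ℕ → (Fin K → ℝ) → Fin K → ℝ := fun n v => regArgmin W v (1 / ((n : ℝ) + 1))
  have hlim : ∀ v, ∃ w, Filter.Tendsto (fun n => g n v) Filter.atTop (nhds w) ∧ w ∈ W ∧
      ∀ u ∈ W, ∑ k, w k * v k ≤ ∑ k, u k * v k := by
    intro v
    let F : Set (Fin K → ℝ) := {w | w ∈ W ∧ ∀ u ∈ W, ∑ k, w k * v k ≤ ∑ k, u k * v k}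
    have hcl : ∀ b : ℝ, IsClosed {w : Fin K → ℝ | ∑ k, w k * v k ≤ b} := fun b =>
      isClosed_le (by fun_prop) continuous_const
    have hFc : IsClosed F := by
      have : F = W ∩ ⋂ u ∈ W, {w : Fin K → ℝ | ∑ k, w k * v k ≤ ∑ k, u k * v k} := by
        ext w; simp [F]
      rw [this]
      exact hc.inter (isClosed_biInter fun u _ => hcl _)
    have hFs : F ⊆ W := fun w hw => hw.1
    have hFconv : Convex ℝ F := by
      intro x hx y hy a b ha hb hab
      refine ⟨hconv hx.1 hy.1 ha hb hab, fun u hu => ?_⟩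
      have e : ∑ k, (a • x + b • y) k * v k = a * ∑ k, x k * v k + b * ∑ k, y k * v k := by
        rw [Finset.mul_sum, Finset.mul_sum, ← Finset.sum_add_distrib]
        refine Finset.sum_congr rfl fun k _ => ?_
        simp only [Pi.add_apply, Pi.smul_apply, smul_eq_mul]; ring
      rw [e]
      have h1 := mul_le_mul_of_nonneg_left (hx.2 u hu) ha
      have h2 := mul_le_mul_of_nonneg_left (hy.2 u hu) hb
      calc _ ≤ a * ∑ k, u k * v k + b * ∑ k, u k * v k := add_le_add h1 h2
        _ = _ := by rw [← add_mul, hab, one_mul]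
    have hFne : F.Nonempty := by
      obtain ⟨h1, h2⟩ := regArgmin_spec hc hne hs v 0
      exact ⟨_, h1, fun u hu => by simpa [hreg0] using h2 u hu⟩
    obtain ⟨hwF, hwmin⟩ := regArgmin_spec hFc hFne (hFs.trans hs) 0 1
    refine ⟨regArgmin F 0 1, ?_, hwF.1, hwF.2⟩
    have hobj : ∀ u : Fin K → ℝ, regObjective 0 1 u = ∑ k, u k * Real.log (u k) := fun u => by
      simp [regObjective]
    refine hcpt.tendsto_nhds_of_unique_mapClusterPt
      (Filter.Eventually.of_forall fun n => (regArgmin_spec hc hne hs v _).1) fun x hxW hx => ?_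
    have hpos : ∀ n : ℕ, (0 : ℝ) < 1 / ((n : ℝ) + 1) := fun n => by positivity
    -- The entropy term lies between `-λ log K` and `0`, so `g n v` is optimal for the linear
    -- objective up to `λ log K`.
    have hxF : x ∈ F := by
      refine ⟨hxW, fun u hu => ?_⟩
      refine le_of_forall_pos_le_add fun e he => ?_
      refine (hcl (∑ k, u k * v k + e)).mem_of_mapClusterPt hx ?_
      have hl : Filter.Tendsto (fun n : ℕ => 1 / ((n : ℝ) + 1) * Real.log K) Filter.atTop
          (nhds (0 * Real.log K)) := tendsto_one_div_add_atTop_nhds_zero_nat.mul_const _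
      rw [zero_mul] at hl
      filter_upwards [hl.eventually (ge_mem_nhds he)] with n hn
      have h1 := (regArgmin_spec hc hne hs v (1 / ((n : ℝ) + 1))).2 u hu
      unfold regObjective at h1
      have h2 := mul_le_mul_of_nonneg_left (entropy_nonpos (hs hu)) (hpos n).le
      have h3 := mul_le_mul_of_nonneg_left
        (neg_log_le_entropy (hs (regArgmin_spec hc hne hs v (1 / ((n : ℝ) + 1))).1)) (hpos n).le
      show ∑ k, g n v k * v k ≤ _
      simp only [g]
      linarith
    -- Here `g n v` is optimal for the regularized objective and the point of `F` for the linear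
    -- one. Subtracting and dividing by the weight compares their entropies.
    have hxe : regObjective 0 1 x ≤ regObjective 0 1 (regArgmin F 0 1) := by
      have hcl2 : IsClosed {w : Fin K → ℝ | regObjective 0 1 w ≤
          regObjective 0 1 (regArgmin F 0 1)} :=
        isClosed_le ((continuous_regObjective 1).comp
          (Continuous.prodMk continuous_const continuous_id)) continuous_const
      refine hcl2.mem_of_mapClusterPt hx (Filter.Eventually.of_forall fun n => ?_)
      have hn := regArgmin_spec hc hne hs v (1 / ((n : ℝ) + 1))
      have h1 := hn.2 _ hwF.1
      have h2 := hwF.2 _ hn.1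
      show regObjective 0 1 (g n v) ≤ _
      rw [hobj, hobj]
      unfold regObjective at h1
      exact le_of_mul_le_mul_left (by simp only [g]; linarith) (hpos n)
    exact regObjective_min_unique hFconv (hFs.trans hs) 0 one_pos hxF hwF
      (fun u hu => hxe.trans (hwmin u hu)) hwmin
  choose sel hsel using hlim
  refine ⟨sel, ?_, fun v => (hsel v).2⟩
  refine measurable_of_tendsto_metrizable (f := g) (fun n => ?_)
    (tendsto_pi_nhds.2 fun v => (hsel v).1)
  exact (continuous_regArgmin hc hconv hne hs (by positivity)).measurable

end Entropy

/-! ### Two-sided regret of entropic dual averaging -/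

section DualAveraging

variable {K : ℕ} {W : Set (Fin K → ℝ)}

/-- Quadratic growth charges `lam / 8 * D ^ 2` for moving the minimizer by `D` in `ℓ¹`, while the
move gains at most `b * D` on the new loss; the net gain is at most `2 * b ^ 2 / lam`. Raising the
weight lowers the objective by at most `(lam' - lam) * log K`. -/
lemma regObjective_argmin_step (hc : IsClosed W) (hconv : Convex ℝ W) (hne : W.Nonempty)
    (hs : W ⊆ stdSimplex ℝ (Fin K)) (L l : Fin K → ℝ) {lam lam' b : ℝ} (hlam : 0 < lam)
    (hl : lam ≤ lam') (hb : ∀ k, |l k| ≤ b) :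
    regObjective L lam (regArgmin W L lam) + ∑ k, regArgmin W L lam k * l k
        - (lam' - lam) * Real.log K - 2 * b ^ 2 / lam ≤
      regObjective (fun k => L k + l k) lam' (regArgmin W (fun k => L k + l k) lam') := by
  obtain ⟨hw', -⟩ := regArgmin_spec hc hne hs (fun k => L k + l k) lam'
  have hg := regArgmin_growth hc hconv hne hs L hlam.le hw'
  set w := regArgmin W L lam
  set w' := regArgmin W (fun k => L k + l k) lam'
  set D := ∑ k, |w' k - w k|
  have h1 : ∑ k, w k * l k - ∑ k, w' k * l k ≤ b * D := by
    rw [← Finset.sum_sub_distrib, Finset.mul_sum]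
    refine Finset.sum_le_sum fun k _ => ?_
    calc w k * l k - w' k * l k ≤ |(w' k - w k) * l k| := by
          rw [abs_mul, ← neg_sub, neg_le_iff_add_nonneg, ← abs_mul]
          have := neg_abs_le ((w' k - w k) * l k); linarith
      _ ≤ b * |w' k - w k| := by
          rw [abs_mul, mul_comm]; exact mul_le_mul_of_nonneg_right (hb k) (abs_nonneg _)
  have h2 := mul_le_mul_of_nonneg_left (neg_log_le_entropy (hs hw')) (sub_nonneg.2 hl)
  have h3 : b * D - lam / 8 * D ^ 2 ≤ 2 * b ^ 2 / lam := by
    rw [le_div_iff₀ hlam]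
    nlinarith [sq_nonneg (lam * D - 4 * b)]
  have h4 : ∑ k, w' k * (L k + l k) = ∑ k, w' k * L k + ∑ k, w' k * l k := by
    rw [← Finset.sum_add_distrib]; exact Finset.sum_congr rfl fun k _ => by ring
  unfold regObjective at hg ⊢
  rw [h4]
  linarith

/-- The old minimizer competes in the new problem, and its entropy term is nonpositive, so a larger
weight only helps. -/
lemma regObjective_argmin_step_le (hc : IsClosed W) (hne : W.Nonempty)
    (hs : W ⊆ stdSimplex ℝ (Fin K)) (L l : Fin K → ℝ) {lam lam' : ℝ}
    (hl : lam ≤ lam') :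
    regObjective (fun k => L k + l k) lam' (regArgmin W (fun k => L k + l k) lam') ≤
      regObjective L lam (regArgmin W L lam) + ∑ k, regArgmin W L lam k * l k := by
  obtain ⟨hw, -⟩ := regArgmin_spec hc hne hs L lam
  have h1 := (regArgmin_spec hc hne hs (fun k => L k + l k) lam').2 _ hw
  refine h1.trans ?_
  set w := regArgmin W L lam
  have h2 := mul_nonpos_of_nonneg_of_nonpos (sub_nonneg.2 hl) (entropy_nonpos (hs hw))
  have h4 : ∑ k, w k * (L k + l k) = ∑ k, w k * L k + ∑ k, w k * l k := by
    rw [← Finset.sum_add_distrib]; exact Finset.sum_congr rfl fun k _ => by ring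
  unfold regObjective
  rw [h4]
  linarith

/-- Regret bounds, from both sides, for entropic dual averaging over `W`. -/
lemma dualAveraging_regret (hc : IsClosed W) (hconv : Convex ℝ W) (hne : W.Nonempty)
    (hs : W ⊆ stdSimplex ℝ (Fin K)) (l : ℕ → Fin K → ℝ) (lam b : ℕ → ℝ) (hlam : ∀ m, 0 < lam m)
    (hmono : Monotone lam) (l0 : l 0 = 0) (w : ℕ → Fin K → ℝ)
    (hw : ∀ m, w (m + 1) = regArgmin W (fun k => ∑ i ∈ Finset.range (m + 1), l i k) (lam m))
    (M : ℕ) (hb : ∀ m < M, ∀ k, |l (m + 1) k| ≤ b m) :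
    (∀ u ∈ W, ∑ m ∈ Finset.range M, ∑ k, w (m + 1) k * l (m + 1) k ≤
        ∑ k, u k * ∑ m ∈ Finset.range M, l (m + 1) k + lam M * Real.log K +
          ∑ m ∈ Finset.range M, 2 * b m ^ 2 / lam m) ∧
    ∃ u ∈ W, ∑ k, u k * ∑ m ∈ Finset.range M, l (m + 1) k - lam M * Real.log K ≤
      ∑ m ∈ Finset.range M, ∑ k, w (m + 1) k * l (m + 1) k := by
  set L : ℕ → Fin K → ℝ := fun m k => ∑ i ∈ Finset.range (m + 1), l i k with hL
  have hLs : ∀ m, L (m + 1) = fun k => L m k + l (m + 1) k := fun m => by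
    funext k; simp only [hL]; rw [Finset.sum_range_succ]
  -- The optimal regularized value serves as potential: its increment is the loss of the current
  -- iterate up to the one-step errors, so both bounds telescope.
  set Φ : ℕ → ℝ := fun m => regObjective (L m) (lam m) (regArgmin W (L m) (lam m)) with hΦ
  have hL0 : L 0 = 0 := by funext k; simp [hL, l0]
  have hlogK : 0 ≤ Real.log K := Real.log_natCast_nonneg K
  have hup : ∀ N ≤ M, Φ 0 + ∑ m ∈ Finset.range N, ∑ k, w (m + 1) k * l (m + 1) k -
      (lam N - lam 0) * Real.log K - ∑ m ∈ Finset.range N, 2 * b m ^ 2 / lam m ≤ Φ N := by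
    intro N
    induction N with
    | zero => simp
    | succ N ih =>
      intro hN
      have h1 := ih (by omega)
      have h2 := regObjective_argmin_step hc hconv hne hs (L N) (l (N + 1)) (hlam N)
        (hmono N.le_succ) (hb N (by omega))
      rw [Finset.sum_range_succ, Finset.sum_range_succ, hw N]
      simp only [hΦ] at h1 ⊢
      rw [hLs N]
      simp only [hL, Nat.succ_eq_add_one] at h1 h2 ⊢
      linarith
  have hlow : ∀ N, Φ N ≤ Φ 0 + ∑ m ∈ Finset.range N, ∑ k, w (m + 1) k * l (m + 1) k := by
    intro N
    induction N with
    | zero => simp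
    | succ N ih =>
      have h2 := regObjective_argmin_step_le hc hne hs (L N) (l (N + 1))
        (hmono N.le_succ)
      rw [Finset.sum_range_succ, hw N]
      simp only [hΦ] at ih ⊢
      rw [hLs N]
      simp only [hL, Nat.succ_eq_add_one] at ih h2 ⊢
      linarith
  have hLM : ∀ k, ∑ m ∈ Finset.range M, l (m + 1) k = L M k := fun k => by
    simp only [hL]; rw [Finset.sum_range_succ']; simp [l0]
  have hreg0 : ∀ (a : ℝ) (u : Fin K → ℝ), regObjective 0 a u = a * ∑ k, u k * Real.log (u k) := fun a u => by
    simp [regObjective]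
  obtain ⟨h0, -⟩ := regArgmin_spec hc hne hs (L 0) (lam 0)
  obtain ⟨hM1, hM2⟩ := regArgmin_spec hc hne hs (L M) (lam M)
  simp only [hLM]
  constructor
  · intro u hu
    have h1 := hup M le_rfl
    have h2 := hM2 u hu
    have h3 : -(lam 0 * Real.log K) ≤ Φ 0 := by
      simp only [hΦ]; rw [hL0] at h0 ⊢
      rw [hreg0]
      have := mul_le_mul_of_nonneg_left (neg_log_le_entropy (hs h0)) (hlam 0).le
      linarith
    have h4 := mul_nonpos_of_nonneg_of_nonpos (hlam M).le (entropy_nonpos (hs hu))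
    have h5 : regObjective (L M) (lam M) u = ∑ k, u k * L M k + lam M * ∑ k, u k * Real.log (u k) :=
      rfl
    linarith
  -- The comparator is the minimizer of the final regularized problem, where `Φ M` is attained.
  · refine ⟨_, hM1, ?_⟩
    have h1 := hlow M
    have h3 : Φ 0 ≤ 0 := by
      simp only [hΦ]; rw [hL0] at h0 ⊢
      rw [hreg0]
      exact mul_nonpos_of_nonneg_of_nonpos (hlam 0).le (entropy_nonpos (hs h0))
    have h4 := mul_le_mul_of_nonneg_left (neg_log_le_entropy (hs hM1)) (hlam M).le
    have h5 : Φ M = ∑ k, regArgmin W (L M) (lam M) k * L M k +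
      lam M * ∑ k, regArgmin W (L M) (lam M) k * Real.log (regArgmin W (L M) (lam M) k) := rfl
    linarith

end DualAveraging

end RobustMDP
namespace RobustMDP

/-! ### Exponential moments of bounded centered vectors -/

section CoshBound

/-- The power series `∑ s ^ n / (2n)!` has nonnegative coefficients. -/
lemma convexOn_cosh_sqrt : ConvexOn ℝ (Set.Ici (0 : ℝ)) fun s => Real.cosh (Real.sqrt s) := by
  refine ⟨convex_Ici 0, fun x hx y hy a b ha hb hab => ?_⟩
  have hs : ∀ s : ℝ, 0 ≤ s →
      HasSum (fun n => s ^ n / ((2 * n).factorial : ℝ)) (Real.cosh (Real.sqrt s)) := by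
    intro s h
    have := Real.hasSum_cosh (Real.sqrt s)
    simpa only [pow_mul, Real.sq_sqrt h] using this
  have hxy : 0 ≤ a • x + b • y := (convex_Ici (0 : ℝ)) hx hy ha hb hab
  refine hasSum_le (fun n => ?_) (hs _ hxy) (((hs x hx).mul_left a).add ((hs y hy).mul_left b))
  have := (convexOn_pow n).2 hx hy ha hb hab
  simp only [smul_eq_mul] at this ⊢
  rw [mul_div_assoc', mul_div_assoc', ← add_div]
  exact div_le_div_of_nonneg_right this (by positivity)

/-- A convex function lies below its chord. On `[(a - b)², (a + b)²]` the chord of `s ↦ cosh √s` is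
affine in `c` with value `cosh a * cosh b` at `c = 0`. The slope `q` does not depend on `c`, so the
linear term vanishes in the mean later. -/
lemma exists_cosh_sqrt_chord {a b : ℝ} (ha : 0 ≤ a) (hb : 0 ≤ b) :
    ∃ q : ℝ, ∀ c, |c| ≤ a * b →
      Real.cosh (Real.sqrt (a ^ 2 + b ^ 2 + 2 * c)) ≤ Real.cosh a * Real.cosh b + q * c := by
  refine ⟨Real.sinh a * Real.sinh b / (a * b), fun c hc => ?_⟩
  rcases (mul_nonneg ha hb).eq_or_lt with h0 | h0
  · have hc0 : c = 0 := by rw [← h0] at hc; exact abs_nonpos_iff.1 hc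
    rcases mul_eq_zero.1 h0.symm with h | h
    · subst h; simp [hc0, Real.sqrt_sq hb]
    · subst h; simp [hc0, Real.sqrt_sq ha]
  · set t : ℝ := (1 + c / (a * b)) / 2 with ht
    obtain ⟨hc1, hc2⟩ := abs_le.1 hc
    have ht0 : 0 ≤ t := by
      have : -1 ≤ c / (a * b) := by rw [le_div_iff₀ h0]; linarith
      rw [ht]; linarith
    have ht1 : t ≤ 1 := by
      have : c / (a * b) ≤ 1 := by rw [div_le_iff₀ h0]; linarith
      rw [ht]; linarith
    have hcab : c / (a * b) * (a * b) = c := div_mul_cancel₀ _ h0.ne'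
    have key := convexOn_cosh_sqrt.2 (show (a - b) ^ 2 ∈ Set.Ici (0 : ℝ) from sq_nonneg (a - b))
      (show (a + b) ^ 2 ∈ Set.Ici (0 : ℝ) from sq_nonneg (a + b)) (sub_nonneg.2 ht1) ht0 (by ring)
    simp only [smul_eq_mul, Real.sqrt_sq_eq_abs, Real.cosh_abs] at key
    rw [Real.cosh_sub, Real.cosh_add] at key
    have e : (1 - t) * (a - b) ^ 2 + t * (a + b) ^ 2 = a ^ 2 + b ^ 2 + 2 * c := by
      rw [← hcab, ht]; ring
    rw [e] at key
    refine key.trans (le_of_eq ?_)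
    have : Real.sinh a * Real.sinh b / (a * b) * c = (c / (a * b)) * (Real.sinh a * Real.sinh b) := by
      ring
    rw [this, ht]
    ring

lemma integrable_of_norm_le {F Ω : Type*} [NormedAddCommGroup F] [MeasurableSpace F] [BorelSpace F]
    [SecondCountableTopology F] [MeasurableSpace Ω] {P : Measure Ω} [IsProbabilityMeasure P]
    {ξ : Ω → F} (hξ : Measurable ξ) {b : ℝ} (hb : ∀ x, ‖ξ x‖ ≤ b) : Integrable ξ P :=
  Integrable.of_bound hξ.aestronglyMeasurable b (Filter.Eventually.of_forall hb)

variable {E : Type*} [NormedAddCommGroup E] [InnerProductSpace ℝ E]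

/-- Only `‖x‖`, `b` and the inner product of `x` and `ξ` enter, so integrating the bound brings in
no dimension. -/
lemma exists_cosh_norm_add_le (x : E) {b : ℝ} (hb : 0 ≤ b) :
    ∃ q : ℝ, ∀ ξ : E, ‖ξ‖ ≤ b →
      Real.cosh ‖x + ξ‖ ≤ Real.cosh ‖x‖ * Real.cosh b + q * inner ℝ x ξ := by
  obtain ⟨q, hq⟩ := exists_cosh_sqrt_chord (norm_nonneg x) hb
  refine ⟨q, fun ξ hξ => ?_⟩
  have h1 : |inner ℝ x ξ| ≤ ‖x‖ * b :=
    (abs_real_inner_le_norm x ξ).trans (mul_le_mul_of_nonneg_left hξ (norm_nonneg _))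
  refine le_trans ?_ (hq _ h1)
  rw [Real.cosh_le_cosh, abs_of_nonneg (norm_nonneg _), abs_of_nonneg (Real.sqrt_nonneg _)]
  refine Real.le_sqrt_of_sq_le ?_
  rw [norm_add_sq_real]
  nlinarith [norm_nonneg ξ]

variable [MeasurableSpace E] [BorelSpace E] [SecondCountableTopology E] [CompleteSpace E]
  {Ω : Type*} [MeasurableSpace Ω] {P : Measure Ω} [IsProbabilityMeasure P]

/-- The `cosh` of the norm grows by at most a factor `exp (b² / 2)` in the mean when a centered
vector of norm at most `b` is added. -/
lemma lintegral_cosh_norm_add_le {ξ : Ω → E} (hξ : Measurable ξ) {b : ℝ} (hb0 : 0 ≤ b)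
    (hb : ∀ x, ‖ξ x‖ ≤ b) (hmean : ∫ x, ξ x ∂P = 0) (x : E) :
    ∫⁻ ω, ENNReal.ofReal (Real.cosh ‖x + ξ ω‖) ∂P ≤
      ENNReal.ofReal (Real.exp (b ^ 2 / 2) * Real.cosh ‖x‖) := by
  obtain ⟨q, hq⟩ := exists_cosh_norm_add_le x hb0
  have hint := integrable_of_norm_le (P := P) hξ hb
  have hin : Integrable (fun ω => Real.cosh ‖x‖ * Real.cosh b + q * inner ℝ x (ξ ω)) P :=
    (integrable_const _).add ((hint.const_inner x).const_mul q)
  have h0 : ∀ ω, 0 ≤ Real.cosh ‖x‖ * Real.cosh b + q * inner ℝ x (ξ ω) := fun ω =>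
    (Real.cosh_pos _).le.trans (hq _ (hb ω))
  calc ∫⁻ ω, ENNReal.ofReal (Real.cosh ‖x + ξ ω‖) ∂P
      ≤ ∫⁻ ω, ENNReal.ofReal (Real.cosh ‖x‖ * Real.cosh b + q * inner ℝ x (ξ ω)) ∂P :=
        lintegral_mono fun ω => ENNReal.ofReal_le_ofReal (hq _ (hb ω))
    _ = ENNReal.ofReal (∫ ω, (Real.cosh ‖x‖ * Real.cosh b + q * inner ℝ x (ξ ω)) ∂P) :=
        (ofReal_integral_eq_lintegral_ofReal hin (Filter.Eventually.of_forall h0)).symm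
    _ = ENNReal.ofReal (Real.cosh ‖x‖ * Real.cosh b) := by
        rw [integral_add (integrable_const _) ((hint.const_inner x).const_mul q),
          integral_const_mul q, integral_inner hint, hmean]
        simp
    _ ≤ _ := by
        refine ENNReal.ofReal_le_ofReal ?_
        rw [mul_comm]
        exact mul_le_mul_of_nonneg_right (Real.cosh_le_exp_half_sq b) (Real.cosh_pos _).le

/-- Hoeffding's argument along `u`: on `[-c, c]` with `c = ‖u‖ * b` the exponential lies below its
chord, whose linear part has mean zero. -/
lemma lintegral_exp_inner_add_le {ξ : Ω → E} (hξ : Measurable ξ) {b : ℝ}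
    (hb : ∀ x, ‖ξ x‖ ≤ b) (hmean : ∫ x, ξ x ∂P = 0) (u x : E) :
    ∫⁻ ω, ENNReal.ofReal (Real.exp (inner ℝ u (x + ξ ω))) ∂P ≤
      ENNReal.ofReal (Real.exp (‖u‖ ^ 2 * b ^ 2 / 2) * Real.exp (inner ℝ u x)) := by
  have hint := integrable_of_norm_le (P := P) hξ hb
  set c := ‖u‖ * b with hc
  have hch : ∀ ω, Real.exp (inner ℝ u (ξ ω)) ≤
      Real.cosh c + (Real.sinh c / c) * inner ℝ u (ξ ω) := by
    intro ω
    have h1 : |inner ℝ u (ξ ω)| ≤ c :=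
      (abs_real_inner_le_norm _ _).trans (mul_le_mul_of_nonneg_left (hb ω) (norm_nonneg _))
    rcases (abs_nonneg _).trans h1 |>.eq_or_lt with h0 | h0
    · rw [← h0] at h1
      rw [abs_nonpos_iff.1 h1, ← h0]; simp
    · have h2 : |inner ℝ u (ξ ω) / c| ≤ 1 := by
        rw [abs_div, abs_of_pos h0, div_le_one h0]; exact h1
      have h3 := Real.exp_mul_le_cosh_add_mul_sinh h2 c
      rw [div_mul_cancel₀ _ h0.ne'] at h3
      calc _ ≤ _ := h3
        _ = _ := by ring
  have hin : Integrable (fun ω => Real.cosh c + (Real.sinh c / c) * inner ℝ u (ξ ω)) P :=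
    (integrable_const _).add ((hint.const_inner u).const_mul _)
  calc ∫⁻ ω, ENNReal.ofReal (Real.exp (inner ℝ u (x + ξ ω))) ∂P
      ≤ ∫⁻ ω, ENNReal.ofReal (Real.exp (inner ℝ u x)) *
          ENNReal.ofReal (Real.cosh c + (Real.sinh c / c) * inner ℝ u (ξ ω)) ∂P := by
        refine lintegral_mono fun ω => ?_
        rw [inner_add_right, Real.exp_add, ENNReal.ofReal_mul (Real.exp_pos _).le]
        gcongr
        exact hch ω
    _ = ENNReal.ofReal (Real.exp (inner ℝ u x)) * ENNReal.ofReal (Real.cosh c) := by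
        rw [lintegral_const_mul' _ _ ENNReal.ofReal_ne_top,
          ← ofReal_integral_eq_lintegral_ofReal hin
          (Filter.Eventually.of_forall fun ω => (Real.exp_pos _).le.trans (hch ω)),
          integral_add (integrable_const _) ((hint.const_inner u).const_mul _),
          integral_const_mul, integral_inner hint, hmean]
        simp
    _ ≤ _ := by
        rw [← ENNReal.ofReal_mul (Real.exp_pos _).le, mul_comm]
        refine ENNReal.ofReal_le_ofReal (mul_le_mul_of_nonneg_right ?_ (Real.exp_pos _).le)
        refine (Real.cosh_le_exp_half_sq c).trans (le_of_eq ?_)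
        rw [hc, mul_pow]

end CoshBound

/-! ### Integrals of bounded functions under setwise close measures -/

section TotalVariation

variable {X : Type*} [MeasurableSpace X]

/-- Layer cake: only levels in `(0, 1)` contribute, and each loses at most `e`. -/
lemma lintegral_ofReal_le_add_of_measure_le {μ ν : Measure X} {e : ENNReal}
    (h : ∀ B, MeasurableSet B → μ B ≤ ν B + e) {f : X → ℝ} (hf : Measurable f)
    (h0 : ∀ x, 0 ≤ f x) (h1 : ∀ x, f x ≤ 1) :
    ∫⁻ x, ENNReal.ofReal (f x) ∂μ ≤ ∫⁻ x, ENNReal.ofReal (f x) ∂ν + e := by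
  have hlay : ∀ m : Measure X, ∫⁻ x, ENNReal.ofReal (f x) ∂m =
      ∫⁻ t in Set.Ioo (0 : ℝ) 1, m {a | t < f a} := by
    intro m
    rw [lintegral_eq_lintegral_meas_lt m (Filter.Eventually.of_forall h0) hf.aemeasurable,
      ← lintegral_indicator measurableSet_Ioi, ← lintegral_indicator measurableSet_Ioo]
    refine lintegral_congr fun t => ?_
    by_cases ht : t ∈ Set.Ioo (0 : ℝ) 1
    · rw [Set.indicator_of_mem ht, Set.indicator_of_mem (show t ∈ Set.Ioi (0 : ℝ) from ht.1)]
    · rw [Set.indicator_of_notMem ht]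
      by_cases ht0 : t ∈ Set.Ioi (0 : ℝ)
      · rw [Set.indicator_of_mem ht0]
        have : {a | t < f a} = ∅ := by
          ext a
          simp only [Set.mem_ofPred_eq, Set.mem_empty_iff_false, iff_false, not_lt]
          exact (h1 a).trans (not_lt.1 fun hlt => ht ⟨ht0, hlt⟩)
        rw [this, measure_empty]
      · rw [Set.indicator_of_notMem ht0]
  rw [hlay, hlay]
  calc ∫⁻ t in Set.Ioo (0 : ℝ) 1, μ {a | t < f a}
      ≤ ∫⁻ t in Set.Ioo (0 : ℝ) 1, (ν {a | t < f a} + e) :=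
        lintegral_mono fun t => h _ (measurableSet_lt measurable_const hf)
    _ = _ := by
        rw [lintegral_add_right _ measurable_const]
        simp

lemma lintegral_le_add_of_measure_le {μ ν : Measure X} {e : ENNReal}
    (h : ∀ B, MeasurableSet B → μ B ≤ ν B + e) {f : X → ENNReal} (hf : Measurable f)
    (h1 : ∀ x, f x ≤ 1) : ∫⁻ x, f x ∂μ ≤ ∫⁻ x, f x ∂ν + e := by
  have := lintegral_ofReal_le_add_of_measure_le h hf.ennreal_toReal
    (fun x => ENNReal.toReal_nonneg) fun x => by
      have := ENNReal.toReal_mono ENNReal.one_ne_top (h1 x)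
      simpa using this
  have e : ∀ x, ENNReal.ofReal (f x).toReal = f x := fun x =>
    ENNReal.ofReal_toReal (ne_top_of_le_ne_top ENNReal.one_ne_top (h1 x))
  simpa only [e] using this

lemma abs_integral_sub_le_of_measure_le {μ ν : Measure X} [IsProbabilityMeasure μ]
    [IsProbabilityMeasure ν] {e : ℝ}
    (h : ∀ B, MeasurableSet B → |μ.real B - ν.real B| ≤ e) {f : X → ℝ} (hf : Measurable f)
    {c : ℝ} (hc : ∀ x, |f x| ≤ c) : |∫ x, f x ∂μ - ∫ x, f x ∂ν| ≤ 2 * c * e := by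
  have he : 0 ≤ e := (abs_nonneg _).trans (h ∅ MeasurableSet.empty)
  have hone : ∀ (μ ν : Measure X) [IsProbabilityMeasure μ] [IsProbabilityMeasure ν],
      (∀ B, MeasurableSet B → |μ.real B - ν.real B| ≤ e) → ∀ g : X → ℝ, Measurable g →
      (∀ x, 0 ≤ g x) → (∀ x, g x ≤ 1) → ∫ x, g x ∂μ ≤ ∫ x, g x ∂ν + e := by
    intro μ ν _ _ h g hg h0 h1
    have hgi : ∀ m : Measure X, IsProbabilityMeasure m → Integrable g m := fun m _ =>
      Integrable.of_bound hg.aestronglyMeasurable 1 (Filter.Eventually.of_forall fun x => by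
        rw [Real.norm_eq_abs, abs_of_nonneg (h0 x)]; exact h1 x)
    have := lintegral_ofReal_le_add_of_measure_le (μ := μ) (ν := ν) (e := ENNReal.ofReal e)
      (fun B hB => by
        have h2 := (abs_le.1 (h B hB)).2
        rw [← ofReal_measureReal (μ := μ), ← ofReal_measureReal (μ := ν),
          ← ENNReal.ofReal_add measureReal_nonneg he]
        exact ENNReal.ofReal_le_ofReal (by linarith)) hg h0 h1
    rw [← ofReal_integral_eq_lintegral_ofReal (hgi μ inferInstance)
        (Filter.Eventually.of_forall h0),
      ← ofReal_integral_eq_lintegral_ofReal (hgi ν inferInstance) (Filter.Eventually.of_forall h0),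
      ← ENNReal.ofReal_add (integral_nonneg h0) he] at this
    exact (ENNReal.ofReal_le_ofReal_iff (add_nonneg (integral_nonneg h0) he)).1 this
  rcases isEmpty_or_nonempty X with hX | ⟨⟨x0⟩⟩
  · exact absurd (measure_univ (μ := μ)) (by simp [Set.eq_empty_of_isEmpty])
  have hc0 : 0 ≤ c := (abs_nonneg _).trans (hc x0)
  rcases hc0.eq_or_lt with h0 | hpos
  · have : ∀ x, f x = 0 := fun x => abs_nonpos_iff.1 (h0 ▸ hc x)
    simp [this, ← h0]
  -- Affine rescaling to `[0, 1]`; undoing it produces the factor `2 * c`.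
  set g : X → ℝ := fun x => (f x + c) / (2 * c) with hg
  have hgm : Measurable g := (hf.add_const c).div_const _
  have hg0 : ∀ x, 0 ≤ g x := fun x => div_nonneg (by linarith [(abs_le.1 (hc x)).1]) (by linarith)
  have hg1 : ∀ x, g x ≤ 1 := fun x => by
    rw [hg, div_le_one (by linarith)]; linarith [(abs_le.1 (hc x)).2]
  have hfi : ∀ m : Measure X, IsProbabilityMeasure m → Integrable f m := fun m _ =>
    Integrable.of_bound hf.aestronglyMeasurable c (Filter.Eventually.of_forall hc)
  have hgint : ∀ m : Measure X, IsProbabilityMeasure m →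
      ∫ x, g x ∂m = (∫ x, f x ∂m + c) / (2 * c) := fun m hm => by
    simp only [hg]
    rw [integral_div, integral_add (hfi m hm) (integrable_const _)]
    simp
  have h1 := hone μ ν h g hgm hg0 hg1
  have h2 := hone ν μ (fun B hB => by rw [abs_sub_comm]; exact h B hB) g hgm hg0 hg1
  rw [hgint μ inferInstance, hgint ν inferInstance] at h1 h2
  have e1 : ∀ a : ℝ, a / (2 * c) * (2 * c) = a := fun a => div_mul_cancel₀ _ (by positivity)
  rw [abs_le]
  constructor
  · have := mul_le_mul_of_nonneg_right h2 (show 0 ≤ 2 * c by positivity)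
    rw [add_mul, e1, e1] at this; linarith
  · have := mul_le_mul_of_nonneg_right h1 (show 0 ≤ 2 * c by positivity)
    rw [add_mul, e1, e1] at this; linarith

lemma measure_le_add_of_abs_sub_le {μ ν : Measure X} [IsFiniteMeasure μ] [IsFiniteMeasure ν]
    {e : ℝ} (he : 0 ≤ e) {B : Set X} (h : |μ.real B - ν.real B| ≤ e) :
    μ B ≤ ν B + ENNReal.ofReal e := by
  have h2 := (abs_le.1 h).2
  rw [← ofReal_measureReal (μ := μ), ← ofReal_measureReal (μ := ν),
    ← ENNReal.ofReal_add measureReal_nonneg he]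
  exact ENNReal.ofReal_le_ofReal (by linarith)

end TotalVariation

/-! ### Bounded measurable functions and Markov kernels -/

section BoundedMeasurable

variable {X Y : Type*} [MeasurableSpace X] [MeasurableSpace Y]

/-- Bounded measurable real functions. -/
def IsBdd (f : X → ℝ) : Prop := Measurable f ∧ ∃ c, ∀ x, |f x| ≤ c

lemma IsBdd.integrable {f : X → ℝ} (hf : IsBdd f) (μ : Measure X) [IsFiniteMeasure μ] :
    Integrable f μ := by
  obtain ⟨hm, c, hc⟩ := hf
  exact Integrable.of_bound hm.aestronglyMeasurable c (Filter.Eventually.of_forall hc)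

lemma isBdd_const (c : ℝ) : IsBdd fun _ : X => c := ⟨measurable_const, |c|, fun _ => le_rfl⟩

lemma IsBdd.add {f g : X → ℝ} (hf : IsBdd f) (hg : IsBdd g) : IsBdd fun x => f x + g x := by
  obtain ⟨hm, c, hc⟩ := hf
  obtain ⟨hm', c', hc'⟩ := hg
  exact ⟨hm.add hm', c + c', fun x => (abs_add_le _ _).trans (add_le_add (hc x) (hc' x))⟩

lemma IsBdd.mul {f g : X → ℝ} (hf : IsBdd f) (hg : IsBdd g) : IsBdd fun x => f x * g x := by
  obtain ⟨hm, c, hc⟩ := hf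
  obtain ⟨hm', c', hc'⟩ := hg
  exact ⟨hm.mul hm', c * c', fun x => by
    rw [abs_mul]
    exact mul_le_mul (hc x) (hc' x) (abs_nonneg _) ((abs_nonneg _).trans (hc x))⟩

lemma IsBdd.const_mul {f : X → ℝ} (hf : IsBdd f) (a : ℝ) : IsBdd fun x => a * f x :=
  (isBdd_const a).mul hf

lemma IsBdd.neg {f : X → ℝ} (hf : IsBdd f) : IsBdd fun x => -f x := by
  obtain ⟨hm, c, hc⟩ := hf
  exact ⟨hm.neg, c, fun x => by rw [abs_neg]; exact hc x⟩

lemma IsBdd.sub {f g : X → ℝ} (hf : IsBdd f) (hg : IsBdd g) : IsBdd fun x => f x - g x := by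
  simpa only [sub_eq_add_neg] using hf.add hg.neg

lemma IsBdd.sum {ι : Type*} (s : Finset ι) {f : ι → X → ℝ} (hf : ∀ i ∈ s, IsBdd (f i)) :
    IsBdd fun x => ∑ i ∈ s, f i x := by
  classical
  induction s using Finset.induction_on with
  | empty => simpa using isBdd_const (X := X) 0
  | insert a s ha ih =>
    simp only [Finset.sum_insert ha]
    exact (hf a (Finset.mem_insert_self _ _)).add
      (ih fun i hi => hf i (Finset.mem_insert_of_mem hi))

lemma IsBdd.comp {f : Y → ℝ} (hf : IsBdd f) {g : X → Y} (hg : Measurable g) :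
    IsBdd fun x => f (g x) :=
  ⟨hf.1.comp hg, hf.2.choose, fun _ => hf.2.choose_spec _⟩

lemma measurable_kernel_integral {f : Y → ℝ} (hf : Measurable f) (κ : Kernel X Y)
    [IsSFiniteKernel κ] : Measurable fun x => ∫ y, f y ∂κ x :=
  (StronglyMeasurable.integral_kernel (κ := κ) hf.stronglyMeasurable).measurable

lemma abs_integral_le_of_abs_le {f : X → ℝ} {μ : Measure X} [IsProbabilityMeasure μ] {c : ℝ}
    (hc : ∀ x, |f x| ≤ c) : |∫ x, f x ∂μ| ≤ c := by
  have := norm_integral_le_of_norm_le_const (μ := μ) (f := f) (C := c)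
    (Filter.Eventually.of_forall hc)
  simpa using this

lemma IsBdd.kernel_integral {f : Y → ℝ} (hf : IsBdd f) (κ : Kernel X Y) [IsMarkovKernel κ] :
    IsBdd fun x => ∫ y, f y ∂κ x :=
  ⟨measurable_kernel_integral hf.1 κ, hf.2.choose, fun _ =>
    abs_integral_le_of_abs_le hf.2.choose_spec⟩

lemma IsBdd.integral_bind {f : Y → ℝ} (hf : IsBdd f) (μ : Measure X) [IsProbabilityMeasure μ]
    (κ : Kernel X Y) [IsMarkovKernel κ] :
    ∫ y, f y ∂(μ.bind κ) = ∫ x, ∫ y, f y ∂κ x ∂μ := by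
  have : IsProbabilityMeasure (μ.bind κ) := inferInstance
  rw [Measure.comp_eq_comp_const_apply] at this ⊢
  rw [Kernel.integral_comp (hf.integrable _), Kernel.const_apply]

lemma IsBdd.integral_comp {Z : Type*} [MeasurableSpace Z] {f : Z → ℝ} (hf : IsBdd f)
    (η : Kernel Y Z) [IsMarkovKernel η] (κ : Kernel X Y) [IsMarkovKernel κ] (x : X) :
    ∫ z, f z ∂((η ∘ₖ κ) x) = ∫ y, ∫ z, f z ∂η y ∂κ x :=
  Kernel.integral_comp (hf.integrable _)

instance isMarkovKernel_pow (κ : Kernel X X) [IsMarkovKernel κ] (n : ℕ) :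
    IsMarkovKernel (κ ^ n : Kernel X X) := by
  induction n with
  | zero => rw [pow_zero]; exact inferInstanceAs (IsMarkovKernel (Kernel.id : Kernel X X))
  | succ n ih => rw [pow_succ]; exact inferInstanceAs (IsMarkovKernel ((κ ^ n) ∘ₖ κ))

lemma IsBdd.integral_pow_zero {f : X → ℝ} (hf : IsBdd f) (κ : Kernel X X) (x : X) :
    ∫ y, f y ∂((κ ^ 0 : Kernel X X) x) = f x := by
  rw [pow_zero]
  show ∫ y, f y ∂((Kernel.id : Kernel X X) x) = f x
  rw [Kernel.id_apply, integral_dirac' _ _ hf.1.stronglyMeasurable]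

lemma IsBdd.integral_pow_succ {f : X → ℝ} (hf : IsBdd f) (κ : Kernel X X) [IsMarkovKernel κ]
    (n : ℕ) (x : X) :
    ∫ y, f y ∂((κ ^ (n + 1) : Kernel X X) x) = ∫ y, ∫ z, f z ∂((κ ^ n : Kernel X X) y) ∂κ x := by
  rw [pow_succ]
  exact hf.integral_comp (κ ^ n : Kernel X X) κ x

lemma IsBdd.integral_pow_succ' {f : X → ℝ} (hf : IsBdd f) (κ : Kernel X X) [IsMarkovKernel κ]
    (n : ℕ) (x : X) :
    ∫ y, f y ∂((κ ^ (n + 1) : Kernel X X) x) = ∫ y, ∫ z, f z ∂κ y ∂((κ ^ n : Kernel X X) x) := by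
  rw [pow_succ']
  exact hf.integral_comp κ (κ ^ n : Kernel X X) x

/-- A bounded subsolution of a discounted fixed point equation is below the constant
supersolution. -/
lemma IsBdd.le_of_le_discount {f : X → ℝ} (hf : IsBdd f) (κ : Kernel X X) [IsMarkovKernel κ]
    {γ a : ℝ} (hγ0 : 0 ≤ γ) (hγ1 : γ < 1) (h : ∀ x, f x ≤ a + γ * ∫ y, f y ∂κ x) (x : X) :
    f x ≤ a / (1 - γ) := by
  obtain ⟨c, hc⟩ := hf.2
  have hg : (1 - γ) ≠ 0 := by linarith
  -- Each use of the inequality shrinks the excess over `a / (1 - γ)` by the factor `γ`.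
  have key : ∀ (n : ℕ) x, f x - a / (1 - γ) ≤ γ ^ n * (c + |a / (1 - γ)|) := by
    intro n
    induction n with
    | zero =>
      intro x
      have h1 := le_abs_self (f x)
      have h2 := neg_abs_le (a / (1 - γ))
      have h3 := hc x
      simp only [pow_zero, one_mul]; linarith
    | succ n ih =>
      intro x
      have h1 : ∫ y, f y ∂κ x ≤ a / (1 - γ) + γ ^ n * (c + |a / (1 - γ)|) := by
        calc ∫ y, f y ∂κ x ≤ ∫ _, (a / (1 - γ) + γ ^ n * (c + |a / (1 - γ)|)) ∂κ x :=
              integral_mono (hf.integrable _) (integrable_const _) fun y => by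
                have := ih y; simp only; linarith
          _ = _ := by simp
      have h2 := mul_le_mul_of_nonneg_left h1 hγ0
      have h3 : a + γ * (a / (1 - γ)) = a / (1 - γ) := by field_simp; ring
      have := h x
      rw [pow_succ]
      nlinarith
  have hlim : Filter.Tendsto (fun n : ℕ => γ ^ n * (c + |a / (1 - γ)|)) Filter.atTop
      (nhds (0 * (c + |a / (1 - γ)|))) :=
    (tendsto_pow_atTop_nhds_zero_of_lt_one hγ0 hγ1).mul_const _
  rw [zero_mul] at hlim
  have := ge_of_tendsto' hlim fun n => key n x
  linarith

end BoundedMeasurable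

end RobustMDP
namespace RobustMDP
set_option linter.unusedSectionVars false

/-! ### Convex combinations and mixtures of kernels -/

section SimplexSums

variable {ι : Type*} [Fintype ι]

lemma abs_sum_mul_le {w : ι → ℝ} (hw : w ∈ stdSimplex ℝ ι) {f : ι → ℝ} {c : ℝ}
    (hf : ∀ i, |f i| ≤ c) : |∑ i, w i * f i| ≤ c := by
  calc |∑ i, w i * f i| ≤ ∑ i, |w i * f i| := Finset.abs_sum_le_sum_abs _ _
    _ ≤ ∑ i, w i * c := Finset.sum_le_sum fun i _ => by
        rw [abs_mul, abs_of_nonneg (hw.1 i)]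
        exact mul_le_mul_of_nonneg_left (hf i) (hw.1 i)
    _ = c := by rw [← Finset.sum_mul, hw.2, one_mul]

lemma sum_mul_le_of_le {w : ι → ℝ} (hw : w ∈ stdSimplex ℝ ι) {f : ι → ℝ} {c : ℝ}
    (hf : ∀ i, f i ≤ c) : ∑ i, w i * f i ≤ c := by
  calc ∑ i, w i * f i ≤ ∑ i, w i * c := Finset.sum_le_sum fun i _ =>
        mul_le_mul_of_nonneg_left (hf i) (hw.1 i)
    _ = c := by rw [← Finset.sum_mul, hw.2, one_mul]

lemma le_sum_mul_of_le {w : ι → ℝ} (hw : w ∈ stdSimplex ℝ ι) {f : ι → ℝ} {c : ℝ}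
    (hf : ∀ i, c ≤ f i) : c ≤ ∑ i, w i * f i := by
  calc c = ∑ i, w i * c := by rw [← Finset.sum_mul, hw.2, one_mul]
    _ ≤ ∑ i, w i * f i := Finset.sum_le_sum fun i _ =>
        mul_le_mul_of_nonneg_left (hf i) (hw.1 i)

lemma prod_mem_stdSimplex {κ : Type*} [Fintype κ] {p : ι → ℝ} (hp : p ∈ stdSimplex ℝ ι)
    {q : κ → ℝ} (hq : q ∈ stdSimplex ℝ κ) :
    (fun i : ι × κ => p i.1 * q i.2) ∈ stdSimplex ℝ (ι × κ) := by
  refine ⟨fun i => mul_nonneg (hp.1 _) (hq.1 _), ?_⟩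
  rw [Fintype.sum_prod_type]
  simp only [← Finset.mul_sum, hq.2, mul_one, hp.2]

end SimplexSums

section Mixture

variable {X Y ι : Type*} [MeasurableSpace X] [MeasurableSpace Y] [Fintype ι]

lemma integral_sum_smul {w : ι → ℝ} (hw : ∀ i, 0 ≤ w i) {m : ι → Measure Y}
    (hm : ∀ i, IsProbabilityMeasure (m i)) {f : Y → ℝ} (hf : IsBdd f) :
    ∫ y, f y ∂(∑ i, ENNReal.ofReal (w i) • m i) = ∑ i, w i * ∫ y, f y ∂(m i) := by
  rw [integral_finsetSum_measure fun i _ => ((hf.integrable (m i)).smul_measure ENNReal.ofReal_ne_top)]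
  refine Finset.sum_congr rfl fun i _ => ?_
  rw [integral_smul_measure, ENNReal.toReal_ofReal (hw i), smul_eq_mul]

lemma integral_mix {w : X → ι → ℝ} (hw : Measurable w) {κ : ι → Kernel X Y}
    (hκ : ∀ i, IsMarkovKernel (κ i)) (h : ∀ x, w x ∈ stdSimplex ℝ ι) {f : Y → ℝ} (hf : IsBdd f)
    (x : X) : ∫ y, f y ∂(mix w hw κ x) = ∑ i, w x i * ∫ y, f y ∂(κ i x) := by
  rw [mix_apply]
  exact integral_sum_smul (fun i => (h x).1 i) (fun i => (hκ i).isProbabilityMeasure x) hf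

lemma lintegral_mix {w : X → ι → ℝ} (hw : Measurable w) {κ : ι → Kernel X Y}
    {f : Y → ENNReal} (x : X) :
    ∫⁻ y, f y ∂(mix w hw κ x) = ∑ i, ENNReal.ofReal (w x i) * ∫⁻ y, f y ∂(κ i x) := by
  rw [mix_apply, lintegral_finsetSum_measure]
  simp

end Mixture

/-! ### Policy evaluation, the robust Bellman equation and performance differences -/

section Values

variable {S A : Type*} {K : ℕ} [TopologicalSpace S] [MeasurableSpace S]
  [OpensMeasurableSpace S] [Fintype A] (𝓜 : Model S A K) (π : ControlPolicy S A)

instance (k : Fin K) (a : A) : IsMarkovKernel (𝓜.kernel k a) := 𝓜.kernel_markov k a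

instance isMarkovKernel_stateKernel (P : A → Kernel S S) [∀ a, IsMarkovKernel (P a)] :
    IsMarkovKernel (stateKernel π P) :=
  isMarkovKernel_mix _ _ _ inferInstance π.prob_mem

instance isMarkovKernel_natureKernel (ω : NaturePolicy 𝓜) (a : A) :
    IsMarkovKernel (natureKernel 𝓜 ω a) :=
  isMarkovKernel_mix _ _ _ (fun _ => inferInstance) fun s => 𝓜.weights_subset (ω.prob_mem s)

/-- The mean reward of the policy `π` in a state. -/
noncomputable def policyReward (s : S) : ℝ := ∑ a, π.prob s a * 𝓜.reward s a

lemma isBdd_policy (a : A) : IsBdd fun s => π.prob s a :=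
  ⟨(measurable_pi_apply a).comp π.measurable_prob, 1, fun s => by
    rw [abs_of_nonneg ((π.prob_mem s).1 a), ← (π.prob_mem s).2]
    exact Finset.single_le_sum (fun i _ => (π.prob_mem s).1 i) (Finset.mem_univ a)⟩

variable {𝓜} in
lemma isBdd_nature (ω : NaturePolicy 𝓜) (k : Fin K) : IsBdd fun s => ω.prob s k :=
  ⟨(measurable_pi_apply k).comp ω.measurable_prob, 1, fun s => by
    have h := 𝓜.weights_subset (ω.prob_mem s)
    rw [abs_of_nonneg (h.1 k), ← h.2]
    exact Finset.single_le_sum (fun i _ => h.1 i) (Finset.mem_univ k)⟩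

lemma isBdd_reward (a : A) : IsBdd fun s => 𝓜.reward s a :=
  ⟨(𝓜.reward_continuous a).measurable, 1, fun s => by
    have := 𝓜.reward_mem s a
    rw [abs_of_nonneg this.1]; exact this.2⟩

lemma isBdd_policyReward : IsBdd (policyReward 𝓜 π) :=
  IsBdd.sum _ fun a _ => (isBdd_policy π a).mul (isBdd_reward 𝓜 a)

lemma policyReward_mem (s : S) : policyReward 𝓜 π s ∈ Set.Icc (0 : ℝ) 1 :=
  ⟨le_sum_mul_of_le (π.prob_mem s) fun a => (𝓜.reward_mem s a).1,
    sum_mul_le_of_le (π.prob_mem s) fun a => (𝓜.reward_mem s a).2⟩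

section Kernel

variable (P : A → Kernel S S) [∀ a, IsMarkovKernel (P a)]

/-- The mean reward at time `t`. -/
noncomputable def rewardAt (t : ℕ) (s : S) : ℝ :=
  ∫ x, policyReward 𝓜 π x ∂((stateKernel π P ^ t : Kernel S S) s)

lemma isBdd_rewardAt (t : ℕ) : IsBdd (rewardAt 𝓜 π P t) :=
  (isBdd_policyReward 𝓜 π).kernel_integral _

lemma rewardAt_mem (t : ℕ) (s : S) : rewardAt 𝓜 π P t s ∈ Set.Icc (0 : ℝ) 1 := by
  refine ⟨integral_nonneg fun x => (policyReward_mem 𝓜 π x).1, ?_⟩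
  refine (le_abs_self _).trans (abs_integral_le_of_abs_le fun x => ?_)
  have := policyReward_mem 𝓜 π x
  rw [abs_of_nonneg this.1]; exact this.2

lemma summable_value (s : S) : Summable fun t => 𝓜.discount ^ t * rewardAt 𝓜 π P t s := by
  refine Summable.of_nonneg_of_le (fun t => ?_) (fun t => ?_)
    (summable_geometric_of_lt_one 𝓜.discount_pos.le 𝓜.discount_lt_one)
  · exact mul_nonneg (pow_nonneg 𝓜.discount_pos.le _) (rewardAt_mem 𝓜 π P t s).1
  · exact mul_le_of_le_one_right (pow_nonneg 𝓜.discount_pos.le _) (rewardAt_mem 𝓜 π P t s).2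

lemma value_eq_tsum (s : S) :
    value 𝓜 π P s = ∑' t, 𝓜.discount ^ t * rewardAt 𝓜 π P t s := rfl

lemma value_mem (s : S) : value 𝓜 π P s ∈ Set.Icc (0 : ℝ) (1 / (1 - 𝓜.discount)) := by
  rw [value_eq_tsum]
  refine ⟨tsum_nonneg fun t =>
    mul_nonneg (pow_nonneg 𝓜.discount_pos.le _) (rewardAt_mem 𝓜 π P t s).1, ?_⟩
  rw [one_div, ← tsum_geometric_of_lt_one 𝓜.discount_pos.le 𝓜.discount_lt_one]
  exact (summable_value 𝓜 π P s).tsum_le_tsum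
    (fun t => mul_le_of_le_one_right (pow_nonneg 𝓜.discount_pos.le _) (rewardAt_mem 𝓜 π P t s).2)
    (summable_geometric_of_lt_one 𝓜.discount_pos.le 𝓜.discount_lt_one)

lemma abs_value_le (s : S) : |value 𝓜 π P s| ≤ 1 / (1 - 𝓜.discount) := by
  have := value_mem 𝓜 π P s
  rw [abs_of_nonneg this.1]; exact this.2

lemma isBdd_value : IsBdd (value 𝓜 π P) := by
  refine ⟨?_, 1 / (1 - 𝓜.discount), abs_value_le 𝓜 π P⟩
  refine measurable_of_tendsto_metrizable
    (f := fun n s => ∑ t ∈ Finset.range n, 𝓜.discount ^ t * rewardAt 𝓜 π P t s) (fun n => ?_)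
    (tendsto_pi_nhds.2 fun s => (summable_value 𝓜 π P s).hasSum.tendsto_sum_nat)
  exact Finset.measurable_sum _ fun t _ => (isBdd_rewardAt 𝓜 π P t).1.const_mul _

/-- The Bellman equation of policy evaluation. -/
lemma value_bellman (s : S) : value 𝓜 π P s =
    policyReward 𝓜 π s + 𝓜.discount * ∫ x, value 𝓜 π P x ∂(stateKernel π P s) := by
  have hγ := 𝓜.discount_pos.le
  have hint : ∫ x, value 𝓜 π P x ∂(stateKernel π P s) =
      ∑' t, 𝓜.discount ^ t * ∫ x, rewardAt 𝓜 π P t x ∂(stateKernel π P s) := by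
    simp only [value_eq_tsum]
    rw [← integral_tsum_of_summable_integral_norm]
    · exact tsum_congr fun t => integral_const_mul _ _
    · exact fun t => ((isBdd_rewardAt 𝓜 π P t).const_mul _).integrable _
    · refine Summable.of_nonneg_of_le (fun t => integral_nonneg fun _ => norm_nonneg _)
        (fun t => ?_) (summable_geometric_of_lt_one hγ 𝓜.discount_lt_one)
      refine (le_abs_self _).trans (abs_integral_le_of_abs_le fun x => ?_)
      rw [abs_norm, norm_mul, norm_pow, Real.norm_of_nonneg hγ,
        Real.norm_of_nonneg (rewardAt_mem 𝓜 π P t x).1]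
      exact mul_le_of_le_one_right (pow_nonneg hγ _) (rewardAt_mem 𝓜 π P t x).2
  rw [hint, value_eq_tsum, (summable_value 𝓜 π P s).tsum_eq_zero_add, ← tsum_mul_left]
  congr 1
  · rw [pow_zero, one_mul, rewardAt, (isBdd_policyReward 𝓜 π).integral_pow_zero]
  · refine tsum_congr fun t => ?_
    rw [rewardAt, (isBdd_policyReward 𝓜 π).integral_pow_succ, pow_succ]
    simp only [rewardAt]
    ring

end Kernel

/-- The action value function attached to a continuation value. -/
noncomputable def actionValue (V : S → ℝ) (z : S × A × Fin K) : ℝ :=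
  𝓜.reward z.1 z.2.1 + 𝓜.discount * ∫ x, V x ∂(𝓜.kernel z.2.2 z.2.1 z.1)

/-- Nature's action value function attached to a continuation value. -/
noncomputable def natureValue (V : S → ℝ) (s : S) (k : Fin K) : ℝ :=
  ∑ a, π.prob s a * actionValue 𝓜 V (s, a, k)

variable {𝓜 π}

lemma isBdd_actionValue {V : S → ℝ} (hV : IsBdd V) (a : A) (k : Fin K) :
    IsBdd fun s => actionValue 𝓜 V (s, a, k) :=
  (isBdd_reward 𝓜 a).add ((hV.kernel_integral (𝓜.kernel k a)).const_mul _)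

lemma isBdd_natureValue {V : S → ℝ} (hV : IsBdd V) (k : Fin K) :
    IsBdd fun s => natureValue 𝓜 π V s k :=
  IsBdd.sum _ fun a _ => (isBdd_policy π a).mul (isBdd_actionValue hV a k)

lemma actionValue_mono {V V' : S → ℝ} (hV : IsBdd V) (hV' : IsBdd V') (h : ∀ s, V s ≤ V' s)
    (z : S × A × Fin K) : actionValue 𝓜 V z ≤ actionValue 𝓜 V' z := by
  unfold actionValue
  have := integral_mono (hV.integrable (𝓜.kernel z.2.2 z.2.1 z.1)) (hV'.integrable _) h
  have := mul_le_mul_of_nonneg_left this 𝓜.discount_pos.le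
  linarith

lemma natureValue_mono {V V' : S → ℝ} (hV : IsBdd V) (hV' : IsBdd V') (h : ∀ s, V s ≤ V' s)
    (s : S) (k : Fin K) : natureValue 𝓜 π V s k ≤ natureValue 𝓜 π V' s k :=
  Finset.sum_le_sum fun a _ =>
    mul_le_mul_of_nonneg_left (actionValue_mono hV hV' h _) ((π.prob_mem s).1 a)

lemma sum_mul_natureValue {V : S → ℝ} {w : Fin K → ℝ} (hw : w ∈ stdSimplex ℝ (Fin K)) (s : S) :
    ∑ k, w k * natureValue 𝓜 π V s k = policyReward 𝓜 π s + 𝓜.discount *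
      ∑ a, π.prob s a * ∑ k, w k * ∫ x, V x ∂(𝓜.kernel k a s) := by
  unfold natureValue policyReward actionValue
  simp only [Finset.mul_sum]
  rw [Finset.sum_comm, ← Finset.sum_add_distrib]
  refine Finset.sum_congr rfl fun a _ => ?_
  rw [show π.prob s a * 𝓜.reward s a = ∑ k, w k * (π.prob s a * 𝓜.reward s a) by
    rw [← Finset.sum_mul, hw.2, one_mul], ← Finset.sum_add_distrib]
  exact Finset.sum_congr rfl fun k _ => by ring

lemma integral_stateKernel {P : A → Kernel S S} (hP : ∀ a, IsMarkovKernel (P a)) {V : S → ℝ}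
    (hV : IsBdd V) (s : S) :
    ∫ x, V x ∂(stateKernel π P s) = ∑ a, π.prob s a * ∫ x, V x ∂(P a s) :=
  integral_mix _ hP π.prob_mem hV s

lemma integral_natureKernel (ω : NaturePolicy 𝓜) (a : A) {V : S → ℝ} (hV : IsBdd V) (s : S) :
    ∫ x, V x ∂(natureKernel 𝓜 ω a s) = ∑ k, ω.prob s k * ∫ x, V x ∂(𝓜.kernel k a s) :=
  integral_mix _ (fun _ => inferInstance) (fun s => 𝓜.weights_subset (ω.prob_mem s)) hV s

lemma sum_nature_mul_natureValue (ω : NaturePolicy 𝓜) {V : S → ℝ} (hV : IsBdd V) (s : S) :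
    ∑ k, ω.prob s k * natureValue 𝓜 π V s k = policyReward 𝓜 π s + 𝓜.discount *
      ∫ x, V x ∂(stateKernel π (natureKernel 𝓜 ω) s) := by
  rw [sum_mul_natureValue (𝓜.weights_subset (ω.prob_mem s)),
    integral_stateKernel (fun _ => inferInstance) hV]
  simp only [integral_natureKernel ω _ hV]

lemma value_nature_eq (ω : NaturePolicy 𝓜) (s : S) : value 𝓜 π (natureKernel 𝓜 ω) s =
    ∑ k, ω.prob s k * natureValue 𝓜 π (value 𝓜 π (natureKernel 𝓜 ω)) s k := by
  rw [sum_nature_mul_natureValue ω (isBdd_value 𝓜 π _)]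
  exact value_bellman 𝓜 π _ s

lemma jointQ_eq (ω : NaturePolicy 𝓜) (z : S × A × Fin K) :
    jointQ 𝓜 π ω z = actionValue 𝓜 (value 𝓜 π (natureKernel 𝓜 ω)) z := rfl

lemma natureKernel_mem_ambiguitySet (ω : NaturePolicy 𝓜) :
    natureKernel 𝓜 ω ∈ ambiguitySet 𝓜 :=
  ⟨fun _ => inferInstance, fun s => ⟨ω.prob s, ω.prob_mem s, fun _ => rfl⟩⟩

/-- A policy of nature satisfying the robust Bellman optimality equation. -/
def IsOptimalNature (π : ControlPolicy S A) (ω : NaturePolicy 𝓜) : Prop :=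
  ∀ s, ∀ w ∈ 𝓜.weights, value 𝓜 π (natureKernel 𝓜 ω) s ≤
    ∑ k, w k * natureValue 𝓜 π (value 𝓜 π (natureKernel 𝓜 ω)) s k

/-- At each state the weights that realize `P` compete in the optimality inequality, so `V^ω - V^P`
is a bounded subsolution of `f ≤ γ κ f` for the state kernel `κ` of `P`. The weights are used one
state at a time, so they need not depend measurably on the state. -/
lemma IsOptimalNature.le_value {ω : NaturePolicy 𝓜} (h : IsOptimalNature π ω)
    {P : A → Kernel S S} (hP : P ∈ ambiguitySet 𝓜) (s : S) :
    value 𝓜 π (natureKernel 𝓜 ω) s ≤ value 𝓜 π P s := by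
  have hPm : ∀ a, IsMarkovKernel (P a) := hP.1
  have hV := isBdd_value 𝓜 π (natureKernel 𝓜 ω)
  have hVP := isBdd_value 𝓜 π P
  have := (hV.sub hVP).le_of_le_discount (stateKernel π P) (a := 0) 𝓜.discount_pos.le
    𝓜.discount_lt_one (fun s => ?_) s
  · rw [zero_div] at this; linarith
  · obtain ⟨w, hw, hPw⟩ := hP.2 s
    have h1 := h s w hw
    rw [sum_mul_natureValue (𝓜.weights_subset hw)] at h1
    have h2 := value_bellman 𝓜 π P s
    have h3 : ∫ x, value 𝓜 π (natureKernel 𝓜 ω) x ∂(stateKernel π P s) =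
        ∑ a, π.prob s a * ∑ k, w k * ∫ x, value 𝓜 π (natureKernel 𝓜 ω) x ∂(𝓜.kernel k a s) := by
      rw [integral_stateKernel hPm hV]
      refine Finset.sum_congr rfl fun a _ => ?_
      rw [hPw a, integral_sum_smul (𝓜.weights_subset hw).1 (fun k => inferInstance) hV]
    rw [integral_sub (hV.integrable _) (hVP.integrable _), h3]
    linarith

lemma IsOptimalNature.robustValue_eq {ω : NaturePolicy 𝓜} (h : IsOptimalNature π ω) (s : S) :
    robustValue 𝓜 π s = value 𝓜 π (natureKernel 𝓜 ω) s := by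
  have : Nonempty (ambiguitySet 𝓜) := ⟨⟨_, natureKernel_mem_ambiguitySet ω⟩⟩
  refine le_antisymm ?_ (le_ciInf fun P => h.le_value P.2 s)
  refine ciInf_le ⟨value 𝓜 π (natureKernel 𝓜 ω) s, ?_⟩
    (⟨_, natureKernel_mem_ambiguitySet ω⟩ : ambiguitySet 𝓜)
  rintro _ ⟨P, rfl⟩
  exact h.le_value P.2 s

lemma IsOptimalNature.jointQ_le {ω : NaturePolicy 𝓜} (h : IsOptimalNature π ω)
    (ω' : NaturePolicy 𝓜) (z : S × A × Fin K) : jointQ 𝓜 π ω z ≤ jointQ 𝓜 π ω' z :=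
  actionValue_mono (isBdd_value 𝓜 π _) (isBdd_value 𝓜 π _)
    (fun s => h.le_value (natureKernel_mem_ambiguitySet ω') s) z

lemma IsOptimalNature.robustQ_eq {ω : NaturePolicy 𝓜} (h : IsOptimalNature π ω)
    (z : S × A × Fin K) : robustQ 𝓜 π z = jointQ 𝓜 π ω z := by
  have : Nonempty (NaturePolicy 𝓜) := ⟨ω⟩
  refine le_antisymm ?_ (le_ciInf fun ω' => h.jointQ_le ω' z)
  refine ciInf_le ⟨jointQ 𝓜 π ω z, ?_⟩ ω
  rintro _ ⟨ω', rfl⟩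
  exact h.jointQ_le ω' z

/-- Existence of a measurable stationary policy of nature satisfying the robust Bellman equation. -/
lemma exists_isOptimalNature (𝓜 : Model S A K) (π : ControlPolicy S A) :
    ∃ ω : NaturePolicy 𝓜, IsOptimalNature π ω := by
  obtain ⟨sel, hselm, hsel⟩ := exists_measurable_linear_argmin 𝓜.weights_closed 𝓜.weights_convex
    𝓜.weights_nonempty 𝓜.weights_subset
  have hγ0 := 𝓜.discount_pos.le
  have hγ1 := 𝓜.discount_lt_one
  let greedy : {V : S → ℝ // IsBdd V} → NaturePolicy 𝓜 := fun V =>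
    { prob := fun s => sel (natureValue 𝓜 π V.1 s)
      measurable_prob := hselm.comp (measurable_pi_lambda _ fun k => (isBdd_natureValue V.2 k).1)
      prob_mem := fun s => (hsel _).1 }
  -- Policy iteration: every policy is greedy for the value of its predecessor. The values decrease
  -- pointwise, which gives a measurable limit.
  obtain ⟨pol, hpol⟩ : ∃ pol : ℕ → NaturePolicy 𝓜, ∀ n s, (pol (n + 1)).prob s =
      sel (natureValue 𝓜 π (value 𝓜 π (natureKernel 𝓜 (pol n))) s) :=
    ⟨fun n => Nat.rec (motive := fun _ => NaturePolicy 𝓜) (greedy ⟨fun _ => 0, isBdd_const 0⟩)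
      (fun _ ω => greedy ⟨value 𝓜 π (natureKernel 𝓜 ω), isBdd_value 𝓜 π _⟩) n, fun _ _ => rfl⟩
  obtain ⟨V, hVdef⟩ : ∃ V : ℕ → S → ℝ, ∀ n, V n = value 𝓜 π (natureKernel 𝓜 (pol n)) :=
    ⟨_, fun _ => rfl⟩
  have hVb : ∀ n, IsBdd (V n) := fun n => hVdef n ▸ isBdd_value 𝓜 π (natureKernel 𝓜 (pol n))
  have hgreedy : ∀ n s, ∀ w ∈ 𝓜.weights, ∑ k, (pol (n + 1)).prob s k *
      natureValue 𝓜 π (V n) s k ≤ ∑ k, w k * natureValue 𝓜 π (V n) s k := fun n s w hw => by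
    rw [hpol n s, ← hVdef n]
    exact (hsel (natureValue 𝓜 π (V n) s)).2 w hw
  have hself : ∀ n s, V n s = ∑ k, (pol n).prob s k * natureValue 𝓜 π (V n) s k := fun n s => by
    rw [hVdef n]; exact value_nature_eq (pol n) s
  have hstep : ∀ n s, ∑ k, (pol (n + 1)).prob s k * natureValue 𝓜 π (V n) s k ≤ V n s :=
    fun n s => (hgreedy n s _ ((pol n).prob_mem s)).trans (hself n s).ge
  have hanti : ∀ n s, V (n + 1) s ≤ V n s := by
    intro n s
    have := ((hVb (n + 1)).sub (hVb n)).le_of_le_discount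
      (stateKernel π (natureKernel 𝓜 (pol (n + 1)))) (a := 0) hγ0 hγ1 (fun s => ?_) s
    · rw [zero_div] at this; linarith
    · have h1 := hstep n s
      have h2 := hself (n + 1) s
      rw [sum_nature_mul_natureValue _ (hVb _)] at h1 h2
      rw [integral_sub ((hVb (n + 1)).integrable _) ((hVb n).integrable _)]
      linarith
  have hlow : ∀ n s, V (n + 1) s ≤ ∑ k, (pol (n + 1)).prob s k * natureValue 𝓜 π (V n) s k := by
    intro n s
    rw [hself (n + 1) s]
    exact Finset.sum_le_sum fun k _ => mul_le_mul_of_nonneg_left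
      (natureValue_mono (hVb _) (hVb _) (hanti n) s k) ((𝓜.weights_subset ((pol _).prob_mem s)).1 k)
  have hVmem : ∀ n s, V n s ∈ Set.Icc (0 : ℝ) (1 / (1 - 𝓜.discount)) := fun n s => by
    rw [hVdef n]; exact value_mem 𝓜 π (natureKernel 𝓜 (pol n)) s
  have hbdd : ∀ s, BddBelow (Set.range fun n => V n s) := fun s =>
    ⟨0, by rintro _ ⟨n, rfl⟩; exact (hVmem n s).1⟩
  let Vs : S → ℝ := fun s => ⨅ n, V n s
  have hlim : ∀ s, Filter.Tendsto (fun n => V n s) Filter.atTop (nhds (Vs s)) := fun s =>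
    tendsto_atTop_ciInf (antitone_nat_of_succ_le fun n => hanti n s) (hbdd s)
  have hVs_le : ∀ n s, Vs s ≤ V n s := fun n s => ciInf_le (hbdd s) n
  have hVsb : IsBdd Vs := by
    refine ⟨measurable_of_tendsto_metrizable (fun n => (hVb n).1) (tendsto_pi_nhds.2 hlim),
      1 / (1 - 𝓜.discount), fun s => ?_⟩
    rw [abs_of_nonneg (le_ciInf fun n => (hVmem n s).1)]
    exact (hVs_le 0 s).trans (hVmem 0 s).2
  have hnlim : ∀ s k, Filter.Tendsto (fun n => natureValue 𝓜 π (V n) s k) Filter.atTop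
      (nhds (natureValue 𝓜 π Vs s k)) := by
    intro s k
    refine tendsto_finsetSum _ fun a _ => Filter.Tendsto.const_mul _ (Filter.Tendsto.const_add _
      (Filter.Tendsto.const_mul _ ?_))
    refine tendsto_integral_of_dominated_convergence (fun _ => 1 / (1 - 𝓜.discount))
      (fun n => (hVb n).1.aestronglyMeasurable) (integrable_const _) (fun n => ?_)
      (Filter.Eventually.of_forall hlim)
    refine Filter.Eventually.of_forall fun x => ?_
    rw [Real.norm_of_nonneg (hVmem n x).1]
    exact (hVmem n x).2
  have hopt1 : ∀ s, ∀ w ∈ 𝓜.weights, Vs s ≤ ∑ k, w k * natureValue 𝓜 π Vs s k := by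
    intro s w hw
    refine ge_of_tendsto' (tendsto_finsetSum _ fun k _ => (hnlim s k).const_mul (w k)) fun n => ?_
    exact (hVs_le (n + 1) s).trans ((hlow n s).trans (hgreedy n s w hw))
  let ω := greedy ⟨Vs, hVsb⟩
  have hopt2 : ∀ s, ∑ k, ω.prob s k * natureValue 𝓜 π Vs s k ≤ Vs s := by
    intro s
    refine ge_of_tendsto' (hlim s) fun n => ?_
    refine le_trans ?_ (hstep n s)
    refine le_trans ((hsel (natureValue 𝓜 π Vs s)).2 _ ((pol (n + 1)).prob_mem s)) ?_
    exact Finset.sum_le_sum fun k _ => mul_le_mul_of_nonneg_left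
      (natureValue_mono hVsb (hVb n) (hVs_le n) s k) ((𝓜.weights_subset ((pol _).prob_mem s)).1 k)
  have hfix : ∀ s, Vs s = policyReward 𝓜 π s + 𝓜.discount *
      ∫ x, Vs x ∂(stateKernel π (natureKernel 𝓜 ω) s) := fun s => by
    rw [← sum_nature_mul_natureValue ω hVsb]
    exact le_antisymm (hopt1 s _ (ω.prob_mem s)) (hopt2 s)
  have hVω := isBdd_value 𝓜 π (natureKernel 𝓜 ω)
  -- The evaluation equation of the greedy policy at the limit has only one bounded solution.
  have heq : value 𝓜 π (natureKernel 𝓜 ω) = Vs := by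
    funext s
    refine le_antisymm ?_ ?_
    · have := (hVω.sub hVsb).le_of_le_discount (stateKernel π (natureKernel 𝓜 ω)) (a := 0) hγ0 hγ1
        (fun s => ?_) s
      · rw [zero_div] at this; linarith
      · rw [integral_sub (hVω.integrable _) (hVsb.integrable _)]
        have h1 := hfix s
        have h2 := value_bellman 𝓜 π (natureKernel 𝓜 ω) s
        linarith
    · have := (hVsb.sub hVω).le_of_le_discount (stateKernel π (natureKernel 𝓜 ω)) (a := 0) hγ0 hγ1
        (fun s => ?_) s
      · rw [zero_div] at this; linarith
      · rw [integral_sub (hVsb.integrable _) (hVω.integrable _)]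
        have h1 := hfix s
        have h2 := value_bellman 𝓜 π (natureKernel 𝓜 ω) s
        linarith
  refine ⟨ω, fun s w hw => ?_⟩
  rw [heq]
  exact hopt1 s w hw

/-- The discounted occupation measure of the states visited from the successor of `z` on when
nature follows `ω`. -/
noncomputable def occupation (π : ControlPolicy S A) (ω : NaturePolicy 𝓜) (z : S × A × Fin K) :
    Measure S :=
  Measure.sum fun t : ℕ => ENNReal.ofReal (𝓜.discount ^ (t + 1)) •
    ((𝓜.kernel z.2.2 z.2.1 z.1).bind
      (stateKernel π (natureKernel 𝓜 ω) ^ t : Kernel S S))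

lemma hasSum_discount_succ (𝓜 : Model S A K) : HasSum (fun t : ℕ => 𝓜.discount ^ (t + 1))
    (𝓜.discount / (1 - 𝓜.discount)) := by
  have := (hasSum_geometric_of_lt_one 𝓜.discount_pos.le 𝓜.discount_lt_one).mul_left 𝓜.discount
  simpa only [pow_succ', div_eq_mul_inv] using this

lemma occupation_univ (π : ControlPolicy S A) (ω : NaturePolicy 𝓜) (z : S × A × Fin K) :
    occupation π ω z Set.univ = ENNReal.ofReal (𝓜.discount / (1 - 𝓜.discount)) := by
  rw [occupation, Measure.sum_apply _ MeasurableSet.univ]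
  simp only [Measure.smul_apply, measure_univ, smul_eq_mul, mul_one]
  rw [← ENNReal.ofReal_tsum_of_nonneg (fun t => pow_nonneg 𝓜.discount_pos.le _)
    (hasSum_discount_succ 𝓜).summable, (hasSum_discount_succ 𝓜).tsum_eq]

instance (π : ControlPolicy S A) (ω : NaturePolicy 𝓜) (z : S × A × Fin K) :
    IsFiniteMeasure (occupation π ω z) :=
  ⟨by rw [occupation_univ]; exact ENNReal.ofReal_lt_top⟩

/-- The performance difference identity. -/
lemma jointQ_sub_jointQ (ω ω' : NaturePolicy 𝓜) (z : S × A × Fin K) :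
    jointQ 𝓜 π ω z - jointQ 𝓜 π ω' z = ∫ s, ∑ k, (ω.prob s k - ω'.prob s k) *
      natureValue 𝓜 π (value 𝓜 π (natureKernel 𝓜 ω)) s k ∂(occupation π ω' z) := by
  have hγ := 𝓜.discount_pos.le
  set V := value 𝓜 π (natureKernel 𝓜 ω) with hVdef
  set V' := value 𝓜 π (natureKernel 𝓜 ω') with hVdef'
  have hV : IsBdd V := isBdd_value 𝓜 π _
  have hV' : IsBdd V' := isBdd_value 𝓜 π _
  set κ := stateKernel π (natureKernel 𝓜 ω') with hκ
  set g : S → ℝ := fun s => ∑ k, (ω.prob s k - ω'.prob s k) * natureValue 𝓜 π V s k with hg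
  have hgb : IsBdd g := IsBdd.sum _ fun k _ =>
    ((isBdd_nature ω k).sub (isBdd_nature ω' k)).mul (isBdd_natureValue hV k)
  set D : S → ℝ := fun s => V s - V' s with hD
  have hDb : IsBdd D := hV.sub hV'
  -- The integrand is the residual `D - γ κ D` of the value difference along the kernel of `ω'`, so
  -- the discounted sum telescopes to `γ * I 0`.
  have hDg : ∀ s, g s = D s - 𝓜.discount * ∫ x, D x ∂κ s := by
    intro s
    simp only [hg, hD, sub_mul, Finset.sum_sub_distrib]
    rw [integral_sub (hV.integrable _) (hV'.integrable _), sum_nature_mul_natureValue ω' hV,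
      ← value_nature_eq]
    have := value_bellman 𝓜 π (natureKernel 𝓜 ω') s
    simp only [← hVdef', ← hκ] at this ⊢
    linarith
  set m := 𝓜.kernel z.2.2 z.2.1 z.1
  set I : ℕ → ℝ := fun t => ∫ x, D x ∂(m.bind (κ ^ t : Kernel S S)) with hI
  have hIg : ∀ t, ∫ x, g x ∂(m.bind (κ ^ t : Kernel S S)) = I t - 𝓜.discount * I (t + 1) := by
    intro t
    simp only [hDg, hI]
    rw [integral_sub (hDb.integrable _) (((hDb.kernel_integral κ).const_mul _).integrable _),
      integral_const_mul, (hDb.kernel_integral κ).integral_bind, hDb.integral_bind]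
    congr 2
    rw [hDb.integral_bind]
    exact integral_congr_ae (Filter.Eventually.of_forall fun x =>
      (hDb.integral_pow_succ' κ t x).symm)
  obtain ⟨c, hc⟩ := hDb.2
  have hIc : ∀ t, |I t| ≤ c := fun t => abs_integral_le_of_abs_le hc
  have hsum := hasSum_integral_measure (μ := fun t : ℕ => ENNReal.ofReal (𝓜.discount ^ (t + 1)) •
    (m.bind (κ ^ t : Kernel S S))) (f := g) (hgb.integrable (occupation π ω' z))
  have hpart : ∀ n, ∑ t ∈ Finset.range n, ∫ x, g x ∂(ENNReal.ofReal (𝓜.discount ^ (t + 1)) •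
      (m.bind (κ ^ t : Kernel S S))) = 𝓜.discount * I 0 - 𝓜.discount ^ (n + 1) * I n := by
    intro n
    induction n with
    | zero => simp
    | succ n ih =>
      rw [Finset.sum_range_succ, ih, integral_smul_measure, hIg,
        ENNReal.toReal_ofReal (pow_nonneg hγ _), smul_eq_mul]
      ring
  have hlim : Filter.Tendsto (fun n => 𝓜.discount * I 0 - 𝓜.discount ^ (n + 1) * I n)
      Filter.atTop (nhds (𝓜.discount * I 0 - 0)) := by
    refine Filter.Tendsto.const_sub _ ?_
    refine squeeze_zero_norm (a := fun n => 𝓜.discount ^ (n + 1) * c) (fun n => ?_) ?_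
    · rw [norm_mul, norm_pow, Real.norm_of_nonneg hγ]
      exact mul_le_mul_of_nonneg_left (hIc n) (pow_nonneg hγ _)
    · have := ((tendsto_pow_atTop_nhds_zero_of_lt_one hγ 𝓜.discount_lt_one).comp
        (Filter.tendsto_add_atTop_nat 1)).mul_const c
      simpa using this
  have heq := tendsto_nhds_unique (hsum.tendsto_sum_nat) (by simpa only [hpart] using hlim)
  have hI0 : I 0 = ∫ x, V x ∂m - ∫ x, V' x ∂m := by
    rw [← integral_sub (hV.integrable _) (hV'.integrable _)]
    simp only [hI]
    rw [hDb.integral_bind]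
    exact integral_congr_ae (Filter.Eventually.of_forall fun x => hDb.integral_pow_zero κ x)
  have hmain : ∫ s, g s ∂(occupation π ω' z) = 𝓜.discount * I 0 := by
    rw [← sub_zero (𝓜.discount * I 0), ← heq]; rfl
  rw [hmain, hI0, jointQ_eq, jointQ_eq]
  unfold actionValue
  ring

end Values

end RobustMDP
namespace RobustMDP
set_option linter.unusedSectionVars false

/-! ### Long run average costs controlled by nature -/

section AverageCost

variable {S A : Type*} {K : ℕ} [TopologicalSpace S] [MeasurableSpace S]
  [OpensMeasurableSpace S] [Fintype A] {𝓜 : Model S A K} {π : ControlPolicy S A}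
  {C ρ : ℝ} {ν : NaturePolicy 𝓜 → Measure S}

lemma abs_integral_stateKernel_pow_sub_le (herg : GeometricallyErgodic 𝓜 π C ρ ν)
    (ω : NaturePolicy 𝓜) {f : S → ℝ} (hf : IsBdd f) {b : ℝ} (hb : ∀ s, |f s| ≤ b) (t : ℕ) (s : S) :
    |∫ x, f x ∂((stateKernel π (natureKernel 𝓜 ω) ^ (t + 1) : Kernel S S) s) - ∫ x, f x ∂(ν ω)|
      ≤ 2 * b * (C * ρ ^ t) := by
  have := (herg ω).1
  exact abs_integral_sub_le_of_measure_le (fun B hB => (herg ω).2.2 s B hB t) hf.1 hb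

lemma integral_stationary_step (herg : GeometricallyErgodic 𝓜 π C ρ ν)
    (ω : NaturePolicy 𝓜) {f : S → ℝ} (hf : IsBdd f) :
    ∫ s, ∫ x, f x ∂(stateKernel π (natureKernel 𝓜 ω) s) ∂(ν ω) = ∫ s, f s ∂(ν ω) := by
  have := (herg ω).1
  rw [← hf.integral_bind, (herg ω).2.1]

/-- In a uniformly ergodic mixture model the long run average of a bounded cost is minimized by some
stationary policy of nature. -/
lemma exists_min_average (herg : GeometricallyErgodic 𝓜 π C ρ ν) (hC : 0 ≤ C)
    (hρ0 : 0 ≤ ρ) (hρ1 : ρ < 1) [Nonempty (NaturePolicy 𝓜)]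
    {c : Fin K → S → ℝ} (hc : ∀ k, IsBdd (c k)) :
    ∃ ω' : NaturePolicy 𝓜, ∀ ω : NaturePolicy 𝓜,
      ∫ s, ∑ k, ω'.prob s k * c k s ∂(ν ω') ≤ ∫ s, ∑ k, ω.prob s k * c k s ∂(ν ω) := by
  have hprob : ∀ ω, IsProbabilityMeasure (ν ω) := fun ω => (herg ω).1
  let u : NaturePolicy 𝓜 → S → ℝ := fun ω s => ∑ k, ω.prob s k * c k s
  have hu : ∀ ω, IsBdd (u ω) := fun ω => IsBdd.sum _ fun k _ => (isBdd_nature ω k).mul (hc k)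
  obtain ⟨b, hb0, hb⟩ : ∃ b, 0 ≤ b ∧ ∀ k s, |c k s| ≤ b := by
    choose b hb using fun k => (hc k).2
    refine ⟨∑ k, |b k|, Finset.sum_nonneg fun _ _ => abs_nonneg _, fun k s => ?_⟩
    exact (hb k s).trans ((le_abs_self _).trans
      (Finset.single_le_sum (f := fun k => |b k|) (fun _ _ => abs_nonneg _) (Finset.mem_univ k)))
  have hub : ∀ ω s, |u ω s| ≤ b := fun ω s =>
    abs_sum_mul_le (𝓜.weights_subset (ω.prob_mem s)) fun k => hb k s
  let J : NaturePolicy 𝓜 → ℝ := fun ω => ∫ s, u ω s ∂(ν ω)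
  have hJb : ∀ ω, |J ω| ≤ b := fun ω => abs_integral_le_of_abs_le (hub ω)
  let κ : NaturePolicy 𝓜 → Kernel S S := fun ω => stateKernel π (natureKernel 𝓜 ω)
  have hκ : ∀ ω, IsMarkovKernel (κ ω) := fun ω => inferInstanceAs (IsMarkovKernel (stateKernel _ _))
  let d : NaturePolicy 𝓜 → ℕ → S → ℝ := fun ω t s => ∫ x, u ω x ∂((κ ω ^ t : Kernel S S) s) - J ω
  have hd : ∀ ω t, IsBdd (d ω t) := fun ω t => ((hu ω).kernel_integral _).sub (isBdd_const _)
  have hdb : ∀ ω t s, |d ω (t + 1) s| ≤ 2 * b * (C * ρ ^ t) := fun ω t s =>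
    abs_integral_stateKernel_pow_sub_le herg ω (hu ω) (hub ω) t s
  -- Truncated relative values; geometric ergodicity bounds them by `H` uniformly in the policy and
  -- in the length.
  let h : NaturePolicy 𝓜 → ℕ → S → ℝ := fun ω n s => ∑ t ∈ Finset.range n, d ω t s
  have hh : ∀ ω n, IsBdd (h ω n) := fun ω n => IsBdd.sum _ fun t _ => hd ω t
  set H : ℝ := 2 * b + 2 * b * C * (1 / (1 - ρ)) with hH
  have hhb : ∀ ω n s, |h ω (n + 1) s| ≤ H := by
    intro ω n s
    simp only [h]
    rw [Finset.sum_range_succ']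
    refine (abs_add_le _ _).trans ?_
    rw [add_comm, hH]
    refine add_le_add ?_ ?_
    · simp only [d]
      rw [(hu ω).integral_pow_zero]
      have h1 := hub ω s
      have h2 := hJb ω
      have := abs_sub (u ω s) (J ω)
      linarith
    · refine (Finset.abs_sum_le_sum_abs _ _).trans ?_
      refine (Finset.sum_le_sum fun t _ => hdb ω t s).trans ?_
      rw [← Finset.mul_sum, ← Finset.mul_sum, ← mul_assoc]
      refine mul_le_mul_of_nonneg_left ?_ (by positivity)
      rw [one_div, ← tsum_geometric_of_lt_one hρ0 hρ1]
      exact (summable_geometric_of_lt_one hρ0 hρ1).sum_le_tsum _ fun _ _ => by positivity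
  -- Poisson equation of the truncation, whose defect `d` is geometrically small.
  have hpois : ∀ ω n s, J ω + h ω n s + d ω n s = u ω s + ∫ x, h ω n x ∂(κ ω s) := by
    intro ω n s
    have h1 : ∫ x, h ω n x ∂(κ ω s) = ∑ t ∈ Finset.range n, d ω (t + 1) s := by
      simp only [h]
      rw [integral_finsetSum _ fun t _ => (hd ω t).integrable _]
      refine Finset.sum_congr rfl fun t _ => ?_
      simp only [d]
      rw [integral_sub (((hu ω).kernel_integral _).integrable _) (integrable_const _),
        (hu ω).integral_pow_succ]
      simp
    have h2 : d ω 0 s = u ω s - J ω := by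
      simp only [d]; rw [(hu ω).integral_pow_zero]
    have h3 : h ω n s + d ω n s = ∑ t ∈ Finset.range n, d ω (t + 1) s + d ω 0 s := by
      simp only [h]; rw [← Finset.sum_range_succ, Finset.sum_range_succ']
    rw [h1]; linarith
  -- nature's one step value of a relative value function
  let Γ : (S → ℝ) → S → Fin K → ℝ := fun V s k =>
    c k s + ∑ a, π.prob s a * ∫ x, V x ∂(𝓜.kernel k a s)
  have hΓ : ∀ {V}, IsBdd V → ∀ k, IsBdd fun s => Γ V s k := fun hV k =>
    (hc k).add (IsBdd.sum _ fun a _ => (isBdd_policy π a).mul (hV.kernel_integral _))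
  have hΓmono : ∀ {V V' : S → ℝ}, IsBdd V → IsBdd V' → (∀ s, V s ≤ V' s) → ∀ s k,
      Γ V s k ≤ Γ V' s k := fun hV hV' hle s k => by
    refine add_le_add le_rfl (Finset.sum_le_sum fun a _ => mul_le_mul_of_nonneg_left ?_
      ((π.prob_mem s).1 a))
    exact integral_mono (hV.integrable _) (hV'.integrable _) hle
  have hΓω : ∀ ω {V}, IsBdd V → ∀ s, ∑ k, ω.prob s k * Γ V s k = u ω s + ∫ x, V x ∂(κ ω s) := by
    intro ω V hV s
    simp only [κ, Γ, u]
    rw [integral_stateKernel (fun _ => inferInstance) hV]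
    simp only [integral_natureKernel ω _ hV, mul_add, Finset.sum_add_distrib, Finset.mul_sum]
    congr 1
    rw [Finset.sum_comm]
    exact Finset.sum_congr rfl fun a _ => Finset.sum_congr rfl fun k _ => by ring
  have hJbdd : BddBelow (Set.range J) :=
    ⟨-b, by rintro _ ⟨ω, rfl⟩; exact (abs_le.1 (hJb ω)).1⟩
  obtain ⟨Js, hJanti, hJlim, hJmem⟩ := exists_seq_tendsto_sInf (Set.range_nonempty J) hJbdd
  choose om hom using hJmem
  set g := sInf (Set.range J) with hg
  -- The policies `om n` have averages tending to the infimum `g`, and the growing length removes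
  -- the Poisson defect. The tail infima `gN` increase to the lower limit `hs`, so dominated
  -- convergence applies to them.
  let hn : ℕ → S → ℝ := fun n => h (om n) (n + 1)
  have hnb : ∀ n, IsBdd (hn n) := fun n => hh _ _
  have hnH : ∀ n s, |hn n s| ≤ H := fun n s => hhb _ _ _
  have hbelow : ∀ N s, BddBelow (Set.range fun n => hn (N + n) s) := fun N s =>
    ⟨-H, by rintro _ ⟨n, rfl⟩; exact (abs_le.1 (hnH _ s)).1⟩
  let gN : ℕ → S → ℝ := fun N s => ⨅ n, hn (N + n) s
  have hgle : ∀ N n s, N ≤ n → gN N s ≤ hn n s := fun N n s hNn => by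
    have := ciInf_le (hbelow N s) (n - N)
    simpa [Nat.add_sub_cancel' hNn] using this
  have hgH : ∀ N s, |gN N s| ≤ H := fun N s =>
    abs_le.2 ⟨le_ciInf fun n => (abs_le.1 (hnH _ s)).1,
      (hgle N N s le_rfl).trans (abs_le.1 (hnH _ s)).2⟩
  have hgb : ∀ N, IsBdd (gN N) := fun N =>
    ⟨Measurable.iInf fun n => (hnb _).1, H, hgH N⟩
  have hgmono : ∀ s, Monotone fun N => gN N s := fun s N N' hNN' =>
    le_ciInf fun n => hgle N (N' + n) s (by omega)
  have hgabove : ∀ s, BddAbove (Set.range fun N => gN N s) := fun s =>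
    ⟨H, by rintro _ ⟨N, rfl⟩; exact (abs_le.1 (hgH N s)).2⟩
  let hs : S → ℝ := fun s => ⨆ N, gN N s
  have hglim : ∀ s, Filter.Tendsto (fun N => gN N s) Filter.atTop (nhds (hs s)) := fun s =>
    tendsto_atTop_ciSup (hgmono s) (hgabove s)
  have hgs : ∀ N s, gN N s ≤ hs s := fun N s => le_ciSup (hgabove s) N
  have hsb : IsBdd hs := by
    refine ⟨measurable_of_tendsto_metrizable (fun N => (hgb N).1) (tendsto_pi_nhds.2 hglim), H,
      fun s => abs_le.2 ⟨((abs_le.1 (hgH 0 s)).1).trans (hgs 0 s),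
        ciSup_le fun N => (abs_le.1 (hgH N s)).2⟩⟩
  have hΓlim : ∀ s k, Filter.Tendsto (fun N => Γ (gN N) s k) Filter.atTop (nhds (Γ hs s k)) := by
    intro s k
    refine Filter.Tendsto.const_add _ (tendsto_finsetSum _ fun a _ => Filter.Tendsto.const_mul _ ?_)
    refine tendsto_integral_of_dominated_convergence (fun _ => H)
      (fun n => (hgb n).1.aestronglyMeasurable) (integrable_const _) (fun n => ?_)
      (Filter.Eventually.of_forall hglim)
    exact Filter.Eventually.of_forall fun x => hgH n x
  obtain ⟨sel, hselm, hsel⟩ := exists_measurable_linear_argmin 𝓜.weights_closed 𝓜.weights_convex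
    𝓜.weights_nonempty 𝓜.weights_subset
  let ω' : NaturePolicy 𝓜 :=
    { prob := fun s => sel (Γ hs s)
      measurable_prob := hselm.comp (measurable_pi_lambda _ fun k => (hΓ hsb k).1)
      prob_mem := fun s => (hsel _).1 }
  -- the average cost optimality inequality
  have hstep : ∀ N s, ∑ k, ω'.prob s k * Γ hs s k - ∑ k, (Γ hs s k - Γ (gN N) s k) ≤ hs s + g := by
    intro N s
    have h1 : ∀ n ≥ N, ∑ k, ω'.prob s k * Γ hs s k - ∑ k, (Γ hs s k - Γ (gN N) s k) ≤
        hn n s + (J (om n) + 2 * b * (C * ρ ^ n)) := by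
      intro n hn'
      have e1 := hpois (om n) (n + 1) s
      rw [← hΓω (om n) (hh _ _) s] at e1
      have e2 := (abs_le.1 (hdb (om n) n s)).2
      have e3 : ∑ k, (om n).prob s k * Γ (gN N) s k ≤
          ∑ k, (om n).prob s k * Γ (h (om n) (n + 1)) s k :=
        Finset.sum_le_sum fun k _ => mul_le_mul_of_nonneg_left
          (hΓmono (hgb N) (hh _ _) (fun x => hgle N n x hn') s k)
          ((𝓜.weights_subset ((om n).prob_mem s)).1 k)
      have e4 : ∑ k, ω'.prob s k * Γ hs s k ≤ ∑ k, (om n).prob s k * Γ hs s k :=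
        (hsel (Γ hs s)).2 _ ((om n).prob_mem s)
      have e5 : ∑ k, (om n).prob s k * Γ hs s k - ∑ k, (om n).prob s k * Γ (gN N) s k ≤
          ∑ k, (Γ hs s k - Γ (gN N) s k) := by
        rw [← Finset.sum_sub_distrib]
        refine Finset.sum_le_sum fun k _ => ?_
        rw [← mul_sub]
        have hw := 𝓜.weights_subset ((om n).prob_mem s)
        refine mul_le_of_le_one_left
          (sub_nonneg.2 (hΓmono (hgb N) hsb (fun x => hgs N x) s k)) ?_
        rw [← hw.2]
        exact Finset.single_le_sum (fun i _ => hw.1 i) (Finset.mem_univ k)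
      simp only [hn]
      linarith
    have h2 : Filter.Tendsto (fun n => J (om n) + 2 * b * (C * ρ ^ n)) Filter.atTop
        (nhds (g + 2 * b * (C * 0))) := by
      refine Filter.Tendsto.add ?_ (Filter.Tendsto.const_mul _ (Filter.Tendsto.const_mul _
        (tendsto_pow_atTop_nhds_zero_of_lt_one hρ0 hρ1)))
      simpa only [hom] using hJlim
    rw [mul_zero, mul_zero, add_zero] at h2
    refine le_of_forall_pos_le_add fun e he => ?_
    obtain ⟨N1, hN1⟩ := Filter.eventually_atTop.1 (h2.eventually (gt_mem_nhds (lt_add_of_pos_right g he)))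
    have h3 : ∑ k, ω'.prob s k * Γ hs s k - ∑ k, (Γ hs s k - Γ (gN N) s k) - (g + e) ≤
        gN (max N N1) s := by
      refine le_ciInf fun n => ?_
      have := h1 (max N N1 + n) (by omega)
      have := hN1 (max N N1 + n) (by omega)
      linarith
    have := hgs (max N N1) s
    linarith
  -- Average cost optimality inequality for the selector `ω'`. Integration against `ν ω'` cancels
  -- `hs` and leaves `J ω' ≤ g`.
  have hacoi : ∀ s, ∑ k, ω'.prob s k * Γ hs s k ≤ hs s + g := by
    intro s
    have hl : Filter.Tendsto (fun N => ∑ k, ω'.prob s k * Γ hs s k -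
        ∑ k, (Γ hs s k - Γ (gN N) s k)) Filter.atTop
        (nhds (∑ k, ω'.prob s k * Γ hs s k - ∑ k, (Γ hs s k - Γ hs s k))) :=
      Filter.Tendsto.const_sub _ (tendsto_finsetSum _ fun k _ => (hΓlim s k).const_sub _)
    have := le_of_tendsto' hl fun N => hstep N s
    simpa using this
  refine ⟨ω', fun ω => ?_⟩
  have hle : J ω' ≤ g := by
    have h1 : ∫ s, (u ω' s + ∫ x, hs x ∂(κ ω' s)) ∂(ν ω') ≤ ∫ s, (hs s + g) ∂(ν ω') := by
      refine integral_mono (((hu ω').add (hsb.kernel_integral _)).integrable _)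
        ((hsb.add (isBdd_const g)).integrable _) fun s => ?_
      have := hacoi s
      rwa [hΓω ω' hsb s] at this
    rw [integral_add ((hu ω').integrable _) ((hsb.kernel_integral _).integrable _),
      integral_add (hsb.integrable _) (integrable_const _),
      integral_stationary_step herg ω' hsb] at h1
    simp only [integral_const, probReal_univ, smul_eq_mul, one_mul] at h1
    simp only [J]
    linarith
  exact hle.trans (csInf_le hJbdd ⟨ω, rfl⟩)

end AverageCost

/-! ### Drawing an action and a kernel index -/

section Draw

variable {S A X : Type*} {K : ℕ} [TopologicalSpace S] [MeasurableSpace S] [MeasurableSpace X]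
  [Fintype A] [MeasurableSpace A] {𝓜 : Model S A K} (π : ControlPolicy S A)

instance isMarkovKernel_drawZ (g : X → S) (hg : Measurable g) (ω : Policy X (Fin K) 𝓜.weights) :
    IsMarkovKernel (drawZ g hg π ω) :=
  isMarkovKernel_mix _ _ _ (fun _ => inferInstance) fun x =>
    prod_mem_stdSimplex (π.prob_mem (g x)) (𝓜.weights_subset (ω.prob_mem x))

lemma integral_drawZ (g : X → S) (hg : Measurable g) (ω : Policy X (Fin K) 𝓜.weights)
    {f : S × A × Fin K → ℝ} (hf : IsBdd f) (x : X) :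
    ∫ z, f z ∂(drawZ g hg π ω x) =
      ∑ k, ω.prob x k * ∑ a, π.prob (g x) a * f (g x, a, k) := by
  unfold drawZ
  rw [integral_mix _ (fun _ => inferInstance) (fun x =>
    prod_mem_stdSimplex (π.prob_mem (g x)) (𝓜.weights_subset (ω.prob_mem x))) hf,
    Fintype.sum_prod_type, Finset.sum_comm]
  refine Finset.sum_congr rfl fun k _ => ?_
  rw [Finset.mul_sum]
  refine Finset.sum_congr rfl fun a _ => ?_
  rw [Kernel.integral_deterministic' _ hf.1.stronglyMeasurable]
  ring

lemma lintegral_drawZ (g : X → S) (hg : Measurable g) (ω : Policy X (Fin K) 𝓜.weights)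
    {f : S × A × Fin K → ENNReal} (hf : Measurable f) (x : X) :
    ∫⁻ z, f z ∂(drawZ g hg π ω x) = ∑ i : A × Fin K,
      ENNReal.ofReal (π.prob (g x) i.1 * ω.prob x i.2) * f (g x, i.1, i.2) := by
  unfold drawZ
  rw [lintegral_mix]
  exact Finset.sum_congr rfl fun i _ => by rw [Kernel.lintegral_deterministic' _ hf]

end Draw

/-! ### Feature covariance and its uniform positivity -/

section Covariance

variable {S A : Type*} {K d : ℕ} [TopologicalSpace S] [MeasurableSpace S]
  [OpensMeasurableSpace S] [Fintype A] [MeasurableSpace A] [DiscreteMeasurableSpace A]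
  {𝓜 : Model S A K} {φ : FeatureMap S A K d} {π : ControlPolicy S A}
  {C ρ : ℝ} {ν : NaturePolicy 𝓜 → Measure S}

lemma measurable_linQ (φ : FeatureMap S A K d) (θ : EuclideanSpace ℝ (Fin d)) :
    Measurable (linQ φ θ) := by
  unfold linQ
  exact φ.measurable_feat.inner measurable_const

lemma abs_linQ_le (φ : FeatureMap S A K d) (θ : EuclideanSpace ℝ (Fin d)) (z : S × A × Fin K) :
    |linQ φ θ z| ≤ ‖θ‖ := by
  unfold linQ
  refine (abs_real_inner_le_norm _ _).trans ?_
  exact mul_le_of_le_one_left (norm_nonneg _) (φ.norm_feat_le z)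

lemma isBdd_linQ (φ : FeatureMap S A K d) (θ : EuclideanSpace ℝ (Fin d)) : IsBdd (linQ φ θ) :=
  ⟨measurable_linQ φ θ, ‖θ‖, abs_linQ_le φ θ⟩

lemma linQ_add (φ : FeatureMap S A K d) (θ θ' : EuclideanSpace ℝ (Fin d)) (z : S × A × Fin K) :
    linQ φ (θ + θ') z = linQ φ θ z + linQ φ θ' z := inner_add_right _ _ _

lemma linQ_sub (φ : FeatureMap S A K d) (θ θ' : EuclideanSpace ℝ (Fin d)) (z : S × A × Fin K) :
    linQ φ (θ - θ') z = linQ φ θ z - linQ φ θ' z := inner_sub_right _ _ _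

lemma linQ_smul (φ : FeatureMap S A K d) (c : ℝ) (θ : EuclideanSpace ℝ (Fin d))
    (z : S × A × Fin K) : linQ φ (c • θ) z = c * linQ φ θ z := real_inner_smul_right _ _ _

lemma isProbabilityMeasure_stationaryZ (herg : GeometricallyErgodic 𝓜 π C ρ ν)
    (ω : NaturePolicy 𝓜) : IsProbabilityMeasure (stationaryZ 𝓜 π ω (ν ω)) := by
  have := (herg ω).1
  unfold stationaryZ
  infer_instance

lemma integral_stationaryZ (herg : GeometricallyErgodic 𝓜 π C ρ ν) (ω : NaturePolicy 𝓜)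
    {f : S × A × Fin K → ℝ} (hf : IsBdd f) :
    ∫ z, f z ∂(stationaryZ 𝓜 π ω (ν ω)) =
      ∫ s, ∑ k, ω.prob s k * ∑ a, π.prob s a * f (s, a, k) ∂(ν ω) := by
  have := (herg ω).1
  unfold stationaryZ
  rw [hf.integral_bind]
  simp only [integral_drawZ π id measurable_id ω hf, id_eq]

/-- The second moment of a linear function of the features under the stationary law. -/
noncomputable def featureEnergy (φ : FeatureMap S A K d) (π : ControlPolicy S A)
    (ν : NaturePolicy 𝓜 → Measure S) (ω : NaturePolicy 𝓜) (v : EuclideanSpace ℝ (Fin d)) : ℝ :=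
  ∫ z, linQ φ v z ^ 2 ∂(stationaryZ 𝓜 π ω (ν ω))

lemma isBdd_linQ_sq (φ : FeatureMap S A K d) (v : EuclideanSpace ℝ (Fin d)) :
    IsBdd fun z => linQ φ v z ^ 2 := by
  simpa only [sq] using (isBdd_linQ φ v).mul (isBdd_linQ φ v)

lemma isBdd_feat (φ : FeatureMap S A K d) (i : Fin d) : IsBdd fun z => φ.feat z i := by
  refine ⟨?_, 1, fun z => ?_⟩
  · exact (measurable_pi_apply i).comp
      ((PiLp.continuous_ofLp 2 (fun _ : Fin d => ℝ)).measurable.comp φ.measurable_feat)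
  · exact (PiLp.norm_apply_le (φ.feat z) i).trans (φ.norm_feat_le z)

lemma linQ_eq_sum (φ : FeatureMap S A K d) (v : EuclideanSpace ℝ (Fin d)) (z : S × A × Fin K) :
    linQ φ v z = ∑ i, φ.feat z i * v i := by
  unfold linQ
  rw [PiLp.inner_apply]
  exact Finset.sum_congr rfl fun i _ => by simp [mul_comm]

lemma dotProduct_covariance (herg : GeometricallyErgodic 𝓜 π C ρ ν) (ω : NaturePolicy 𝓜)
    (v : EuclideanSpace ℝ (Fin d)) :
    (v.ofLp ⬝ᵥ (covariance 𝓜 φ π ν ω).mulVec v.ofLp) = featureEnergy φ π ν ω v := by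
  have := isProbabilityMeasure_stationaryZ herg ω
  have hb : ∀ i j, IsBdd fun z => φ.feat z i * φ.feat z j := fun i j =>
    (isBdd_feat φ i).mul (isBdd_feat φ j)
  unfold featureEnergy covariance dotProduct Matrix.mulVec dotProduct
  have e : ∀ z, linQ φ v z ^ 2 = ∑ i, ∑ j, v i * v j * (φ.feat z i * φ.feat z j) := by
    intro z
    rw [linQ_eq_sum, sq, Finset.sum_mul_sum]
    exact Finset.sum_congr rfl fun i _ => Finset.sum_congr rfl fun j _ => by ring
  simp only [e]
  rw [integral_finsetSum _ fun i _ =>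
    (IsBdd.sum _ fun j _ => (hb i j).const_mul _).integrable _]
  refine Finset.sum_congr rfl fun i _ => ?_
  rw [integral_finsetSum _ fun j _ => ((hb i j).const_mul _).integrable _, Finset.mul_sum]
  refine Finset.sum_congr rfl fun j _ => ?_
  rw [integral_const_mul, Matrix.of_apply]
  ring

lemma featureEnergy_nonneg (ω : NaturePolicy 𝓜) (v : EuclideanSpace ℝ (Fin d)) :
    0 ≤ featureEnergy φ π ν ω v := integral_nonneg fun _ => sq_nonneg _

lemma featureEnergy_le (herg : GeometricallyErgodic 𝓜 π C ρ ν) (ω : NaturePolicy 𝓜)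
    (v : EuclideanSpace ℝ (Fin d)) : featureEnergy φ π ν ω v ≤ ‖v‖ ^ 2 := by
  have := isProbabilityMeasure_stationaryZ herg ω
  refine (le_abs_self _).trans (abs_integral_le_of_abs_le fun z => ?_)
  rw [abs_pow]
  exact pow_le_pow_left₀ (abs_nonneg _) (abs_linQ_le φ v z) 2

lemma featureEnergy_smul (ω : NaturePolicy 𝓜) (c : ℝ) (v : EuclideanSpace ℝ (Fin d)) :
    featureEnergy φ π ν ω (c • v) = c ^ 2 * featureEnergy φ π ν ω v := by
  unfold featureEnergy
  rw [← integral_const_mul]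
  simp only [linQ_smul, mul_pow]

lemma featureEnergy_sub_le (herg : GeometricallyErgodic 𝓜 π C ρ ν) (ω : NaturePolicy 𝓜)
    (v v' : EuclideanSpace ℝ (Fin d)) :
    featureEnergy φ π ν ω v - featureEnergy φ π ν ω v' ≤ ‖v - v'‖ * (‖v‖ + ‖v'‖) := by
  have := isProbabilityMeasure_stationaryZ herg ω
  unfold featureEnergy
  rw [← integral_sub ((isBdd_linQ_sq φ v).integrable _) ((isBdd_linQ_sq φ v').integrable _)]
  refine (le_abs_self _).trans (abs_integral_le_of_abs_le fun z => ?_)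
  rw [sq_sub_sq, mul_comm, abs_mul, ← linQ_sub]
  refine mul_le_mul (abs_linQ_le φ _ z) ((abs_add_le _ _).trans
    (add_le_add (abs_linQ_le φ _ z) (abs_linQ_le φ _ z))) (abs_nonneg _) (norm_nonneg _)

/-- In a fixed direction `v` the energy is a stationary average cost, so some policy minimizes it,
and positive definiteness at that policy makes the minimum positive. On the unit sphere the energy
is Lipschitz in `v` uniformly in `ω`, so compactness gives one constant for all directions. -/
lemma exists_featureEnergy_lower_bound (herg : GeometricallyErgodic 𝓜 π C ρ ν) (hC : 0 ≤ C)
    (hρ0 : 0 ≤ ρ) (hρ1 : ρ < 1) [Nonempty (NaturePolicy 𝓜)]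
    (hcov : ∀ ω, (covariance 𝓜 φ π ν ω).PosDef) :
    ∃ c > 0, ∀ (ω : NaturePolicy 𝓜) (v : EuclideanSpace ℝ (Fin d)),
      c * ‖v‖ ^ 2 ≤ featureEnergy φ π ν ω v := by
  have hpos : ∀ v : EuclideanSpace ℝ (Fin d), v ≠ 0 →
      ∃ c > 0, ∀ ω : NaturePolicy 𝓜, c ≤ featureEnergy φ π ν ω v := by
    intro v hv
    have hb := isBdd_linQ_sq φ v
    have hcb : ∀ k : Fin K, IsBdd fun s => ∑ a, π.prob s a * linQ φ v (s, a, k) ^ 2 := fun k =>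
      IsBdd.sum _ fun a _ => (isBdd_policy π a).mul
        (hb.comp (g := fun s => (s, a, k)) (by fun_prop))
    obtain ⟨ω', hω'⟩ := exists_min_average herg hC hρ0 hρ1 hcb
    refine ⟨featureEnergy φ π ν ω' v, ?_, fun ω => ?_⟩
    · rw [← dotProduct_covariance herg]
      have hv' : v.ofLp ≠ 0 := fun h => hv (by ext i; simp [h])
      simpa using (hcov ω').dotProduct_mulVec_pos hv'
    · have := hω' ω
      unfold featureEnergy
      rwa [integral_stationaryZ herg ω' hb, integral_stationaryZ herg ω hb]
  have hsph : ∃ c > 0, ∀ v ∈ Metric.sphere (0 : EuclideanSpace ℝ (Fin d)) 1,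
      ∀ ω : NaturePolicy 𝓜, c ≤ featureEnergy φ π ν ω v := by
    refine (isCompact_sphere (0 : EuclideanSpace ℝ (Fin d)) 1).induction_on
      (p := fun t => ∃ c > 0, ∀ v ∈ t, ∀ ω : NaturePolicy 𝓜, c ≤ featureEnergy φ π ν ω v)
      ⟨1, one_pos, fun v hv => absurd hv (Set.notMem_empty v)⟩ ?_ ?_ ?_
    · rintro s t hst ⟨c, hc, h⟩
      exact ⟨c, hc, fun v hv => h v (hst hv)⟩
    · rintro s t ⟨c, hc, h⟩ ⟨c', hc', h'⟩
      refine ⟨min c c', lt_min hc hc', fun v hv ω => ?_⟩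
      rcases hv with hv | hv
      · exact (min_le_left _ _).trans (h v hv ω)
      · exact (min_le_right _ _).trans (h' v hv ω)
    · intro v hv
      have hv1 : ‖v‖ = 1 := by simpa using hv
      obtain ⟨c, hc, h⟩ := hpos v (by rintro rfl; simp at hv1)
      refine ⟨Metric.ball v (c / 4) ∩ Metric.sphere 0 1, Filter.inter_mem
        (mem_nhdsWithin_of_mem_nhds (Metric.ball_mem_nhds _ (by positivity))) self_mem_nhdsWithin,
        c / 2, by positivity, ?_⟩
      rintro v' ⟨hv', hv's⟩ ω
      have hv'1 : ‖v'‖ = 1 := by simpa using hv's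
      have h1 := featureEnergy_sub_le (φ := φ) herg ω v v'
      rw [hv1, hv'1] at h1
      rw [Metric.mem_ball, dist_comm, dist_eq_norm] at hv'
      have := h ω
      linarith
  obtain ⟨c, hc, h⟩ := hsph
  refine ⟨c, hc, fun ω v => ?_⟩
  rcases eq_or_ne v 0 with rfl | hv
  · simpa using featureEnergy_nonneg ω 0
  · have hn : ‖v‖ ≠ 0 := norm_ne_zero_iff.2 hv
    have := h (‖v‖⁻¹ • v) (by simp [norm_smul, hn]) ω
    rw [featureEnergy_smul] at this
    have h2 := mul_le_mul_of_nonneg_right this (sq_nonneg ‖v‖)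
    rwa [mul_right_comm, ← mul_pow, inv_mul_cancel₀ hn, one_pow, one_mul] at h2

/-- Both sides say that `M - c` is positive semidefinite. -/
lemma spectrum_bound_iff {M : Matrix (Fin d) (Fin d) ℝ} (hM : M.IsHermitian) (c : ℝ) :
    (∀ x ∈ spectrum ℝ M, c ≤ x) ↔
      ∀ v : Fin d → ℝ, c * (v ⬝ᵥ v) ≤ v ⬝ᵥ M.mulVec v := by
  have hc : (algebraMap ℝ (Matrix (Fin d) (Fin d) ℝ) c) = c • (1 : Matrix (Fin d) (Fin d) ℝ) :=
    Algebra.algebraMap_eq_smul_one c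
  have hH : (M - algebraMap ℝ (Matrix (Fin d) (Fin d) ℝ) c).IsHermitian := by
    rw [hc]
    exact hM.sub ((Matrix.isHermitian_one).smul (by simp [IsSelfAdjoint]))
  have h1 : (M - algebraMap ℝ (Matrix (Fin d) (Fin d) ℝ) c).PosSemidef ↔
      ∀ x ∈ spectrum ℝ M, c ≤ x := by
    rw [Matrix.posSemidef_iff_isHermitian_and_spectrum_nonneg, ← spectrum.sub_singleton_eq]
    simp only [hH, true_and, Set.sub_singleton, Set.image_subset_iff]
    exact ⟨fun h x hx => sub_nonneg.1 (h hx), fun h x hx => sub_nonneg.2 (h x hx)⟩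
  have hq : ∀ v : Fin d → ℝ, star v ⬝ᵥ (M - algebraMap ℝ (Matrix (Fin d) (Fin d) ℝ) c).mulVec v =
      v ⬝ᵥ M.mulVec v - c * (v ⬝ᵥ v) := fun v => by
    rw [hc, Matrix.sub_mulVec, Matrix.smul_mulVec, Matrix.one_mulVec, dotProduct_sub,
      dotProduct_smul, star_trivial, smul_eq_mul]
  rw [← h1]
  constructor
  · intro h v
    have := h.dotProduct_mulVec_nonneg v
    rw [hq] at this
    linarith
  · intro h
    refine Matrix.PosSemidef.of_dotProduct_mulVec_nonneg hH fun v => ?_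
    rw [hq]
    have := h v
    linarith

end Covariance

end RobustMDP
namespace RobustMDP
set_option linter.unusedSectionVars false

/-! ### The extreme eigenvalues -/

section Constants

variable {S A : Type*} {K d : ℕ} [TopologicalSpace S] [MeasurableSpace S]
  [OpensMeasurableSpace S] [Fintype A] [MeasurableSpace A] [DiscreteMeasurableSpace A]
  {𝓜 : Model S A K} {φ : FeatureMap S A K d} {π : ControlPolicy S A}
  {C ρ : ℝ} {ν : NaturePolicy 𝓜 → Measure S}

instance nonempty_naturePolicy (𝓜 : Model S A K) : Nonempty (NaturePolicy 𝓜) :=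
  ⟨⟨fun _ => 𝓜.weights_nonempty.some, measurable_const, fun _ => 𝓜.weights_nonempty.some_mem⟩⟩

lemma ofLp_dotProduct_self (v : EuclideanSpace ℝ (Fin d)) : v.ofLp ⬝ᵥ v.ofLp = ‖v‖ ^ 2 := by
  rw [EuclideanSpace.norm_sq_eq, dotProduct]
  exact Finset.sum_congr rfl fun i _ => by simp [sq]

/-- `0 < d` makes the spectrum nonempty; with the lower bound, `sInf` is then a true infimum and not
a default value. -/
lemma covariance_spectrum (herg : GeometricallyErgodic 𝓜 π C ρ ν)
    (hcov : ∀ ω, (covariance 𝓜 φ π ν ω).PosDef) (hd : 0 < d) (ω : NaturePolicy 𝓜) :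
    (spectrum ℝ (covariance 𝓜 φ π ν ω)).Nonempty ∧
    BddBelow (spectrum ℝ (covariance 𝓜 φ π ν ω)) ∧
    ∀ c : ℝ, (∀ x ∈ spectrum ℝ (covariance 𝓜 φ π ν ω), c ≤ x) ↔
      ∀ v, c * ‖v‖ ^ 2 ≤ featureEnergy φ π ν ω v := by
  have hiff : ∀ c : ℝ, (∀ x ∈ spectrum ℝ (covariance 𝓜 φ π ν ω), c ≤ x) ↔
      ∀ v, c * ‖v‖ ^ 2 ≤ featureEnergy φ π ν ω v := by
    intro c
    rw [spectrum_bound_iff (hcov ω).1]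
    constructor
    · intro h v
      have := h v.ofLp
      rwa [dotProduct_covariance herg, ofLp_dotProduct_self] at this
    · intro h v
      have := h (WithLp.toLp 2 v)
      rw [← dotProduct_covariance herg, ← ofLp_dotProduct_self] at this
      exact this
  refine ⟨?_, ⟨0, fun x hx => (hiff 0).2 (fun v => by
    rw [zero_mul]; exact featureEnergy_nonneg ω v) x hx⟩, hiff⟩
  have : Nonempty (Fin d) := ⟨⟨0, hd⟩⟩
  rw [(hcov ω).1.spectrum_real_eq_range_eigenvalues]
  exact Set.range_nonempty _

lemma sInf_spectrum_mul_le (herg : GeometricallyErgodic 𝓜 π C ρ ν)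
    (hcov : ∀ ω, (covariance 𝓜 φ π ν ω).PosDef) (hd : 0 < d) (ω : NaturePolicy 𝓜)
    (v : EuclideanSpace ℝ (Fin d)) :
    sInf (spectrum ℝ (covariance 𝓜 φ π ν ω)) * ‖v‖ ^ 2 ≤ featureEnergy φ π ν ω v := by
  obtain ⟨h1, h2, h3⟩ := covariance_spectrum herg hcov hd ω
  exact (h3 _).1 (fun x hx => csInf_le h2 hx) v

variable {hK : 2 ≤ K}

lemma lamMin_pos (herg : GeometricallyErgodic 𝓜 π C ρ ν) (hC : 0 ≤ C) (hρ0 : 0 ≤ ρ) (hρ1 : ρ < 1)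
    (hcov : ∀ ω, (covariance 𝓜 φ π ν ω).PosDef) (hd : 0 < d) :
    0 < (evalConsts 𝓜 φ π ν C ρ hK).lamMin := by
  obtain ⟨c, hc, h⟩ := exists_featureEnergy_lower_bound herg hC hρ0 hρ1 hcov
  refine hc.trans_le (le_ciInf fun ω => ?_)
  obtain ⟨h1, h2, h3⟩ := covariance_spectrum herg hcov hd ω
  exact le_csInf h1 ((h3 c).2 (h ω))

lemma lamMin_mul_le (herg : GeometricallyErgodic 𝓜 π C ρ ν)
    (hcov : ∀ ω, (covariance 𝓜 φ π ν ω).PosDef) (hd : 0 < d) (ω : NaturePolicy 𝓜)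
    (v : EuclideanSpace ℝ (Fin d)) :
    (evalConsts 𝓜 φ π ν C ρ hK).lamMin * ‖v‖ ^ 2 ≤ featureEnergy φ π ν ω v := by
  refine le_trans (mul_le_mul_of_nonneg_right ?_ (sq_nonneg _))
    (sInf_spectrum_mul_le herg hcov hd ω v)
  refine ciInf_le ⟨0, ?_⟩ ω
  rintro _ ⟨ω', rfl⟩
  refine Real.sInf_nonneg fun x hx => ?_
  exact ((covariance_spectrum herg hcov hd ω').2.2 0).2 (fun v => by
    rw [zero_mul]; exact featureEnergy_nonneg ω' v) x hx

lemma lamMax_nonneg (herg : GeometricallyErgodic 𝓜 π C ρ ν)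
    (hcov : ∀ ω, (covariance 𝓜 φ π ν ω).PosDef) (hd : 0 < d) :
    0 ≤ (evalConsts 𝓜 φ π ν C ρ hK).lamMax := by
  refine Real.iSup_nonneg fun ω => Real.sSup_nonneg fun x hx => ?_
  exact ((covariance_spectrum herg hcov hd ω).2.2 0).2 (fun v => by
    rw [zero_mul]; exact featureEnergy_nonneg ω v) x hx

/-- The trace of the covariance is the mean of `‖φ‖²`, hence at most one, and each diagonal entry is
at least the smallest eigenvalue. This is what later removes the dimension from the union bound over
the net. -/
lemma dim_mul_lamMin_le_one (herg : GeometricallyErgodic 𝓜 π C ρ ν)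
    (hcov : ∀ ω, (covariance 𝓜 φ π ν ω).PosDef) (hd : 0 < d) :
    d * (evalConsts 𝓜 φ π ν C ρ hK).lamMin ≤ 1 := by
  obtain ⟨ω⟩ := nonempty_naturePolicy 𝓜
  have := isProbabilityMeasure_stationaryZ herg ω
  have h1 : ∀ i : Fin d, (evalConsts 𝓜 φ π ν C ρ hK).lamMin ≤
      ∫ z, φ.feat z i ^ 2 ∂(stationaryZ 𝓜 π ω (ν ω)) := by
    intro i
    have := lamMin_mul_le (hK := hK) herg hcov hd ω (EuclideanSpace.single i (1 : ℝ))
    rw [PiLp.norm_single, norm_one, one_pow, mul_one] at this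
    refine this.trans (le_of_eq ?_)
    unfold featureEnergy
    refine integral_congr_ae (Filter.Eventually.of_forall fun z => ?_)
    simp only [linQ, EuclideanSpace.inner_single_right]
    simp
  have hb : ∀ i, IsBdd fun z => φ.feat z i ^ 2 := fun i => by
    simpa only [sq] using (isBdd_feat φ i).mul (isBdd_feat φ i)
  calc d * (evalConsts 𝓜 φ π ν C ρ hK).lamMin
      = ∑ _i : Fin d, (evalConsts 𝓜 φ π ν C ρ hK).lamMin := by simp
    _ ≤ ∑ i, ∫ z, φ.feat z i ^ 2 ∂(stationaryZ 𝓜 π ω (ν ω)) := Finset.sum_le_sum fun i _ => h1 i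
    _ = ∫ z, ∑ i, φ.feat z i ^ 2 ∂(stationaryZ 𝓜 π ω (ν ω)) :=
        (integral_finsetSum _ fun i _ => (hb i).integrable _).symm
    _ ≤ 1 := by
        refine (le_abs_self _).trans (abs_integral_le_of_abs_le fun z => ?_)
        rw [abs_of_nonneg (Finset.sum_nonneg fun _ _ => sq_nonneg _)]
        have e : ∑ i, φ.feat z i ^ 2 = ‖φ.feat z‖ ^ 2 := by
          rw [EuclideanSpace.norm_sq_eq]; exact Finset.sum_congr rfl fun i _ => by simp
        rw [e]
        exact pow_le_one₀ (norm_nonneg _) (φ.norm_feat_le z)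

end Constants

/-! ### The stationary law of two consecutive triples -/

section PairLaw

variable {S A : Type*} {K d : ℕ} [TopologicalSpace S] [MeasurableSpace S]
  [OpensMeasurableSpace S] [Fintype A] [MeasurableSpace A] [DiscreteMeasurableSpace A]
  {𝓜 : Model S A K} {φ : FeatureMap S A K d} {π : ControlPolicy S A}
  {C ρ : ℝ} {ν : NaturePolicy 𝓜 → Measure S}

instance (𝓜 : Model S A K) : IsMarkovKernel (transition 𝓜) :=
  ⟨fun z => (𝓜.kernel_markov z.2.2 z.2.1).isProbabilityMeasure z.1⟩

/-- One step of the process `Z_t = (S_t, A_t, K_t)` under `(π, ω)`. -/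
noncomputable def nextZ (π : ControlPolicy S A) (ω : NaturePolicy 𝓜) :
    Kernel (S × A × Fin K) (S × A × Fin K) :=
  drawZ id measurable_id π ω ∘ₖ transition 𝓜

instance (π : ControlPolicy S A) (ω : NaturePolicy 𝓜) : IsMarkovKernel (nextZ π ω) := by
  unfold nextZ; infer_instance

/-- The law of `(Z_0, Z_1)` given `S_0 = s`. -/
noncomputable def pairLaw (π : ControlPolicy S A) (ω : NaturePolicy 𝓜) :
    Kernel S ((S × A × Fin K) × (S × A × Fin K)) :=
  (Kernel.id ×ₖ nextZ π ω) ∘ₖ drawZ id measurable_id π ω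

instance (π : ControlPolicy S A) (ω : NaturePolicy 𝓜) : IsMarkovKernel (pairLaw π ω) := by
  unfold pairLaw; infer_instance

/-- The law of `(Z_0, Z_1)` for the stationary process. -/
noncomputable def stationaryPair (π : ControlPolicy S A) (ν : NaturePolicy 𝓜 → Measure S)
    (ω : NaturePolicy 𝓜) : Measure ((S × A × Fin K) × (S × A × Fin K)) :=
  (ν ω).bind (pairLaw π ω)

lemma isProbabilityMeasure_stationaryPair (herg : GeometricallyErgodic 𝓜 π C ρ ν)
    (ω : NaturePolicy 𝓜) : IsProbabilityMeasure (stationaryPair π ν ω) := by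
  have := (herg ω).1
  unfold stationaryPair
  infer_instance

lemma integral_nextZ (ω : NaturePolicy 𝓜) {f : S × A × Fin K → ℝ} (hf : IsBdd f)
    (z : S × A × Fin K) : ∫ z', f z' ∂(nextZ π ω z) =
      ∫ x, ∑ a, ∑ k, π.prob x a * ω.prob x k * f (x, a, k) ∂(𝓜.kernel z.2.2 z.2.1 z.1) := by
  unfold nextZ
  rw [hf.integral_comp]
  refine integral_congr_ae (Filter.Eventually.of_forall fun x => ?_)
  simp only
  rw [integral_drawZ π id measurable_id ω hf, Finset.sum_comm]
  refine Finset.sum_congr rfl fun k _ => ?_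
  rw [Finset.mul_sum]
  exact Finset.sum_congr rfl fun a _ => by simp only [id_eq]; ring

lemma integral_stationaryPair (herg : GeometricallyErgodic 𝓜 π C ρ ν) (ω : NaturePolicy 𝓜)
    {f : (S × A × Fin K) × (S × A × Fin K) → ℝ} (hf : IsBdd f) :
    ∫ ξ, f ξ ∂(stationaryPair π ν ω) =
      ∫ z, ∫ z', f (z, z') ∂(nextZ π ω z) ∂(stationaryZ 𝓜 π ω (ν ω)) := by
  have := (herg ω).1
  have hid : ∀ z, ∫ ξ, f ξ ∂((Kernel.id ×ₖ nextZ π ω) z) = ∫ z', f (z, z') ∂(nextZ π ω z) := by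
    intro z
    have hm : StronglyMeasurable fun z₁ => ∫ z', f (z₁, z') ∂(nextZ π ω z) :=
      hf.1.stronglyMeasurable.integral_prod_right'
    rw [Kernel.prod_apply, integral_prod _ (hf.integrable _), Kernel.id_apply,
      integral_dirac' _ _ hm]
  have h2 : IsBdd fun z => ∫ z', f (z, z') ∂(nextZ π ω z) := by
    simpa only [hid] using hf.kernel_integral (Kernel.id ×ₖ nextZ π ω)
  unfold stationaryPair stationaryZ
  rw [hf.integral_bind, h2.integral_bind]
  refine integral_congr_ae (Filter.Eventually.of_forall fun s => ?_)
  simp only [pairLaw]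
  rw [hf.integral_comp]
  simp only [hid]

lemma integral_stationaryPair_fst (herg : GeometricallyErgodic 𝓜 π C ρ ν) (ω : NaturePolicy 𝓜)
    {f : S × A × Fin K → ℝ} (hf : IsBdd f) :
    ∫ ξ, f ξ.1 ∂(stationaryPair π ν ω) = ∫ z, f z ∂(stationaryZ 𝓜 π ω (ν ω)) := by
  rw [integral_stationaryPair herg ω (f := fun ξ => f ξ.1) (hf.comp measurable_fst)]
  simp

lemma integral_transition_draw (ω : NaturePolicy 𝓜) {f : S → ℝ} (hf : IsBdd f) (s : S) :
    ∫ z, ∫ x, f x ∂(transition 𝓜 z) ∂(drawZ id measurable_id π ω s) =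
      ∫ x, f x ∂(stateKernel π (natureKernel 𝓜 ω) s) := by
  rw [integral_drawZ π id measurable_id ω (hf.kernel_integral (transition 𝓜)),
    integral_stateKernel (fun _ => inferInstance) hf]
  simp only [integral_natureKernel ω _ hf, Finset.mul_sum]
  rw [Finset.sum_comm]
  refine Finset.sum_congr rfl fun a _ => Finset.sum_congr rfl fun k _ => ?_
  simp only [id_eq]
  rw [show (transition 𝓜) (s, a, k) = 𝓜.kernel k a s from rfl]
  ring

lemma integral_stationaryPair_snd (herg : GeometricallyErgodic 𝓜 π C ρ ν) (ω : NaturePolicy 𝓜)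
    {f : S × A × Fin K → ℝ} (hf : IsBdd f) :
    ∫ ξ, f ξ.2 ∂(stationaryPair π ν ω) = ∫ z, f z ∂(stationaryZ 𝓜 π ω (ν ω)) := by
  have := (herg ω).1
  rw [integral_stationaryPair herg ω (f := fun ξ => f ξ.2) (hf.comp measurable_snd)]
  have hg : IsBdd fun s => ∫ z, f z ∂(drawZ id measurable_id π ω s) := hf.kernel_integral _
  have h1 : ∀ z, ∫ z', f z' ∂(nextZ π ω z) =
      ∫ x, ∫ z, f z ∂(drawZ id measurable_id π ω x) ∂(transition 𝓜 z) := fun z => by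
    unfold nextZ
    rw [hf.integral_comp]
  unfold stationaryZ
  simp only [h1]
  rw [(hg.kernel_integral _).integral_bind, hf.integral_bind, ← integral_stationary_step herg ω hg]
  refine integral_congr_ae (Filter.Eventually.of_forall fun s => ?_)
  exact integral_transition_draw ω hg s

end PairLaw

/-! ### The mean TD operator and the projected Bellman equation -/

section Target

variable {S A : Type*} {K d : ℕ} [TopologicalSpace S] [MeasurableSpace S]
  [OpensMeasurableSpace S] [Fintype A] [MeasurableSpace A] [DiscreteMeasurableSpace A]
  {𝓜 : Model S A K} {φ : FeatureMap S A K d} {π : ControlPolicy S A}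
  {C ρ : ℝ} {ν : NaturePolicy 𝓜 → Measure S}

lemma measurable_reward_fst (𝓜 : Model S A K) :
    Measurable fun z : S × A × Fin K => 𝓜.reward z.1 z.2.1 :=
  measurable_from_prod_countable_left fun i => (𝓜.reward_continuous i.1).measurable

lemma isBdd_reward_fst (𝓜 : Model S A K) :
    IsBdd fun z : S × A × Fin K => 𝓜.reward z.1 z.2.1 :=
  ⟨measurable_reward_fst 𝓜, 1, fun z => by
    have := 𝓜.reward_mem z.1 z.2.1
    rw [abs_of_nonneg this.1]; exact this.2⟩

lemma measurable_tdOperator_comp (𝓜 : Model S A K) (φ : FeatureMap S A K d) {Y : Type*}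
    [MeasurableSpace Y] {g : Y → EuclideanSpace ℝ (Fin d)}
    {p : Y → (S × A × Fin K) × (S × A × Fin K)} (hg : Measurable g) (hp : Measurable p) :
    Measurable fun y => tdOperator 𝓜 φ (g y) (p y) := by
  unfold tdOperator linQ
  have h1 : Measurable fun y => φ.feat (p y).1 := φ.measurable_feat.comp hp.fst
  have h2 : Measurable fun y => φ.feat (p y).2 := φ.measurable_feat.comp hp.snd
  have h3 : Measurable fun y => 𝓜.reward (p y).1.1 (p y).1.2.1 :=
    (measurable_reward_fst 𝓜).comp hp.fst
  exact (((h1.inner hg).sub h3).sub ((h2.inner hg).const_mul _)).smul h1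

lemma measurable_tdOperator (𝓜 : Model S A K) (φ : FeatureMap S A K d)
    (θ : EuclideanSpace ℝ (Fin d)) : Measurable (tdOperator 𝓜 φ θ) :=
  measurable_tdOperator_comp 𝓜 φ measurable_const measurable_id

lemma norm_tdOperator_le (𝓜 : Model S A K) (φ : FeatureMap S A K d)
    (θ : EuclideanSpace ℝ (Fin d)) (ξ : (S × A × Fin K) × (S × A × Fin K)) :
    ‖tdOperator 𝓜 φ θ ξ‖ ≤ 2 * ‖θ‖ + 1 := by
  unfold tdOperator
  rw [norm_smul, Real.norm_eq_abs]
  refine (mul_le_of_le_one_right (abs_nonneg _) (φ.norm_feat_le _)).trans ?_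
  have h1 := abs_linQ_le φ θ ξ.1
  have h2 := abs_linQ_le φ θ ξ.2
  have h3 := 𝓜.reward_mem ξ.1.1 ξ.1.2.1
  have h4 : |𝓜.discount * linQ φ θ ξ.2| ≤ ‖θ‖ := by
    rw [abs_mul, abs_of_pos 𝓜.discount_pos]
    exact (mul_le_of_le_one_left (abs_nonneg _) 𝓜.discount_lt_one.le).trans h2
  rw [abs_le] at h1 h4 ⊢
  constructor <;> linarith [h3.1, h3.2, h1.1, h1.2, h4.1, h4.2]

/-- The linear part of the stochastic operator. -/
noncomputable def tdLinear (𝓜 : Model S A K) (φ : FeatureMap S A K d)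
    (v : EuclideanSpace ℝ (Fin d)) (ξ : (S × A × Fin K) × (S × A × Fin K)) :
    EuclideanSpace ℝ (Fin d) :=
  (linQ φ v ξ.1 - 𝓜.discount * linQ φ v ξ.2) • φ.feat ξ.1

lemma tdOperator_eq_add (θ v : EuclideanSpace ℝ (Fin d))
    (ξ : (S × A × Fin K) × (S × A × Fin K)) :
    tdOperator 𝓜 φ (θ + v) ξ = tdOperator 𝓜 φ θ ξ + tdLinear 𝓜 φ v ξ := by
  unfold tdOperator tdLinear
  rw [linQ_add, linQ_add, ← add_smul]
  congr 1; ring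

lemma measurable_tdLinear (v : EuclideanSpace ℝ (Fin d)) : Measurable (tdLinear 𝓜 φ v) := by
  have : tdLinear 𝓜 φ v = fun ξ => tdOperator 𝓜 φ v ξ - tdOperator 𝓜 φ 0 ξ := by
    funext ξ
    have := tdOperator_eq_add (𝓜 := 𝓜) (φ := φ) 0 v ξ
    rw [zero_add] at this
    rw [this, add_sub_cancel_left]
  rw [this]
  exact (measurable_tdOperator 𝓜 φ v).sub (measurable_tdOperator 𝓜 φ 0)

lemma norm_tdLinear_le (v : EuclideanSpace ℝ (Fin d)) (ξ : (S × A × Fin K) × (S × A × Fin K)) :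
    ‖tdLinear 𝓜 φ v ξ‖ ≤ 2 * ‖v‖ := by
  unfold tdLinear
  rw [norm_smul, Real.norm_eq_abs]
  refine (mul_le_of_le_one_right (abs_nonneg _) (φ.norm_feat_le _)).trans ?_
  have h1 := abs_linQ_le φ v ξ.1
  have h2 := abs_linQ_le φ v ξ.2
  have h4 : |𝓜.discount * linQ φ v ξ.2| ≤ ‖v‖ := by
    rw [abs_mul, abs_of_pos 𝓜.discount_pos]
    exact (mul_le_of_le_one_left (abs_nonneg _) 𝓜.discount_lt_one.le).trans h2
  rw [abs_le] at h1 h4 ⊢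
  constructor <;> linarith [h1.1, h1.2, h4.1, h4.2]

/-- The mean operator `F_ω` of temporal difference learning under the stationary law. -/
noncomputable def meanTD (φ : FeatureMap S A K d) (π : ControlPolicy S A)
    (ν : NaturePolicy 𝓜 → Measure S) (ω : NaturePolicy 𝓜) (θ : EuclideanSpace ℝ (Fin d)) :
    EuclideanSpace ℝ (Fin d) :=
  ∫ ξ, tdOperator 𝓜 φ θ ξ ∂(stationaryPair π ν ω)

lemma integrable_tdOperator (herg : GeometricallyErgodic 𝓜 π C ρ ν) (ω : NaturePolicy 𝓜)
    (θ : EuclideanSpace ℝ (Fin d)) : Integrable (tdOperator 𝓜 φ θ) (stationaryPair π ν ω) := by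
  have := isProbabilityMeasure_stationaryPair herg ω
  exact integrable_of_norm_le (measurable_tdOperator 𝓜 φ θ) (norm_tdOperator_le 𝓜 φ θ)

lemma integrable_tdLinear (herg : GeometricallyErgodic 𝓜 π C ρ ν) (ω : NaturePolicy 𝓜)
    (v : EuclideanSpace ℝ (Fin d)) : Integrable (tdLinear 𝓜 φ v) (stationaryPair π ν ω) := by
  have := isProbabilityMeasure_stationaryPair herg ω
  exact integrable_of_norm_le (measurable_tdLinear v) (norm_tdLinear_le v)

/-- The linear part of the mean operator `F_ω`. -/
noncomputable def meanTDLinear (φ : FeatureMap S A K d)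
    (herg : GeometricallyErgodic 𝓜 π C ρ ν) (ω : NaturePolicy 𝓜) :
    EuclideanSpace ℝ (Fin d) →L[ℝ] EuclideanSpace ℝ (Fin d) :=
  LinearMap.toContinuousLinearMap
    { toFun := fun v => ∫ ξ, tdLinear 𝓜 φ v ξ ∂(stationaryPair π ν ω)
      map_add' := fun v w => by
        rw [← integral_add (integrable_tdLinear herg ω v) (integrable_tdLinear herg ω w)]
        congr 1; funext ξ
        simp only [tdLinear, linQ_add, ← add_smul]
        congr 1; ring
      map_smul' := fun c v => by
        rw [RingHom.id_apply, ← integral_smul]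
        congr 1; funext ξ
        simp only [tdLinear, linQ_smul, smul_smul]
        congr 1; ring }

lemma meanTDLinear_apply (herg : GeometricallyErgodic 𝓜 π C ρ ν) (ω : NaturePolicy 𝓜)
    (v : EuclideanSpace ℝ (Fin d)) :
    meanTDLinear φ herg ω v = ∫ ξ, tdLinear 𝓜 φ v ξ ∂(stationaryPair π ν ω) := rfl

lemma meanTD_add (herg : GeometricallyErgodic 𝓜 π C ρ ν) (ω : NaturePolicy 𝓜)
    (θ v : EuclideanSpace ℝ (Fin d)) :
    meanTD φ π ν ω (θ + v) = meanTD φ π ν ω θ + meanTDLinear φ herg ω v := by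
  unfold meanTD
  rw [meanTDLinear_apply,
    ← integral_add (integrable_tdOperator herg ω θ) (integrable_tdLinear herg ω v)]
  simp only [tdOperator_eq_add]

lemma norm_meanTDLinear_le (herg : GeometricallyErgodic 𝓜 π C ρ ν) (ω : NaturePolicy 𝓜)
    (v : EuclideanSpace ℝ (Fin d)) : ‖meanTDLinear φ herg ω v‖ ≤ 2 * ‖v‖ := by
  have := isProbabilityMeasure_stationaryPair herg ω
  rw [meanTDLinear_apply]
  have := norm_integral_le_of_norm_le_const (μ := stationaryPair π ν ω)
    (Filter.Eventually.of_forall (norm_tdLinear_le (𝓜 := 𝓜) (φ := φ) v))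
  simpa using this

lemma norm_meanTD_le (herg : GeometricallyErgodic 𝓜 π C ρ ν) (ω : NaturePolicy 𝓜)
    (θ : EuclideanSpace ℝ (Fin d)) : ‖meanTD φ π ν ω θ‖ ≤ 2 * ‖θ‖ + 1 := by
  have := isProbabilityMeasure_stationaryPair herg ω
  have := norm_integral_le_of_norm_le_const (μ := stationaryPair π ν ω)
    (Filter.Eventually.of_forall (norm_tdOperator_le 𝓜 φ θ))
  simpa [meanTD] using this

/-- This is `2xy ≤ x² + y²` for the values at consecutive times, which have the same second moment
under the stationary law. It makes the nonsymmetric linear part of TD learning strongly monotone. -/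
lemma featureEnergy_le_inner (herg : GeometricallyErgodic 𝓜 π C ρ ν) (ω : NaturePolicy 𝓜)
    (v : EuclideanSpace ℝ (Fin d)) :
    (1 - 𝓜.discount) * featureEnergy φ π ν ω v ≤ inner ℝ (meanTDLinear φ herg ω v) v := by
  have := isProbabilityMeasure_stationaryPair herg ω
  have hγ := 𝓜.discount_pos.le
  have h1 : inner ℝ (meanTDLinear φ herg ω v) v =
      ∫ ξ, (linQ φ v ξ.1 - 𝓜.discount * linQ φ v ξ.2) * linQ φ v ξ.1 ∂(stationaryPair π ν ω) := by
    rw [real_inner_comm, meanTDLinear_apply, ← integral_inner (integrable_tdLinear herg ω v)]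
    refine integral_congr_ae (Filter.Eventually.of_forall fun ξ => ?_)
    simp only [tdLinear, real_inner_smul_right]
    rw [real_inner_comm]; rfl
  have hq := isBdd_linQ_sq φ v
  have hb1 := isBdd_linQ φ v
  have hl1 : IsBdd fun ξ : (S × A × Fin K) × (S × A × Fin K) => linQ φ v ξ.1 :=
    hb1.comp measurable_fst
  have hl2 : IsBdd fun ξ : (S × A × Fin K) × (S × A × Fin K) => linQ φ v ξ.2 :=
    hb1.comp measurable_snd
  have hq1 : IsBdd fun ξ : (S × A × Fin K) × (S × A × Fin K) => linQ φ v ξ.1 ^ 2 :=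
    hq.comp measurable_fst
  have hq2 : IsBdd fun ξ : (S × A × Fin K) × (S × A × Fin K) => linQ φ v ξ.2 ^ 2 :=
    hq.comp measurable_snd
  have h2 : ∫ ξ, ((1 - 𝓜.discount / 2) * linQ φ v ξ.1 ^ 2 - 𝓜.discount / 2 * linQ φ v ξ.2 ^ 2)
      ∂(stationaryPair π ν ω) ≤
      ∫ ξ, (linQ φ v ξ.1 - 𝓜.discount * linQ φ v ξ.2) * linQ φ v ξ.1 ∂(stationaryPair π ν ω) := by
    refine integral_mono (((hq1.const_mul _).sub (hq2.const_mul _)).integrable _)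
      (((hl1.sub (hl2.const_mul _)).mul hl1).integrable _) fun ξ => ?_
    simp only
    nlinarith [mul_nonneg hγ (sq_nonneg (linQ φ v ξ.1 - linQ φ v ξ.2))]
  rw [integral_sub ((hq1.const_mul _).integrable _) ((hq2.const_mul _).integrable _),
    integral_const_mul, integral_const_mul, integral_stationaryPair_fst herg ω hq,
    integral_stationaryPair_snd herg ω hq] at h2
  rw [h1]
  unfold featureEnergy
  linarith

lemma isBdd_bellman (ω : NaturePolicy 𝓜) {Q : S × A × Fin K → ℝ} (hQ : IsBdd Q) :
    IsBdd (bellman 𝓜 π ω Q) := by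
  have h : bellman 𝓜 π ω Q = fun z =>
      𝓜.reward z.1 z.2.1 + 𝓜.discount * ∫ z', Q z' ∂(nextZ π ω z) := by
    funext z
    rw [integral_nextZ ω hQ]
    rfl
  rw [h]
  exact (isBdd_reward_fst 𝓜).add ((hQ.kernel_integral _).const_mul _)

lemma inner_meanTD (herg : GeometricallyErgodic 𝓜 π C ρ ν) (ω : NaturePolicy 𝓜)
    (θ v : EuclideanSpace ℝ (Fin d)) : inner ℝ v (meanTD φ π ν ω θ) =
      ∫ z, (linQ φ θ z - bellman 𝓜 π ω (linQ φ θ) z) * linQ φ v z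
        ∂(stationaryZ 𝓜 π ω (ν ω)) := by
  have hQ := isBdd_linQ φ θ
  have hv := isBdd_linQ φ v
  unfold meanTD
  rw [← integral_inner (integrable_tdOperator herg ω θ)]
  have hb : IsBdd fun ξ : (S × A × Fin K) × (S × A × Fin K) =>
      (linQ φ θ ξ.1 - 𝓜.reward ξ.1.1 ξ.1.2.1 - 𝓜.discount * linQ φ θ ξ.2) * linQ φ v ξ.1 :=
    (((hQ.comp measurable_fst).sub ((isBdd_reward_fst 𝓜).comp measurable_fst)).sub
      ((hQ.comp measurable_snd).const_mul _)).mul (hv.comp measurable_fst)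
  have e : ∀ ξ, inner ℝ v (tdOperator 𝓜 φ θ ξ) =
      (linQ φ θ ξ.1 - 𝓜.reward ξ.1.1 ξ.1.2.1 - 𝓜.discount * linQ φ θ ξ.2) * linQ φ v ξ.1 := by
    intro ξ
    simp only [tdOperator, real_inner_smul_right]
    rw [real_inner_comm]; rfl
  simp only [e]
  rw [integral_stationaryPair herg ω hb]
  refine integral_congr_ae (Filter.Eventually.of_forall fun z => ?_)
  simp only
  rw [integral_mul_const, integral_sub (integrable_const _) ((hQ.const_mul _).integrable _),
    integral_const_mul, integral_nextZ ω hQ]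
  simp only [integral_const, probReal_univ, smul_eq_mul, one_mul, bellman]
  ring

/-- Orthogonality of the projection: the squared distance at `θ + v` is quadratic in `v` with linear
part twice the inner product of `v` with the mean operator at `θ`. -/
lemma isProjectedSolution_iff (herg : GeometricallyErgodic 𝓜 π C ρ ν) (ω : NaturePolicy 𝓜)
    (θ : EuclideanSpace ℝ (Fin d)) :
    IsProjectedSolution 𝓜 φ π ω (stationaryZ 𝓜 π ω (ν ω)) θ ↔ meanTD φ π ν ω θ = 0 := by
  have := isProbabilityMeasure_stationaryZ herg ω
  set g : S × A × Fin K → ℝ := fun z => bellman 𝓜 π ω (linQ φ θ) z - linQ φ θ z with hg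
  have hgb : IsBdd g := (isBdd_bellman ω (isBdd_linQ φ θ)).sub (isBdd_linQ φ θ)
  have hinner : ∀ v, ∫ z, g z * linQ φ v z ∂(stationaryZ 𝓜 π ω (ν ω)) =
      -inner ℝ v (meanTD φ π ν ω θ) := by
    intro v
    rw [inner_meanTD herg, ← integral_neg]
    exact integral_congr_ae (Filter.Eventually.of_forall fun z => by simp only [hg]; ring)
  have hexp : ∀ v, ∫ z, (bellman 𝓜 π ω (linQ φ θ) z - linQ φ (θ + v) z) ^ 2
      ∂(stationaryZ 𝓜 π ω (ν ω)) =
      ∫ z, (bellman 𝓜 π ω (linQ φ θ) z - linQ φ θ z) ^ 2 ∂(stationaryZ 𝓜 π ω (ν ω)) +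
        2 * inner ℝ v (meanTD φ π ν ω θ) + featureEnergy φ π ν ω v := by
    intro v
    have e : ∀ z, (bellman 𝓜 π ω (linQ φ θ) z - linQ φ (θ + v) z) ^ 2 =
        (g z ^ 2 - 2 * (g z * linQ φ v z)) + linQ φ v z ^ 2 := fun z => by
      rw [linQ_add]; simp only [hg]; ring
    have hg2 : IsBdd fun z => g z ^ 2 := by simpa only [sq] using hgb.mul hgb
    have hgv : IsBdd fun z => g z * linQ φ v z := hgb.mul (isBdd_linQ φ v)
    simp only [e]
    rw [integral_add ((hg2.sub (hgv.const_mul 2)).integrable _)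
      ((isBdd_linQ_sq φ v).integrable _), integral_sub (hg2.integrable _)
      ((hgv.const_mul 2).integrable _), integral_const_mul, hinner]
    unfold featureEnergy
    simp only [hg]
    ring
  constructor
  · intro h
    set F := meanTD φ π ν ω θ with hF
    -- Moving by `-F/2` changes the squared distance by at most `-‖F‖² + ‖F‖²/4`, since the energy
    -- is at most the squared norm.
    have h1 := h (θ + (-(1 / 2 : ℝ)) • F)
    rw [hexp, featureEnergy_smul, real_inner_smul_left, real_inner_self_eq_norm_sq] at h1
    have h2 := featureEnergy_le (φ := φ) herg ω F
    have h3 : ‖F‖ ^ 2 ≤ 0 := by nlinarith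
    have h4 : ‖F‖ = 0 := pow_eq_zero_iff (two_ne_zero) |>.1 (le_antisymm h3 (sq_nonneg _))
    exact norm_eq_zero.1 h4
  · intro h θ'
    have h1 := hexp (θ' - θ)
    rw [add_sub_cancel, h, inner_zero_right, mul_zero, add_zero] at h1
    rw [h1]
    have := featureEnergy_nonneg (φ := φ) (π := π) (ν := ν) ω (θ' - θ)
    linarith

variable {hK : 2 ≤ K}

lemma mu_mul_le_inner (herg : GeometricallyErgodic 𝓜 π C ρ ν)
    (hcov : ∀ ω, (covariance 𝓜 φ π ν ω).PosDef) (hd : 0 < d) (ω : NaturePolicy 𝓜)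
    (v : EuclideanSpace ℝ (Fin d)) :
    (evalConsts 𝓜 φ π ν C ρ hK).mu * ‖v‖ ^ 2 ≤ inner ℝ (meanTDLinear φ herg ω v) v := by
  refine le_trans ?_ (featureEnergy_le_inner herg ω v)
  have h1 := lamMin_mul_le (hK := hK) herg hcov hd ω v
  have h2 := mul_le_mul_of_nonneg_left h1 (sub_nonneg.2 𝓜.discount_lt_one.le)
  unfold Consts.mu
  calc _ = (1 - 𝓜.discount) * ((evalConsts 𝓜 φ π ν C ρ hK).lamMin * ‖v‖ ^ 2) := by
        simp only [evalConsts]; ring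
    _ ≤ _ := h2

lemma mu_pos (herg : GeometricallyErgodic 𝓜 π C ρ ν) (hC : 0 ≤ C) (hρ0 : 0 ≤ ρ) (hρ1 : ρ < 1)
    (hcov : ∀ ω, (covariance 𝓜 φ π ν ω).PosDef) (hd : 0 < d) :
    0 < (evalConsts 𝓜 φ π ν C ρ hK).mu :=
  mul_pos (lamMin_pos herg hC hρ0 hρ1 hcov hd) (sub_pos.2 𝓜.discount_lt_one)

/-- Strong monotonicity makes the linear part injective, hence surjective in finite dimension. The
equation is therefore solvable and the choice made in `tdTarget` is a solution. -/
lemma meanTD_tdTarget (herg : GeometricallyErgodic 𝓜 π C ρ ν) (hC : 0 ≤ C) (hρ0 : 0 ≤ ρ)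
    (hρ1 : ρ < 1) (hK : 2 ≤ K) (hcov : ∀ ω, (covariance 𝓜 φ π ν ω).PosDef) (hd : 0 < d)
    (ω : NaturePolicy 𝓜) : meanTD φ π ν ω (tdTarget 𝓜 φ π ν ω) = 0 := by
  have hμ := mu_pos (hK := hK) herg hC hρ0 hρ1 hcov hd
  rw [← isProjectedSolution_iff herg]
  unfold tdTarget
  refine Classical.epsilon_spec (p := IsProjectedSolution 𝓜 φ π ω (stationaryZ 𝓜 π ω (ν ω))) ?_
  have hinj : Function.Injective
      (meanTDLinear φ herg ω : EuclideanSpace ℝ (Fin d) →ₗ[ℝ] EuclideanSpace ℝ (Fin d)) := by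
    rw [← LinearMap.ker_eq_bot, LinearMap.ker_eq_bot']
    intro v hv
    have h1 := mu_mul_le_inner (hK := hK) herg hcov hd ω v
    rw [show meanTDLinear φ herg ω v = 0 from hv, inner_zero_left] at h1
    have h2 : ‖v‖ ^ 2 ≤ 0 := by
      by_contra hcon
      exact absurd (mul_pos hμ (not_le.1 hcon)) (not_lt.2 h1)
    exact norm_eq_zero.1 (pow_eq_zero_iff two_ne_zero |>.1 (le_antisymm h2 (sq_nonneg _)))
  obtain ⟨v, hv⟩ := LinearMap.injective_iff_surjective.1 hinj (-meanTD φ π ν ω 0)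
  refine ⟨v, (isProjectedSolution_iff herg ω v).2 ?_⟩
  have := meanTD_add (φ := φ) herg ω 0 v
  rw [zero_add] at this
  rw [this, show meanTDLinear φ herg ω v = -meanTD φ π ν ω 0 from hv, add_neg_cancel]

/-- The equation, tested with `θ` itself, has a right side of norm at most one, the mean operator at
zero. The bound is uniform in `ω`, so the supremum `R` is a true one and not the default value of an
unbounded family. -/
lemma mu_mul_norm_tdTarget_le (herg : GeometricallyErgodic 𝓜 π C ρ ν) (hC : 0 ≤ C) (hρ0 : 0 ≤ ρ)
    (hρ1 : ρ < 1) (hcov : ∀ ω, (covariance 𝓜 φ π ν ω).PosDef) (hd : 0 < d)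
    (ω : NaturePolicy 𝓜) : (evalConsts 𝓜 φ π ν C ρ hK).mu * ‖tdTarget 𝓜 φ π ν ω‖ ≤ 1 := by
  set θ := tdTarget 𝓜 φ π ν ω
  have h0 := meanTD_tdTarget herg hC hρ0 hρ1 hK hcov hd ω
  have h1 := mu_mul_le_inner (hK := hK) herg hcov hd ω θ
  have h2 := meanTD_add (φ := φ) herg ω 0 θ
  rw [zero_add, h0] at h2
  have h3 : meanTDLinear φ herg ω θ = -meanTD φ π ν ω 0 := by
    rw [eq_neg_iff_add_eq_zero, add_comm]; exact h2.symm
  have h4 := norm_meanTD_le (φ := φ) herg ω 0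
  rw [norm_zero, mul_zero, zero_add] at h4
  have h5 : inner ℝ (meanTDLinear φ herg ω θ) θ ≤ ‖θ‖ := by
    refine (real_inner_le_norm _ _).trans ?_
    rw [h3, norm_neg]
    exact mul_le_of_le_one_left (norm_nonneg _) h4
  rcases (norm_nonneg θ).eq_or_lt with h | h
  · rw [← h, mul_zero]; exact zero_le_one
  · have : (evalConsts 𝓜 φ π ν C ρ hK).mu * ‖θ‖ * ‖θ‖ ≤ 1 * ‖θ‖ := by nlinarith
    exact le_of_mul_le_mul_right this h

lemma norm_tdTarget_le (herg : GeometricallyErgodic 𝓜 π C ρ ν) (hC : 0 ≤ C) (hρ0 : 0 ≤ ρ)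
    (hρ1 : ρ < 1) (hcov : ∀ ω, (covariance 𝓜 φ π ν ω).PosDef) (hd : 0 < d)
    (ω : NaturePolicy 𝓜) : ‖tdTarget 𝓜 φ π ν ω‖ ≤ (evalConsts 𝓜 φ π ν C ρ hK).R := by
  have hμ := mu_pos (hK := hK) herg hC hρ0 hρ1 hcov hd
  refine le_ciSup (f := fun ω => ‖tdTarget 𝓜 φ π ν ω‖)
    ⟨1 / (evalConsts 𝓜 φ π ν C ρ hK).mu, ?_⟩ ω
  rintro _ ⟨ω', rfl⟩
  rw [le_div_iff₀ hμ, mul_comm]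
  exact mu_mul_norm_tdTarget_le herg hC hρ0 hρ1 hcov hd ω'

lemma abs_jointQ_le (ω : NaturePolicy 𝓜) (z : S × A × Fin K) :
    |jointQ 𝓜 π ω z| ≤ 1 / (1 - 𝓜.discount) := by
  have hγ : 0 < 1 - 𝓜.discount := sub_pos.2 𝓜.discount_lt_one
  have h1 : |∫ x, value 𝓜 π (natureKernel 𝓜 ω) x ∂(𝓜.kernel z.2.2 z.2.1 z.1)| ≤ _ :=
    abs_integral_le_of_abs_le (abs_value_le 𝓜 π (natureKernel 𝓜 ω))
  unfold jointQ
  have h2 := 𝓜.reward_mem z.1 z.2.1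
  have h3 : |𝓜.discount * ∫ x, value 𝓜 π (natureKernel 𝓜 ω) x ∂(𝓜.kernel z.2.2 z.2.1 z.1)| ≤
      𝓜.discount * (1 / (1 - 𝓜.discount)) := by
    rw [abs_mul, abs_of_pos 𝓜.discount_pos]
    exact mul_le_mul_of_nonneg_left h1 𝓜.discount_pos.le
  have h4 : 1 + 𝓜.discount * (1 / (1 - 𝓜.discount)) = 1 / (1 - 𝓜.discount) := by
    field_simp; ring
  rw [abs_le] at h3 ⊢
  constructor <;> linarith [h2.1, h2.2, h3.1, h3.2]

/-- The differences are bounded by `R + 1/(1 - γ)`, so both suprema in `ε_approx` are true suprema.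
-/
lemma abs_linQ_tdTarget_sub_jointQ_le (herg : GeometricallyErgodic 𝓜 π C ρ ν) (hC : 0 ≤ C)
    (hρ0 : 0 ≤ ρ) (hρ1 : ρ < 1) (hcov : ∀ ω, (covariance 𝓜 φ π ν ω).PosDef) (hd : 0 < d)
    (ω : NaturePolicy 𝓜) (z : S × A × Fin K) :
    |linQ φ (tdTarget 𝓜 φ π ν ω) z - jointQ 𝓜 π ω z| ≤
      (evalConsts 𝓜 φ π ν C ρ hK).εapprox := by
  have hb : ∀ ω z, |linQ φ (tdTarget 𝓜 φ π ν ω) z - jointQ 𝓜 π ω z| ≤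
      (evalConsts 𝓜 φ π ν C ρ hK).R + 1 / (1 - 𝓜.discount) := fun ω z =>
    (abs_sub _ _).trans (add_le_add ((abs_linQ_le φ _ z).trans
      (norm_tdTarget_le herg hC hρ0 hρ1 hcov hd ω)) (abs_jointQ_le ω z))
  have : Nonempty (S × A × Fin K) := ⟨z⟩
  refine (le_ciSup (f := fun z => |linQ φ (tdTarget 𝓜 φ π ν ω) z - jointQ 𝓜 π ω z|)
    ⟨_, by rintro _ ⟨z, rfl⟩; exact hb ω z⟩ z).trans ?_
  refine le_ciSup (f := fun ω => ⨆ z, |linQ φ (tdTarget 𝓜 φ π ν ω) z - jointQ 𝓜 π ω z|)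
    ⟨(evalConsts 𝓜 φ π ν C ρ hK).R + 1 / (1 - 𝓜.discount), ?_⟩ ω
  rintro _ ⟨ω', rfl⟩
  exact ciSup_le fun z => hb ω' z

end Target

end RobustMDP
namespace RobustMDP
set_option linter.unusedSectionVars false

/-! ### Iterated kernels -/

section KernelPowers

variable {X : Type*} [MeasurableSpace X]

lemma lintegral_pow_zero (κ : Kernel X X) {f : X → ENNReal} (hf : Measurable f) (x : X) :
    ∫⁻ y, f y ∂((κ ^ 0 : Kernel X X) x) = f x := by
  rw [pow_zero]
  show ∫⁻ y, f y ∂((Kernel.id : Kernel X X) x) = f x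
  rw [Kernel.id_apply, lintegral_dirac' _ hf]

lemma lintegral_pow_succ (κ : Kernel X X) (n : ℕ) {f : X → ENNReal} (hf : Measurable f) (x : X) :
    ∫⁻ y, f y ∂((κ ^ (n + 1) : Kernel X X) x) =
      ∫⁻ y, ∫⁻ z, f z ∂((κ ^ n : Kernel X X) y) ∂κ x := by
  rw [pow_succ]
  exact Kernel.lintegral_comp (κ ^ n : Kernel X X) κ x hf

lemma lintegral_pow_succ' (κ : Kernel X X) (n : ℕ) {f : X → ENNReal} (hf : Measurable f) (x : X) :
    ∫⁻ y, f y ∂((κ ^ (n + 1) : Kernel X X) x) =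
      ∫⁻ y, ∫⁻ z, f z ∂κ y ∂((κ ^ n : Kernel X X) x) := by
  rw [pow_succ']
  exact Kernel.lintegral_comp κ (κ ^ n : Kernel X X) x hf

end KernelPowers

/-! ### The Markov sampler and its distance to stationarity -/

section Sampler

variable {S A H : Type*} {K d : ℕ} [TopologicalSpace S] [MeasurableSpace S]
  [OpensMeasurableSpace S] [Fintype A] [MeasurableSpace A] [DiscreteMeasurableSpace A]
  [MeasurableSpace H] {𝓜 : Model S A K} {φ : FeatureMap S A K d} {π : ControlPolicy S A}
  {C ρ : ℝ} {ν : NaturePolicy 𝓜 → Measure S}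

/-- The policy of nature at a fixed value of the parameter. -/
def Policy.freeze (ω : Policy (H × S) (Fin K) 𝓜.weights) (h : H) : NaturePolicy 𝓜 where
  prob s := ω.prob (h, s)
  measurable_prob := ω.measurable_prob.comp (measurable_const.prodMk measurable_id)
  prob_mem s := ω.prob_mem (h, s)

lemma lintegral_drawZ_freeze (ω : Policy (H × S) (Fin K) 𝓜.weights) (h : H) (s : S)
    {f : S × A × Fin K → ENNReal} (hf : Measurable f) :
    ∫⁻ z, f z ∂(drawZ Prod.snd measurable_snd π ω (h, s)) =
      ∫⁻ z, f z ∂(drawZ id measurable_id π (ω.freeze h) s) := by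
  rw [lintegral_drawZ π _ _ _ hf, lintegral_drawZ π _ _ _ hf]
  rfl

instance (ω : Policy (H × S) (Fin K) 𝓜.weights) : IsMarkovKernel (chainInit 𝓜 π ω) := by
  unfold chainInit; infer_instance

instance (ω : Policy (H × S) (Fin K) 𝓜.weights) : IsMarkovKernel (chainStep 𝓜 π ω) := by
  unfold chainStep; infer_instance

instance (ω : Policy (H × S) (Fin K) 𝓜.weights) (τ : ℕ) :
    IsMarkovKernel (markovSampler 𝓜 π ω τ) := by
  unfold markovSampler
  have : IsMarkovKernel ((chainStep 𝓜 π ω).map Prod.snd) := Kernel.IsMarkovKernel.map _ measurable_snd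
  infer_instance

lemma lintegral_chainInit (ω : Policy (H × S) (Fin K) 𝓜.weights)
    {f : H × (S × A × Fin K) → ENNReal} (hf : Measurable f) (h : H) (s : S) :
    ∫⁻ x, f x ∂(chainInit 𝓜 π ω (h, s)) =
      ∫⁻ z, f (h, z) ∂(drawZ id measurable_id π (ω.freeze h) s) := by
  unfold chainInit
  rw [Kernel.lintegral_deterministic_prod measurable_fst _ _ hf]
  exact lintegral_drawZ_freeze ω h s (hf.comp (measurable_const.prodMk measurable_id))

lemma lintegral_nextZ (ω : NaturePolicy 𝓜) {f : S × A × Fin K → ENNReal} (hf : Measurable f)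
    (z : S × A × Fin K) : ∫⁻ z', f z' ∂(nextZ π ω z) =
      ∫⁻ x, ∫⁻ z', f z' ∂(drawZ id measurable_id π ω x) ∂(transition 𝓜 z) := by
  unfold nextZ
  exact Kernel.lintegral_comp _ _ _ hf

lemma lintegral_chainStep (ω : Policy (H × S) (Fin K) 𝓜.weights)
    {f : H × (S × A × Fin K) → ENNReal} (hf : Measurable f) (h : H) (z : S × A × Fin K) :
    ∫⁻ x, f x ∂(chainStep 𝓜 π ω (h, z)) = ∫⁻ z', f (h, z') ∂(nextZ π (ω.freeze h) z) := by
  have hm : Measurable fun x => ∫⁻ y, f y ∂(chainInit 𝓜 π ω x) := hf.lintegral_kernel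
  have hfh : Measurable fun z => f (h, z) := hf.comp (measurable_const.prodMk measurable_id)
  unfold chainStep
  rw [Kernel.lintegral_comp _ _ _ hf, Kernel.parallelComp_apply, Kernel.id_apply,
    lintegral_prod _ hm.aemeasurable, lintegral_dirac' _ hm.lintegral_prod_right',
    lintegral_nextZ _ hfh]
  exact lintegral_congr fun x => lintegral_chainInit ω hf h x

lemma lintegral_transition_draw (ω : NaturePolicy 𝓜) {f : S → ENNReal} (hf : Measurable f)
    (s : S) : ∫⁻ z, ∫⁻ x, f x ∂(transition 𝓜 z) ∂(drawZ id measurable_id π ω s) =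
      ∫⁻ x, f x ∂(stateKernel π (natureKernel 𝓜 ω) s) := by
  rw [lintegral_drawZ π id measurable_id ω hf.lintegral_kernel]
  unfold stateKernel natureKernel
  simp only [lintegral_mix, Finset.mul_sum]
  rw [Fintype.sum_prod_type]
  refine Finset.sum_congr rfl fun a _ => Finset.sum_congr rfl fun k _ => ?_
  rw [← mul_assoc, ← ENNReal.ofReal_mul ((π.prob_mem s).1 a)]
  rfl

/-- Action and index are drawn afresh in every state, so averaging them out turns the chain of
triples into the chain of states. -/
lemma lintegral_chain (ω : Policy (H × S) (Fin K) 𝓜.weights) (n : ℕ) (h : H) (s : S)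
    {f : H × (S × A × Fin K) → ENNReal} (hf : Measurable f) :
    ∫⁻ x, f x ∂(((chainStep 𝓜 π ω ^ n : Kernel _ _) ∘ₖ chainInit 𝓜 π ω) (h, s)) =
      ∫⁻ x, ∫⁻ z, f (h, z) ∂(drawZ id measurable_id π (ω.freeze h) x)
        ∂((stateKernel π (natureKernel 𝓜 (ω.freeze h)) ^ n : Kernel S S) s) := by
  induction n generalizing f with
  | zero =>
    have hfh : Measurable fun z => f (h, z) := hf.comp (measurable_const.prodMk measurable_id)
    rw [lintegral_pow_zero _ hfh.lintegral_kernel, Kernel.lintegral_comp _ _ _ hf]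
    simp only [lintegral_pow_zero _ hf]
    exact lintegral_chainInit ω hf h s
  | succ n ih =>
    have hfh : Measurable fun z => f (h, z) := hf.comp (measurable_const.prodMk measurable_id)
    have hg : Measurable fun x => ∫⁻ z, f (h, z) ∂(drawZ id measurable_id π (ω.freeze h) x) :=
      hfh.lintegral_kernel
    rw [lintegral_pow_succ' _ _ hg, Kernel.lintegral_comp _ _ _ hf]
    simp only [lintegral_pow_succ' _ _ hf]
    rw [← Kernel.lintegral_comp _ _ _ hf.lintegral_kernel, ih hf.lintegral_kernel]
    refine lintegral_congr fun x => ?_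
    simp only [lintegral_chainStep ω hf, lintegral_nextZ _ hfh]
    exact lintegral_transition_draw _ hg x

lemma lintegral_pairLaw (ω : NaturePolicy 𝓜)
    {f : (S × A × Fin K) × (S × A × Fin K) → ENNReal} (hf : Measurable f) (s : S) :
    ∫⁻ ξ, f ξ ∂(pairLaw π ω s) =
      ∫⁻ z, ∫⁻ z', f (z, z') ∂(nextZ π ω z) ∂(drawZ id measurable_id π ω s) := by
  unfold pairLaw
  rw [Kernel.lintegral_comp _ _ _ hf]
  exact lintegral_congr fun z => Kernel.lintegral_id_prod hf _ _

lemma lintegral_markovSampler (ω : Policy (H × S) (Fin K) 𝓜.weights) (n : ℕ) (h : H) (s : S)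
    {f : (S × A × Fin K) × (S × A × Fin K) → ENNReal} (hf : Measurable f) :
    ∫⁻ ξ, f ξ ∂(markovSampler 𝓜 π ω (n + 1) (h, s)) =
      ∫⁻ x, ∫⁻ ξ, f ξ ∂(pairLaw π (ω.freeze h) x)
        ∂((stateKernel π (natureKernel 𝓜 (ω.freeze h)) ^ n : Kernel S S) s) := by
  have : IsMarkovKernel ((chainStep 𝓜 π ω).map Prod.snd) :=
    Kernel.IsMarkovKernel.map _ measurable_snd
  unfold markovSampler
  rw [Kernel.lintegral_comp _ _ _ hf, Nat.add_sub_cancel, lintegral_chain ω n h s hf.lintegral_kernel]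
  refine lintegral_congr fun x => ?_
  rw [lintegral_pairLaw _ hf]
  refine lintegral_congr fun z => ?_
  have hfz : Measurable fun z' => f (z, z') := hf.comp (measurable_const.prodMk measurable_id)
  rw [Kernel.lintegral_deterministic_prod measurable_snd _ _ hf,
    Kernel.lintegral_map _ measurable_snd _ hfz,
    lintegral_chainStep ω (f := fun y => f (z, y.2)) (hfz.comp measurable_snd)]

/-- With parameter `τ = n + 2` the first triple of the pair sits at a state reached after `n + 1`
transitions, where ergodicity gives the error `C ρ^n`. From there both laws pass through the same
kernel `pairLaw`. Hence the error `C ρ^(τ-2)`. -/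
lemma lintegral_markovSampler_le (herg : GeometricallyErgodic 𝓜 π C ρ ν) (hC : 0 ≤ C)
    (hρ0 : 0 ≤ ρ) (ω : Policy (H × S) (Fin K) 𝓜.weights) (n : ℕ) (h : H) (s : S)
    {f : (S × A × Fin K) × (S × A × Fin K) → ENNReal} (hf : Measurable f) (h1 : ∀ ξ, f ξ ≤ 1) :
    ∫⁻ ξ, f ξ ∂(markovSampler 𝓜 π ω (n + 2) (h, s)) ≤
        ∫⁻ ξ, f ξ ∂(stationaryPair π ν (ω.freeze h)) + ENNReal.ofReal (C * ρ ^ n) ∧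
      ∫⁻ ξ, f ξ ∂(stationaryPair π ν (ω.freeze h)) ≤
        ∫⁻ ξ, f ξ ∂(markovSampler 𝓜 π ω (n + 2) (h, s)) + ENNReal.ofReal (C * ρ ^ n) := by
  obtain ⟨hp, -, ht⟩ := herg (ω.freeze h)
  have hg : Measurable fun x => ∫⁻ ξ, f ξ ∂(pairLaw π (ω.freeze h) x) := hf.lintegral_kernel
  have hg1 : ∀ x, ∫⁻ ξ, f ξ ∂(pairLaw π (ω.freeze h) x) ≤ 1 := fun x =>
    (lintegral_mono h1).trans (by simp)
  have he : 0 ≤ C * ρ ^ n := by positivity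
  rw [lintegral_markovSampler ω (n + 1) h s hf, stationaryPair,
    Measure.lintegral_bind (pairLaw π (ω.freeze h)).measurable.aemeasurable hf.aemeasurable]
  constructor
  · refine lintegral_le_add_of_measure_le (fun B hB => ?_) hg hg1
    exact measure_le_add_of_abs_sub_le he (ht s B hB n)
  · refine lintegral_le_add_of_measure_le (fun B hB => ?_) hg hg1
    refine measure_le_add_of_abs_sub_le he ?_
    rw [abs_sub_comm]
    exact ht s B hB n

lemma nonempty_of_geometricallyErgodic (herg : GeometricallyErgodic 𝓜 π C ρ ν) : Nonempty S := by
  obtain ⟨ω⟩ := nonempty_naturePolicy 𝓜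
  have := (herg ω).1
  exact (ν ω).nonempty_of_neZero

/-- `ν` is just a function on policies, so measurability in the history has to be proved: the
stationary law is the setwise limit of the sampler laws, which are kernels. -/
lemma measurable_stationaryPair_freeze (herg : GeometricallyErgodic 𝓜 π C ρ ν) (hC : 0 ≤ C)
    (hρ0 : 0 ≤ ρ) (hρ1 : ρ < 1) (ω : Policy (H × S) (Fin K) 𝓜.weights) :
    Measurable fun h => stationaryPair π ν (ω.freeze h) := by
  obtain ⟨s⟩ := nonempty_of_geometricallyErgodic herg
  refine Measure.measurable_of_measurable_coe _ fun B hB => ?_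
  refine measurable_of_tendsto_metrizable (f := fun n h => markovSampler 𝓜 π ω (n + 2) (h, s) B)
    (fun n => ((markovSampler 𝓜 π ω (n + 2)).measurable_coe hB).comp
      (measurable_id.prodMk measurable_const)) ?_
  rw [tendsto_pi_nhds]
  intro h
  have := isProbabilityMeasure_stationaryPair herg (ω.freeze h)
  have hlim : Filter.Tendsto (fun n : ℕ => ENNReal.ofReal (C * ρ ^ n)) Filter.atTop (nhds 0) := by
    have h1 := (tendsto_pow_atTop_nhds_zero_of_lt_one hρ0 hρ1).const_mul C
    rw [mul_zero] at h1
    have h2 := (ENNReal.continuous_ofReal.tendsto 0).comp h1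
    rw [ENNReal.ofReal_zero] at h2
    exact h2
  have hb := fun n => lintegral_markovSampler_le herg hC hρ0 ω n h s
    (f := B.indicator 1) (measurable_one.indicator hB)
    (fun ξ => Set.indicator_le_self' (fun _ _ => bot_le) ξ)
  simp only [lintegral_indicator_one hB] at hb
  refine tendsto_of_tendsto_of_tendsto_of_le_of_le
    (g := fun n => stationaryPair π ν (ω.freeze h) B - ENNReal.ofReal (C * ρ ^ n))
    (h := fun n => stationaryPair π ν (ω.freeze h) B + ENNReal.ofReal (C * ρ ^ n)) ?_ ?_
    (fun n => tsub_le_iff_right.2 (hb n).2) (fun n => (hb n).1)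
  · have := ENNReal.Tendsto.sub (tendsto_const_nhds (x := stationaryPair π ν (ω.freeze h) B)
      (f := Filter.atTop)) hlim (Or.inl (measure_ne_top _ _))
    simpa using this
  · have := (tendsto_const_nhds (x := stationaryPair π ν (ω.freeze h) B)
      (f := Filter.atTop)).add hlim
    simpa using this

/-- The stationary law of a pair of consecutive `Z` as a kernel in the parameter. -/
noncomputable def stationaryPairKernel (herg : GeometricallyErgodic 𝓜 π C ρ ν) (hC : 0 ≤ C)
    (hρ0 : 0 ≤ ρ) (hρ1 : ρ < 1) (ω : Policy (H × S) (Fin K) 𝓜.weights) :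
    Kernel H ((S × A × Fin K) × (S × A × Fin K)) where
  toFun h := stationaryPair π ν (ω.freeze h)
  measurable' := measurable_stationaryPair_freeze herg hC hρ0 hρ1 ω

lemma measurable_meanTD_freeze (herg : GeometricallyErgodic 𝓜 π C ρ ν) (hC : 0 ≤ C)
    (hρ0 : 0 ≤ ρ) (hρ1 : ρ < 1) (ω : Policy (H × S) (Fin K) 𝓜.weights)
    {g : H → EuclideanSpace ℝ (Fin d)} (hg : Measurable g) :
    Measurable fun h => meanTD φ π ν (ω.freeze h) (g h) := by
  have : IsMarkovKernel (stationaryPairKernel herg hC hρ0 hρ1 ω) :=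
    ⟨fun h => isProbabilityMeasure_stationaryPair herg (ω.freeze h)⟩
  have hm : Measurable fun x : H × ((S × A × Fin K) × (S × A × Fin K)) =>
      tdOperator 𝓜 φ (g x.1) x.2 :=
    measurable_tdOperator_comp 𝓜 φ (hg.comp measurable_fst) measurable_snd
  exact (hm.stronglyMeasurable.integral_kernel_prod_right'
    (κ := stationaryPairKernel herg hC hρ0 hρ1 ω)).measurable

end Sampler

end RobustMDP
namespace RobustMDP
set_option linter.unusedSectionVars false

/-! ### Contractive linear recursions with bounded centered noise -/

section Perturbed

variable {E Ω : Type*} [NormedAddCommGroup E] [InnerProductSpace ℝ E] [CompleteSpace E]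
  [MeasurableSpace E] [BorelSpace E] [SecondCountableTopology E] [MeasurableSpace Ω]

/-- The transition `θ ↦ c + B (θ - c) + N (θ, ξ)`, where `ξ` has law `P`. -/
noncomputable def perturbedKernel (P : Measure Ω) (c : E) (B : E →L[ℝ] E) (N : E × Ω → E) :
    Kernel E E :=
  (Kernel.id ×ₖ Kernel.const E P).map fun y => c + B (y.1 - c) + N y

variable {P : Measure Ω} [IsProbabilityMeasure P] {c : E} {B : E →L[ℝ] E} {N : E × Ω → E}

lemma measurable_perturbed (hN : Measurable N) :
    Measurable fun y : E × Ω => c + B (y.1 - c) + N y :=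
  (measurable_const.add (B.measurable.comp (measurable_fst.sub_const c))).add hN

lemma isMarkovKernel_perturbedKernel (hN : Measurable N) :
    IsMarkovKernel (perturbedKernel P c B N) :=
  Kernel.IsMarkovKernel.map _ (measurable_perturbed hN)

lemma lintegral_perturbedKernel (hN : Measurable N) {f : E → ENNReal} (hf : Measurable f) (θ : E) :
    ∫⁻ x, f x ∂(perturbedKernel P c B N θ) = ∫⁻ ξ, f (c + B (θ - c) + N (θ, ξ)) ∂P := by
  unfold perturbedKernel
  rw [Kernel.lintegral_map _ (measurable_perturbed hN) _ hf,
    Kernel.lintegral_id_prod (f := fun y : E × Ω => f (c + B (y.1 - c) + N y))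
      (hf.comp (measurable_perturbed hN)), Kernel.const_apply]

variable {b r s : ℝ}

/-- In the last step the centered noise costs a factor `exp (‖u‖² b² / 2)`, and the linear map
passes to `u` as its adjoint, of norm at most `r`. The condition `b² + s r² ≤ s` keeps `s` a
variance proxy for any number of steps. -/
lemma lintegral_exp_perturbedKernel_pow (hN : Measurable N) (hb : ∀ y, ‖N y‖ ≤ b)
    (hmean : ∀ θ, ∫ ξ, N (θ, ξ) ∂P = 0) (hr : 0 ≤ r) (hB : ∀ v, ‖B v‖ ≤ r * ‖v‖) (hs : 0 ≤ s)
    (hbs : b ^ 2 + s * r ^ 2 ≤ s) (n : ℕ) (u θ : E) :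
    ∫⁻ x, ENNReal.ofReal (Real.exp (inner ℝ u (x - c)))
        ∂((perturbedKernel P c B N ^ n : Kernel E E) θ) ≤
      ENNReal.ofReal (Real.exp (s * ‖u‖ ^ 2 / 2 + r ^ n * ‖u‖ * ‖θ - c‖)) := by
  have hm : ∀ u : E, Measurable fun x : E => ENNReal.ofReal (Real.exp (inner ℝ u (x - c))) :=
    fun u => ((measurable_const.inner (measurable_id.sub_const c)).exp).ennreal_ofReal
  induction n generalizing u with
  | zero =>
    rw [lintegral_pow_zero _ (hm u)]
    refine ENNReal.ofReal_le_ofReal (Real.exp_le_exp.2 ?_)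
    have := real_inner_le_norm u (θ - c)
    have h2 : 0 ≤ s * ‖u‖ ^ 2 / 2 := by positivity
    rw [pow_zero, one_mul]; linarith
  | succ n ih =>
    rw [lintegral_pow_succ' _ _ (hm u)]
    set u' := ContinuousLinearMap.adjoint B u with hu'
    have hu'n : ‖u'‖ ≤ r * ‖u‖ := by
      refine (ContinuousLinearMap.le_opNorm _ _).trans ?_
      rw [LinearIsometryEquiv.norm_map]
      exact mul_le_mul_of_nonneg_right (B.opNorm_le_bound hr hB) (norm_nonneg _)
    have hstep : ∀ y, ∫⁻ x, ENNReal.ofReal (Real.exp (inner ℝ u (x - c)))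
        ∂(perturbedKernel P c B N y) ≤
        ENNReal.ofReal (Real.exp (‖u‖ ^ 2 * b ^ 2 / 2)) *
          ENNReal.ofReal (Real.exp (inner ℝ u' (y - c))) := by
      intro y
      rw [lintegral_perturbedKernel hN (hm u), ← ENNReal.ofReal_mul (Real.exp_pos _).le]
      have := lintegral_exp_inner_add_le (P := P) (ξ := fun ω => N (y, ω))
        (hN.comp (measurable_const.prodMk measurable_id)) (fun ω => hb _) (hmean y) u (B (y - c))
      rw [hu', ContinuousLinearMap.adjoint_inner_left]
      refine le_trans (le_of_eq (lintegral_congr fun ω => ?_)) this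
      congr 3
      abel
    refine (lintegral_mono hstep).trans ?_
    rw [lintegral_const_mul _ (hm u')]
    refine (mul_le_mul_right (ih u') _).trans ?_
    rw [← ENNReal.ofReal_mul (Real.exp_pos _).le, ← Real.exp_add]
    refine ENNReal.ofReal_le_ofReal (Real.exp_le_exp.2 ?_)
    have h1 : s * ‖u'‖ ^ 2 ≤ s * (r * ‖u‖) ^ 2 :=
      mul_le_mul_of_nonneg_left (pow_le_pow_left₀ (norm_nonneg _) hu'n 2) hs
    have h2 : r ^ n * ‖u'‖ * ‖θ - c‖ ≤ r ^ n * (r * ‖u‖) * ‖θ - c‖ :=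
      mul_le_mul_of_nonneg_right (mul_le_mul_of_nonneg_left hu'n (pow_nonneg hr n)) (norm_nonneg _)
    have h3 := mul_le_mul_of_nonneg_right hbs (sq_nonneg ‖u‖)
    rw [pow_succ r n]
    nlinarith

/-- The same recursion for the norm itself, with `l` shrinking to `l * r`; the cosh inequality keeps
it free of the dimension. -/
lemma lintegral_cosh_perturbedKernel_pow (hN : Measurable N) (hb0 : 0 ≤ b) (hb : ∀ y, ‖N y‖ ≤ b)
    (hmean : ∀ θ, ∫ ξ, N (θ, ξ) ∂P = 0) (hr : 0 ≤ r) (hB : ∀ v, ‖B v‖ ≤ r * ‖v‖)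
    (hbs : b ^ 2 + s * r ^ 2 ≤ s) (hs : 0 ≤ s) (n : ℕ) {l : ℝ} (hl : 0 ≤ l) (θ : E) :
    ∫⁻ x, ENNReal.ofReal (Real.cosh (l * ‖x - c‖))
        ∂((perturbedKernel P c B N ^ n : Kernel E E) θ) ≤
      ENNReal.ofReal (Real.exp (s * l ^ 2 / 2) * Real.cosh (l * r ^ n * ‖θ - c‖)) := by
  have hm : ∀ l : ℝ, Measurable fun x : E => ENNReal.ofReal (Real.cosh (l * ‖x - c‖)) :=
    fun l => (Real.continuous_cosh.measurable.comp
      ((measurable_id.sub_const c).norm.const_mul l)).ennreal_ofReal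
  induction n generalizing l with
  | zero =>
    rw [lintegral_pow_zero _ (hm l), pow_zero, mul_one]
    refine ENNReal.ofReal_le_ofReal (le_mul_of_one_le_left (Real.cosh_pos _).le ?_)
    exact Real.one_le_exp (by positivity)
  | succ n ih =>
    rw [lintegral_pow_succ' _ _ (hm l)]
    have hstep : ∀ y, ∫⁻ x, ENNReal.ofReal (Real.cosh (l * ‖x - c‖))
        ∂(perturbedKernel P c B N y) ≤
        ENNReal.ofReal (Real.exp ((l * b) ^ 2 / 2)) *
          ENNReal.ofReal (Real.cosh (l * r * ‖y - c‖)) := by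
      intro y
      rw [lintegral_perturbedKernel hN (hm l), ← ENNReal.ofReal_mul (Real.exp_pos _).le]
      have h1 : ∀ ω, ‖l • N (y, ω)‖ ≤ l * b := fun ω => by
        rw [norm_smul, Real.norm_of_nonneg hl]
        exact mul_le_mul_of_nonneg_left (hb _) hl
      have := lintegral_cosh_norm_add_le (P := P) (ξ := fun ω => l • N (y, ω))
        ((hN.comp (measurable_const.prodMk measurable_id)).const_smul l) (mul_nonneg hl hb0) h1
        (by rw [integral_smul, hmean, smul_zero]) (l • B (y - c))
      refine (le_of_eq (lintegral_congr fun ω => ?_)).trans (this.trans ?_)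
      · rw [← smul_add, norm_smul, Real.norm_of_nonneg hl]
        congr 4
        abel
      · refine ENNReal.ofReal_le_ofReal (mul_le_mul_of_nonneg_left ?_ (Real.exp_pos _).le)
        rw [Real.cosh_le_cosh, abs_of_nonneg (norm_nonneg _), abs_of_nonneg (by positivity),
          norm_smul, Real.norm_of_nonneg hl, mul_assoc]
        exact mul_le_mul_of_nonneg_left (hB _) hl
    refine (lintegral_mono hstep).trans ?_
    rw [lintegral_const_mul _ (hm _)]
    refine (mul_le_mul_right (ih (mul_nonneg hl hr)) _).trans ?_
    rw [← ENNReal.ofReal_mul (Real.exp_pos _).le, ← mul_assoc, ← Real.exp_add]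
    refine ENNReal.ofReal_le_ofReal (mul_le_mul ?_ (le_of_eq ?_) (Real.cosh_pos _).le
      (Real.exp_pos _).le)
    · refine Real.exp_le_exp.2 ?_
      have h3 := mul_le_mul_of_nonneg_right hbs (sq_nonneg l)
      nlinarith
    · rw [pow_succ]; congr 1; ring

/-- Markov's inequality for `cosh (l ‖x - c‖)` with `l = 1/s`; the exponent `s l²/2 + l R - l (R +
1)` equals `-1/(2s)`. -/
lemma perturbedKernel_pow_tail (hN : Measurable N) (hb0 : 0 ≤ b) (hb : ∀ y, ‖N y‖ ≤ b)
    (hmean : ∀ θ, ∫ ξ, N (θ, ξ) ∂P = 0) (hr : 0 ≤ r) (hr1 : r ≤ 1) (hB : ∀ v, ‖B v‖ ≤ r * ‖v‖)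
    (hbs : b ^ 2 + s * r ^ 2 ≤ s) (hs : 0 < s) (n : ℕ) {θ : E} {R : ℝ} (hR : ‖θ - c‖ ≤ R) :
    (perturbedKernel P c B N ^ n : Kernel E E) θ {x | R + 1 < ‖x - c‖} ≤
      ENNReal.ofReal (2 * Real.exp (-(1 / (2 * s)))) := by
  set l := 1 / s with hl
  have hl0 : 0 < l := by positivity
  have hR0 : 0 ≤ R := (norm_nonneg _).trans hR
  have h1 := lintegral_cosh_perturbedKernel_pow (P := P) (c := c) hN hb0 hb hmean hr hB hbs hs.le n hl0.le θ
  have hm : Measurable fun x : E => ENNReal.ofReal (Real.cosh (l * ‖x - c‖)) :=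
    (Real.continuous_cosh.measurable.comp
      ((measurable_id.sub_const c).norm.const_mul l)).ennreal_ofReal
  set μ := (perturbedKernel P c B N ^ n : Kernel E E) θ
  have hch : (0 : ℝ) < Real.exp (l * (R + 1)) / 2 := by positivity
  have h2 : {x | R + 1 < ‖x - c‖} ⊆ {x | ENNReal.ofReal (Real.exp (l * (R + 1)) / 2) ≤
      ENNReal.ofReal (Real.cosh (l * ‖x - c‖))} := by
    intro x hx
    refine ENNReal.ofReal_le_ofReal ?_
    have h3 : l * (R + 1) ≤ l * ‖x - c‖ := mul_le_mul_of_nonneg_left (le_of_lt hx) hl0.le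
    rw [Real.cosh_eq]
    have := Real.exp_le_exp.2 h3
    have := Real.exp_pos (-(l * ‖x - c‖))
    linarith
  have h4 := mul_meas_ge_le_lintegral (μ := μ) hm (ENNReal.ofReal (Real.exp (l * (R + 1)) / 2))
  have h5 : ENNReal.ofReal (Real.exp (s * l ^ 2 / 2) * Real.cosh (l * r ^ n * ‖θ - c‖)) ≤
      ENNReal.ofReal (Real.exp (l * (R + 1)) / 2) *
        ENNReal.ofReal (2 * Real.exp (-(1 / (2 * s)))) := by
    rw [← ENNReal.ofReal_mul hch.le]
    refine ENNReal.ofReal_le_ofReal ?_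
    have h6 : Real.cosh (l * r ^ n * ‖θ - c‖) ≤ Real.exp (l * R) := by
      have h7 : l * r ^ n * ‖θ - c‖ ≤ l * R := by
        refine mul_le_mul (mul_le_of_le_one_right hl0.le (pow_le_one₀ hr hr1)) hR
          (norm_nonneg _) hl0.le
      have h8 : 0 ≤ l * r ^ n * ‖θ - c‖ := by positivity
      rw [Real.cosh_eq]
      have := Real.exp_le_exp.2 h7
      have := Real.exp_le_exp.2 (show -(l * r ^ n * ‖θ - c‖) ≤ l * R by linarith)
      linarith
    refine (mul_le_mul_of_nonneg_left h6 (Real.exp_pos _).le).trans (le_of_eq ?_)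
    have e : s * l ^ 2 / 2 + l * R = l * (R + 1) + -(1 / (2 * s)) := by
      rw [hl]; field_simp; ring
    rw [← Real.exp_add, e, Real.exp_add]; ring
  refine (measure_mono h2).trans ?_
  have h6 := (h4.trans h1).trans h5
  exact (ENNReal.mul_le_mul_iff_right (ENNReal.ofReal_pos.2 hch).ne' ENNReal.ofReal_ne_top).1 h6

end Perturbed

/-! ### Contraction of the mean step and measurability of its fixed point -/

section Target

variable {S A H : Type*} {K d : ℕ} [TopologicalSpace S] [MeasurableSpace S]
  [OpensMeasurableSpace S] [Fintype A] [MeasurableSpace A] [DiscreteMeasurableSpace A]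
  [MeasurableSpace H] {𝓜 : Model S A K} {φ : FeatureMap S A K d} {π : ControlPolicy S A}
  {C ρ : ℝ} {ν : NaturePolicy 𝓜 → Measure S} {hK : 2 ≤ K}

lemma mu_le_one (herg : GeometricallyErgodic 𝓜 π C ρ ν) (hC : 0 ≤ C) (hρ0 : 0 ≤ ρ) (hρ1 : ρ < 1)
    (hcov : ∀ ω, (covariance 𝓜 φ π ν ω).PosDef) (hd : 0 < d) :
    d * (evalConsts 𝓜 φ π ν C ρ hK).mu ≤ 1 := by
  have h1 := dim_mul_lamMin_le_one (hK := hK) herg hcov hd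
  have h2 := lamMin_pos (hK := hK) herg hC hρ0 hρ1 hcov hd
  have h3 : (evalConsts 𝓜 φ π ν C ρ hK).mu ≤ (evalConsts 𝓜 φ π ν C ρ hK).lamMin := by
    refine mul_le_of_le_one_right h2.le ?_
    have : (evalConsts 𝓜 φ π ν C ρ hK).γ = 𝓜.discount := rfl
    have := 𝓜.discount_pos
    linarith
  exact (mul_le_mul_of_nonneg_left h3 (Nat.cast_nonneg d)).trans h1

/-- The first order gain is `2aμ`, and the second order loss is at most `4a²`, hence at most `aμ`.
-/
lemma norm_sub_smul_meanTDLinear_sq_le (herg : GeometricallyErgodic 𝓜 π C ρ ν)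
    (hcov : ∀ ω, (covariance 𝓜 φ π ν ω).PosDef) (hd : 0 < d) (ω : NaturePolicy 𝓜) {a : ℝ}
    (ha : 0 ≤ a) (ha' : 4 * a ≤ (evalConsts 𝓜 φ π ν C ρ hK).mu) (v : EuclideanSpace ℝ (Fin d)) :
    ‖v - a • meanTDLinear φ herg ω v‖ ^ 2 ≤
      (1 - a * (evalConsts 𝓜 φ π ν C ρ hK).mu) * ‖v‖ ^ 2 := by
  have h1 := mu_mul_le_inner (hK := hK) herg hcov hd ω v
  have h2 := norm_meanTDLinear_le (φ := φ) herg ω v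
  rw [norm_sub_sq_real, real_inner_smul_right, norm_smul, Real.norm_of_nonneg ha, mul_pow,
    real_inner_comm]
  have h3 : ‖meanTDLinear φ herg ω v‖ ^ 2 ≤ (2 * ‖v‖) ^ 2 := pow_le_pow_left₀ (norm_nonneg _) h2 2
  have h4 := mul_le_mul_of_nonneg_left h1 ha
  have h5 := mul_le_mul_of_nonneg_left h3 (sq_nonneg a)
  have h6 := mul_le_mul_of_nonneg_right ha' (mul_nonneg ha (sq_nonneg ‖v‖))
  nlinarith

lemma meanTD_eq (herg : GeometricallyErgodic 𝓜 π C ρ ν) (hC : 0 ≤ C) (hρ0 : 0 ≤ ρ)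
    (hρ1 : ρ < 1) (hK : 2 ≤ K) (hcov : ∀ ω, (covariance 𝓜 φ π ν ω).PosDef) (hd : 0 < d)
    (ω : NaturePolicy 𝓜) (θ : EuclideanSpace ℝ (Fin d)) :
    meanTD φ π ν ω θ = meanTDLinear φ herg ω (θ - tdTarget 𝓜 φ π ν ω) := by
  have h := meanTD_add (φ := φ) herg ω (tdTarget 𝓜 φ π ν ω) (θ - tdTarget 𝓜 φ π ν ω)
  rwa [add_sub_cancel, meanTD_tdTarget herg hC hρ0 hρ1 hK hcov hd ω, zero_add] at h

/-- The target is the limit of the exact iteration with step `μ/4` started at zero, all of whose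
iterates are measurable in the history. -/
lemma measurable_tdTarget_freeze (herg : GeometricallyErgodic 𝓜 π C ρ ν) (hC : 0 ≤ C)
    (hρ0 : 0 ≤ ρ) (hρ1 : ρ < 1) (hK : 2 ≤ K) (hcov : ∀ ω, (covariance 𝓜 φ π ν ω).PosDef)
    (hd : 0 < d) (ω : Policy (H × S) (Fin K) 𝓜.weights) :
    Measurable fun h => tdTarget 𝓜 φ π ν (ω.freeze h) := by
  set μ := (evalConsts 𝓜 φ π ν C ρ hK).mu with hμ
  have hμ0 : 0 < μ := mu_pos herg hC hρ0 hρ1 hcov hd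
  have hμ1 : μ ≤ 1 := by
    have h1 := mu_le_one (hK := hK) herg hC hρ0 hρ1 hcov hd
    have h2 : (1 : ℝ) ≤ d := by exact_mod_cast hd
    exact (le_mul_of_one_le_left hμ0.le h2).trans h1
  let x : ℕ → H → EuclideanSpace ℝ (Fin d) := fun n => Nat.rec (fun _ => 0)
    (fun _ y h => y h - (μ / 4) • meanTD φ π ν (ω.freeze h) (y h)) n
  have hx0 : ∀ h, x 0 h = 0 := fun _ => rfl
  have hx1 : ∀ n h, x (n + 1) h = x n h - (μ / 4) • meanTD φ π ν (ω.freeze h) (x n h) :=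
    fun _ _ => rfl
  obtain ⟨x, hx0, hx1⟩ : ∃ x : ℕ → H → EuclideanSpace ℝ (Fin d), (∀ h, x 0 h = 0) ∧
    ∀ n h, x (n + 1) h = x n h - (μ / 4) • meanTD φ π ν (ω.freeze h) (x n h) := ⟨x, hx0, hx1⟩
  have hm : ∀ n, Measurable (x n) := by
    intro n
    induction n with
    | zero => rw [show x 0 = fun _ => 0 from funext hx0]; exact measurable_const
    | succ n ih =>
      rw [show x (n + 1) = _ from funext (hx1 n)]
      exact ih.sub ((measurable_meanTD_freeze herg hC hρ0 hρ1 ω ih).const_smul (μ / 4))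
  refine measurable_of_tendsto_metrizable hm ?_
  rw [tendsto_pi_nhds]
  intro h
  set c := tdTarget 𝓜 φ π ν (ω.freeze h) with hc
  set q := 1 - μ / 4 * μ with hq
  have hq0 : 0 ≤ q := by nlinarith
  have hq1 : q < 1 := by nlinarith [mul_pos hμ0 hμ0]
  have key : ∀ n, ‖x n h - c‖ ^ 2 ≤ q ^ n * ‖c‖ ^ 2 := by
    intro n
    induction n with
    | zero => simp [hx0]
    | succ n ih =>
      have e : x (n + 1) h - c = (x n h - c) -
          (μ / 4) • meanTDLinear φ herg (ω.freeze h) (x n h - c) := by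
        rw [hx1, meanTD_eq herg hC hρ0 hρ1 hK hcov hd]
        abel
      rw [e, pow_succ' q]
      refine (norm_sub_smul_meanTDLinear_sq_le (hK := hK) herg hcov hd (ω.freeze h)
        (a := μ / 4) (by positivity) (le_of_eq (by ring)) _).trans ?_
      rw [mul_assoc]
      exact mul_le_mul_of_nonneg_left ih hq0
  rw [tendsto_iff_norm_sub_tendsto_zero]
  have h2 : Filter.Tendsto (fun n => q ^ n * ‖c‖ ^ 2) Filter.atTop (nhds 0) := by
    simpa using (tendsto_pow_atTop_nhds_zero_of_lt_one hq0 hq1).mul_const (‖c‖ ^ 2)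
  have h3 : Filter.Tendsto (fun n => ‖x n h - c‖ ^ 2) Filter.atTop (nhds 0) :=
    squeeze_zero (fun _ => sq_nonneg _) key h2
  have h4 := (Real.continuous_sqrt.tendsto 0).comp h3
  rw [Real.sqrt_zero] at h4
  refine h4.congr fun n => ?_
  simp [Real.sqrt_sq (norm_nonneg _)]

end Target

end RobustMDP
namespace RobustMDP
set_option linter.unusedSectionVars false

/-! ### Comparison of TD learning with a clipped stationary recursion -/

section TDLaw

variable {S A H : Type*} {K d : ℕ} [TopologicalSpace S] [MeasurableSpace S]
  [OpensMeasurableSpace S] [Fintype A] [MeasurableSpace A] [DiscreteMeasurableSpace A]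
  [MeasurableSpace H] {𝓜 : Model S A K} {φ : FeatureMap S A K d} {π : ControlPolicy S A}
  {C ρ : ℝ} {ν : NaturePolicy 𝓜 → Measure S}

lemma measurable_tdStep_map (𝓜 : Model S A K) (φ : FeatureMap S A K d) (η : ℝ) :
    Measurable fun y : (H × ((S × A × Fin K) × (S × A × Fin K)) × EuclideanSpace ℝ (Fin d)) ×
        ((S × A × Fin K) × (S × A × Fin K)) =>
      (y.1.1, y.2, y.1.2.2 - η • tdOperator 𝓜 φ y.1.2.2 y.2) := by
  have h1 : Measurable fun y : (H × ((S × A × Fin K) × (S × A × Fin K)) ×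
      EuclideanSpace ℝ (Fin d)) × ((S × A × Fin K) × (S × A × Fin K)) => y.1.2.2 :=
    measurable_snd.comp (measurable_snd.comp measurable_fst)
  have h2 : Measurable fun y : (H × ((S × A × Fin K) × (S × A × Fin K)) ×
      EuclideanSpace ℝ (Fin d)) × ((S × A × Fin K) × (S × A × Fin K)) =>
      tdOperator 𝓜 φ y.1.2.2 y.2 := measurable_tdOperator_comp 𝓜 φ h1 measurable_snd
  exact (measurable_fst.comp measurable_fst).prodMk
    (measurable_snd.prodMk (h1.sub (h2.const_smul η)))

instance (𝓜 : Model S A K) (φ : FeatureMap S A K d) (ω : Policy (H × S) (Fin K) 𝓜.weights)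
    (η : ℝ) (τ : ℕ) : IsMarkovKernel (tdStep 𝓜 φ π ω η τ) :=
  Kernel.IsMarkovKernel.map _ (measurable_tdStep_map 𝓜 φ η)

lemma measurable_tdKernel_init :
    Measurable fun y : H × ((S × A × Fin K) × (S × A × Fin K)) =>
      (y.1, y.2, (0 : EuclideanSpace ℝ (Fin d))) :=
  measurable_fst.prodMk (measurable_snd.prodMk measurable_const)

lemma measurable_snd_snd {X Y Z : Type*} [MeasurableSpace X] [MeasurableSpace Y]
    [MeasurableSpace Z] : Measurable fun x : X × Y × Z => x.2.2 :=
  measurable_snd.comp measurable_snd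

instance isMarkovKernel_tdKernel (𝓜 : Model S A K) (φ : FeatureMap S A K d)
    (ω : Policy (H × S) (Fin K) 𝓜.weights) (s₀ : S) (η : ℝ) (T τ : ℕ) :
    IsMarkovKernel (tdKernel 𝓜 φ π ω s₀ η T τ) := by
  have := Kernel.IsMarkovKernel.map (Kernel.id ×ₖ
    ((markovSampler 𝓜 π ω 1).comap (fun h => (h, s₀)) (by fun_prop)))
    (measurable_tdKernel_init (H := H) (S := S) (A := A) (K := K) (d := d))
  unfold tdKernel
  exact Kernel.IsMarkovKernel.map _ measurable_snd_snd

lemma lintegral_tdStep (ω : Policy (H × S) (Fin K) 𝓜.weights) (η : ℝ) (τ : ℕ)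
    {f : H × ((S × A × Fin K) × (S × A × Fin K)) × EuclideanSpace ℝ (Fin d) → ENNReal}
    (hf : Measurable f) (h : H) (ξ : (S × A × Fin K) × (S × A × Fin K))
    (θ : EuclideanSpace ℝ (Fin d)) :
    ∫⁻ x, f x ∂(tdStep 𝓜 φ π ω η τ (h, ξ, θ)) =
      ∫⁻ ξ', f (h, ξ', θ - η • tdOperator 𝓜 φ θ ξ') ∂(markovSampler 𝓜 π ω τ (h, ξ.1.1)) := by
  have hm := measurable_tdStep_map (H := H) 𝓜 φ η
  unfold tdStep
  rw [Kernel.lintegral_map _ hm _ hf]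
  exact Kernel.lintegral_id_prod (hf.comp hm) _ _

/-- The stochastic error of a step of temporal difference learning with stationary samples,
switched off far away from the solution of the projected Bellman equation. -/
noncomputable def clippedNoise (𝓜 : Model S A K) (φ : FeatureMap S A K d) (π : ControlPolicy S A)
    (ν : NaturePolicy 𝓜 → Measure S) (ω : NaturePolicy 𝓜) (η R : ℝ)
    (y : EuclideanSpace ℝ (Fin d) × ((S × A × Fin K) × (S × A × Fin K))) :
    EuclideanSpace ℝ (Fin d) :=
  if ‖y.1 - tdTarget 𝓜 φ π ν ω‖ ≤ R + 1 then
    (-η) • (tdOperator 𝓜 φ y.1 y.2 - meanTD φ π ν ω y.1) else 0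

/-- A step of temporal difference learning with stationary samples, with the noise switched off far
away from the solution of the projected Bellman equation. -/
noncomputable def clippedTD (φ : FeatureMap S A K d) (herg : GeometricallyErgodic 𝓜 π C ρ ν)
    (ω : NaturePolicy 𝓜) (η R : ℝ) :
    Kernel (EuclideanSpace ℝ (Fin d)) (EuclideanSpace ℝ (Fin d)) :=
  perturbedKernel (stationaryPair π ν ω) (tdTarget 𝓜 φ π ν ω)
    (ContinuousLinearMap.id ℝ _ - η • meanTDLinear φ herg ω) (clippedNoise 𝓜 φ π ν ω η R)

lemma measurable_clippedNoise (herg : GeometricallyErgodic 𝓜 π C ρ ν) (ω : NaturePolicy 𝓜)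
    (η R : ℝ) : Measurable (clippedNoise 𝓜 φ π ν ω η R) := by
  have h1 : Measurable (meanTD φ π ν ω) := by
    have : meanTD φ π ν ω = fun θ => meanTD φ π ν ω 0 + meanTDLinear φ herg ω θ := by
      funext θ
      rw [← meanTD_add, zero_add]
    rw [this]
    exact measurable_const.add (meanTDLinear φ herg ω).measurable
  have h2 : Measurable fun y : EuclideanSpace ℝ (Fin d) ×
      ((S × A × Fin K) × (S × A × Fin K)) => tdOperator 𝓜 φ y.1 y.2 - meanTD φ π ν ω y.1 :=
    (measurable_tdOperator_comp 𝓜 φ measurable_fst measurable_snd).sub (h1.comp measurable_fst)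
  exact Measurable.ite
    (measurableSet_le (measurable_fst.sub_const _).norm measurable_const)
    (h2.const_smul (-η)) measurable_const

/-- Inside the ball `‖θ‖ ≤ 2R + 1`, and both operators are bounded by `2‖θ‖ + 1`, which gives `8R +
6`. Clipping provides this bound for every `θ`, where the unclipped noise could grow with `‖θ‖`. -/
lemma norm_clippedNoise_le (herg : GeometricallyErgodic 𝓜 π C ρ ν) (ω : NaturePolicy 𝓜) {η R : ℝ}
    (hη : 0 ≤ η) (hR : ‖tdTarget 𝓜 φ π ν ω‖ ≤ R)
    (y : EuclideanSpace ℝ (Fin d) × ((S × A × Fin K) × (S × A × Fin K))) :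
    ‖clippedNoise 𝓜 φ π ν ω η R y‖ ≤ η * (8 * R + 6) := by
  have hR0 : 0 ≤ R := (norm_nonneg _).trans hR
  unfold clippedNoise
  split_ifs with h
  · rw [norm_smul, norm_neg, Real.norm_of_nonneg hη]
    refine mul_le_mul_of_nonneg_left ?_ hη
    have h1 := norm_tdOperator_le 𝓜 φ y.1 y.2
    have h2 := norm_meanTD_le (φ := φ) herg ω y.1
    have h3 : ‖y.1‖ ≤ 2 * R + 1 := by
      have := norm_add_le (y.1 - tdTarget 𝓜 φ π ν ω) (tdTarget 𝓜 φ π ν ω)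
      rw [sub_add_cancel] at this
      linarith
    refine (norm_sub_le _ _).trans ?_
    linarith
  · rw [norm_zero]; positivity

lemma integral_clippedNoise (herg : GeometricallyErgodic 𝓜 π C ρ ν) (ω : NaturePolicy 𝓜)
    (η R : ℝ) (θ : EuclideanSpace ℝ (Fin d)) :
    ∫ ξ, clippedNoise 𝓜 φ π ν ω η R (θ, ξ) ∂(stationaryPair π ν ω) = 0 := by
  have := isProbabilityMeasure_stationaryPair herg ω
  unfold clippedNoise
  simp only
  split_ifs with h
  · rw [integral_smul, integral_sub (integrable_tdOperator herg ω θ) (integrable_const _)]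
    simp [meanTD]
  · simp

lemma isMarkovKernel_clippedTD (herg : GeometricallyErgodic 𝓜 π C ρ ν) (ω : NaturePolicy 𝓜)
    (η R : ℝ) : IsMarkovKernel (clippedTD φ herg ω η R) := by
  have := isProbabilityMeasure_stationaryPair herg ω
  exact isMarkovKernel_perturbedKernel (measurable_clippedNoise herg ω η R)

lemma lintegral_clippedTD (herg : GeometricallyErgodic 𝓜 π C ρ ν) (hC : 0 ≤ C)
    (hρ0 : 0 ≤ ρ) (hρ1 : ρ < 1) (hK : 2 ≤ K) (hcov : ∀ ω, (covariance 𝓜 φ π ν ω).PosDef)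
    (hd : 0 < d) (ω : NaturePolicy 𝓜) (η R : ℝ) {f : EuclideanSpace ℝ (Fin d) → ENNReal}
    (hf : Measurable f) {θ : EuclideanSpace ℝ (Fin d)}
    (hθ : ‖θ - tdTarget 𝓜 φ π ν ω‖ ≤ R + 1) :
    ∫⁻ x, f x ∂(clippedTD φ herg ω η R θ) =
      ∫⁻ ξ, f (θ - η • tdOperator 𝓜 φ θ ξ) ∂(stationaryPair π ν ω) := by
  have := isProbabilityMeasure_stationaryPair herg ω
  unfold clippedTD
  rw [lintegral_perturbedKernel (measurable_clippedNoise herg ω η R) hf]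
  refine lintegral_congr fun ξ => ?_
  congr 1
  simp only [clippedNoise, if_pos hθ, sub_apply, ContinuousLinearMap.id_apply, smul_apply]
  rw [meanTD_eq herg hC hρ0 hρ1 hK hcov hd]
  module

/-- The probability that clipping is active in one of the first `n` steps, plus `n * e`. -/
noncomputable def clipLoss (φ : FeatureMap S A K d) (herg : GeometricallyErgodic 𝓜 π C ρ ν)
    (ω : NaturePolicy 𝓜) (η R : ℝ) (e : ENNReal) (n : ℕ) (θ : EuclideanSpace ℝ (Fin d)) :
    ENNReal :=
  ∑ j ∈ Finset.range n, (e + (clippedTD φ herg ω η R ^ j : Kernel _ _) θ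
    {x | R + 1 < ‖x - tdTarget 𝓜 φ π ν ω‖})

lemma measurableSet_clip (ω : NaturePolicy 𝓜) (R : ℝ) :
    MeasurableSet {x | R + 1 < ‖x - tdTarget 𝓜 φ π ν ω‖} :=
  measurableSet_lt measurable_const (measurable_id.sub_const _).norm

/-- Steps are exchanged one at a time. Each pays `e` for replacing the sampled pair by a stationary
one, and the probability that the recursion is outside the ball. The latter concerns the clipped
chain only, for which tail bounds hold without circularity. -/
lemma lintegral_tdStep_pow_le (herg : GeometricallyErgodic 𝓜 π C ρ ν) (hC : 0 ≤ C)
    (hρ0 : 0 ≤ ρ) (hρ1 : ρ < 1) (hK : 2 ≤ K) (hcov : ∀ ω, (covariance 𝓜 φ π ν ω).PosDef)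
    (hd : 0 < d) (ω : Policy (H × S) (Fin K) 𝓜.weights) (η R : ℝ) (τ : ℕ)
    {f : EuclideanSpace ℝ (Fin d) → ENNReal} (hf : Measurable f) (hf1 : ∀ x, f x ≤ 1)
    (n : ℕ) (h : H) (ξ : (S × A × Fin K) × (S × A × Fin K)) (θ : EuclideanSpace ℝ (Fin d)) :
    ∫⁻ x, f x.2.2 ∂((tdStep 𝓜 φ π ω η (τ + 2) ^ n : Kernel _ _) (h, ξ, θ)) ≤
      ∫⁻ x, f x ∂((clippedTD φ herg (ω.freeze h) η R ^ n : Kernel _ _) θ) +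
        clipLoss φ herg (ω.freeze h) η R (ENNReal.ofReal (C * ρ ^ τ)) n θ := by
  have hMk := isMarkovKernel_clippedTD (φ := φ) herg (ω.freeze h) η R
  set κ := clippedTD φ herg (ω.freeze h) η R with hκ
  set e := ENNReal.ofReal (C * ρ ^ τ) with he
  set D := {x | R + 1 < ‖x - tdTarget 𝓜 φ π ν (ω.freeze h)‖} with hD
  have hDm : MeasurableSet D := measurableSet_clip (ω.freeze h) R
  have hfm : Measurable fun x : H × ((S × A × Fin K) × (S × A × Fin K)) ×
      EuclideanSpace ℝ (Fin d) => f x.2.2 := hf.comp measurable_snd_snd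
  induction n generalizing ξ θ with
  | zero =>
    rw [lintegral_pow_zero _ hfm, lintegral_pow_zero _ hf]
    exact le_self_add
  | succ n ih =>
    have hone : ∀ y, ∫⁻ x, f x.2.2 ∂((tdStep 𝓜 φ π ω η (τ + 2) ^ n : Kernel _ _) y) ≤ 1 :=
      fun y => (lintegral_mono fun x => hf1 _).trans (by simp)
    have hlm : Measurable fun θ => clipLoss φ herg (ω.freeze h) η R e n θ := by
      unfold clipLoss
      exact Finset.measurable_fun_sum _ fun j _ =>
        measurable_const.add (Kernel.measurable_coe (κ ^ j : Kernel _ _) hDm)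
    have hgm : Measurable fun θ => ∫⁻ x, f x ∂((κ ^ n : Kernel _ _) θ) := hf.lintegral_kernel
    rw [lintegral_pow_succ _ _ hfm, lintegral_tdStep ω η (τ + 2) hfm.lintegral_kernel]
    by_cases hθ : θ ∈ D
    · refine (lintegral_mono fun ξ' => hone _).trans ?_
      -- Outside the ball the term `j = 0` of the loss is already at least one, and the bound is
      -- trivial.
      have h1 : (1 : ENNReal) ≤ clipLoss φ herg (ω.freeze h) η R e (n + 1) θ := by
        unfold clipLoss
        refine le_trans ?_ (Finset.single_le_sum (f := fun j => e +
          (clippedTD φ herg (ω.freeze h) η R ^ j : Kernel _ _) θ D)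
          (fun _ _ => bot_le) (Finset.mem_range.2 (Nat.succ_pos n)))
        refine le_trans ?_ le_add_self
        rw [pow_zero]
        show 1 ≤ (Kernel.id : Kernel _ _) θ D
        rw [Kernel.id_apply, Measure.dirac_apply' _ hDm, Set.indicator_of_mem hθ]
        rfl
      simp only [lintegral_const, measure_univ, mul_one]
      exact h1.trans le_add_self
    -- Truncated at one, because the comparison with the stationary pair needs a test function with
    -- values in `[0, 1]`.
    · set g : EuclideanSpace ℝ (Fin d) → ENNReal := fun θ =>
        min 1 (∫⁻ x, f x ∂((κ ^ n : Kernel _ _) θ) + clipLoss φ herg (ω.freeze h) η R e n θ)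
        with hg
      have hgmm : Measurable g := measurable_const.min (hgm.add hlm)
      have hstep : Measurable fun ξ' => g (θ - η • tdOperator 𝓜 φ θ ξ') :=
        hgmm.comp (measurable_const.sub ((measurable_tdOperator 𝓜 φ θ).const_smul η))
      have hle : θ ∉ D → ‖θ - tdTarget 𝓜 φ π ν (ω.freeze h)‖ ≤ R + 1 := fun hn => not_lt.1 hn
      calc _ ≤ ∫⁻ ξ', g (θ - η • tdOperator 𝓜 φ θ ξ')
            ∂(markovSampler 𝓜 π ω (τ + 2) (h, ξ.1.1)) :=
            lintegral_mono fun ξ' => le_min (hone _) (ih ξ' _)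
        _ ≤ ∫⁻ ξ', g (θ - η • tdOperator 𝓜 φ θ ξ') ∂(stationaryPair π ν (ω.freeze h)) + e :=
            (lintegral_markovSampler_le herg hC hρ0 ω τ h ξ.1.1 hstep
              (fun _ => min_le_left _ _)).1
        _ = ∫⁻ x, g x ∂(κ θ) + e := by
            rw [hκ, lintegral_clippedTD herg hC hρ0 hρ1 hK hcov hd (ω.freeze h) η R hgmm (hle hθ)]
        _ ≤ ∫⁻ x, (∫⁻ y, f y ∂((κ ^ n : Kernel _ _) x) +
              clipLoss φ herg (ω.freeze h) η R e n x) ∂(κ θ) + e := by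
            gcongr with x
            exact min_le_right _ _
        _ = ∫⁻ x, f x ∂((κ ^ (n + 1) : Kernel _ _) θ) +
              (∫⁻ x, clipLoss φ herg (ω.freeze h) η R e n x ∂(κ θ) + e) := by
            rw [lintegral_add_left hgm, lintegral_pow_succ _ _ hf, add_assoc]
        _ ≤ _ := by
            gcongr
            unfold clipLoss
            have hj : ∀ j ∈ Finset.range n, Measurable fun x => e + (κ ^ j : Kernel _ _) x D :=
              fun j _ => measurable_const.add (Kernel.measurable_coe (κ ^ j : Kernel _ _) hDm)
            rw [← hκ, ← hD, lintegral_finsetSum _ hj, Finset.sum_range_succ']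
            refine add_le_add (le_of_eq (Finset.sum_congr rfl fun j _ => ?_)) le_self_add
            rw [lintegral_add_left measurable_const, lintegral_const, measure_univ, mul_one]
            congr 1
            have := lintegral_pow_succ κ j (f := D.indicator 1) (measurable_one.indicator hDm) θ
            simp only [lintegral_indicator_one hDm] at this
            exact this.symm

lemma lintegral_tdKernel_le (herg : GeometricallyErgodic 𝓜 π C ρ ν) (hC : 0 ≤ C)
    (hρ0 : 0 ≤ ρ) (hρ1 : ρ < 1) (hK : 2 ≤ K) (hcov : ∀ ω, (covariance 𝓜 φ π ν ω).PosDef)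
    (hd : 0 < d) (ω : Policy (H × S) (Fin K) 𝓜.weights) (s₀ : S) (η R : ℝ) (T τ : ℕ)
    {f : EuclideanSpace ℝ (Fin d) → ENNReal} (hf : Measurable f) (hf1 : ∀ x, f x ≤ 1) (h : H) :
    ∫⁻ x, f x ∂(tdKernel 𝓜 φ π ω s₀ η T (τ + 2) h) ≤
      ∫⁻ x, f x ∂((clippedTD φ herg (ω.freeze h) η R ^ (T + 1) : Kernel _ _) 0) +
        clipLoss φ herg (ω.freeze h) η R (ENNReal.ofReal (C * ρ ^ τ)) (T + 1) 0 := by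
  have hfm : Measurable fun x : H × ((S × A × Fin K) × (S × A × Fin K)) ×
      EuclideanSpace ℝ (Fin d) => f x.2.2 := hf.comp measurable_snd_snd
  have hG := hfm.lintegral_kernel (κ := (tdStep 𝓜 φ π ω η (τ + 2) ^ (T + 1) : Kernel _ _))
  have hinit := measurable_tdKernel_init (H := H) (S := S) (A := A) (K := K) (d := d)
  unfold tdKernel
  rw [Kernel.lintegral_map _ measurable_snd_snd _ hf, Kernel.lintegral_comp _ _ _ hfm,
    Kernel.lintegral_map _ hinit _ hG, Kernel.lintegral_id_prod (f := fun y =>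
      ∫⁻ x, f x.2.2 ∂((tdStep 𝓜 φ π ω η (τ + 2) ^ (T + 1) : Kernel _ _) (y.1, y.2, 0)))
      (hG.comp hinit)]
  refine (lintegral_mono fun ξ =>
    lintegral_tdStep_pow_le herg hC hρ0 hρ1 hK hcov hd ω η R τ hf hf1 (T + 1) h ξ 0).trans ?_
  rw [lintegral_const, measure_univ, mul_one]

end TDLaw

end RobustMDP
namespace RobustMDP
set_option linter.unusedSectionVars false

/-! ### Moments, tails and clipping loss of one TD run -/

section TDBounds

variable {S A : Type*} {K d : ℕ} [TopologicalSpace S] [MeasurableSpace S]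
  [OpensMeasurableSpace S] [Fintype A] [MeasurableSpace A] [DiscreteMeasurableSpace A]
  {𝓜 : Model S A K} {φ : FeatureMap S A K d} {π : ControlPolicy S A}
  {C ρ : ℝ} {ν : NaturePolicy 𝓜 → Measure S} {hK : 2 ≤ K}

/-- The subgaussian variance proxy of a run of temporal difference learning with stepsize `η`. -/
noncomputable def Consts.variance (q : Consts) (η : ℝ) : ℝ := η * (8 * q.R + 6) ^ 2 / q.mu

lemma norm_sub_smul_meanTDLinear_le (herg : GeometricallyErgodic 𝓜 π C ρ ν)
    (hcov : ∀ ω, (covariance 𝓜 φ π ν ω).PosDef) (hd : 0 < d) (ω : NaturePolicy 𝓜) {η : ℝ}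
    (hη : 0 ≤ η) (hη' : 4 * η ≤ (evalConsts 𝓜 φ π ν C ρ hK).mu) (v : EuclideanSpace ℝ (Fin d)) :
    ‖(ContinuousLinearMap.id ℝ (EuclideanSpace ℝ (Fin d)) - η • meanTDLinear φ herg ω) v‖ ≤
      Real.sqrt (1 - η * (evalConsts 𝓜 φ π ν C ρ hK).mu) * ‖v‖ := by
  have h := norm_sub_smul_meanTDLinear_sq_le (hK := hK) herg hcov hd ω hη hη' v
  have h2 := Real.sqrt_le_sqrt h
  rw [Real.sqrt_sq (norm_nonneg _), Real.sqrt_mul' _ (sq_nonneg _),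
    Real.sqrt_sq (norm_nonneg _)] at h2
  exact h2

lemma eta_mul_mu_le (herg : GeometricallyErgodic 𝓜 π C ρ ν) (hC : 0 ≤ C) (hρ0 : 0 ≤ ρ)
    (hρ1 : ρ < 1) (hcov : ∀ ω, (covariance 𝓜 φ π ν ω).PosDef) (hd : 0 < d) {η : ℝ}
    (hη : 0 ≤ η) (hη' : 4 * η ≤ (evalConsts 𝓜 φ π ν C ρ hK).mu) :
    0 ≤ η * (evalConsts 𝓜 φ π ν C ρ hK).mu ∧ η * (evalConsts 𝓜 φ π ν C ρ hK).mu ≤ 1 := by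
  have h1 := mu_le_one (hK := hK) herg hC hρ0 hρ1 hcov hd
  have h2 := mu_pos (hK := hK) herg hC hρ0 hρ1 hcov hd
  have h3 : (1 : ℝ) ≤ d := by exact_mod_cast hd
  have h4 : (evalConsts 𝓜 φ π ν C ρ hK).mu ≤ 1 := (le_mul_of_one_le_left h2.le h3).trans h1
  exact ⟨by positivity, by nlinarith⟩

/-- `variance` is the fixed point of the recursion: `s` with `b² = η μ s`, where `b = η (8R + 6)`.
-/
lemma variance_recursion (herg : GeometricallyErgodic 𝓜 π C ρ ν) (hC : 0 ≤ C) (hρ0 : 0 ≤ ρ)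
    (hρ1 : ρ < 1) (hcov : ∀ ω, (covariance 𝓜 φ π ν ω).PosDef) (hd : 0 < d) {η : ℝ}
    (hη : 0 ≤ η) (hη' : 4 * η ≤ (evalConsts 𝓜 φ π ν C ρ hK).mu) :
    (η * (8 * (evalConsts 𝓜 φ π ν C ρ hK).R + 6)) ^ 2 +
      (evalConsts 𝓜 φ π ν C ρ hK).variance η *
        Real.sqrt (1 - η * (evalConsts 𝓜 φ π ν C ρ hK).mu) ^ 2 ≤
      (evalConsts 𝓜 φ π ν C ρ hK).variance η := by
  have h1 := eta_mul_mu_le (hK := hK) herg hC hρ0 hρ1 hcov hd hη hη'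
  have h2 := mu_pos (hK := hK) herg hC hρ0 hρ1 hcov hd
  rw [Real.sq_sqrt (by linarith [h1.2])]
  unfold Consts.variance
  apply le_of_eq
  field_simp
  ring

lemma variance_nonneg (herg : GeometricallyErgodic 𝓜 π C ρ ν) (hC : 0 ≤ C) (hρ0 : 0 ≤ ρ)
    (hρ1 : ρ < 1) (hcov : ∀ ω, (covariance 𝓜 φ π ν ω).PosDef) (hd : 0 < d) {η : ℝ}
    (hη : 0 < η) : 0 < (evalConsts 𝓜 φ π ν C ρ hK).variance η := by
  have h2 := mu_pos (hK := hK) herg hC hρ0 hρ1 hcov hd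
  have h3 := (evalConsts 𝓜 φ π ν C ρ hK).R_nonneg
  unfold Consts.variance
  positivity

lemma lintegral_exp_clippedTD_le (herg : GeometricallyErgodic 𝓜 π C ρ ν) (hC : 0 ≤ C)
    (hρ0 : 0 ≤ ρ) (hρ1 : ρ < 1) (hcov : ∀ ω, (covariance 𝓜 φ π ν ω).PosDef) (hd : 0 < d)
    (ω : NaturePolicy 𝓜) {η : ℝ} (hη : 0 < η)
    (hη' : 4 * η ≤ (evalConsts 𝓜 φ π ν C ρ hK).mu) (n : ℕ) (u : EuclideanSpace ℝ (Fin d)) :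
    ∫⁻ x, ENNReal.ofReal (Real.exp (inner ℝ u (x - tdTarget 𝓜 φ π ν ω)))
        ∂((clippedTD φ herg ω η (evalConsts 𝓜 φ π ν C ρ hK).R ^ n : Kernel _ _) 0) ≤
      ENNReal.ofReal (Real.exp ((evalConsts 𝓜 φ π ν C ρ hK).variance η * ‖u‖ ^ 2 / 2 +
        Real.sqrt (1 - η * (evalConsts 𝓜 φ π ν C ρ hK).mu) ^ n *
          (evalConsts 𝓜 φ π ν C ρ hK).R * ‖u‖)) := by
  have := isProbabilityMeasure_stationaryPair herg ω
  have hR := norm_tdTarget_le (hK := hK) herg hC hρ0 hρ1 hcov hd ω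
  have h := lintegral_exp_perturbedKernel_pow (P := stationaryPair π ν ω)
    (c := tdTarget 𝓜 φ π ν ω) (measurable_clippedNoise (φ := φ) herg ω η
      (evalConsts 𝓜 φ π ν C ρ hK).R) (norm_clippedNoise_le herg ω hη.le hR)
    (integral_clippedNoise herg ω η _) (Real.sqrt_nonneg _)
    (norm_sub_smul_meanTDLinear_le (hK := hK) herg hcov hd ω hη.le hη')
    (variance_nonneg (hK := hK) herg hC hρ0 hρ1 hcov hd hη).le
    (variance_recursion (hK := hK) herg hC hρ0 hρ1 hcov hd hη.le hη') n u 0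
  refine h.trans (ENNReal.ofReal_le_ofReal (Real.exp_le_exp.2 ?_))
  rw [zero_sub, norm_neg]
  have h1 : 0 ≤ Real.sqrt (1 - η * (evalConsts 𝓜 φ π ν C ρ hK).mu) ^ n * ‖u‖ := by positivity
  nlinarith [mul_le_mul_of_nonneg_left hR h1]

lemma clippedTD_tail_le (herg : GeometricallyErgodic 𝓜 π C ρ ν) (hC : 0 ≤ C)
    (hρ0 : 0 ≤ ρ) (hρ1 : ρ < 1) (hcov : ∀ ω, (covariance 𝓜 φ π ν ω).PosDef) (hd : 0 < d)
    (ω : NaturePolicy 𝓜) {η : ℝ} (hη : 0 < η)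
    (hη' : 4 * η ≤ (evalConsts 𝓜 φ π ν C ρ hK).mu) (n : ℕ) :
    (clippedTD φ herg ω η (evalConsts 𝓜 φ π ν C ρ hK).R ^ n : Kernel _ _) 0
        {x | (evalConsts 𝓜 φ π ν C ρ hK).R + 1 < ‖x - tdTarget 𝓜 φ π ν ω‖} ≤
      ENNReal.ofReal (2 * Real.exp (-(1 / (2 * (evalConsts 𝓜 φ π ν C ρ hK).variance η)))) := by
  have := isProbabilityMeasure_stationaryPair herg ω
  have hR := norm_tdTarget_le (hK := hK) herg hC hρ0 hρ1 hcov hd ω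
  have h1 := eta_mul_mu_le (hK := hK) herg hC hρ0 hρ1 hcov hd hη.le hη'
  have hR0 := (evalConsts 𝓜 φ π ν C ρ hK).R_nonneg
  exact perturbedKernel_pow_tail (P := stationaryPair π ν ω)
    (c := tdTarget 𝓜 φ π ν ω) (measurable_clippedNoise (φ := φ) herg ω η
      (evalConsts 𝓜 φ π ν C ρ hK).R) (by positivity) (norm_clippedNoise_le herg ω hη.le hR)
    (integral_clippedNoise herg ω η _) (Real.sqrt_nonneg _)
    (Real.sqrt_le_one.2 (by linarith [h1.1]))
    (norm_sub_smul_meanTDLinear_le (hK := hK) herg hcov hd ω hη.le hη')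
    (variance_recursion (hK := hK) herg hC hρ0 hρ1 hcov hd hη.le hη')
    (variance_nonneg (hK := hK) herg hC hρ0 hρ1 hcov hd hη) n
    (by rw [zero_sub, norm_neg]; exact hR)

lemma clipLoss_le (herg : GeometricallyErgodic 𝓜 π C ρ ν) (hC : 0 ≤ C)
    (hρ0 : 0 ≤ ρ) (hρ1 : ρ < 1) (hcov : ∀ ω, (covariance 𝓜 φ π ν ω).PosDef) (hd : 0 < d)
    (ω : NaturePolicy 𝓜) {η : ℝ} (hη : 0 < η)
    (hη' : 4 * η ≤ (evalConsts 𝓜 φ π ν C ρ hK).mu) {e : ℝ} (he : 0 ≤ e) (n : ℕ) :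
    clipLoss φ herg ω η (evalConsts 𝓜 φ π ν C ρ hK).R (ENNReal.ofReal e) n 0 ≤
      ENNReal.ofReal
        (n * (e + 2 * Real.exp (-(1 / (2 * (evalConsts 𝓜 φ π ν C ρ hK).variance η))))) := by
  have h2 : (0 : ℝ) ≤
      2 * Real.exp (-(1 / (2 * (evalConsts 𝓜 φ π ν C ρ hK).variance η))) := by positivity
  unfold clipLoss
  refine (Finset.sum_le_sum fun j _ => add_le_add_right
    (clippedTD_tail_le herg hC hρ0 hρ1 hcov hd ω hη hη' j) _).trans ?_
  rw [← ENNReal.ofReal_add he h2, Finset.sum_const, Finset.card_range, nsmul_eq_mul,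
    ENNReal.ofReal_mul (Nat.cast_nonneg n), ENNReal.ofReal_natCast]

end TDBounds

/-! ### Exponential moments along the iterations of dual averaging -/

section Outer

variable {S A : Type*} {K d : ℕ} [TopologicalSpace S] [MeasurableSpace S]
  [OpensMeasurableSpace S] [Fintype A] [MeasurableSpace A] [DiscreteMeasurableSpace A]
  {𝓜 : Model S A K} {φ : FeatureMap S A K d} {π : ControlPolicy S A}
  {C ρ : ℝ} {ν : NaturePolicy 𝓜 → Measure S}
  {ω₀ : NaturePolicy 𝓜} {α lam : ℕ → ℝ} {hlam : ∀ m, 0 < lam m} {s₀ : S} {η : ℝ} {T τ : ℕ}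

/-- Nature's policy in the iteration `m`, given the history. -/
noncomputable def spdaNature (𝓜 : Model S A K) (φ : FeatureMap S A K d) (π : ControlPolicy S A)
    (ω₀ : NaturePolicy 𝓜) (α lam : ℕ → ℝ) (hlam : ∀ m, 0 < lam m) (m : ℕ) (h : History d) :
    NaturePolicy 𝓜 :=
  (spdaPolicy 𝓜 φ π ω₀ α lam hlam m).freeze h

lemma Policy.ext_prob {X ι : Type*} [MeasurableSpace X] {W : Set (ι → ℝ)} {p p' : Policy X ι W}
    (h : p.prob = p'.prob) : p = p' := by
  cases p; cases p'; cases h; rfl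

lemma hHat_congr {h h' : History d} {i : ℕ} (hi : h i = h' i) (s : S) (k : Fin K) :
    hHat φ π h i s k = hHat φ π h' i s k := by
  unfold hHat; rw [hi]

lemma spdaNature_congr {m : ℕ} {h h' : History d} (hh : ∀ i < m, h i = h' i) :
    spdaNature 𝓜 φ π ω₀ α lam hlam m h = spdaNature 𝓜 φ π ω₀ α lam hlam m h' := by
  refine Policy.ext_prob (funext fun s => ?_)
  cases m with
  | zero => rfl
  | succ m =>
    show regArgmin 𝓜.weights _ _ = regArgmin 𝓜.weights _ _
    congr 1
    funext k
    refine Finset.sum_congr rfl fun i hi => ?_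
    show α i * hHat φ π h i s k = α i * hHat φ π h' i s k
    rw [hHat_congr (hh i (Finset.mem_range.1 hi))]

/-- The error of the estimate of iteration `m`. -/
noncomputable def spdaError (φ : FeatureMap S A K d) (π : ControlPolicy S A)
    (ν : NaturePolicy 𝓜 → Measure S) (ω₀ : NaturePolicy 𝓜) (α lam : ℕ → ℝ)
    (hlam : ∀ m, 0 < lam m) (m : ℕ) (h : History d) : EuclideanSpace ℝ (Fin d) :=
  h m - tdTarget 𝓜 φ π ν (spdaNature 𝓜 φ π ω₀ α lam hlam m h)

lemma measurable_spdaError (herg : GeometricallyErgodic 𝓜 π C ρ ν) (hC : 0 ≤ C)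
    (hρ0 : 0 ≤ ρ) (hρ1 : ρ < 1) (hK : 2 ≤ K) (hcov : ∀ ω, (covariance 𝓜 φ π ν ω).PosDef)
    (hd : 0 < d) (m : ℕ) : Measurable (spdaError φ π ν ω₀ α lam hlam m) :=
  (measurable_pi_apply m).sub (measurable_tdTarget_freeze herg hC hρ0 hρ1 hK hcov hd _)

lemma spdaError_congr {m : ℕ} {h h' : History d} (hh : ∀ i ≤ m, h i = h' i) :
    spdaError φ π ν ω₀ α lam hlam m h = spdaError φ π ν ω₀ α lam hlam m h' := by
  unfold spdaError
  rw [spdaNature_congr fun i hi => hh i (le_of_lt hi), hh m le_rfl]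

lemma spdaError_update {m : ℕ} (h : History d) (θ : EuclideanSpace ℝ (Fin d)) :
    spdaError φ π ν ω₀ α lam hlam m (Function.update h m θ) =
      θ - tdTarget 𝓜 φ π ν (spdaNature 𝓜 φ π ω₀ α lam hlam m h) := by
  unfold spdaError
  rw [Function.update_self, spdaNature_congr (h' := h) fun i hi =>
    Function.update_of_ne (ne_of_lt hi) _ _]

lemma measurable_history_update (m : ℕ) :
    Measurable fun y : History d × EuclideanSpace ℝ (Fin d) => Function.update y.1 m y.2 := by
  refine measurable_pi_lambda _ fun i => ?_
  by_cases hi : i = m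
  · subst hi
    simpa using measurable_snd
  · simp only [Function.update_of_ne hi]
    exact (measurable_pi_apply i).comp measurable_fst

lemma lintegral_spdaStep (m : ℕ) {f : History d → ENNReal} (hf : Measurable f) (h : History d) :
    ∫⁻ x, f x ∂(spdaStep 𝓜 φ π ω₀ α lam hlam s₀ η T τ m h) =
      ∫⁻ θ, f (Function.update h m θ)
        ∂(tdKernel 𝓜 φ π (spdaPolicy 𝓜 φ π ω₀ α lam hlam m) s₀ η T τ h) := by
  have hm := measurable_history_update (d := d) m
  unfold spdaStep
  rw [Kernel.lintegral_map _ hm _ hf]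
  exact Kernel.lintegral_id_prod (hf.comp hm) _ _

instance (m : ℕ) : IsMarkovKernel (spdaStep 𝓜 φ π ω₀ α lam hlam s₀ η T τ m) :=
  Kernel.IsMarkovKernel.map _ (measurable_history_update m)

/-- The law of the history after `m` iterations. -/
noncomputable def spdaPrefix (𝓜 : Model S A K) (φ : FeatureMap S A K d) (π : ControlPolicy S A)
    (ω₀ : NaturePolicy 𝓜) (α lam : ℕ → ℝ) (hlam : ∀ m, 0 < lam m) (s₀ : S) (η : ℝ) (T τ : ℕ) :
    ℕ → Measure (History d)
  | 0 => Measure.dirac 0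
  | m + 1 => spdaLaw 𝓜 φ π ω₀ α lam hlam s₀ η T τ m

lemma spdaPrefix_succ (m : ℕ) : spdaPrefix 𝓜 φ π ω₀ α lam hlam s₀ η T τ (m + 1) =
    (spdaPrefix 𝓜 φ π ω₀ α lam hlam s₀ η T τ m).bind
      (spdaStep 𝓜 φ π ω₀ α lam hlam s₀ η T τ m) := by
  cases m <;> rfl

instance (m : ℕ) : IsProbabilityMeasure (spdaPrefix 𝓜 φ π ω₀ α lam hlam s₀ η T τ m) := by
  induction m with
  | zero => exact Measure.dirac.isProbabilityMeasure
  | succ m ih => rw [spdaPrefix_succ]; infer_instance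

lemma lintegral_spdaPrefix_succ (m : ℕ) {f : History d → ENNReal} (hf : Measurable f) :
    ∫⁻ x, f x ∂(spdaPrefix 𝓜 φ π ω₀ α lam hlam s₀ η T τ (m + 1)) =
      ∫⁻ h, ∫⁻ θ, f (Function.update h m θ)
        ∂(tdKernel 𝓜 φ π (spdaPolicy 𝓜 φ π ω₀ α lam hlam m) s₀ η T τ h)
        ∂(spdaPrefix 𝓜 φ π ω₀ α lam hlam s₀ η T τ m) := by
  rw [spdaPrefix_succ, Measure.lintegral_bind (Kernel.measurable _).aemeasurable hf.aemeasurable]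
  exact lintegral_congr fun h => lintegral_spdaStep m hf h

/-- A predictable sequence of vectors. -/
def Predictable (g : ℕ → History d → EuclideanSpace ℝ (Fin d)) : Prop :=
  ∀ i, Measurable (g i) ∧ ∀ h h' : History d, (∀ j < i, h j = h' j) → g i h = g i h'

/-- A supermartingale estimate: given the past, `g j m` and the policy are fixed, so `hexp` applies
to the error of run `m`. The truncation at one is what allows errors in total variation to be added.
With the sum over `j` kept inside it, the loss `E₀` is paid once per iteration and not once per test
direction. -/
lemma lintegral_min_sum_exp_le (herg : GeometricallyErgodic 𝓜 π C ρ ν) (hC : 0 ≤ C)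
    (hρ0 : 0 ≤ ρ) (hρ1 : ρ < 1) (hK : 2 ≤ K) (hcov : ∀ ω, (covariance 𝓜 φ π ν ω).PosDef)
    (hd : 0 < d) {R s β : ℝ} (hs : 0 ≤ s) (hβ : 0 ≤ β) {E₀ : ENNReal}
    (hexp : ∀ (ω : NaturePolicy 𝓜) (u : EuclideanSpace ℝ (Fin d)),
      ∫⁻ x, ENNReal.ofReal (Real.exp (inner ℝ u (x - tdTarget 𝓜 φ π ν ω)))
        ∂((clippedTD φ herg ω η R ^ (T + 1) : Kernel _ _) 0) ≤
      ENNReal.ofReal (Real.exp (s * ‖u‖ ^ 2 / 2 + β * ‖u‖)))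
    (hE : ∀ ω : NaturePolicy 𝓜, clipLoss φ herg ω η R (ENNReal.ofReal (C * ρ ^ τ)) (T + 1) 0 ≤ E₀)
    {ι : Type*} [Fintype ι] {g : ι → ℕ → History d → EuclideanSpace ℝ (Fin d)}
    (hg : ∀ j, Predictable (g j)) {a : ℕ → ℝ} (ha : ∀ j i h, ‖g j i h‖ ≤ a i) (m : ℕ)
    (y : ι → ℝ) :
    ∫⁻ h, min 1 (∑ j, ENNReal.ofReal (Real.exp (y j +
        ∑ i ∈ Finset.range m, inner ℝ (g j i h) (spdaError φ π ν ω₀ α lam hlam i h))))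
        ∂(spdaPrefix 𝓜 φ π ω₀ α lam hlam s₀ η T (τ + 2) m) ≤
      ∑ j, ENNReal.ofReal (Real.exp (y j +
        ∑ i ∈ Finset.range m, (s * a i ^ 2 / 2 + β * a i))) + m * E₀ := by
  have hmeas : ∀ (m : ℕ) (y : ι → ℝ), Measurable fun h => min 1 (∑ j, ENNReal.ofReal (Real.exp
      (y j + ∑ i ∈ Finset.range m,
        inner ℝ (g j i h) (spdaError φ π ν ω₀ α lam hlam i h)))) := by
    intro m y
    refine measurable_const.min (Finset.measurable_fun_sum _ fun j _ => ?_)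
    refine (Real.measurable_exp.comp (measurable_const.add ?_)).ennreal_ofReal
    exact Finset.measurable_fun_sum _ fun i _ =>
      (hg j i).1.inner (measurable_spdaError herg hC hρ0 hρ1 hK hcov hd i)
  induction m generalizing y with
  | zero =>
    simp only [Finset.range_zero, Finset.sum_empty, add_zero, Nat.cast_zero, zero_mul]
    refine (lintegral_mono fun h => min_le_right _ _).trans ?_
    rw [lintegral_const, measure_univ, mul_one]
  | succ m ih =>
    rw [lintegral_spdaPrefix_succ m (hmeas (m + 1) y)]
    -- The contribution of the last run, absorbed into the free constants `y` before the induction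
    -- hypothesis is used.
    set v := s * a m ^ 2 / 2 + β * a m with hv
    have hstep : ∀ h : History d, ∫⁻ θ, min 1 (∑ j, ENNReal.ofReal (Real.exp (y j +
        ∑ i ∈ Finset.range (m + 1), inner ℝ (g j i (Function.update h m θ))
          (spdaError φ π ν ω₀ α lam hlam i (Function.update h m θ)))))
        ∂(tdKernel 𝓜 φ π (spdaPolicy 𝓜 φ π ω₀ α lam hlam m) s₀ η T (τ + 2) h) ≤
        min 1 (∑ j, ENNReal.ofReal (Real.exp ((y j + v) +
        ∑ i ∈ Finset.range m, inner ℝ (g j i h) (spdaError φ π ν ω₀ α lam hlam i h)))) + E₀ := by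
      intro h
      set ω := spdaNature 𝓜 φ π ω₀ α lam hlam m h with hω
      have hMk := isMarkovKernel_clippedTD (φ := φ) herg ω η R
      set Y : ι → ℝ := fun j =>
        ∑ i ∈ Finset.range m, inner ℝ (g j i h) (spdaError φ π ν ω₀ α lam hlam i h) with hY
      have hupd : ∀ (θ : EuclideanSpace ℝ (Fin d)) (j : ι),
          ∑ i ∈ Finset.range (m + 1), inner ℝ (g j i (Function.update h m θ))
          (spdaError φ π ν ω₀ α lam hlam i (Function.update h m θ)) =
          Y j + inner ℝ (g j m h) (θ - tdTarget 𝓜 φ π ν ω) := by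
        intro θ j
        rw [Finset.sum_range_succ, spdaError_update, (hg j m).2 _ h fun i hi =>
          Function.update_of_ne (ne_of_lt hi) _ _]
        congr 1
        refine Finset.sum_congr rfl fun i hi => ?_
        have hi' := Finset.mem_range.1 hi
        rw [(hg j i).2 _ h fun i' hi'' => Function.update_of_ne (by omega) _ _,
          spdaError_congr (h' := h) fun i' hi'' => Function.update_of_ne (by omega) _ _]
      simp only [hupd]
      set f : EuclideanSpace ℝ (Fin d) → ENNReal := fun θ => min 1 (∑ j, ENNReal.ofReal
        (Real.exp (y j + (Y j + inner ℝ (g j m h) (θ - tdTarget 𝓜 φ π ν ω))))) with hf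
      have hterm : ∀ j, Measurable fun θ : EuclideanSpace ℝ (Fin d) => ENNReal.ofReal
          (Real.exp (inner ℝ (g j m h) (θ - tdTarget 𝓜 φ π ν ω))) := fun j =>
        (Real.measurable_exp.comp
          (measurable_const.inner (measurable_id.sub_const _))).ennreal_ofReal
      have hfm : Measurable f := by
        refine measurable_const.min (Finset.measurable_fun_sum _ fun j _ => ?_)
        exact (Real.measurable_exp.comp (measurable_const.add (measurable_const.add
          (measurable_const.inner (measurable_id.sub_const _))))).ennreal_ofReal
      refine (lintegral_tdKernel_le herg hC hρ0 hρ1 hK hcov hd _ s₀ η R T τ hfm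
        (fun _ => min_le_left _ _) h).trans (add_le_add ?_ (hE _))
      refine le_min ?_ ?_
      · refine (lintegral_mono fun θ => min_le_left _ _).trans ?_
        rw [lintegral_const, one_mul]
        exact prob_le_one (μ := (clippedTD φ herg ω η R ^ (T + 1) : Kernel _ _) 0)
      · refine (lintegral_mono fun θ => min_le_right _ _).trans ?_
        have e1 : ∀ (j : ι) (θ : EuclideanSpace ℝ (Fin d)), ENNReal.ofReal
            (Real.exp (y j + (Y j + inner ℝ (g j m h) (θ - tdTarget 𝓜 φ π ν ω)))) =
            ENNReal.ofReal (Real.exp (y j + Y j)) * ENNReal.ofReal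
              (Real.exp (inner ℝ (g j m h) (θ - tdTarget 𝓜 φ π ν ω))) := fun j θ => by
          rw [← ENNReal.ofReal_mul (Real.exp_pos _).le, ← Real.exp_add, add_assoc]
        simp only [e1]
        rw [lintegral_finsetSum _ fun j _ => (hterm j).const_mul _]
        refine Finset.sum_le_sum fun j _ => ?_
        rw [lintegral_const_mul _ (hterm j)]
        refine (mul_le_mul_right (hexp ω (g j m h)) _).trans ?_
        rw [← ENNReal.ofReal_mul (Real.exp_pos _).le, ← Real.exp_add]
        refine ENNReal.ofReal_le_ofReal (Real.exp_le_exp.2 ?_)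
        have h1 := ha j m h
        have h2 : s * ‖g j m h‖ ^ 2 ≤ s * a m ^ 2 :=
          mul_le_mul_of_nonneg_left (pow_le_pow_left₀ (norm_nonneg _) h1 2) hs
        have h3 := mul_le_mul_of_nonneg_left h1 hβ
        rw [hv]
        linarith
    refine (lintegral_mono hstep).trans ?_
    rw [lintegral_add_right _ measurable_const, lintegral_const, measure_univ, mul_one]
    refine (add_le_add_left (ih fun j => y j + v) _).trans (le_of_eq ?_)
    rw [add_assoc]
    congr 1
    · refine Finset.sum_congr rfl fun j _ => ?_
      rw [Finset.sum_range_succ]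
      congr 2
      ring
    · push_cast
      ring

/-- Union bound over the runs: a clipped run ends outside the ball with probability at most `E₁`,
and the true run deviates from it by at most `E₀`. -/
lemma spdaPrefix_exists_le (herg : GeometricallyErgodic 𝓜 π C ρ ν) (hC : 0 ≤ C)
    (hρ0 : 0 ≤ ρ) (hρ1 : ρ < 1) (hK : 2 ≤ K) (hcov : ∀ ω, (covariance 𝓜 φ π ν ω).PosDef)
    (hd : 0 < d) {R : ℝ} {E₀ E₁ : ENNReal}
    (htail : ∀ ω : NaturePolicy 𝓜, (clippedTD φ herg ω η R ^ (T + 1) : Kernel _ _) 0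
        {x | R + 1 < ‖x - tdTarget 𝓜 φ π ν ω‖} ≤ E₁)
    (hE : ∀ ω : NaturePolicy 𝓜, clipLoss φ herg ω η R (ENNReal.ofReal (C * ρ ^ τ)) (T + 1) 0 ≤ E₀)
    (m : ℕ) : spdaPrefix 𝓜 φ π ω₀ α lam hlam s₀ η T (τ + 2) m
      {h | ∃ i < m, R + 1 < ‖spdaError φ π ν ω₀ α lam hlam i h‖} ≤ m * (E₀ + E₁) := by
  have hDm : ∀ i, MeasurableSet {h : History d | R + 1 < ‖spdaError φ π ν ω₀ α lam hlam i h‖} :=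
    fun i => measurableSet_lt measurable_const
      (measurable_spdaError herg hC hρ0 hρ1 hK hcov hd i).norm
  have hm : ∀ m, MeasurableSet
      {h : History d | ∃ i < m, R + 1 < ‖spdaError φ π ν ω₀ α lam hlam i h‖} := by
    intro m
    have : {h : History d | ∃ i < m, R + 1 < ‖spdaError φ π ν ω₀ α lam hlam i h‖} =
        ⋃ i ∈ Finset.range m, {h | R + 1 < ‖spdaError φ π ν ω₀ α lam hlam i h‖} := by
      ext h; simp
    rw [this]
    exact Finset.measurableSet_biUnion _ fun i _ => hDm i
  induction m with
  | zero => simp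
  | succ m ih =>
    set D := {h : History d | ∃ i < m, R + 1 < ‖spdaError φ π ν ω₀ α lam hlam i h‖} with hD
    rw [← lintegral_indicator_one (hm (m + 1)),
      lintegral_spdaPrefix_succ m (measurable_one.indicator (hm (m + 1)))]
    have hstep : ∀ h : History d, ∫⁻ θ, ({h : History d | ∃ i < m + 1, R + 1 <
        ‖spdaError φ π ν ω₀ α lam hlam i h‖}).indicator 1 (Function.update h m θ)
        ∂(tdKernel 𝓜 φ π (spdaPolicy 𝓜 φ π ω₀ α lam hlam m) s₀ η T (τ + 2) h) ≤
        D.indicator 1 h + (E₀ + E₁) := by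
      intro h
      set ω := spdaNature 𝓜 φ π ω₀ α lam hlam m h with hω
      set D' := {x | R + 1 < ‖x - tdTarget 𝓜 φ π ν ω‖} with hD'
      have hD'm : MeasurableSet D' := measurableSet_clip ω R
      have hle : ∀ θ, ({h : History d | ∃ i < m + 1, R + 1 <
          ‖spdaError φ π ν ω₀ α lam hlam i h‖}).indicator (1 : History d → ENNReal)
          (Function.update h m θ) ≤ D.indicator 1 h + D'.indicator 1 θ := by
        intro θ
        by_cases h1 : θ ∈ D'
        · rw [Set.indicator_of_mem h1]
          exact (Set.indicator_le_self' (fun _ _ => bot_le) _).trans le_add_self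
        by_cases h2 : h ∈ D
        · rw [Set.indicator_of_mem h2]
          exact (Set.indicator_le_self' (fun _ _ => bot_le) _).trans le_self_add
        · rw [Set.indicator_of_notMem]
          · exact bot_le
          · rintro ⟨i, hi, hi2⟩
            rcases Nat.lt_succ_iff_lt_or_eq.1 hi with h3 | h3
            · refine h2 ⟨i, h3, ?_⟩
              rwa [spdaError_congr (h' := h) fun i' hi'' =>
                Function.update_of_ne (by omega) _ _] at hi2
            · subst h3
              rw [spdaError_update] at hi2
              exact h1 hi2
      refine (lintegral_mono hle).trans ?_
      rw [lintegral_add_left measurable_const, lintegral_const, measure_univ, mul_one]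
      refine add_le_add_right ?_ _
      refine (lintegral_tdKernel_le herg hC hρ0 hρ1 hK hcov hd _ s₀ η R T τ
        (measurable_one.indicator hD'm) (fun x => Set.indicator_le_self' (fun _ _ => bot_le) _)
        h).trans ?_
      rw [add_comm, lintegral_indicator_one hD'm]
      exact add_le_add (hE _) (htail ω)
    refine (lintegral_mono hstep).trans ?_
    rw [lintegral_add_right _ measurable_const, lintegral_const, measure_univ, mul_one,
      lintegral_indicator_one (hm m)]
    refine (add_le_add_left ih _).trans (le_of_eq ?_)
    push_cast
    ring

end Outer

end RobustMDP
namespace RobustMDP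
set_option linter.unusedSectionVars false

/-! ### The averaging weights -/

section Weights

lemma sum_Icc_one_eq_sum_range {β : Type*} [AddCommMonoid β] (f : ℕ → β) (M : ℕ) :
    ∑ m ∈ Finset.Icc 1 M, f m = ∑ m ∈ Finset.range M, f (m + 1) := by
  induction M with
  | zero => simp
  | succ M ih => rw [Finset.sum_Icc_succ_top (by omega), ih, Finset.sum_range_succ]

lemma alpha_nonneg (m : ℕ) : 0 ≤ alpha m := Real.sqrt_nonneg _

/-- The order `M ^ (3/2)` makes every averaging weight at most `2 / M`, and with it the sum of their
squares. -/
lemma half_mul_sqrt_le_sum_alpha (M : ℕ) :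
    M * Real.sqrt M / 2 ≤ ∑ j ∈ Finset.Icc 1 M, alpha j := by
  induction M with
  | zero => simp
  | succ M ih =>
    rw [Finset.sum_Icc_succ_top (by omega)]
    refine le_trans ?_ (add_le_add_left ih _)
    unfold alpha
    have h0 : Real.sqrt (M : ℝ) ^ 2 = M := Real.sq_sqrt (Nat.cast_nonneg M)
    have h1 : Real.sqrt ((M + 1 : ℕ) : ℝ) ^ 2 = M + 1 := by
      rw [Real.sq_sqrt (Nat.cast_nonneg _)]; push_cast; ring
    have h2 : Real.sqrt (M : ℝ) ≤ Real.sqrt ((M + 1 : ℕ) : ℝ) :=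
      Real.sqrt_le_sqrt (by push_cast; linarith)
    have h3 := Real.sqrt_nonneg (M : ℝ)
    set x := Real.sqrt (M : ℝ)
    set y := Real.sqrt ((M + 1 : ℕ) : ℝ)
    push_cast
    have h4 : x * (y - x) ≤ 1 := by nlinarith
    have h5 : x * (x * (y - x)) ≤ x * 1 := mul_le_mul_of_nonneg_left h4 h3
    nlinarith

lemma sum_alpha_pos {M : ℕ} (hM : 0 < M) : 0 < ∑ j ∈ Finset.Icc 1 M, alpha j := by
  refine lt_of_lt_of_le ?_ (half_mul_sqrt_le_sum_alpha M)
  have : (0 : ℝ) < M := by exact_mod_cast hM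
  positivity

lemma avgWeight_nonneg (M m : ℕ) : 0 ≤ avgWeight alpha M m :=
  div_nonneg (alpha_nonneg m) (Finset.sum_nonneg fun _ _ => alpha_nonneg _)

lemma sum_avgWeight {M : ℕ} (hM : 0 < M) : ∑ m ∈ Finset.Icc 1 M, avgWeight alpha M m = 1 := by
  unfold avgWeight
  rw [← Finset.sum_div, div_self (sum_alpha_pos hM).ne']

lemma avgWeight_zero (M : ℕ) : avgWeight alpha M 0 = 0 := by simp [avgWeight, alpha]

/-- `α 0 = 0`, so iteration `0` can be carried along in the probabilistic estimates at no cost. -/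
lemma sum_range_avgWeight_mul (M : ℕ) (f : ℕ → ℝ) :
    ∑ m ∈ Finset.range (M + 1), avgWeight alpha M m * f m =
      ∑ m ∈ Finset.Icc 1 M, avgWeight alpha M m * f m := by
  rw [sum_Icc_one_eq_sum_range, Finset.sum_range_succ', avgWeight_zero, zero_mul, add_zero]

lemma avgWeight_le {M m : ℕ} (hM : 0 < M) (hm : m ≤ M) : avgWeight alpha M m ≤ 2 / M := by
  have hM' : (0 : ℝ) < M := by exact_mod_cast hM
  have h1 : alpha m ≤ Real.sqrt M := Real.sqrt_le_sqrt (by exact_mod_cast hm)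
  unfold avgWeight
  rw [div_le_div_iff₀ (sum_alpha_pos hM) hM']
  have := half_mul_sqrt_le_sum_alpha M
  nlinarith

lemma sum_avgWeight_sq_le {M : ℕ} (hM : 0 < M) :
    ∑ m ∈ Finset.Icc 1 M, avgWeight alpha M m ^ 2 ≤ 2 / M := by
  calc ∑ m ∈ Finset.Icc 1 M, avgWeight alpha M m ^ 2
      ≤ ∑ m ∈ Finset.Icc 1 M, 2 / M * avgWeight alpha M m := by
        refine Finset.sum_le_sum fun m hm => ?_
        rw [sq]
        exact mul_le_mul_of_nonneg_right (avgWeight_le hM (Finset.mem_Icc.1 hm).2)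
          (avgWeight_nonneg M m)
    _ = 2 / M := by rw [← Finset.mul_sum, sum_avgWeight hM, mul_one]

lemma sum_avgWeight_mul_le {M : ℕ} (hM : 0 < M) {f : ℕ → ℝ} {c : ℝ}
    (h : ∀ m ∈ Finset.Icc 1 M, f m ≤ c) : ∑ m ∈ Finset.Icc 1 M, avgWeight alpha M m * f m ≤ c := by
  calc _ ≤ ∑ m ∈ Finset.Icc 1 M, avgWeight alpha M m * c :=
        Finset.sum_le_sum fun m hm => mul_le_mul_of_nonneg_left (h m hm) (avgWeight_nonneg M m)
    _ = c := by rw [← Finset.sum_mul, sum_avgWeight hM, one_mul]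

lemma abs_sum_avgWeight_mul_le {M : ℕ} (hM : 0 < M) {f : ℕ → ℝ} {c : ℝ}
    (h : ∀ m ∈ Finset.Icc 1 M, |f m| ≤ c) :
    |∑ m ∈ Finset.Icc 1 M, avgWeight alpha M m * f m| ≤ c := by
  rw [abs_le]
  constructor
  · have := sum_avgWeight_mul_le hM (f := fun m => -f m) (c := c) fun m hm =>
      (neg_le_abs _).trans (h m hm)
    simp only [mul_neg, Finset.sum_neg_distrib] at this
    linarith
  · exact sum_avgWeight_mul_le hM fun m hm => (le_abs_self _).trans (h m hm)

end Weights

/-! ### Performance differences in terms of features -/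

section Shift

variable {S A : Type*} {K d : ℕ} [TopologicalSpace S] [MeasurableSpace S]
  [OpensMeasurableSpace S] [Fintype A] [MeasurableSpace A] [DiscreteMeasurableSpace A]
  {𝓜 : Model S A K} {φ : FeatureMap S A K d} {π : ControlPolicy S A}
  {C ρ : ℝ} {ν : NaturePolicy 𝓜 → Measure S} {hK : 2 ≤ K}

/-- The mean of the features over the actions. -/
noncomputable def meanFeature (φ : FeatureMap S A K d) (π : ControlPolicy S A) (s : S)
    (k : Fin K) : EuclideanSpace ℝ (Fin d) :=
  ∑ a, π.prob s a • φ.feat (s, a, k)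

lemma inner_meanFeature (θ : EuclideanSpace ℝ (Fin d)) (s : S) (k : Fin K) :
    inner ℝ (meanFeature φ π s k) θ = ∑ a, π.prob s a * linQ φ θ (s, a, k) := by
  simp only [meanFeature, sum_inner, real_inner_smul_left, linQ]

lemma hHat_eq_inner (h : History d) (m : ℕ) (s : S) (k : Fin K) :
    hHat φ π h m s k = inner ℝ (meanFeature φ π s k) (h m) := by
  rw [inner_meanFeature]; rfl

lemma measurable_meanFeature (k : Fin K) : Measurable fun s => meanFeature φ π s k := by
  unfold meanFeature
  refine Finset.measurable_fun_sum _ fun a _ => ?_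
  exact ((measurable_pi_apply a).comp π.measurable_prob).smul
    (φ.measurable_feat.comp (measurable_id.prodMk measurable_const))

lemma norm_meanFeature_le (s : S) (k : Fin K) : ‖meanFeature φ π s k‖ ≤ 1 := by
  unfold meanFeature
  refine (norm_sum_le _ _).trans ?_
  calc ∑ a, ‖π.prob s a • φ.feat (s, a, k)‖ ≤ ∑ a, π.prob s a * 1 := by
        refine Finset.sum_le_sum fun a _ => ?_
        rw [norm_smul, Real.norm_of_nonneg ((π.prob_mem s).1 a)]
        exact mul_le_mul_of_nonneg_left (φ.norm_feat_le _) ((π.prob_mem s).1 a)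
    _ = 1 := by simp only [mul_one]; exact (π.prob_mem s).2

/-- The difference of the mean features under two policies of nature. -/
noncomputable def featureShift (φ : FeatureMap S A K d) (π : ControlPolicy S A)
    (w w' : Fin K → ℝ) (s : S) : EuclideanSpace ℝ (Fin d) :=
  ∑ k, (w k - w' k) • meanFeature φ π s k

lemma inner_featureShift (w w' : Fin K → ℝ) (s : S) (θ : EuclideanSpace ℝ (Fin d)) :
    inner ℝ (featureShift φ π w w' s) θ =
      ∑ k, (w k - w' k) * inner ℝ (meanFeature φ π s k) θ := by
  simp only [featureShift, sum_inner, real_inner_smul_left]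

lemma abs_sum_sub_mul_le {w w' : Fin K → ℝ} (hw : w ∈ stdSimplex ℝ (Fin K))
    (hw' : w' ∈ stdSimplex ℝ (Fin K)) {f : Fin K → ℝ} {c : ℝ} (hf : ∀ k, |f k| ≤ c) :
    |∑ k, (w k - w' k) * f k| ≤ 2 * c := by
  simp only [sub_mul, Finset.sum_sub_distrib]
  have h1 := abs_sum_mul_le hw hf
  have h2 := abs_sum_mul_le hw' hf
  refine (abs_sub _ _).trans ?_
  linarith

lemma norm_featureShift_le {w w' : Fin K → ℝ} (hw : w ∈ stdSimplex ℝ (Fin K))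
    (hw' : w' ∈ stdSimplex ℝ (Fin K)) (s : S) : ‖featureShift φ π w w' s‖ ≤ 2 := by
  unfold featureShift
  refine (norm_sum_le _ _).trans ?_
  calc ∑ k, ‖(w k - w' k) • meanFeature φ π s k‖ ≤ ∑ k, (w k + w' k) := by
        refine Finset.sum_le_sum fun k _ => ?_
        rw [norm_smul, Real.norm_eq_abs]
        refine (mul_le_of_le_one_right (abs_nonneg _) (norm_meanFeature_le s k)).trans ?_
        rw [abs_le]
        constructor <;> linarith [hw.1 k, hw'.1 k]
    _ = 2 := by rw [Finset.sum_add_distrib, hw.2, hw'.2]; norm_num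

/-- The change of the discounted mean features when nature deviates from `ω'` to `ω`. -/
noncomputable def occupationShift (φ : FeatureMap S A K d) (π : ControlPolicy S A)
    (ω ω' : NaturePolicy 𝓜) (z : S × A × Fin K) : EuclideanSpace ℝ (Fin d) :=
  ∫ s, featureShift φ π (ω.prob s) (ω'.prob s) s ∂(occupation π ω' z)

lemma measurable_featureShift (ω ω' : NaturePolicy 𝓜) :
    Measurable fun s => featureShift φ π (ω.prob s) (ω'.prob s) s := by
  unfold featureShift
  refine Finset.measurable_fun_sum _ fun k _ => ?_
  exact (((measurable_pi_apply k).comp ω.measurable_prob).sub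
    ((measurable_pi_apply k).comp ω'.measurable_prob)).smul (measurable_meanFeature k)

lemma norm_naturePolicy_shift_le (ω ω' : NaturePolicy 𝓜) (s : S) :
    ‖featureShift φ π (ω.prob s) (ω'.prob s) s‖ ≤ 2 :=
  norm_featureShift_le (𝓜.weights_subset (ω.prob_mem s)) (𝓜.weights_subset (ω'.prob_mem s)) s

lemma integrable_featureShift (ω ω' : NaturePolicy 𝓜) (z : S × A × Fin K) :
    Integrable (fun s => featureShift φ π (ω.prob s) (ω'.prob s) s) (occupation π ω' z) :=
  Integrable.of_bound (measurable_featureShift ω ω').aestronglyMeasurable 2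
    (Filter.Eventually.of_forall (norm_naturePolicy_shift_le ω ω'))

lemma occupation_real_univ (ω : NaturePolicy 𝓜) (z : S × A × Fin K) :
    (occupation π ω z).real Set.univ = 𝓜.discount / (1 - 𝓜.discount) := by
  rw [Measure.real, occupation_univ, ENNReal.toReal_ofReal
    (div_nonneg 𝓜.discount_pos.le (sub_nonneg.2 𝓜.discount_lt_one.le))]

lemma norm_occupationShift_le (ω ω' : NaturePolicy 𝓜) (z : S × A × Fin K) :
    ‖occupationShift φ π ω ω' z‖ ≤ 2 / (1 - 𝓜.discount) := by
  have h := norm_integral_le_of_norm_le_const (μ := occupation π ω' z)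
    (Filter.Eventually.of_forall (norm_naturePolicy_shift_le (φ := φ) (π := π) ω ω'))
  rw [occupation_real_univ] at h
  refine h.trans ?_
  have hγ : 0 < 1 - 𝓜.discount := sub_pos.2 𝓜.discount_lt_one
  rw [mul_div_assoc', div_le_div_iff_of_pos_right hγ]
  linarith [𝓜.discount_lt_one]

lemma inner_occupationShift (ω ω' : NaturePolicy 𝓜) (z : S × A × Fin K)
    (θ : EuclideanSpace ℝ (Fin d)) : inner ℝ (occupationShift φ π ω ω' z) θ =
      ∫ s, inner ℝ (featureShift φ π (ω.prob s) (ω'.prob s) s) θ ∂(occupation π ω' z) := by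
  rw [real_inner_comm, occupationShift, ← integral_inner (integrable_featureShift ω ω' z)]
  simp only [real_inner_comm]

lemma integrable_inner_featureShift (ω ω' : NaturePolicy 𝓜) (z : S × A × Fin K)
    (θ : EuclideanSpace ℝ (Fin d)) :
    Integrable (fun s => inner ℝ (featureShift φ π (ω.prob s) (ω'.prob s) s) θ)
      (occupation π ω' z) :=
  (integrable_featureShift ω ω' z).inner_const θ

lemma integral_occupation_le {f : S → ℝ} {c : ℝ} (ω : NaturePolicy 𝓜) (z : S × A × Fin K)
    (hf : Integrable f (occupation π ω z)) (h : ∀ s, f s ≤ c) :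
    ∫ s, f s ∂(occupation π ω z) ≤ 𝓜.discount / (1 - 𝓜.discount) * c := by
  refine (integral_mono hf (integrable_const c) h).trans (le_of_eq ?_)
  rw [integral_const, occupation_real_univ, smul_eq_mul]

lemma abs_natureValue_sub_inner_le (herg : GeometricallyErgodic 𝓜 π C ρ ν) (hC : 0 ≤ C)
    (hρ0 : 0 ≤ ρ) (hρ1 : ρ < 1) (hcov : ∀ ω, (covariance 𝓜 φ π ν ω).PosDef) (hd : 0 < d)
    (ω : NaturePolicy 𝓜) (s : S) (k : Fin K) :
    |natureValue 𝓜 π (value 𝓜 π (natureKernel 𝓜 ω)) s k -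
      inner ℝ (meanFeature φ π s k) (tdTarget 𝓜 φ π ν ω)| ≤
      (evalConsts 𝓜 φ π ν C ρ hK).εapprox := by
  rw [inner_meanFeature]
  unfold natureValue
  rw [← Finset.sum_sub_distrib]
  simp only [← mul_sub]
  refine abs_sum_mul_le (π.prob_mem s) fun a => ?_
  rw [abs_sub_comm]
  exact abs_linQ_tdTarget_sub_jointQ_le (hK := hK) herg hC hρ0 hρ1 hcov hd ω (s, a, k)

/-- In the performance difference the true action values are replaced by linear ones with an
arbitrary parameter `θ`. The error of `θ` appears only in an inner product with a vector determined
by the two policies and `z`. The approximation error counts for `ω` and for `ω'`, on an occupation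
mass `γ/(1 - γ)`. -/
lemma jointQ_sub_jointQ_le (herg : GeometricallyErgodic 𝓜 π C ρ ν) (hC : 0 ≤ C)
    (hρ0 : 0 ≤ ρ) (hρ1 : ρ < 1) (hcov : ∀ ω, (covariance 𝓜 φ π ν ω).PosDef) (hd : 0 < d)
    (ω ω' : NaturePolicy 𝓜) (z : S × A × Fin K) (θ : EuclideanSpace ℝ (Fin d)) :
    jointQ 𝓜 π ω z - jointQ 𝓜 π ω' z ≤
      ∫ s, inner ℝ (featureShift φ π (ω.prob s) (ω'.prob s) s) θ ∂(occupation π ω' z) -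
        inner ℝ (occupationShift φ π ω ω' z) (θ - tdTarget 𝓜 φ π ν ω) +
        𝓜.discount / (1 - 𝓜.discount) * (2 * (evalConsts 𝓜 φ π ν C ρ hK).εapprox) := by
  have hV := isBdd_value 𝓜 π (natureKernel 𝓜 ω)
  have hb : IsBdd fun s => ∑ k, (ω.prob s k - ω'.prob s k) *
      natureValue 𝓜 π (value 𝓜 π (natureKernel 𝓜 ω)) s k := IsBdd.sum _ fun k _ =>
    ((isBdd_nature ω k).sub (isBdd_nature ω' k)).mul (isBdd_natureValue hV k)
  have hi := integrable_inner_featureShift (φ := φ) (π := π) ω ω' z (tdTarget 𝓜 φ π ν ω)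
  have h1 : ∫ s, (∑ k, (ω.prob s k - ω'.prob s k) *
      natureValue 𝓜 π (value 𝓜 π (natureKernel 𝓜 ω)) s k -
      inner ℝ (featureShift φ π (ω.prob s) (ω'.prob s) s) (tdTarget 𝓜 φ π ν ω))
      ∂(occupation π ω' z) ≤
      𝓜.discount / (1 - 𝓜.discount) * (2 * (evalConsts 𝓜 φ π ν C ρ hK).εapprox) := by
    refine integral_occupation_le ω' z ((hb.integrable _).sub hi) fun s => ?_
    rw [inner_featureShift, ← Finset.sum_sub_distrib]
    simp only [← mul_sub]
    exact (le_abs_self _).trans (abs_sum_sub_mul_le (𝓜.weights_subset (ω.prob_mem s))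
      (𝓜.weights_subset (ω'.prob_mem s)) fun k =>
      abs_natureValue_sub_inner_le herg hC hρ0 hρ1 hcov hd ω s k)
  rw [integral_sub (hb.integrable _) hi] at h1
  rw [jointQ_sub_jointQ, inner_sub_right, inner_occupationShift, inner_occupationShift]
  linarith

end Shift

/-! ### Regret of the iterates in every state -/

section Regret

variable {S A : Type*} {K d : ℕ} [TopologicalSpace S] [MeasurableSpace S]
  [OpensMeasurableSpace S] [Fintype A] [MeasurableSpace A] [DiscreteMeasurableSpace A]
  {𝓜 : Model S A K} {φ : FeatureMap S A K d} {π : ControlPolicy S A}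
  {C ρ : ℝ} {ν : NaturePolicy 𝓜 → Measure S}

/-- The bound for the average regret of dual averaging. -/
noncomputable def Consts.regret (q : Consts) (M : ℕ) : ℝ :=
  34 * q.B * Real.sqrt (Real.log q.K) / Real.sqrt M

lemma Consts.B_pos (q : Consts) : 0 < q.B := by
  have h1 := q.R_nonneg
  have h2 := q.εapprox_nonneg
  unfold Consts.B
  linarith

lemma Consts.monotone_lam (q : Consts) : Monotone q.lam := by
  intro m n hmn
  have h2 := q.B_pos
  unfold Consts.lam
  have : (m : ℝ) ≤ n := by exact_mod_cast hmn
  gcongr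

lemma Consts.log_K_pos (q : Consts) : 0 < Real.log q.K :=
  Real.log_pos (by exact_mod_cast q.two_le_K)

/-- Since `2R + 1 ≤ 2B`, every quadratic term is at most `16 B √(log K)`, and the regularization
costs at most `M B √(log K)`. Dividing `17 M B √(log K)` by `∑ α ≥ M √M / 2` gives the constant
`34`. -/
lemma Consts.regret_bound (q : Consts) {M : ℕ} (hM : 0 < M) :
    q.lam M * Real.log q.K + ∑ m ∈ Finset.range M,
      2 * (alpha (m + 1) * (2 * q.R + 1)) ^ 2 / q.lam m ≤
      q.regret M * ∑ j ∈ Finset.Icc 1 M, alpha j := by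
  have hM' : (1 : ℝ) ≤ M := by exact_mod_cast hM
  have hB := q.B_pos
  have hlog := q.log_K_pos
  set L := Real.sqrt (Real.log q.K) with hL
  have hL0 : 0 < L := Real.sqrt_pos.2 hlog
  have hL2 : Real.log q.K = L ^ 2 := (Real.sq_sqrt hlog.le).symm
  have h1 : ∀ m ∈ Finset.range M,
      2 * (alpha (m + 1) * (2 * q.R + 1)) ^ 2 / q.lam m ≤ 16 * q.B * L := by
    intro m _
    have e1 : alpha (m + 1) ^ 2 = m + 1 := by
      unfold alpha
      rw [Real.sq_sqrt (Nat.cast_nonneg _)]; push_cast; ring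
    have hm : (0 : ℝ) < m + 1 := by positivity
    rw [mul_pow, e1, div_le_iff₀ (q.lam_pos m)]
    have h2 : (2 * q.R + 1) ^ 2 ≤ (2 * q.B) ^ 2 := by
      have := q.R_nonneg
      have := q.εapprox_nonneg
      refine pow_le_pow_left₀ (by linarith) ?_ 2
      unfold Consts.B; linarith
    unfold Consts.lam
    rw [← hL]
    have e2 : 16 * q.B * L * ((m + 1) * q.B / (2 * L)) = 2 * ((m + 1) * (2 * q.B) ^ 2) := by
      field_simp; ring
    rw [e2]
    gcongr
  have h2 : q.lam M * Real.log q.K ≤ M * (q.B * L) := by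
    unfold Consts.lam
    rw [← hL, hL2]
    have e : ((M : ℝ) + 1) * q.B / (2 * L) * L ^ 2 = (M + 1) / 2 * (q.B * L) := by
      field_simp
    rw [e]
    refine mul_le_mul_of_nonneg_right ?_ (by positivity)
    linarith
  have h3 : ∑ m ∈ Finset.range M,
      2 * (alpha (m + 1) * (2 * q.R + 1)) ^ 2 / q.lam m ≤ M * (16 * q.B * L) := by
    refine (Finset.sum_le_sum h1).trans (le_of_eq ?_)
    rw [Finset.sum_const, Finset.card_range, nsmul_eq_mul]
  have h4 : q.regret M * (M * Real.sqrt M / 2) = M * (17 * (q.B * L)) := by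
    unfold Consts.regret
    have : Real.sqrt (M : ℝ) ≠ 0 := (Real.sqrt_pos.2 (by linarith)).ne'
    rw [← hL]
    field_simp
    ring
  have h5 : 0 ≤ q.regret M := by unfold Consts.regret; positivity
  have h6 := mul_le_mul_of_nonneg_left (half_mul_sqrt_le_sum_alpha M) h5
  linarith

lemma abs_inner_meanFeature_le {θ : EuclideanSpace ℝ (Fin d)} {c : ℝ} (h : ‖θ‖ ≤ c) (s : S)
    (k : Fin K) : |inner ℝ (meanFeature φ π s k) θ| ≤ c :=
  (abs_real_inner_le_norm _ _).trans
    ((mul_le_of_le_one_left (norm_nonneg _) (norm_meanFeature_le s k)).trans h)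

/-- Dual averaging acts separately in each state, so the deterministic bound holds for every `s` and
every history with bounded estimates. The reverse inequality with its comparator `u` serves the
lower bound for `V̂`. -/
lemma spda_regret {q : Consts} (hqK : q.K = K) {ω₀ : NaturePolicy 𝓜} {M : ℕ} (hM : 0 < M)
    {h : History d} (hh : ∀ m ∈ Finset.Icc 1 M, ‖h m‖ ≤ 2 * q.R + 1) (s : S) :
    (∀ u ∈ 𝓜.weights, ∑ m ∈ Finset.Icc 1 M, avgWeight alpha M m *
        ∑ k, (spdaNature 𝓜 φ π ω₀ alpha q.lam q.lam_pos m h).prob s k *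
          inner ℝ (meanFeature φ π s k) (h m) ≤
      ∑ k, u k * ∑ m ∈ Finset.Icc 1 M, avgWeight alpha M m *
        inner ℝ (meanFeature φ π s k) (h m) + q.regret M) ∧
    ∃ u ∈ 𝓜.weights, ∑ k, u k * ∑ m ∈ Finset.Icc 1 M, avgWeight alpha M m *
        inner ℝ (meanFeature φ π s k) (h m) - q.regret M ≤
      ∑ m ∈ Finset.Icc 1 M, avgWeight alpha M m *
        ∑ k, (spdaNature 𝓜 φ π ω₀ alpha q.lam q.lam_pos m h).prob s k *
          inner ℝ (meanFeature φ π s k) (h m) := by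
  set w : ℕ → Fin K → ℝ := fun m => (spdaNature 𝓜 φ π ω₀ alpha q.lam q.lam_pos m h).prob s with hw
  set l : ℕ → Fin K → ℝ := fun m k => alpha m * hHat φ π h m s k with hl
  have hl' : ∀ m k, l m k = alpha m * inner ℝ (meanFeature φ π s k) (h m) := fun m k => by
    simp only [hl, hHat_eq_inner]
  -- `α 0 = 0` removes from the losses the run under the arbitrary initial policy.
  have l0 : l 0 = 0 := by funext k; simp [hl, alpha]
  have hb : ∀ m < M, ∀ k, |l (m + 1) k| ≤ alpha (m + 1) * (2 * q.R + 1) := by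
    intro m hm k
    rw [hl', abs_mul, abs_of_nonneg (alpha_nonneg _)]
    exact mul_le_mul_of_nonneg_left (abs_inner_meanFeature_le
      (hh (m + 1) (Finset.mem_Icc.2 ⟨by omega, by omega⟩)) s k) (alpha_nonneg _)
  obtain ⟨h1, u, hu, h2⟩ := dualAveraging_regret 𝓜.weights_closed 𝓜.weights_convex
    𝓜.weights_nonempty 𝓜.weights_subset l q.lam (fun m => alpha (m + 1) * (2 * q.R + 1))
    q.lam_pos q.monotone_lam l0 w (fun m => rfl) M hb
  set As := ∑ j ∈ Finset.Icc 1 M, alpha j with hAs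
  have hAs0 : 0 < As := sum_alpha_pos hM
  have hreg := q.regret_bound hM
  rw [hqK, ← hAs] at hreg
  have hnn : 0 ≤ ∑ m ∈ Finset.range M, 2 * (alpha (m + 1) * (2 * q.R + 1)) ^ 2 / q.lam m :=
    Finset.sum_nonneg fun m _ => div_nonneg (by positivity) (q.lam_pos m).le
  have e1 : ∑ m ∈ Finset.range M, ∑ k, w (m + 1) k * l (m + 1) k =
      As * ∑ m ∈ Finset.Icc 1 M, avgWeight alpha M m *
        ∑ k, w m k * inner ℝ (meanFeature φ π s k) (h m) := by
    rw [Finset.mul_sum, sum_Icc_one_eq_sum_range]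
    refine Finset.sum_congr rfl fun m _ => ?_
    unfold avgWeight
    rw [← hAs, ← mul_assoc, mul_div_cancel₀ _ hAs0.ne', Finset.mul_sum]
    refine Finset.sum_congr rfl fun k _ => ?_
    rw [hl']; ring
  have e2 : ∀ u : Fin K → ℝ, ∑ k, u k * ∑ m ∈ Finset.range M, l (m + 1) k =
      As * ∑ k, u k * ∑ m ∈ Finset.Icc 1 M, avgWeight alpha M m *
        inner ℝ (meanFeature φ π s k) (h m) := by
    intro u
    have hk : ∀ k, ∑ m ∈ Finset.range M, l (m + 1) k = As * ∑ m ∈ Finset.Icc 1 M,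
        avgWeight alpha M m * inner ℝ (meanFeature φ π s k) (h m) := by
      intro k
      rw [Finset.mul_sum, sum_Icc_one_eq_sum_range]
      refine Finset.sum_congr rfl fun m _ => ?_
      unfold avgWeight
      rw [← hAs, ← mul_assoc, mul_div_cancel₀ _ hAs0.ne', hl']
    simp only [hk]
    rw [Finset.mul_sum]
    exact Finset.sum_congr rfl fun k _ => by ring
  constructor
  · intro u hu
    have h3 := h1 u hu
    rw [e1, e2] at h3
    refine le_of_mul_le_mul_left ?_ hAs0
    refine h3.trans ?_
    rw [mul_add]
    linarith
  · refine ⟨u, hu, ?_⟩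
    rw [e1, e2] at h2
    refine le_of_mul_le_mul_left (le_trans ?_ h2) hAs0
    rw [mul_sub]
    linarith

end Regret

end RobustMDP
namespace RobustMDP
set_option linter.unusedSectionVars false

/-! ### Accuracy on good histories -/

section Pathwise

variable {S A : Type*} {K d : ℕ} [TopologicalSpace S] [MeasurableSpace S]
  [OpensMeasurableSpace S] [Fintype A] [MeasurableSpace A] [DiscreteMeasurableSpace A]
  {𝓜 : Model S A K} {φ : FeatureMap S A K d} {π : ControlPolicy S A}
  {C ρ : ℝ} {ν : NaturePolicy 𝓜 → Measure S} {hK : 2 ≤ K}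

/-- The histories for which the estimates are good enough on the test points `p`. -/
structure GoodHistory (φ : FeatureMap S A K d) (π : ControlPolicy S A)
    (ν : NaturePolicy 𝓜 → Measure S) (ω₀ ω' : NaturePolicy 𝓜) (q : Consts) (M : ℕ) {ι : Type*}
    (p : ι → S × A × Fin K) (y : ℝ) (h : History d) : Prop where
  error_le : ∀ m ∈ Finset.Icc 1 M, ‖spdaError φ π ν ω₀ alpha q.lam q.lam_pos m h‖ ≤ q.R + 1
  feat_le : ∀ j, |∑ m ∈ Finset.Icc 1 M, avgWeight alpha M m *
    inner ℝ (φ.feat (p j)) (spdaError φ π ν ω₀ alpha q.lam q.lam_pos m h)| ≤ y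
  shift_le : ∀ j, -y ≤ ∑ m ∈ Finset.Icc 1 M, avgWeight alpha M m *
    inner ℝ (occupationShift φ π (spdaNature 𝓜 φ π ω₀ alpha q.lam q.lam_pos m h) ω' (p j))
      (spdaError φ π ν ω₀ alpha q.lam q.lam_pos m h)

/-- The bound for the error of `Q̂` on good histories. -/
noncomputable def Consts.qBound (q : Consts) (M : ℕ) (y κ : ℝ) : ℝ :=
  q.εapprox * (3 + 2 * (q.γ / (1 - q.γ))) + q.γ / (1 - q.γ) * q.regret M + 2 * y +
    κ * (3 * q.R + 1)

variable {ω₀ ω' : NaturePolicy 𝓜} {M : ℕ} {ι : Type*} {p : ι → S × A × Fin K} {y κ : ℝ}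
  {h : History d}

lemma GoodHistory.norm_le (herg : GeometricallyErgodic 𝓜 π C ρ ν) (hC : 0 ≤ C)
    (hρ0 : 0 ≤ ρ) (hρ1 : ρ < 1) (hcov : ∀ ω, (covariance 𝓜 φ π ν ω).PosDef) (hd : 0 < d)
    (hG : GoodHistory φ π ν ω₀ ω' (evalConsts 𝓜 φ π ν C ρ hK) M p y h) :
    ∀ m ∈ Finset.Icc 1 M, ‖h m‖ ≤ 2 * (evalConsts 𝓜 φ π ν C ρ hK).R + 1 := by
  intro m hm
  have h1 := hG.error_le m hm
  have h2 := norm_tdTarget_le (hK := hK) herg hC hρ0 hρ1 hcov hd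
    (spdaNature 𝓜 φ π ω₀ alpha (evalConsts 𝓜 φ π ν C ρ hK).lam
      (evalConsts 𝓜 φ π ν C ρ hK).lam_pos m h)
  unfold spdaError at h1
  have h3 := norm_sub_norm_le (h m) (tdTarget 𝓜 φ π ν
    (spdaNature 𝓜 φ π ω₀ alpha (evalConsts 𝓜 φ π ν C ρ hK).lam
      (evalConsts 𝓜 φ π ν C ρ hK).lam_pos m h))
  linarith

lemma GoodHistory.abs_qHat_sub_average_le (herg : GeometricallyErgodic 𝓜 π C ρ ν) (hC : 0 ≤ C)
    (hρ0 : 0 ≤ ρ) (hρ1 : ρ < 1) (hcov : ∀ ω, (covariance 𝓜 φ π ν ω).PosDef) (hd : 0 < d)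
    (hM : 0 < M) (hG : GoodHistory φ π ν ω₀ ω' (evalConsts 𝓜 φ π ν C ρ hK) M p y h) (j : ι) :
    |qHat φ alpha M h (p j) - ∑ m ∈ Finset.Icc 1 M, avgWeight alpha M m *
      jointQ 𝓜 π (spdaNature 𝓜 φ π ω₀ alpha (evalConsts 𝓜 φ π ν C ρ hK).lam
        (evalConsts 𝓜 φ π ν C ρ hK).lam_pos m h) (p j)| ≤
      (evalConsts 𝓜 φ π ν C ρ hK).εapprox + y := by
  set q := evalConsts 𝓜 φ π ν C ρ hK
  have h1 := abs_sum_avgWeight_mul_le hM (c := q.εapprox) (f := fun m =>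
    linQ φ (tdTarget 𝓜 φ π ν (spdaNature 𝓜 φ π ω₀ alpha q.lam q.lam_pos m h)) (p j) -
      jointQ 𝓜 π (spdaNature 𝓜 φ π ω₀ alpha q.lam q.lam_pos m h) (p j)) fun m _ =>
    abs_linQ_tdTarget_sub_jointQ_le (hK := hK) herg hC hρ0 hρ1 hcov hd _ (p j)
  have h2 := hG.feat_le j
  have e : qHat φ alpha M h (p j) - ∑ m ∈ Finset.Icc 1 M, avgWeight alpha M m *
      jointQ 𝓜 π (spdaNature 𝓜 φ π ω₀ alpha q.lam q.lam_pos m h) (p j) =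
      ∑ m ∈ Finset.Icc 1 M, avgWeight alpha M m *
        (linQ φ (tdTarget 𝓜 φ π ν (spdaNature 𝓜 φ π ω₀ alpha q.lam q.lam_pos m h)) (p j) -
        jointQ 𝓜 π (spdaNature 𝓜 φ π ω₀ alpha q.lam q.lam_pos m h) (p j)) +
      ∑ m ∈ Finset.Icc 1 M, avgWeight alpha M m *
        inner ℝ (φ.feat (p j)) (spdaError φ π ν ω₀ alpha q.lam q.lam_pos m h) := by
    unfold qHat
    rw [← Finset.sum_sub_distrib, ← Finset.sum_add_distrib]
    refine Finset.sum_congr rfl fun m _ => ?_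
    unfold spdaError
    rw [inner_sub_right]
    unfold linQ
    ring
  rw [e]
  exact (abs_add_le _ _).trans (add_le_add h1 h2)

/-- The occupation measure is that of `ω'` for every `m`. The weighted sum therefore goes under the
integral, where regret against `ω'` bounds it in each state; `shift_le` controls the estimation
errors. -/
lemma GoodHistory.average_sub_le (herg : GeometricallyErgodic 𝓜 π C ρ ν) (hC : 0 ≤ C)
    (hρ0 : 0 ≤ ρ) (hρ1 : ρ < 1) (hcov : ∀ ω, (covariance 𝓜 φ π ν ω).PosDef) (hd : 0 < d)
    (hM : 0 < M) (hG : GoodHistory φ π ν ω₀ ω' (evalConsts 𝓜 φ π ν C ρ hK) M p y h) (j : ι) :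
    ∑ m ∈ Finset.Icc 1 M, avgWeight alpha M m *
      jointQ 𝓜 π (spdaNature 𝓜 φ π ω₀ alpha (evalConsts 𝓜 φ π ν C ρ hK).lam
        (evalConsts 𝓜 φ π ν C ρ hK).lam_pos m h) (p j) - jointQ 𝓜 π ω' (p j) ≤
      𝓜.discount / (1 - 𝓜.discount) * ((evalConsts 𝓜 φ π ν C ρ hK).regret M +
        2 * (evalConsts 𝓜 φ π ν C ρ hK).εapprox) + y := by
  have hnorm := hG.norm_le herg hC hρ0 hρ1 hcov hd
  set q := evalConsts 𝓜 φ π ν C ρ hK with hq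
  set ω : ℕ → NaturePolicy 𝓜 := fun m => spdaNature 𝓜 φ π ω₀ alpha q.lam q.lam_pos m h with hω
  have h1 : ∀ m, jointQ 𝓜 π (ω m) (p j) - jointQ 𝓜 π ω' (p j) ≤
      ∫ s, inner ℝ (featureShift φ π ((ω m).prob s) (ω'.prob s) s) (h m)
        ∂(occupation π ω' (p j)) -
        inner ℝ (occupationShift φ π (ω m) ω' (p j))
          (spdaError φ π ν ω₀ alpha q.lam q.lam_pos m h) +
        𝓜.discount / (1 - 𝓜.discount) * (2 * q.εapprox) := fun m =>
    jointQ_sub_jointQ_le herg hC hρ0 hρ1 hcov hd (ω m) ω' (p j) (h m)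
  have h2 : ∑ m ∈ Finset.Icc 1 M, avgWeight alpha M m *
      ∫ s, inner ℝ (featureShift φ π ((ω m).prob s) (ω'.prob s) s) (h m)
        ∂(occupation π ω' (p j)) ≤ 𝓜.discount / (1 - 𝓜.discount) * q.regret M := by
    have hint : ∀ m ∈ Finset.Icc 1 M, Integrable (fun s => avgWeight alpha M m *
        inner ℝ (featureShift φ π ((ω m).prob s) (ω'.prob s) s) (h m))
        (occupation π ω' (p j)) := fun m _ =>
      (integrable_inner_featureShift (φ := φ) (π := π) (ω m) ω' (p j) (h m)).const_mul _
    simp only [← integral_const_mul]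
    rw [← integral_finsetSum _ hint]
    refine integral_occupation_le ω' (p j) (integrable_finsetSum _ hint) fun s => ?_
    have h3 := (spda_regret (φ := φ) (π := π) (q := q) (ω₀ := ω₀) rfl hM hnorm s).1 _
      (ω'.prob_mem s)
    have e : ∑ m ∈ Finset.Icc 1 M, avgWeight alpha M m *
        inner ℝ (featureShift φ π ((ω m).prob s) (ω'.prob s) s) (h m) =
        ∑ m ∈ Finset.Icc 1 M, avgWeight alpha M m *
          ∑ k, (ω m).prob s k * inner ℝ (meanFeature φ π s k) (h m) -
        ∑ k, ω'.prob s k * ∑ m ∈ Finset.Icc 1 M, avgWeight alpha M m *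
          inner ℝ (meanFeature φ π s k) (h m) := by
      have e2 : ∑ k, ω'.prob s k * ∑ m ∈ Finset.Icc 1 M, avgWeight alpha M m *
          inner ℝ (meanFeature φ π s k) (h m) = ∑ m ∈ Finset.Icc 1 M, avgWeight alpha M m *
          ∑ k, ω'.prob s k * inner ℝ (meanFeature φ π s k) (h m) := by
        simp only [Finset.mul_sum]
        rw [Finset.sum_comm]
        refine Finset.sum_congr rfl fun m _ => Finset.sum_congr rfl fun k _ => ?_
        ring
      rw [e2, ← Finset.sum_sub_distrib]
      refine Finset.sum_congr rfl fun m _ => ?_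
      rw [inner_featureShift, ← mul_sub, ← Finset.sum_sub_distrib]
      simp only [sub_mul]
    rw [e]
    linarith
  have h3 := hG.shift_le j
  have h4 : ∑ m ∈ Finset.Icc 1 M, avgWeight alpha M m *
      (jointQ 𝓜 π (ω m) (p j) - jointQ 𝓜 π ω' (p j)) ≤
      ∑ m ∈ Finset.Icc 1 M, avgWeight alpha M m *
        (∫ s, inner ℝ (featureShift φ π ((ω m).prob s) (ω'.prob s) s) (h m)
        ∂(occupation π ω' (p j)) -
        inner ℝ (occupationShift φ π (ω m) ω' (p j))
          (spdaError φ π ν ω₀ alpha q.lam q.lam_pos m h) +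
        𝓜.discount / (1 - 𝓜.discount) * (2 * q.εapprox)) :=
    Finset.sum_le_sum fun m _ => mul_le_mul_of_nonneg_left (h1 m) (avgWeight_nonneg M m)
  simp only [mul_add, mul_sub, Finset.sum_add_distrib, Finset.sum_sub_distrib,
    ← Finset.sum_mul, sum_avgWeight hM, one_mul] at h4 ⊢
  linarith

/-- At a net point, the average of `Q^{ω_m}` is at least `Q^{ω'}` by optimality and exceeds it by at
most the regret terms. The passage from the net point to `z` costs `κ (2R + 1)` for `Q̂`. `Q^{ω'}`
need not be Lipschitz in the features, so it is replaced at both points by its linear approximation,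
at the cost `κ R + 2 ε_approx`. -/
lemma GoodHistory.abs_qHat_sub_robustQ_le (herg : GeometricallyErgodic 𝓜 π C ρ ν) (hC : 0 ≤ C)
    (hρ0 : 0 ≤ ρ) (hρ1 : ρ < 1) (hcov : ∀ ω, (covariance 𝓜 φ π ν ω).PosDef) (hd : 0 < d)
    (hM : 0 < M) (hopt : IsOptimalNature π ω')
    (hp : ∀ z, ∃ j, ‖φ.feat z - φ.feat (p j)‖ ≤ κ)
    (hG : GoodHistory φ π ν ω₀ ω' (evalConsts 𝓜 φ π ν C ρ hK) M p y h) (z : S × A × Fin K) :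
    |qHat φ alpha M h z - robustQ 𝓜 π z| ≤ (evalConsts 𝓜 φ π ν C ρ hK).qBound M y κ := by
  have hnorm := hG.norm_le herg hC hρ0 hρ1 hcov hd
  obtain ⟨j, hj⟩ := hp z
  have h1 := hG.abs_qHat_sub_average_le herg hC hρ0 hρ1 hcov hd hM j
  have h2 := hG.average_sub_le herg hC hρ0 hρ1 hcov hd hM j
  set q := evalConsts 𝓜 φ π ν C ρ hK with hq
  have hR := q.R_nonneg
  have hκ : 0 ≤ κ := (norm_nonneg _).trans hj
  have h3 : jointQ 𝓜 π ω' (p j) ≤ ∑ m ∈ Finset.Icc 1 M, avgWeight alpha M m *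
      jointQ 𝓜 π (spdaNature 𝓜 φ π ω₀ alpha q.lam q.lam_pos m h) (p j) := by
    have := sum_avgWeight_mul_le hM (f := fun m => -jointQ 𝓜 π
      (spdaNature 𝓜 φ π ω₀ alpha q.lam q.lam_pos m h) (p j)) (c := -jointQ 𝓜 π ω' (p j))
      fun m _ => neg_le_neg (hopt.jointQ_le _ _)
    simp only [mul_neg, Finset.sum_neg_distrib] at this
    linarith
  have hlip : ∀ {θ : EuclideanSpace ℝ (Fin d)} {c : ℝ}, ‖θ‖ ≤ c →
      |linQ φ θ z - linQ φ θ (p j)| ≤ κ * c := by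
    intro θ c hθ
    unfold linQ
    rw [← inner_sub_left]
    exact (abs_real_inner_le_norm _ _).trans (mul_le_mul hj hθ (norm_nonneg _) hκ)
  have h4 : |qHat φ alpha M h z - qHat φ alpha M h (p j)| ≤ κ * (2 * q.R + 1) := by
    have := abs_sum_avgWeight_mul_le hM (f := fun m => linQ φ (h m) z - linQ φ (h m) (p j))
      fun m hm => hlip (hnorm m hm)
    simp only [mul_sub, Finset.sum_sub_distrib] at this
    simpa only [qHat, mul_add, mul_one] using this
  have h5 := hlip (norm_tdTarget_le (hK := hK) herg hC hρ0 hρ1 hcov hd ω')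
  have h6 := abs_linQ_tdTarget_sub_jointQ_le (hK := hK) herg hC hρ0 hρ1 hcov hd ω' z
  have h7 := abs_linQ_tdTarget_sub_jointQ_le (hK := hK) herg hC hρ0 hρ1 hcov hd ω' (p j)
  rw [← hq] at h5 h6 h7
  have hγ : 0 < 1 - 𝓜.discount := sub_pos.2 𝓜.discount_lt_one
  have h8 : 0 ≤ 𝓜.discount / (1 - 𝓜.discount) := div_nonneg 𝓜.discount_pos.le hγ.le
  have h9 : 0 ≤ q.regret M := by
    have := q.B_pos
    unfold Consts.regret
    positivity
  have h10 := mul_nonneg h8 h9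
  have h11 := mul_nonneg h8 q.εapprox_nonneg
  have h12 := (abs_nonneg _).trans (hG.feat_le j)
  have eγ : q.γ = 𝓜.discount := rfl
  rw [hopt.robustQ_eq]
  unfold Consts.qBound
  rw [eγ]
  rw [abs_le] at h1 h4 h5 h6 h7 ⊢
  constructor
  · nlinarith [h1.1, h4.1, h5.1, h5.2, h6.1, h6.2, h7.1, h7.2, q.εapprox_nonneg]
  · nlinarith [h1.2, h4.2, h5.1, h5.2, h6.1, h6.2, h7.1, h7.2]

lemma vHat_eq (q : Consts) (s : S) :
    vHat 𝓜 φ π ω₀ alpha q.lam q.lam_pos M h s = ∑ m ∈ Finset.Icc 1 M, avgWeight alpha M m *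
      ∑ k, (spdaNature 𝓜 φ π ω₀ alpha q.lam q.lam_pos m h).prob s k *
        inner ℝ (meanFeature φ π s k) (h m) := by
  unfold vHat
  refine Finset.sum_congr rfl fun m _ => ?_
  congr 1
  rw [Finset.sum_comm]
  refine Finset.sum_congr rfl fun k _ => ?_
  rw [inner_meanFeature, Finset.mul_sum]
  refine Finset.sum_congr rfl fun a _ => ?_
  rw [← mul_assoc]
  rfl

/-- From above, the regret is taken against `ω'` at `s`. From below, it is taken against the
comparator `u` supplied by dual averaging, and the optimality inequality of `ω'` is applied to `u`.
In both cases the averaged `Ĥ` inherits the error of `Q̂`, so only one more regret is added. -/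
lemma GoodHistory.abs_vHat_sub_robustValue_le (herg : GeometricallyErgodic 𝓜 π C ρ ν) (hC : 0 ≤ C)
    (hρ0 : 0 ≤ ρ) (hρ1 : ρ < 1) (hcov : ∀ ω, (covariance 𝓜 φ π ν ω).PosDef) (hd : 0 < d)
    (hM : 0 < M) (hopt : IsOptimalNature π ω')
    (hp : ∀ z, ∃ j, ‖φ.feat z - φ.feat (p j)‖ ≤ κ)
    (hG : GoodHistory φ π ν ω₀ ω' (evalConsts 𝓜 φ π ν C ρ hK) M p y h) (s : S) :
    |vHat 𝓜 φ π ω₀ alpha (evalConsts 𝓜 φ π ν C ρ hK).lam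
      (evalConsts 𝓜 φ π ν C ρ hK).lam_pos M h s - robustValue 𝓜 π s| ≤
      (evalConsts 𝓜 φ π ν C ρ hK).qBound M y κ + (evalConsts 𝓜 φ π ν C ρ hK).regret M := by
  have hnorm := hG.norm_le herg hC hρ0 hρ1 hcov hd
  have hQ := hG.abs_qHat_sub_robustQ_le herg hC hρ0 hρ1 hcov hd hM hopt hp
  set q := evalConsts 𝓜 φ π ν C ρ hK with hq
  obtain ⟨h1, u, hu, h2⟩ := spda_regret (φ := φ) (π := π) (q := q) (ω₀ := ω₀) rfl hM hnorm s
  set V := value 𝓜 π (natureKernel 𝓜 ω') with hV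
  have hH : ∀ k, |∑ m ∈ Finset.Icc 1 M, avgWeight alpha M m *
      inner ℝ (meanFeature φ π s k) (h m) - natureValue 𝓜 π V s k| ≤ q.qBound M y κ := by
    intro k
    have e : ∑ m ∈ Finset.Icc 1 M, avgWeight alpha M m * inner ℝ (meanFeature φ π s k) (h m) =
        ∑ a, π.prob s a * qHat φ alpha M h (s, a, k) := by
      simp only [inner_meanFeature, qHat, Finset.mul_sum]
      rw [Finset.sum_comm]
      refine Finset.sum_congr rfl fun a _ => Finset.sum_congr rfl fun m _ => ?_
      ring
    unfold natureValue
    rw [e, ← Finset.sum_sub_distrib]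
    simp only [← mul_sub]
    refine abs_sum_mul_le (π.prob_mem s) fun a => ?_
    have := hQ (s, a, k)
    rwa [hopt.robustQ_eq] at this
  have hcmp : ∀ w ∈ 𝓜.weights, |∑ k, w k * ∑ m ∈ Finset.Icc 1 M, avgWeight alpha M m *
      inner ℝ (meanFeature φ π s k) (h m) - ∑ k, w k * natureValue 𝓜 π V s k| ≤
      q.qBound M y κ := by
    intro w hw
    rw [← Finset.sum_sub_distrib]
    simp only [← mul_sub]
    exact abs_sum_mul_le (𝓜.weights_subset hw) hH
  rw [vHat_eq, hopt.robustValue_eq]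
  have h3 := h1 _ (ω'.prob_mem s)
  have h4 := hcmp _ (ω'.prob_mem s)
  have h5 := hcmp _ hu
  have h6 := hopt s u hu
  have h7 := value_nature_eq (π := π) ω' s
  rw [← hV] at h6 h7 ⊢
  rw [abs_le] at h4 h5 ⊢
  constructor
  · linarith [h5.1]
  · linarith [h4.2]

end Pathwise

end RobustMDP
namespace RobustMDP
set_option linter.unusedSectionVars false

/-! ### A finite net in feature space -/

section Net

lemma EuclideanSpace.norm_le_of_forall_abs_le {d : ℕ} {x : EuclideanSpace ℝ (Fin d)} {c : ℝ}
    (hc : 0 ≤ c) (h : ∀ i, |x i| ≤ c) : ‖x‖ ≤ d * c := by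
  refine abs_le_of_sq_le_sq' ?_ (by positivity) |>.2
  rw [EuclideanSpace.norm_sq_eq]
  calc ∑ i, ‖x i‖ ^ 2 ≤ ∑ _i : Fin d, c ^ 2 :=
        Finset.sum_le_sum fun i _ => pow_le_pow_left₀ (norm_nonneg _) (h i) 2
    _ = d * c ^ 2 := by simp
    _ ≤ (d * c) ^ 2 := by
        rcases Nat.eq_zero_or_pos d with rfl | hd
        · simp
        · have : (1 : ℝ) ≤ d := by exact_mod_cast hd
          nlinarith [sq_nonneg c, mul_nonneg (sub_nonneg.2 this) (sq_nonneg c)]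

/-- Each coordinate in `[-1, 1]` is cut into cells of length `2/N`, with one more index for the
value `1`; features in one cell differ by at most `2/N` per coordinate. -/
lemma exists_feature_net {S A : Type*} {K d : ℕ} [MeasurableSpace S] [MeasurableSpace A]
    (φ : FeatureMap S A K d) (z₀ : S × A × Fin K) {N : ℕ} (hN : 0 < N) :
    ∃ p : (Fin d → Fin (N + 1)) → S × A × Fin K,
      ∀ z, ∃ j, ‖φ.feat z - φ.feat (p j)‖ ≤ d * (2 / N) := by
  have hN' : (0 : ℝ) < N := by exact_mod_cast hN
  have habs : ∀ z i, |φ.feat z i| ≤ 1 := fun z i =>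
    (PiLp.norm_apply_le (φ.feat z) i).trans (φ.norm_feat_le z)
  have hnn : ∀ z i, 0 ≤ (φ.feat z i + 1) / 2 * N := fun z i =>
    mul_nonneg (div_nonneg (by linarith [(abs_le.1 (habs z i)).1]) (by norm_num)) hN'.le
  have hlt : ∀ z i, ⌊(φ.feat z i + 1) / 2 * N⌋₊ < N + 1 := by
    intro z i
    rw [Nat.lt_succ_iff]
    refine Nat.floor_le_of_le ?_
    have := (abs_le.1 (habs z i)).2
    nlinarith
  let cell : S × A × Fin K → Fin d → Fin (N + 1) := fun z i => ⟨_, hlt z i⟩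
  classical
  -- The test points have to be triples, so one is chosen from every nonempty cell; `z₀` only fills
  -- the empty cells.
  refine ⟨fun j => if hj : ∃ z, cell z = j then hj.choose else z₀, fun z => ⟨cell z, ?_⟩⟩
  have hex : ∃ z', cell z' = cell z := ⟨z, rfl⟩
  simp only [dif_pos hex]
  set z' := hex.choose
  have hz' : cell z' = cell z := hex.choose_spec
  refine EuclideanSpace.norm_le_of_forall_abs_le (by positivity) fun i => ?_
  have hi : ⌊(φ.feat z' i + 1) / 2 * N⌋₊ = ⌊(φ.feat z i + 1) / 2 * N⌋₊ :=
    congrArg Fin.val (congrFun hz' i)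
  have h1 := Nat.floor_le (hnn z' i)
  have h2 := Nat.lt_floor_add_one ((φ.feat z' i + 1) / 2 * N)
  have h3 := Nat.floor_le (hnn z i)
  have h4 := Nat.lt_floor_add_one ((φ.feat z i + 1) / 2 * N)
  rw [hi] at h1 h2
  rw [PiLp.sub_apply, abs_le, ← neg_div, div_le_iff₀ hN', le_div_iff₀ hN']
  constructor <;> nlinarith

end Net

/-! ### The probability of bad histories -/

section Probability

variable {S A : Type*} {K d : ℕ} [TopologicalSpace S] [MeasurableSpace S]
  [OpensMeasurableSpace S] [Fintype A] [MeasurableSpace A] [DiscreteMeasurableSpace A]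
  {𝓜 : Model S A K} {φ : FeatureMap S A K d} {π : ControlPolicy S A}
  {C ρ : ℝ} {ν : NaturePolicy 𝓜 → Measure S} {hK : 2 ≤ K}
  {ω₀ : NaturePolicy 𝓜} {lam : ℕ → ℝ} {hlam : ∀ m, 0 < lam m} {s₀ : S} {η : ℝ} {T τ : ℕ}

lemma predictable_const (v : EuclideanSpace ℝ (Fin d)) : Predictable fun _ _ => v :=
  fun _ => ⟨measurable_const, fun _ _ _ => rfl⟩

lemma predictable_occupationShift {α : ℕ → ℝ} (ω' : NaturePolicy 𝓜) (z : S × A × Fin K) :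
    Predictable fun i h =>
      occupationShift φ π (spdaNature 𝓜 φ π ω₀ α lam hlam i h) ω' z := by
  intro i
  constructor
  · have hm : Measurable fun x : History d × S => featureShift φ π
        ((spdaPolicy 𝓜 φ π ω₀ α lam hlam i).prob x) (ω'.prob x.2) x.2 := by
      unfold featureShift
      refine Finset.measurable_fun_sum _ fun k _ => ?_
      exact (((measurable_pi_apply k).comp
        (spdaPolicy 𝓜 φ π ω₀ α lam hlam i).measurable_prob).sub
        ((measurable_pi_apply k).comp (ω'.measurable_prob.comp measurable_snd))).smul
        ((measurable_meanFeature k).comp measurable_snd)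
    exact (hm.stronglyMeasurable.integral_prod_right' (ν := occupation π ω' z)).measurable
  · intro h h' hh
    show occupationShift φ π _ ω' z = occupationShift φ π _ ω' z
    rw [spdaNature_congr hh]

lemma Predictable.weighted_smul {g : ℕ → History d → EuclideanSpace ℝ (Fin d)}
    (hg : Predictable g) (c : ℕ → ℝ) : Predictable fun i h => c i • g i h :=
  fun i => ⟨(hg i).1.const_smul (c i), fun h h' hh => by
    show c i • g i h = c i • g i h'
    rw [(hg i).2 h h' hh]⟩

lemma Predictable.neg {g : ℕ → History d → EuclideanSpace ℝ (Fin d)}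
    (hg : Predictable g) : Predictable fun i h => -g i h :=
  fun i => ⟨(hg i).1.neg, fun h h' hh => by
    show -g i h = -g i h'
    rw [(hg i).2 h h' hh]⟩

/-- Chernoff's method with parameter `l`: the predictable vectors `l ϑ_i g_i` have norm at most `l
ϑ_i b`. The bound `∑ ϑ_i² ≤ 2/M` produces the variance term with its gain `1/M`, while the biases
are merely averaged. -/
lemma spdaPrefix_exists_lt_average_le (herg : GeometricallyErgodic 𝓜 π C ρ ν) (hC : 0 ≤ C)
    (hρ0 : 0 ≤ ρ) (hρ1 : ρ < 1) (hK : 2 ≤ K) (hcov : ∀ ω, (covariance 𝓜 φ π ν ω).PosDef)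
    (hd : 0 < d) {R s β : ℝ} (hs : 0 ≤ s) (hβ : 0 ≤ β) {E₀ : ENNReal}
    (hexp : ∀ (ω : NaturePolicy 𝓜) (u : EuclideanSpace ℝ (Fin d)),
      ∫⁻ x, ENNReal.ofReal (Real.exp (inner ℝ u (x - tdTarget 𝓜 φ π ν ω)))
        ∂((clippedTD φ herg ω η R ^ (T + 1) : Kernel _ _) 0) ≤
      ENNReal.ofReal (Real.exp (s * ‖u‖ ^ 2 / 2 + β * ‖u‖)))
    (hE : ∀ ω : NaturePolicy 𝓜, clipLoss φ herg ω η R (ENNReal.ofReal (C * ρ ^ τ)) (T + 1) 0 ≤ E₀)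
    {ι : Type*} [Fintype ι] {g : ι → ℕ → History d → EuclideanSpace ℝ (Fin d)}
    (hg : ∀ j, Predictable (g j)) {b : ℝ} (hb : ∀ j i h, ‖g j i h‖ ≤ b) {M : ℕ} (hM : 0 < M)
    {l y : ℝ} (hl : 0 ≤ l) :
    spdaPrefix 𝓜 φ π ω₀ alpha lam hlam s₀ η T (τ + 2) (M + 1)
      {h | ∃ j, y < ∑ m ∈ Finset.Icc 1 M, avgWeight alpha M m *
        inner ℝ (g j m h) (spdaError φ π ν ω₀ alpha lam hlam m h)} ≤
      Fintype.card ι * ENNReal.ofReal (Real.exp (s * (l * b) ^ 2 / M + β * (l * b) - l * y)) +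
        (M + 1 : ℕ) * E₀ := by
  rcases isEmpty_or_nonempty ι with hι | ⟨⟨j₀⟩⟩
  · simp
  have hb0 : 0 ≤ b := (norm_nonneg _).trans (hb j₀ 0 0)
  have hM' : (0 : ℝ) < M := by exact_mod_cast hM
  have key := lintegral_min_sum_exp_le (ω₀ := ω₀) (α := alpha) (lam := lam) (hlam := hlam)
    (s₀ := s₀) herg hC hρ0 hρ1 hK hcov hd hs hβ hexp hE
    (fun j => (hg j).weighted_smul fun i => l * avgWeight alpha M i)
    (a := fun i => avgWeight alpha M i * (l * b)) (fun j i h => by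
      rw [norm_smul, Real.norm_of_nonneg (mul_nonneg hl (avgWeight_nonneg M i))]
      have := mul_le_mul_of_nonneg_left (hb j i h) (mul_nonneg hl (avgWeight_nonneg M i))
      linarith) (M + 1) (fun _ => -(l * y))
  have hin : ∀ j h, ∑ i ∈ Finset.range (M + 1), inner ℝ ((l * avgWeight alpha M i) • g j i h)
      (spdaError φ π ν ω₀ alpha lam hlam i h) = l * ∑ m ∈ Finset.Icc 1 M, avgWeight alpha M m *
        inner ℝ (g j m h) (spdaError φ π ν ω₀ alpha lam hlam m h) := by
    intro j h
    rw [← sum_range_avgWeight_mul, Finset.mul_sum]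
    refine Finset.sum_congr rfl fun i _ => ?_
    rw [real_inner_smul_left, mul_assoc]
  have hsum : ∑ i ∈ Finset.range (M + 1), (s * (avgWeight alpha M i * (l * b)) ^ 2 / 2 +
      β * (avgWeight alpha M i * (l * b))) ≤ s * (l * b) ^ 2 / M + β * (l * b) := by
    have e : ∀ i, s * (avgWeight alpha M i * (l * b)) ^ 2 / 2 +
        β * (avgWeight alpha M i * (l * b)) =
        avgWeight alpha M i * (avgWeight alpha M i * (s * (l * b) ^ 2 / 2) + β * (l * b)) :=
      fun i => by ring
    simp only [e]
    rw [sum_range_avgWeight_mul]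
    simp only [mul_add, ← mul_assoc, Finset.sum_add_distrib, ← Finset.sum_mul, sum_avgWeight hM,
      ← sq]
    have h1 := sum_avgWeight_sq_le hM
    have h2 : 0 ≤ s * (l * b) ^ 2 / 2 := by positivity
    have h3 := mul_le_mul_of_nonneg_right h1 h2
    have e2 : 2 / (M : ℝ) * (s * (l * b) ^ 2 / 2) = s * (l * b) ^ 2 / M := by field_simp
    rw [e2] at h3
    calc _ = (∑ m ∈ Finset.Icc 1 M, avgWeight alpha M m ^ 2) * (s * (l * b) ^ 2 / 2) +
          β * (l * b) := by ring
      _ ≤ _ := by linarith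
  refine (meas_le_lintegral₀ ?_ ?_).trans (key.trans ?_)
  · refine Measurable.aemeasurable (measurable_const.min ?_)
    refine Finset.measurable_fun_sum _ fun j _ => ?_
    refine (Real.measurable_exp.comp (measurable_const.add ?_)).ennreal_ofReal
    refine Finset.measurable_fun_sum _ fun i _ => ?_
    exact Measurable.inner (𝕜 := ℝ) ((hg j i).1.const_smul (l * avgWeight alpha M i))
      (measurable_spdaError herg hC hρ0 hρ1 hK hcov hd i)
  · rintro h ⟨j, hj⟩
    refine le_min le_rfl ?_
    refine le_trans ?_ (Finset.single_le_sum (fun _ _ => bot_le) (Finset.mem_univ j))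
    rw [hin, ← ENNReal.ofReal_one]
    refine ENNReal.ofReal_le_ofReal (Real.one_le_exp ?_)
    nlinarith [mul_le_mul_of_nonneg_left hj.le hl]
  · refine add_le_add_left ?_ _
    rw [Finset.sum_const, Finset.card_univ, nsmul_eq_mul]
    refine mul_le_mul_right (ENNReal.ofReal_le_ofReal (Real.exp_le_exp.2 ?_)) _
    linarith

/-- The bound for the probability of the bad histories. -/
noncomputable def Consts.failure (q : Consts) (n M T : ℕ) (η e l y : ℝ) : ℝ :=
  3 * n * Real.exp (q.variance η * (l * (2 / (1 - q.γ))) ^ 2 / M +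
    Real.sqrt (1 - η * q.mu) ^ (T + 1) * q.R * (l * (2 / (1 - q.γ))) - l * y) +
  2 * (M + 1) * (T + 2) * (e + 2 * Real.exp (-(1 / (2 * q.variance η))))

lemma spdaPrefix_not_goodHistory_le (herg : GeometricallyErgodic 𝓜 π C ρ ν) (hC : 0 ≤ C)
    (hρ0 : 0 ≤ ρ) (hρ1 : ρ < 1) (hcov : ∀ ω, (covariance 𝓜 φ π ν ω).PosDef) (hd : 0 < d)
    (hη : 0 < η) (hη' : 4 * η ≤ (evalConsts 𝓜 φ π ν C ρ hK).mu) (ω' : NaturePolicy 𝓜)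
    {ι : Type*} [Fintype ι] (p : ι → S × A × Fin K) {M : ℕ} (hM : 0 < M) {l : ℝ} (hl : 0 ≤ l)
    (y : ℝ) :
    spdaPrefix 𝓜 φ π ω₀ alpha (evalConsts 𝓜 φ π ν C ρ hK).lam
      (evalConsts 𝓜 φ π ν C ρ hK).lam_pos s₀ η T (τ + 2) (M + 1)
      {h | ¬ GoodHistory φ π ν ω₀ ω' (evalConsts 𝓜 φ π ν C ρ hK) M p y h} ≤
      ENNReal.ofReal ((evalConsts 𝓜 φ π ν C ρ hK).failure (Fintype.card ι) M T η (C * ρ ^ τ) l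
        y) := by
  have hexp := fun ω u => lintegral_exp_clippedTD_le (hK := hK) (φ := φ) (π := π) herg hC hρ0 hρ1
    hcov hd ω hη hη' (T + 1) u
  have htail := fun ω => clippedTD_tail_le (hK := hK) (φ := φ) (π := π) herg hC hρ0 hρ1
    hcov hd ω hη hη' (T + 1)
  have he : 0 ≤ C * ρ ^ τ := mul_nonneg hC (pow_nonneg hρ0 _)
  have hloss := fun ω => clipLoss_le (hK := hK) (φ := φ) (π := π) herg hC hρ0 hρ1 hcov hd ω hη hη'
    he (T + 1)
  have hs := variance_nonneg (hK := hK) (φ := φ) herg hC hρ0 hρ1 hcov hd hη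
  have hγ : 0 < 1 - 𝓜.discount := sub_pos.2 𝓜.discount_lt_one
  set q := evalConsts 𝓜 φ π ν C ρ hK with hq
  have eγ : q.γ = 𝓜.discount := rfl
  set σ := q.variance η with hσ
  set t := 2 * Real.exp (-(1 / (2 * σ))) with ht
  have ht0 : 0 ≤ t := by positivity
  set b := 2 / (1 - 𝓜.discount) with hb
  have hb1 : 1 ≤ b := by rw [hb, le_div_iff₀ hγ]; linarith [𝓜.discount_pos]
  set P := spdaPrefix 𝓜 φ π ω₀ alpha q.lam q.lam_pos s₀ η T (τ + 2) (M + 1) with hP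
  set E₀ := ENNReal.ofReal ((T + 1 : ℕ) * (C * ρ ^ τ + t)) with hE₀
  -- Three one-sided families: the features with both signs for `feat_le`, and the negative
  -- occupation shift for `shift_le`. All have norm at most `b = 2/(1 - γ)`.
  let g : ι ⊕ ι ⊕ ι → ℕ → History d → EuclideanSpace ℝ (Fin d) :=
    Sum.elim (fun j _ _ => φ.feat (p j)) (Sum.elim (fun j _ _ => -φ.feat (p j))
      fun j i h => -occupationShift φ π (spdaNature 𝓜 φ π ω₀ alpha q.lam q.lam_pos i h) ω' (p j))
  have hg : ∀ j, Predictable (g j) := by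
    rintro (j | j | j)
    · exact predictable_const _
    · exact predictable_const _
    · exact (predictable_occupationShift ω' (p j)).neg
  have hgb : ∀ j i h, ‖g j i h‖ ≤ b := by
    rintro (j | j | j) i h
    · exact (φ.norm_feat_le _).trans hb1
    · exact (norm_neg (φ.feat (p j))).trans_le ((φ.norm_feat_le _).trans hb1)
    · exact (norm_neg _).trans_le (norm_occupationShift_le _ _ _)
  have h1 := spdaPrefix_exists_lt_average_le (ω₀ := ω₀) (lam := q.lam) (hlam := q.lam_pos)
    (s₀ := s₀) (τ := τ) herg hC hρ0 hρ1 hK hcov hd hs.le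
    (mul_nonneg (pow_nonneg (Real.sqrt_nonneg _) _) q.R_nonneg) hexp hloss hg hgb hM hl (y := y)
  have h2 := spdaPrefix_exists_le (ω₀ := ω₀) (α := alpha) (lam := q.lam) (hlam := q.lam_pos)
    (s₀ := s₀) (τ := τ) herg hC hρ0 hρ1 hK hcov hd htail hloss (M + 1)
  rw [← hP] at h1 h2
  have hsub : {h | ¬ GoodHistory φ π ν ω₀ ω' q M p y h} ⊆
      {h | ∃ j, y < ∑ m ∈ Finset.Icc 1 M, avgWeight alpha M m *
        inner ℝ (g j m h) (spdaError φ π ν ω₀ alpha q.lam q.lam_pos m h)} ∪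
      {h | ∃ i < M + 1, q.R + 1 < ‖spdaError φ π ν ω₀ alpha q.lam q.lam_pos i h‖} := by
    intro h hh
    by_contra hcon
    simp only [Set.mem_union, Set.mem_ofPred_eq, not_or, not_exists, not_and, not_lt] at hcon
    obtain ⟨hc1, hc2⟩ := hcon
    refine hh ⟨fun m hm => hc2 m (Nat.lt_succ_of_le (Finset.mem_Icc.1 hm).2), fun j => ?_,
      fun j => ?_⟩
    · have h3 := hc1 (Sum.inl j)
      have h4 := hc1 (Sum.inr (Sum.inl j))
      simp only [g, Sum.elim_inl, Sum.elim_inr, inner_neg_left, mul_neg,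
        Finset.sum_neg_distrib] at h3 h4
      exact abs_le.2 ⟨by linarith, h3⟩
    · have h4 := hc1 (Sum.inr (Sum.inr j))
      simp only [g, Sum.elim_inr, inner_neg_left, mul_neg, Finset.sum_neg_distrib] at h4
      linarith
  refine (measure_mono hsub).trans ((measure_union_le _ _).trans ((add_le_add h1 h2).trans ?_))
  have hcard : (Fintype.card (ι ⊕ ι ⊕ ι) : ENNReal) =
      ENNReal.ofReal (3 * (Fintype.card ι : ℝ)) := by
    have : (3 * (Fintype.card ι : ℝ)) = ((3 * Fintype.card ι : ℕ) : ℝ) := by push_cast; ring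
    rw [this, ENNReal.ofReal_natCast, Fintype.card_sum, Fintype.card_sum]
    congr 1
    ring
  have hM1 : ((M + 1 : ℕ) : ENNReal) = ENNReal.ofReal ((M : ℝ) + 1) := by
    rw [← ENNReal.ofReal_natCast]; push_cast; rfl
  have hE₀' : 0 ≤ ((T + 1 : ℕ) : ℝ) * (C * ρ ^ τ + t) := by positivity
  rw [hcard, hM1, hE₀, ← ENNReal.ofReal_add hE₀' ht0, ← ENNReal.ofReal_mul (by positivity),
    ← ENNReal.ofReal_mul (by positivity), ← ENNReal.ofReal_mul (by positivity),
    ← ENNReal.ofReal_add (by positivity) (by positivity),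
    ← ENNReal.ofReal_add (by positivity) (by positivity)]
  refine ENNReal.ofReal_le_ofReal ?_
  unfold Consts.failure
  rw [eγ, ← hb, ← hσ, ← ht]
  have h5 : (M + 1 : ℝ) * (((T + 1 : ℕ) : ℝ) * (C * ρ ^ τ + t)) +
      (M + 1) * (((T + 1 : ℕ) : ℝ) * (C * ρ ^ τ + t) + t) ≤
      2 * (M + 1) * (T + 2) * (C * ρ ^ τ + t) := by
    push_cast
    have : (0 : ℝ) ≤ (M + 1) * (C * ρ ^ τ + (C * ρ ^ τ + t)) := by positivity
    nlinarith
  linarith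

lemma one_sub_le_spdaLaw_of_failure_le (herg : GeometricallyErgodic 𝓜 π C ρ ν) (hC : 0 ≤ C)
    (hρ0 : 0 ≤ ρ) (hρ1 : ρ < 1) (hcov : ∀ ω, (covariance 𝓜 φ π ν ω).PosDef) (hd : 0 < d)
    (hη : 0 < η) (hη' : 4 * η ≤ (evalConsts 𝓜 φ π ν C ρ hK).mu)
    {M N : ℕ} (hM : 0 < M) (hN : 0 < N) {l y δ ε : ℝ} (hl : 0 ≤ l)
    (hδ : (evalConsts 𝓜 φ π ν C ρ hK).failure ((N + 1) ^ d) M T η (C * ρ ^ τ) l y ≤ δ)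
    (hε : (evalConsts 𝓜 φ π ν C ρ hK).qBound M y (d * (2 / N)) +
      (evalConsts 𝓜 φ π ν C ρ hK).regret M ≤ ε) :
    1 - δ ≤ (spdaLaw 𝓜 φ π ω₀ alpha (evalConsts 𝓜 φ π ν C ρ hK).lam
      (evalConsts 𝓜 φ π ν C ρ hK).lam_pos s₀ η T (τ + 2) M).real
      {h | ∀ (s : S) (a : A) (k : Fin K),
        |vHat 𝓜 φ π ω₀ alpha (evalConsts 𝓜 φ π ν C ρ hK).lam
          (evalConsts 𝓜 φ π ν C ρ hK).lam_pos M h s - robustValue 𝓜 π s| ≤ ε ∧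
        |qHat φ alpha M h (s, a, k) - robustQ 𝓜 π (s, a, k)| ≤ ε} := by
  obtain ⟨ω', hopt⟩ := exists_isOptimalNature 𝓜 π
  -- Without actions the probabilities at `s₀` would sum to zero.
  obtain ⟨a₀⟩ : Nonempty A := by
    by_contra hA
    rw [not_nonempty_iff] at hA
    have := (π.prob_mem s₀).2
    simp at this
  obtain ⟨p, hp⟩ := exists_feature_net φ (s₀, a₀, ⟨0, by omega⟩) hN
  set q := evalConsts 𝓜 φ π ν C ρ hK with hq
  have hbad := spdaPrefix_not_goodHistory_le (ω₀ := ω₀) (s₀ := s₀) (hK := hK) (T := T) (τ := τ)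
    herg hC hρ0 hρ1 hcov hd hη hη' ω' p hM hl y
  have hcard : Fintype.card (Fin d → Fin (N + 1)) = (N + 1) ^ d := by simp
  rw [← hq, hcard] at hbad
  have hreg : 0 ≤ q.regret M := by
    have := q.B_pos
    unfold Consts.regret
    positivity
  set G := {h | ∀ (s : S) (a : A) (k : Fin K),
        |vHat 𝓜 φ π ω₀ alpha q.lam q.lam_pos M h s - robustValue 𝓜 π s| ≤ ε ∧
        |qHat φ alpha M h (s, a, k) - robustQ 𝓜 π (s, a, k)| ≤ ε} with hG
  have hsub : Gᶜ ⊆ {h | ¬ GoodHistory φ π ν ω₀ ω' q M p y h} := by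
    intro h hh hgood
    refine hh fun s a k => ⟨?_, ?_⟩
    · exact (hgood.abs_vHat_sub_robustValue_le herg hC hρ0 hρ1 hcov hd hM hopt hp s).trans hε
    · refine (hgood.abs_qHat_sub_robustQ_le herg hC hρ0 hρ1 hcov hd hM hopt hp (s, a, k)).trans ?_
      linarith
  have hprob : IsProbabilityMeasure (spdaLaw 𝓜 φ π ω₀ alpha q.lam q.lam_pos s₀ η T (τ + 2) M) :=
    inferInstanceAs (IsProbabilityMeasure
      (spdaPrefix 𝓜 φ π ω₀ alpha q.lam q.lam_pos s₀ η T (τ + 2) (M + 1)))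
  set P := spdaLaw 𝓜 φ π ω₀ alpha q.lam q.lam_pos s₀ η T (τ + 2) M with hP
  have h1 : P.real Gᶜ ≤ δ := by
    have hf : 0 ≤ q.failure ((N + 1) ^ d) M T η (C * ρ ^ τ) l y := by
      unfold Consts.failure
      positivity
    have h2 : P Gᶜ ≤ ENNReal.ofReal δ :=
      (measure_mono hsub).trans (hbad.trans (ENNReal.ofReal_le_ofReal hδ))
    exact ENNReal.toReal_le_of_le_ofReal (hf.trans hδ) h2
  -- Subadditivity suffices here, so `G`, an intersection over all states, need not be measurable.
  have h3 : (1 : ℝ) ≤ P.real G + P.real Gᶜ := by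
    have := measureReal_union_le (μ := P) G Gᶜ
    rwa [Set.union_compl_self, probReal_univ] at this
  linarith

end Probability

end RobustMDP
namespace RobustMDP
set_option linter.unusedSectionVars false

/-! ### Stepsize constants and the length of a TD run -/

section Parameters

/-- The properties of the constants of an evaluation problem with `d` features. -/
structure Consts.Admissible (q : Consts) (d : ℕ) : Prop where
  gamma_pos : 0 < q.γ
  gamma_lt_one : q.γ < 1
  C_pos : 0 < q.C
  rho_pos : 0 < q.ρ
  rho_lt_one : q.ρ < 1
  one_le_dim : (1 : ℝ) ≤ d
  mu_pos : 0 < q.mu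
  dim_mul_mu_le : d * q.mu ≤ 1
  L_nonneg : 0 ≤ q.L

namespace Consts

lemma one_le_B (q : Consts) : 1 ≤ q.B := by
  have := q.R_nonneg; have := q.εapprox_nonneg; unfold B; linarith

lemma R_le_B (q : Consts) : q.R + 1 ≤ q.B := by
  have := q.εapprox_nonneg; unfold B; linarith

lemma inv_le_Bbar (q : Consts) : 1 / (1 - q.γ) ≤ q.Bbar := by
  have := q.one_le_B; unfold Bbar; linarith

lemma half_le_log_K (q : Consts) : 1 / 2 ≤ Real.log q.K := by
  have h : (2 : ℝ) ≤ q.K := by exact_mod_cast q.two_le_K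
  have := Real.log_le_log (by norm_num) h
  linarith [Real.log_two_gt_d9]

/-- The limit of the parameter `nu` of temporal difference learning for long sampler runs. -/
noncomputable def nuLim (q : Consts) (M T : ℕ) (δ : ℝ) : ℝ :=
  min (q.mu / (q.L ^ 2 + 8)) (min (1 / (2 * q.U)) (1 / (4 * q.G M T δ)))

end Consts

variable {q : Consts} {d M T τ : ℕ} {δ ε : ℝ}

namespace Consts.Admissible

lemma mu_le_one (hq : q.Admissible d) : q.mu ≤ 1 :=
  (le_mul_of_one_le_left hq.mu_pos.le hq.one_le_dim).trans hq.dim_mul_mu_le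

lemma B_le_Bbar (hq : q.Admissible d) : q.B ≤ q.Bbar := by
  have : 0 < 1 / (1 - q.γ) := one_div_pos.2 (sub_pos.2 hq.gamma_lt_one)
  unfold Consts.Bbar; linarith

lemma one_le_Bbar (hq : q.Admissible d) : 1 ≤ q.Bbar := q.one_le_B.trans hq.B_le_Bbar

end Consts.Admissible

lemma two_le_log (hM : 0 < M) (hT : 0 < T) (hδ : δ ∈ Set.Ioo (0 : ℝ) 1) :
    2 ≤ Real.log (8 * M * T / δ) := by
  have hM' : (1 : ℝ) ≤ M := by exact_mod_cast hM
  have hT' : (1 : ℝ) ≤ T := by exact_mod_cast hT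
  have h8 : (8 : ℝ) ≤ 8 * M * T / δ := by
    rw [le_div_iff₀ hδ.1]
    nlinarith [hδ.2, mul_le_mul hM' hT' (by norm_num) (by linarith)]
  rw [Real.le_log_iff_exp_le (by linarith)]
  refine le_trans ?_ h8
  have h1 := Real.exp_one_lt_d9
  have h2 := Real.exp_pos 1
  have h3 : Real.exp 2 = Real.exp 1 * Real.exp 1 := by rw [← Real.exp_add]; norm_num
  rw [h3]
  nlinarith

namespace Consts.Admissible

lemma two_mul_C_le_G (hq : q.Admissible d) : 2 * q.C ≤ q.G M T δ := by
  refine le_trans ?_ (le_max_left _ _)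
  have := hq.C_pos
  have h1 : 1 ≤ 1 + q.γ := by linarith [hq.gamma_pos]
  have h2 : 1 ≤ q.R ^ 2 + 1 := by nlinarith [sq_nonneg q.R]
  calc 2 * q.C = 2 * 1 * q.C * 1 := by ring
    _ ≤ 2 * (1 + q.γ) * q.C * (q.R ^ 2 + 1) := by gcongr

lemma G_pos (hq : q.Admissible d) : 0 < q.G M T δ := by
  linarith [hq.two_mul_C_le_G (M := M) (T := T) (δ := δ), hq.C_pos]

lemma sqrt_log_mul_le_G (hq : q.Admissible d) :
    4 * Real.sqrt (Real.log (8 * M * T / δ)) * (4 * q.R ^ 2 + 3 * q.R + 3) ≤ q.G M T δ := by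
  refine le_trans ?_ (le_max_right _ _)
  have hL := hq.L_nonneg
  have : 0 ≤ q.L * (q.R ^ 2 + 1) := by positivity
  refine mul_le_mul_of_nonneg_left ?_ (by positivity)
  unfold Consts.U
  nlinarith

lemma nuLim_pos (hq : q.Admissible d) : 0 < q.nuLim M T δ := by
  have h1 := hq.mu_pos
  have h2 := hq.G_pos (M := M) (T := T) (δ := δ)
  have h3 : 0 < q.U := by have := q.R_nonneg; unfold Consts.U; linarith
  unfold Consts.nuLim
  refine lt_min (by positivity) (lt_min (by positivity) (by positivity))

lemma nuLim_le (hq : q.Admissible d) : q.nuLim M T δ ≤ q.mu / 8 := by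
  refine (min_le_left _ _).trans ?_
  refine div_le_div_of_nonneg_left hq.mu_pos.le (by norm_num) ?_
  nlinarith [sq_nonneg q.L]

lemma nuLim_mul_G_le (hq : q.Admissible d) : q.nuLim M T δ * (4 * q.G M T δ) ≤ 1 := by
  have h := hq.G_pos (M := M) (T := T) (δ := δ)
  rw [← le_div_iff₀ (by positivity)]
  exact (min_le_right _ _).trans (min_le_right _ _)

lemma nuLim_mul_C_le (hq : q.Admissible d) : q.nuLim M T δ * (8 * q.C) ≤ 1 := by
  refine le_trans ?_ (hq.nuLim_mul_G_le (M := M) (T := T) (δ := δ))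
  refine mul_le_mul_of_nonneg_left ?_ hq.nuLim_pos.le
  linarith [hq.two_mul_C_le_G (M := M) (T := T) (δ := δ)]

/-- From the second entry of `G` and `7 (8R + 6) ≤ 16 (4R² + 3R + 3)`. It keeps `ν (8R + 6)` below
`1 / (7 √log(8MT/δ))`, which is what the clipping bounds require. -/
lemma nuLim_mul_noise_le (hq : q.Admissible d) :
    7 * Real.sqrt (Real.log (8 * M * T / δ)) * (q.nuLim M T δ * (8 * q.R + 6)) ≤ 1 := by
  refine le_trans ?_ (hq.nuLim_mul_G_le (M := M) (T := T) (δ := δ))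
  have h1 := hq.sqrt_log_mul_le_G (M := M) (T := T) (δ := δ)
  have h2 := hq.nuLim_pos (M := M) (T := T) (δ := δ)
  have h3 := Real.sqrt_nonneg (Real.log (8 * M * T / δ))
  have h4 : 7 * (8 * q.R + 6) ≤ 16 * (4 * q.R ^ 2 + 3 * q.R + 3) := by
    nlinarith [sq_nonneg (16 * q.R - 1)]
  calc _ = q.nuLim M T δ * (Real.sqrt (Real.log (8 * M * T / δ)) * (7 * (8 * q.R + 6))) := by ring
    _ ≤ q.nuLim M T δ * (Real.sqrt (Real.log (8 * M * T / δ)) *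
        (16 * (4 * q.R ^ 2 + 3 * q.R + 3))) := by gcongr
    _ ≤ _ := by
      refine mul_le_mul_of_nonneg_left ?_ h2.le
      linarith

lemma muTilde_bounds (hq : q.Admissible d) (h : (1 + q.γ) * q.C * q.ρ ^ τ ≤ q.mu / 2) :
    q.mu / 2 ≤ q.muTilde τ ∧ q.muTilde τ ≤ q.mu := by
  have h1 : 0 ≤ (1 + q.γ) * q.C * q.ρ ^ τ := by
    have := hq.gamma_pos; have := hq.C_pos; have := hq.rho_pos
    positivity
  unfold Consts.muTilde
  constructor <;> linarith

/-- `μ̃` is within a factor two of `μ`. So `M` and `T` can be chosen through `nuLim`, before `τ`,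
and one choice serves all sufficiently large `τ`. -/
lemma nu_bounds (hq : q.Admissible d) (h : (1 + q.γ) * q.C * q.ρ ^ τ ≤ q.mu / 2) :
    q.nuLim M T δ / 2 ≤ q.nu M T τ δ ∧ q.nu M T τ δ ≤ q.nuLim M T δ := by
  obtain ⟨h1, h2⟩ := hq.muTilde_bounds h
  have h3 : (0 : ℝ) < q.L ^ 2 + 8 := by positivity
  have h4 := hq.nuLim_pos (M := M) (T := T) (δ := δ)
  unfold Consts.nu
  constructor
  · refine le_min ?_ ?_
    · have : q.nuLim M T δ ≤ q.mu / (q.L ^ 2 + 8) := min_le_left _ _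
      calc q.nuLim M T δ / 2 ≤ q.mu / (q.L ^ 2 + 8) / 2 := by linarith
        _ = q.mu / 2 / (q.L ^ 2 + 8) := by ring
        _ ≤ _ := div_le_div_of_nonneg_right h1 h3.le
    · have : q.nuLim M T δ ≤ min (1 / (2 * q.U)) (1 / (4 * q.G M T δ)) := min_le_right _ _
      linarith
  · exact min_le_min_right _ (div_le_div_of_nonneg_right h2 h3.le)

end Consts.Admissible

/-- The logarithmic factor in the number of iterations of temporal difference learning. -/
noncomputable def Consts.logBias (q : Consts) (ε : ℝ) : ℝ :=
  Real.log (Real.exp 1 + q.Bbar / ((1 - q.γ) * ε))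

lemma one_le_log_exp_add {x : ℝ} (hx : 0 ≤ x) : 1 ≤ Real.log (Real.exp 1 + x) := by
  rw [Real.le_log_iff_exp_le (by positivity)]
  linarith

lemma Consts.Admissible.one_le_logBias (hq : q.Admissible d) (hε : 0 < ε) :
    1 ≤ q.logBias ε := by
  have h1 := hq.one_le_Bbar
  have h2 : 0 < 1 - q.γ := sub_pos.2 hq.gamma_lt_one
  exact one_le_log_exp_add (by positivity)

/-- The number of iterations of temporal difference learning that suffices, as a function of the
number of iterations that enters the constants. -/
noncomputable def Consts.tdLength (q : Consts) (M T : ℕ) (δ ε : ℝ) : ℝ :=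
  1024 * q.logBias ε ^ 2 / (q.nuLim M T δ ^ 2 * q.mu ^ 2)

/-- For the least positive `n` with `f n ≤ n`, a positive predecessor `m` satisfies `m < f m ≤ f (m
+ 1)`. Hence `n ≤ f n + 1 ≤ 2 f n`. -/
lemma exists_nat_between {f : ℕ → ℝ} (h1 : ∀ n, 1 ≤ f n) (hmono : ∀ n, 0 < n → f n ≤ f (n + 1))
    (hex : ∃ n, 0 < n ∧ f n ≤ n) : ∃ n, 0 < n ∧ f n ≤ n ∧ (n : ℝ) ≤ 2 * f n := by
  classical
  obtain ⟨hn, hf⟩ := Nat.find_spec hex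
  refine ⟨Nat.find hex, hn, hf, ?_⟩
  have hmin := fun m => Nat.find_min (H := hex) (m := m)
  generalize Nat.find hex = n at hn hf hmin
  obtain ⟨m, rfl⟩ : ∃ m, n = m + 1 := ⟨n - 1, by omega⟩
  rcases Nat.eq_zero_or_pos m with rfl | hm
  · have := h1 (0 + 1)
    push_cast at *
    linarith
  · have h2 := hmin m (Nat.lt_succ_self m)
    have h3 : (m : ℝ) < f m := by
      by_contra hc
      exact h2 ⟨hm, not_lt.1 hc⟩
    have h4 := hmono m hm
    have h5 := h1 (m + 1)
    push_cast
    linarith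

lemma log_le_two_mul_sqrt {x : ℝ} (hx : 0 < x) : Real.log x ≤ 2 * Real.sqrt x := by
  have h1 := Real.log_le_sub_one_of_pos (Real.sqrt_pos.2 hx)
  rw [Real.log_sqrt hx.le] at h1
  linarith

lemma Consts.G_mono (q : Consts) (hL : 0 ≤ q.L) (hM : 0 < M) (hδ : 0 < δ) {n : ℕ} (hn : 0 < n) :
    q.G M n δ ≤ q.G M (n + 1) δ := by
  refine max_le_max_left _ ?_
  have hR := q.R_nonneg
  have hM' : (0 : ℝ) < M := by exact_mod_cast hM
  have hn' : (0 : ℝ) < n := by exact_mod_cast hn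
  refine mul_le_mul_of_nonneg_right ?_ (by unfold Consts.U; positivity)
  refine mul_le_mul_of_nonneg_left (Real.sqrt_le_sqrt (Real.log_le_log (by positivity) ?_))
    (by norm_num)
  push_cast
  gcongr
  linarith

lemma Consts.Admissible.one_div_nuLim_le (hq : q.Admissible d) :
    1 / q.nuLim M T δ ≤ (q.L ^ 2 + 8) / q.mu + 2 * q.U + 4 * q.G M T δ := by
  have h1 := hq.mu_pos
  have h2 := hq.G_pos (M := M) (T := T) (δ := δ)
  have h3 : 0 < q.U := by have := q.R_nonneg; unfold Consts.U; linarith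
  have h4 : 0 < (q.L ^ 2 + 8) / q.mu := by positivity
  rw [one_div_le hq.nuLim_pos (by positivity)]
  unfold Consts.nuLim
  refine le_min ?_ (le_min ?_ ?_)
  · have e : q.mu / (q.L ^ 2 + 8) = 1 / ((q.L ^ 2 + 8) / q.mu) := (one_div_div _ _).symm
    rw [e]
    exact one_div_le_one_div_of_le h4 (by linarith)
  · exact one_div_le_one_div_of_le (by positivity) (by linarith)
  · exact one_div_le_one_div_of_le (by positivity) (by linarith)

lemma Consts.tdLength_eq (q : Consts) (M T : ℕ) (δ ε : ℝ) :
    q.tdLength M T δ ε = 1024 * q.logBias ε ^ 2 / q.mu ^ 2 * (1 / q.nuLim M T δ) ^ 2 := by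
  unfold Consts.tdLength
  generalize q.logBias ε = x
  generalize q.nuLim M T δ = y
  rw [div_pow, one_pow, div_mul_div_comm, mul_one, mul_comm (q.mu ^ 2)]

lemma Consts.Admissible.exists_tdLength_le (hq : q.Admissible d) (hM : 0 < M)
    (hδ : δ ∈ Set.Ioo (0 : ℝ) 1) :
    ∃ D : ℝ, 0 ≤ D ∧ ∀ n : ℕ, 0 < n → q.tdLength M n δ ε ≤ D * Real.sqrt n := by
  have hmu := hq.mu_pos
  have hM' : (0 : ℝ) < M := by exact_mod_cast hM
  have hR := q.R_nonneg
  have hL := hq.L_nonneg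
  have hU : 0 < q.U := by unfold Consts.U; linarith
  have hk0 : 0 < 8 * (M : ℝ) / δ := div_pos (by positivity) hδ.1
  have hc₁0 : 0 ≤ 2 * (1 + q.γ) * q.C * (q.R ^ 2 + 1) := by
    have := hq.gamma_pos; have := hq.C_pos
    positivity
  have hc₂0 : 0 ≤ (q.L + 2) * (q.R ^ 2 + 1) + q.U * (q.R + 1) := by positivity
  have hG : ∀ n : ℕ, q.G M n δ ≤ 2 * (1 + q.γ) * q.C * (q.R ^ 2 + 1) +
      4 * Real.sqrt (Real.log (8 * M * n / δ)) *
        ((q.L + 2) * (q.R ^ 2 + 1) + q.U * (q.R + 1)) := fun n =>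
    max_le (le_add_of_nonneg_right (by positivity)) (le_add_of_nonneg_left hc₁0)
  generalize hc₁ : 2 * (1 + q.γ) * q.C * (q.R ^ 2 + 1) = c₁ at *
  generalize hc₂ : (q.L + 2) * (q.R ^ 2 + 1) + q.U * (q.R + 1) = c₂ at *
  have ha₀0 : 0 ≤ (q.L ^ 2 + 8) / q.mu + 2 * q.U + 4 * c₁ := by positivity
  have hinv : ∀ n : ℕ, 1 / q.nuLim M n δ ≤ (q.L ^ 2 + 8) / q.mu + 2 * q.U + 4 * c₁ +
      16 * c₂ * Real.sqrt (Real.log (8 * M * n / δ)) := fun n => by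
    have h1 := hq.one_div_nuLim_le (M := M) (T := n) (δ := δ)
    have h2 := hG n
    linarith
  generalize ha₀ : (q.L ^ 2 + 8) / q.mu + 2 * q.U + 4 * c₁ = a₀ at *
  refine ⟨1024 * q.logBias ε ^ 2 / q.mu ^ 2 * (2 * a₀ ^ 2 + 2 * (16 * c₂) ^ 2 *
      (2 * Real.sqrt (8 * M / δ))), by positivity, fun n hn => ?_⟩
  have hsn : 1 ≤ Real.sqrt n := Real.one_le_sqrt.2 (by exact_mod_cast hn)
  have hlog : Real.sqrt (Real.log (8 * M * n / δ)) ^ 2 ≤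
      2 * (Real.sqrt (8 * M / δ) * Real.sqrt n) := by
    have hn' : (0 : ℝ) < n := by exact_mod_cast hn
    rw [Real.sq_sqrt (by linarith [two_le_log hM hn hδ]), ← Real.sqrt_mul hk0.le]
    refine (log_le_two_mul_sqrt (div_pos (by positivity) hδ.1)).trans (le_of_eq ?_)
    congr 2
    ring
  have hinv0 : 0 ≤ 1 / q.nuLim M n δ := (one_div_pos.2 hq.nuLim_pos).le
  have hin := hinv n
  rw [Consts.tdLength_eq, mul_assoc]
  refine mul_le_mul_of_nonneg_left ?_ (by positivity)
  generalize 1 / q.nuLim M n δ = z at *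
  generalize Real.sqrt (Real.log (8 * M * n / δ)) = a at *
  generalize Real.sqrt (8 * M / δ) = b at *
  generalize Real.sqrt n = r at *
  calc z ^ 2 ≤ (a₀ + 16 * c₂ * a) ^ 2 := pow_le_pow_left₀ hinv0 hin 2
    _ ≤ 2 * a₀ ^ 2 + 2 * (16 * c₂) ^ 2 * a ^ 2 := by
      nlinarith [sq_nonneg (a₀ - 16 * c₂ * a)]
    _ ≤ 2 * a₀ ^ 2 * r + 2 * (16 * c₂) ^ 2 * (2 * (b * r)) := by
      refine add_le_add ?_ (mul_le_mul_of_nonneg_left hlog (by positivity))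
      exact le_mul_of_one_le_right (by positivity) hsn
    _ = _ := by ring

/-- The required length depends on `T` through the logarithm in `G`, so `T` is defined implicitly.
Sublinear growth makes the condition solvable, and minimality gives the converse bound up to a
factor two. -/
lemma Consts.Admissible.exists_tdLength (hq : q.Admissible d) (hM : 0 < M)
    (hδ : δ ∈ Set.Ioo (0 : ℝ) 1) (hε : 0 < ε) :
    ∃ T, 0 < T ∧ q.tdLength M T δ ε ≤ T ∧ (T : ℝ) ≤ 2 * q.tdLength M T δ ε := by
  have hX := hq.one_le_logBias hε
  have hmu := hq.mu_pos
  have hmu1 := hq.mu_le_one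
  refine exists_nat_between (f := fun T => q.tdLength M T δ ε) (fun T => ?_) (fun T hT => ?_) ?_
  · have h1 := hq.nuLim_pos (M := M) (T := T) (δ := δ)
    have h2 := hq.nuLim_le (M := M) (T := T) (δ := δ)
    unfold Consts.tdLength
    rw [le_div_iff₀ (by positivity), one_mul]
    have h3 : q.nuLim M T δ ^ 2 ≤ 1 := pow_le_one₀ h1.le (by linarith)
    have h4 : q.mu ^ 2 ≤ 1 := pow_le_one₀ hmu.le hmu1
    have h5 : 1 ≤ q.logBias ε ^ 2 := one_le_pow₀ hX
    have h6 := mul_le_one₀ h3 (by positivity) h4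
    linarith
  · have h1 := hq.nuLim_pos (M := M) (T := T + 1) (δ := δ)
    have h2 : q.nuLim M (T + 1) δ ≤ q.nuLim M T δ := by
      refine min_le_min_left _ (min_le_min_left _ ?_)
      refine one_div_le_one_div_of_le ?_ ?_
      · have := hq.G_pos (M := M) (T := T) (δ := δ)
        positivity
      · linarith [q.G_mono hq.L_nonneg hM hδ.1 hT]
    show q.tdLength M T δ ε ≤ q.tdLength M (T + 1) δ ε
    unfold Consts.tdLength
    gcongr
  · obtain ⟨D, hD0, hD⟩ := hq.exists_tdLength_le (ε := ε) hM hδ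
    -- `D √n ≤ n` as soon as `D² ≤ n`.
    refine ⟨⌈D ^ 2⌉₊ + 1, by omega, (hD (⌈D ^ 2⌉₊ + 1) (by omega)).trans ?_⟩
    have hnD : D ^ 2 ≤ ((⌈D ^ 2⌉₊ + 1 : ℕ) : ℝ) := by
      push_cast
      linarith [Nat.le_ceil (D ^ 2)]
    generalize ⌈D ^ 2⌉₊ + 1 = n at *
    calc D * Real.sqrt n ≤ Real.sqrt n * Real.sqrt n :=
          mul_le_mul_of_nonneg_right (Real.le_sqrt_of_sq_le hnD) (Real.sqrt_nonneg _)
      _ = n := Real.mul_self_sqrt (Nat.cast_nonneg n)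

end Parameters

end RobustMDP
namespace RobustMDP
set_option linter.unusedSectionVars false

/-! ### Accuracy and failure probability for the chosen parameters -/

section Accuracy

variable {q : Consts} {d M T τ : ℕ} {δ ε : ℝ}

namespace Consts.Admissible

lemma logBias_le_sqrt (hq : q.Admissible d) (hε : 0 < ε) (hT : q.tdLength M T δ ε ≤ T) :
    32 * q.logBias ε ≤ Real.sqrt T * (q.nuLim M T δ * q.mu) := by
  have h1 := hq.nuLim_pos (M := M) (T := T) (δ := δ)
  have h2 := hq.mu_pos
  have h3 := hq.one_le_logBias hε
  rw [← div_le_iff₀ (by positivity)]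
  refine Real.le_sqrt_of_sq_le (le_trans (le_of_eq ?_) hT)
  unfold Consts.tdLength
  rw [div_pow, mul_pow, mul_pow]
  norm_num

lemma eta_pos (hq : q.Admissible d) (hT0 : 0 < T)
    (h : (1 + q.γ) * q.C * q.ρ ^ τ ≤ q.mu / 2) : 0 < q.eta M T τ δ := by
  have h1 := hq.nuLim_pos (M := M) (T := T) (δ := δ)
  have h2 := (hq.nu_bounds (M := M) (T := T) (δ := δ) h).1
  have h3 : 0 < Real.sqrt T := Real.sqrt_pos.2 (by exact_mod_cast hT0)
  exact div_pos (by linarith) h3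

lemma eta_mul_sqrt_le (hq : q.Admissible d) (hT0 : 0 < T)
    (h : (1 + q.γ) * q.C * q.ρ ^ τ ≤ q.mu / 2) :
    q.eta M T τ δ * Real.sqrt T ≤ q.nuLim M T δ ∧
      q.nuLim M T δ / 2 ≤ q.eta M T τ δ * Real.sqrt T := by
  have h3 : 0 < Real.sqrt T := Real.sqrt_pos.2 (by exact_mod_cast hT0)
  have e : q.eta M T τ δ * Real.sqrt T = q.nu M T τ δ := div_mul_cancel₀ _ h3.ne'
  rw [e]
  exact ⟨(hq.nu_bounds h).2, (hq.nu_bounds h).1⟩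

lemma four_mul_eta_le (hq : q.Admissible d) (hT0 : 0 < T)
    (h : (1 + q.γ) * q.C * q.ρ ^ τ ≤ q.mu / 2) : 4 * q.eta M T τ δ ≤ q.mu := by
  have h1 := (hq.eta_mul_sqrt_le (M := M) (δ := δ) hT0 h).1
  have h2 : 1 ≤ Real.sqrt T := Real.one_le_sqrt.2 (by exact_mod_cast hT0)
  have h3 := le_mul_of_one_le_right (hq.eta_pos (M := M) (δ := δ) hT0 h).le h2
  have h4 := hq.nuLim_le (M := M) (T := T) (δ := δ)
  have := hq.mu_pos
  linarith

lemma variance_pos (hq : q.Admissible d) (hT0 : 0 < T)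
    (h : (1 + q.γ) * q.C * q.ρ ^ τ ≤ q.mu / 2) : 0 < q.variance (q.eta M T τ δ) := by
  have h1 := hq.eta_pos (M := M) (δ := δ) hT0 h
  have h2 := hq.mu_pos
  have h3 := q.R_nonneg
  unfold Consts.variance
  positivity

/-- `η √T ≤ ν` and `√T ν μ ≥ 32`, so `η ≤ ν² μ / 32`. -/
lemma variance_le (hq : q.Admissible d) (hε : 0 < ε) (hT0 : 0 < T)
    (hT : q.tdLength M T δ ε ≤ T) (h : (1 + q.γ) * q.C * q.ρ ^ τ ≤ q.mu / 2) :
    32 * q.variance (q.eta M T τ δ) ≤ (q.nuLim M T δ * (8 * q.R + 6)) ^ 2 := by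
  have h1 := (hq.eta_mul_sqrt_le (M := M) (δ := δ) hT0 h).1
  have h2 := hq.mu_pos
  have h3 := hq.logBias_le_sqrt hε hT
  have h4 := hq.one_le_logBias hε
  have h5 := hq.eta_pos (M := M) (δ := δ) hT0 h
  have h6 : 0 < Real.sqrt T := Real.sqrt_pos.2 (by exact_mod_cast hT0)
  have h7 := hq.nuLim_pos (M := M) (T := T) (δ := δ)
  unfold Consts.variance
  rw [mul_pow, ← mul_div_assoc, div_le_iff₀ h2, ← mul_assoc, mul_right_comm _ _ q.mu]
  refine mul_le_mul_of_nonneg_right ?_ (sq_nonneg _)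
  generalize q.eta M T τ δ = η at *
  generalize q.nuLim M T δ = x at *
  generalize Real.sqrt (T : ℝ) = r at *
  have h8 : 32 ≤ r * (x * q.mu) := by linarith
  calc 32 * η ≤ r * (x * q.mu) * η := mul_le_mul_of_nonneg_right h8 h5.le
    _ = (η * r) * (x * q.mu) := by ring
    _ ≤ x * (x * q.mu) := mul_le_mul_of_nonneg_right h1 (by positivity)
    _ = x ^ 2 * q.mu := by ring

/-- This makes the tail `exp (-1/(2σ))` at most `(δ / (8MT))²`, small enough for a union bound over
all steps of all runs. -/
lemma variance_mul_log_le (hq : q.Admissible d) (hM : 0 < M) (hδ : δ ∈ Set.Ioo (0 : ℝ) 1)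
    (hε : 0 < ε) (hT0 : 0 < T) (hT : q.tdLength M T δ ε ≤ T)
    (h : (1 + q.γ) * q.C * q.ρ ^ τ ≤ q.mu / 2) :
    4 * q.variance (q.eta M T τ δ) * Real.log (8 * M * T / δ) ≤ 1 := by
  have h1 := hq.variance_le hε hT0 hT h
  have h2 := hq.nuLim_mul_noise_le (M := M) (T := T) (δ := δ)
  have h3 := two_le_log hM hT0 hδ
  have h4 : Real.sqrt (Real.log (8 * M * T / δ)) ^ 2 = Real.log (8 * M * T / δ) :=
    Real.sq_sqrt (by linarith)
  have h5 := Real.sqrt_nonneg (Real.log (8 * M * T / δ))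
  have h6 := hq.nuLim_pos (M := M) (T := T) (δ := δ)
  have h7 : 0 ≤ q.nuLim M T δ * (8 * q.R + 6) := by have := q.R_nonneg; positivity
  rw [← h4]
  generalize q.nuLim M T δ * (8 * q.R + 6) = w at *
  generalize Real.sqrt (Real.log (8 * M * T / δ)) = a at *
  have h8 : (7 * a * w) ^ 2 ≤ 1 := pow_le_one₀ (by positivity) h2
  nlinarith [mul_le_mul_of_nonneg_right h1 (sq_nonneg a)]

/-- `ν ≤ μ/8` and `d μ ≤ 1` give `d ν ≤ 1/8`. The variance proxy is quadratic in `ν`: one factor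
absorbs the dimension, the other the remaining `8R + 6`. -/
lemma dim_mul_variance_le (hq : q.Admissible d) (hM : 0 < M) (hδ : δ ∈ Set.Ioo (0 : ℝ) 1)
    (hε : 0 < ε) (hT0 : 0 < T) (hT : q.tdLength M T δ ε ≤ T)
    (h : (1 + q.γ) * q.C * q.ρ ^ τ ≤ q.mu / 2) :
    d * q.variance (q.eta M T τ δ) ≤ q.B / 224 := by
  have h1 := hq.variance_le hε hT0 hT h
  have h2 := hq.nuLim_mul_noise_le (M := M) (T := T) (δ := δ)
  have h3 := two_le_log hM hT0 hδ
  have h4 : 1 ≤ Real.sqrt (Real.log (8 * M * T / δ)) := Real.one_le_sqrt.2 (by linarith)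
  have h5 := hq.nuLim_pos (M := M) (T := T) (δ := δ)
  have h6 := hq.nuLim_le (M := M) (T := T) (δ := δ)
  have hR := q.R_nonneg
  have h7 : 8 * q.R + 6 ≤ 8 * q.B := by linarith [q.R_le_B]
  have hd := hq.one_le_dim
  have h8 : d * q.nuLim M T δ ≤ 1 / 8 := by
    have := mul_le_mul_of_nonneg_left h6 (by linarith : (0 : ℝ) ≤ d)
    linarith [hq.dim_mul_mu_le]
  have h9 : 7 * (q.nuLim M T δ * (8 * q.R + 6)) ≤ 1 := by
    refine le_trans ?_ h2
    have h10 : 0 ≤ q.nuLim M T δ * (8 * q.R + 6) := by positivity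
    nlinarith
  generalize q.nuLim M T δ = x at *
  have h11 : d * (x * (8 * q.R + 6)) ^ 2 ≤ 1 / 8 * (8 * q.B) * (1 / 7) := by
    calc d * (x * (8 * q.R + 6)) ^ 2 = (d * x) * (8 * q.R + 6) * (x * (8 * q.R + 6)) := by ring
      _ ≤ 1 / 8 * (8 * q.B) * (1 / 7) := by
        refine mul_le_mul (mul_le_mul h8 h7 (by positivity) (by norm_num)) (by linarith)
          (by positivity) ?_
        linarith [q.one_le_B]
  have h12 := mul_le_mul_of_nonneg_left h1 (by linarith : (0 : ℝ) ≤ d)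
  linarith

/-- The contraction over a run is at most `exp (-η μ T / 2)`, and the choice of `T` makes this at
most `exp (-8 X)` with `X = logBias`. One `X` pays for `Bbar / ((1 - γ) ε)`, and the others, being
at least one each, for the factor `32`. Only a logarithm in `1/ε` is spent on the bias. -/
lemma bias_le (hq : q.Admissible d) (hε : 0 < ε) (hT0 : 0 < T)
    (hT : q.tdLength M T δ ε ≤ T) (h : (1 + q.γ) * q.C * q.ρ ^ τ ≤ q.mu / 2) :
    Real.sqrt (1 - q.eta M T τ δ * q.mu) ^ (T + 1) * q.R * (2 / (1 - q.γ)) ≤ ε / 16 := by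
  have h1 := (hq.eta_mul_sqrt_le (M := M) (δ := δ) hT0 h).2
  have h2 := hq.mu_pos
  have h3 := hq.logBias_le_sqrt hε hT
  have h4 := hq.one_le_logBias hε
  have h5 := hq.eta_pos (M := M) (δ := δ) hT0 h
  have hγ : 0 < 1 - q.γ := sub_pos.2 hq.gamma_lt_one
  have hB := hq.one_le_Bbar
  have hRB : q.R ≤ q.Bbar := by linarith [q.R_le_B, hq.B_le_Bbar]
  have h6 : Real.sqrt (1 - q.eta M T τ δ * q.mu) ^ (T + 1) ≤ Real.exp (-(8 * q.logBias ε)) := by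
    generalize q.eta M T τ δ = η at *
    have h7 : Real.sqrt (1 - η * q.mu) ≤ Real.exp (-(η * q.mu / 2)) := by
      refine Real.sqrt_le_iff.2 ⟨(Real.exp_pos _).le, ?_⟩
      rw [sq, ← Real.exp_add]
      refine le_trans (le_of_eq ?_) (Real.add_one_le_exp _)
      ring
    have h8 : Real.sqrt (1 - η * q.mu) ≤ 1 :=
      Real.sqrt_le_one.2 (by have : 0 < η * q.mu := by positivity
                             linarith)
    calc Real.sqrt (1 - η * q.mu) ^ (T + 1) ≤ Real.sqrt (1 - η * q.mu) ^ T :=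
          pow_le_pow_of_le_one (Real.sqrt_nonneg _) h8 (Nat.le_succ T)
      _ ≤ Real.exp (-(η * q.mu / 2)) ^ T := pow_le_pow_left₀ (Real.sqrt_nonneg _) h7 T
      _ = Real.exp (T * -(η * q.mu / 2)) := (Real.exp_nat_mul _ T).symm
      _ ≤ Real.exp (-(8 * q.logBias ε)) := by
        refine Real.exp_le_exp.2 ?_
        have e : (T : ℝ) = Real.sqrt T * Real.sqrt T := (Real.mul_self_sqrt (Nat.cast_nonneg T)).symm
        have h9 := Real.sqrt_nonneg (T : ℝ)
        rw [e]
        generalize Real.sqrt (T : ℝ) = r at *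
        have h10 := mul_le_mul_of_nonneg_right h1 (mul_nonneg h9 h2.le)
        nlinarith
  have h7 : Real.exp (-(8 * q.logBias ε)) ≤ (1 - q.γ) * ε / q.Bbar / 32 := by
    have e1 : Real.exp (q.logBias ε) = Real.exp 1 + q.Bbar / ((1 - q.γ) * ε) :=
      Real.exp_log (by positivity)
    have e2 : (32 : ℝ) ≤ Real.exp 7 := by
      have h1 := Real.exp_one_gt_d9
      have e3 : Real.exp 7 = Real.exp 1 ^ 7 := by rw [← Real.exp_nat_mul]; norm_num
      rw [e3]
      calc (32 : ℝ) ≤ 2 ^ 7 := by norm_num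
        _ ≤ _ := pow_le_pow_left₀ (by norm_num) (by linarith) 7
    have e4 : q.Bbar / ((1 - q.γ) * ε) * 32 ≤ Real.exp (8 * q.logBias ε) := by
      calc q.Bbar / ((1 - q.γ) * ε) * 32 ≤ Real.exp (q.logBias ε) * Real.exp 7 := by
            refine mul_le_mul ?_ e2 (by norm_num) (Real.exp_pos _).le
            rw [e1]; linarith [Real.exp_pos 1]
        _ = Real.exp (q.logBias ε + 7) := (Real.exp_add _ _).symm
        _ ≤ _ := Real.exp_le_exp.2 (by linarith)
    rw [Real.exp_neg]
    refine (inv_anti₀ (by positivity) e4).trans (le_of_eq ?_)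
    rw [mul_inv, inv_div, div_eq_mul_inv _ (32 : ℝ)]
  calc Real.sqrt (1 - q.eta M T τ δ * q.mu) ^ (T + 1) * q.R * (2 / (1 - q.γ))
      ≤ (1 - q.γ) * ε / q.Bbar / 32 * q.Bbar * (2 / (1 - q.γ)) := by
        refine mul_le_mul_of_nonneg_right ?_ (by positivity)
        exact mul_le_mul (h6.trans h7) hRB q.R_nonneg (by positivity)
    _ = ε / 16 := by field_simp; ring

end Consts.Admissible

/-- The argument of the logarithmic factor that does not depend on the parameters. -/
noncomputable def Consts.scale (q : Consts) (δ ε : ℝ) : ℝ :=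
  Real.exp 1 + q.Bbar + 1 / δ + 1 / ε + 1 / q.mu

/-- The number of iterations of dual averaging that suffices, up to rounding. -/
noncomputable def Consts.daLength (q : Consts) (δ ε : ℝ) : ℝ :=
  20000 * (q.Bbar ^ 2 * Real.log q.K / ((1 - q.γ) ^ 2 * ε ^ 2)) * Real.log (q.scale δ ε)

namespace Consts.Admissible

lemma scale_bounds (hq : q.Admissible d) (hδ : δ ∈ Set.Ioo (0 : ℝ) 1) (hε : 0 < ε) :
    27 / 10 ≤ q.scale δ ε ∧ 1 ≤ Real.log (q.scale δ ε) ∧ q.Bbar ≤ q.scale δ ε ∧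
      1 / δ ≤ q.scale δ ε ∧ 1 / ε ≤ q.scale δ ε ∧ 1 / q.mu ≤ q.scale δ ε := by
  have h1 := hq.one_le_Bbar
  have h2 := one_div_pos.2 hδ.1
  have h3 := one_div_pos.2 hε
  have h4 := one_div_pos.2 hq.mu_pos
  have h5 := Real.exp_one_gt_d9
  unfold Consts.scale
  refine ⟨by linarith, ?_, by linarith, by linarith, by linarith, by linarith⟩
  have := one_le_log_exp_add (x := q.Bbar + 1 / δ + 1 / ε + 1 / q.mu) (by linarith)
  simpa only [← add_assoc] using this

/-- `136 = 4 * 34` and `136² ≤ 20000`, the constant of `daLength`. -/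
lemma regret_le (hq : q.Admissible d) (hδ : δ ∈ Set.Ioo (0 : ℝ) 1) (hε : 0 < ε)
    (hM : q.daLength δ ε ≤ M) : q.regret M ≤ (1 - q.γ) * ε / 4 := by
  have hγ : 0 < 1 - q.γ := sub_pos.2 hq.gamma_lt_one
  have hl := (hq.scale_bounds hδ hε).2.1
  have hB := q.one_le_B
  have hBB := hq.B_le_Bbar
  have hK := q.half_le_log_K
  have h1 : (136 * q.B * Real.sqrt (Real.log q.K) / ((1 - q.γ) * ε)) ^ 2 ≤ M := by
    refine le_trans ?_ hM
    rw [div_pow, mul_pow, mul_pow, mul_pow, Real.sq_sqrt (by linarith)]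
    unfold Consts.daLength
    have h2 : q.B ^ 2 ≤ q.Bbar ^ 2 := pow_le_pow_left₀ (by linarith) hBB 2
    calc 136 ^ 2 * q.B ^ 2 * Real.log q.K / ((1 - q.γ) ^ 2 * ε ^ 2)
        ≤ 20000 * q.Bbar ^ 2 * Real.log q.K / ((1 - q.γ) ^ 2 * ε ^ 2) := by
          gcongr
          norm_num
      _ = 20000 * (q.Bbar ^ 2 * Real.log q.K / ((1 - q.γ) ^ 2 * ε ^ 2)) := by ring
      _ ≤ _ := le_mul_of_one_le_right (by positivity) hl
  have h2 := Real.le_sqrt_of_sq_le h1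
  have h3 : 0 < 136 * q.B * Real.sqrt (Real.log q.K) / ((1 - q.γ) * ε) := by
    have : 0 < Real.sqrt (Real.log q.K) := Real.sqrt_pos.2 (by linarith)
    positivity
  unfold Consts.regret
  rw [div_le_iff₀ (h3.trans_le h2)]
  have h4 := mul_le_mul_of_nonneg_left h2 (by positivity : 0 ≤ (1 - q.γ) * ε / 4)
  refine le_trans (le_of_eq ?_) h4
  field_simp
  ring

/-- The budget in units of `ε/8`: three for the approximation error, two for `regret / (1 - γ)`, two
for `2y`, one for the net. -/
lemma qBound_add_regret_le (hq : q.Admissible d) (hδ : δ ∈ Set.Ioo (0 : ℝ) 1) (hε : 0 < ε)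
    (hεa : 8 * q.εapprox / (1 - q.γ) ≤ ε) (hM : q.daLength δ ε ≤ M) {κ : ℝ}
    (hκ : κ * (3 * q.R + 1) ≤ ε / 8) : q.qBound M (ε / 8) κ + q.regret M ≤ ε := by
  have hγ : 0 < 1 - q.γ := sub_pos.2 hq.gamma_lt_one
  have h1 := hq.regret_le hδ hε hM
  have hr : q.γ / (1 - q.γ) + 1 = 1 / (1 - q.γ) := by field_simp; ring
  have hg : 0 ≤ q.γ / (1 - q.γ) := div_nonneg hq.gamma_pos.le hγ.le
  have h2 : q.γ / (1 - q.γ) * q.regret M + q.regret M ≤ ε / 4 := by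
    have e : q.γ / (1 - q.γ) * q.regret M + q.regret M = q.regret M / (1 - q.γ) := by
      rw [div_eq_mul_one_div (q.regret M), ← hr]; ring
    rw [e, div_le_iff₀ hγ]
    linarith
  have h3 : q.εapprox * (3 + 2 * (q.γ / (1 - q.γ))) ≤ 3 * (ε / 8) := by
    have e : 8 * q.εapprox / (1 - q.γ) = 8 * (q.εapprox * (q.γ / (1 - q.γ) + 1)) := by
      rw [hr]; ring
    rw [e] at hεa
    have := mul_nonneg q.εapprox_nonneg hg
    linarith
  unfold Consts.qBound
  linarith

/-- The number of cells per coordinate in the discretization of the features. -/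
lemma exists_net_size (hq : q.Admissible d) (hδ : δ ∈ Set.Ioo (0 : ℝ) 1) (hε : 0 < ε) :
    ∃ N : ℕ, 0 < N ∧ d * (2 / (N : ℝ)) * (3 * q.R + 1) ≤ ε / 8 ∧
      ((N + 1 : ℕ) : ℝ) ≤ Real.exp (8 * Real.log (q.scale δ ε)) := by
  obtain ⟨hW, hl, hWB, hWδ, hWε, hWμ⟩ := hq.scale_bounds hδ hε
  have hR := q.R_nonneg
  have hd := hq.one_le_dim
  have hpos : 0 < 16 * d * (3 * q.R + 1) / ε := by positivity
  -- This size achieves the mesh, and it is polynomial in `scale` because `d ≤ 1/μ`.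
  refine ⟨⌈16 * d * (3 * q.R + 1) / ε⌉₊, Nat.ceil_pos.2 hpos, ?_, ?_⟩
  · have h1 := Nat.le_ceil (16 * d * (3 * q.R + 1) / ε)
    have h2 := hpos.trans_le h1
    rw [div_le_iff₀ hε] at h1
    rw [mul_div_assoc', div_mul_eq_mul_div, div_le_iff₀ h2]
    linarith
  · have h1 := (Nat.ceil_lt_add_one hpos.le).le
    have h2 : (d : ℝ) ≤ q.scale δ ε := by
      refine le_trans ?_ hWμ
      rw [le_div_iff₀ hq.mu_pos]
      exact hq.dim_mul_mu_le
    have h3 : 3 * q.R + 1 ≤ 3 * q.scale δ ε := by linarith [q.R_le_B, hq.B_le_Bbar]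
    have e1 : Real.exp (8 * Real.log (q.scale δ ε)) = q.scale δ ε ^ 8 := by
      have := Real.exp_nat_mul (Real.log (q.scale δ ε)) 8
      rw [Real.exp_log (by linarith)] at this
      exact_mod_cast this
    rw [e1]
    have h4 : 16 * d * (3 * q.R + 1) / ε ≤ 48 * q.scale δ ε ^ 3 := by
      calc 16 * d * (3 * q.R + 1) / ε = 16 * d * (3 * q.R + 1) * (1 / ε) := by ring
        _ ≤ 16 * q.scale δ ε * (3 * q.scale δ ε) * q.scale δ ε := by gcongr
        _ = _ := by ring
    push_cast
    generalize q.scale δ ε = W at *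
    have h5 : (27 / 10 : ℝ) ^ 5 ≤ W ^ 5 := pow_le_pow_left₀ (by norm_num) hW 5
    have h6 : (27 / 10 : ℝ) ^ 3 ≤ W ^ 3 := pow_le_pow_left₀ (by norm_num) hW 3
    have h7 : W ^ 8 = W ^ 5 * W ^ 3 := by ring
    nlinarith

/-- Write `b = 2/(1 - γ)` and `y = ε/8`. The bias uses at most half of `y`, and `l = M y / (4 σ b²)`
is the optimal Chernoff parameter for the other half; the exponent becomes `-M ε² (1 - γ)² / (4096
σ)`. It has to beat `8 d ℓ` for the net and `4 ℓ` for `δ`, where `ℓ` is the logarithm of `scale`.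
Since `d σ ≤ B/224`, the choice of `M` does this without any factor `d`. -/
lemma union_bound_le (hq : q.Admissible d) (hδ : δ ∈ Set.Ioo (0 : ℝ) 1) (hε : 0 < ε)
    (hM0 : 0 < M) (hM : q.daLength δ ε ≤ M) {N : ℕ}
    (hN : ((N + 1 : ℕ) : ℝ) ≤ Real.exp (8 * Real.log (q.scale δ ε))) {σ β : ℝ} (hσ : 0 < σ)
    (hdσ : d * σ ≤ q.B / 224) (hbias : β * (2 / (1 - q.γ)) ≤ ε / 16) :
    3 * (((N + 1) ^ d : ℕ) : ℝ) * Real.exp (σ * (M * (ε / 8) /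
      (4 * σ * (2 / (1 - q.γ)) ^ 2) * (2 / (1 - q.γ))) ^ 2 / M +
      β * (M * (ε / 8) / (4 * σ * (2 / (1 - q.γ)) ^ 2) * (2 / (1 - q.γ))) -
      M * (ε / 8) / (4 * σ * (2 / (1 - q.γ)) ^ 2) * (ε / 8)) ≤ δ / 4 := by
  have hγ : 0 < 1 - q.γ := sub_pos.2 hq.gamma_lt_one
  have hM' : (1 : ℝ) ≤ M := by exact_mod_cast hM0
  obtain ⟨hW, hl, hWB, hWδ, hWε, hWμ⟩ := hq.scale_bounds hδ hε
  set ℓ := Real.log (q.scale δ ε) with hℓ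
  have hexp : σ * (M * (ε / 8) / (4 * σ * (2 / (1 - q.γ)) ^ 2) * (2 / (1 - q.γ))) ^ 2 / M +
      β * (M * (ε / 8) / (4 * σ * (2 / (1 - q.γ)) ^ 2) * (2 / (1 - q.γ))) -
      M * (ε / 8) / (4 * σ * (2 / (1 - q.γ)) ^ 2) * (ε / 8) ≤ -(4 * ℓ) - d * (8 * ℓ) := by
    have hl0 : 0 ≤ M * (ε / 8) / (4 * σ * (2 / (1 - q.γ)) ^ 2) := by positivity
    have e1 : σ * (M * (ε / 8) / (4 * σ * (2 / (1 - q.γ)) ^ 2) * (2 / (1 - q.γ))) ^ 2 / M =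
        M * (ε / 8) / (4 * σ * (2 / (1 - q.γ)) ^ 2) * (ε / 32) := by
      field_simp
      ring
    have e2 := mul_le_mul_of_nonneg_left hbias hl0
    have e3 : M * (ε / 8) / (4 * σ * (2 / (1 - q.γ)) ^ 2) * (ε / 32) =
        M * (ε ^ 2 * (1 - q.γ) ^ 2) / (4096 * σ) := by
      field_simp
      ring
    have e4 : σ * (4 * ℓ + d * (8 * ℓ)) ≤ M * (ε ^ 2 * (1 - q.γ) ^ 2) / 4096 := by
      have hσd : σ ≤ d * σ := le_mul_of_one_le_left hσ.le hq.one_le_dim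
      have f1 : σ * (4 * ℓ + d * (8 * ℓ)) ≤ 12 * (q.B / 224) * ℓ := by
        have : 4 * σ + 8 * (d * σ) ≤ 12 * (q.B / 224) := by linarith
        nlinarith [mul_le_mul_of_nonneg_right this (by linarith : 0 ≤ ℓ)]
      have f2 : q.daLength δ ε * (ε ^ 2 * (1 - q.γ) ^ 2) =
          20000 * q.Bbar ^ 2 * Real.log q.K * ℓ := by
        unfold Consts.daLength
        rw [← hℓ]
        field_simp
      have f3 := mul_le_mul_of_nonneg_right hM (by positivity : 0 ≤ ε ^ 2 * (1 - q.γ) ^ 2)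
      rw [f2] at f3
      have f4 : q.B ≤ q.Bbar ^ 2 := by nlinarith [hq.B_le_Bbar, hq.one_le_Bbar]
      have f5 : q.B * (1 / 2) ≤ q.Bbar ^ 2 * Real.log q.K :=
        mul_le_mul f4 q.half_le_log_K (by norm_num) (by positivity)
      have f6 := mul_le_mul_of_nonneg_right f5 (by linarith : 0 ≤ ℓ)
      have f7 : 0 ≤ q.B * ℓ := mul_nonneg (by linarith [q.one_le_B]) (by linarith)
      linarith
    have e5 : 4 * ℓ + d * (8 * ℓ) ≤ M * (ε ^ 2 * (1 - q.γ) ^ 2) / (4096 * σ) := by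
      rw [le_div_iff₀ (by positivity)]
      linarith
    rw [e1]
    rw [← e3] at e5
    linarith
  have hn : (((N + 1) ^ d : ℕ) : ℝ) ≤ Real.exp (d * (8 * ℓ)) := by
    rw [Real.exp_nat_mul]
    push_cast at hN ⊢
    exact pow_le_pow_left₀ (by positivity) hN d
  have hδ4 : Real.exp (-(4 * ℓ)) ≤ δ / 12 := by
    have e1 : Real.exp (4 * ℓ) = q.scale δ ε ^ 4 := by
      have := Real.exp_nat_mul ℓ 4
      rw [hℓ, Real.exp_log (by linarith)] at this
      exact_mod_cast this
    rw [Real.exp_neg, e1]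
    have e2 : 12 / δ ≤ q.scale δ ε ^ 4 := by
      have e3 : (27 / 10 : ℝ) ^ 3 ≤ q.scale δ ε ^ 3 := pow_le_pow_left₀ (by norm_num) hW 3
      calc 12 / δ = 12 * (1 / δ) := by ring
        _ ≤ q.scale δ ε ^ 3 * q.scale δ ε :=
          mul_le_mul (by linarith) hWδ (by have := hδ.1; positivity) (by positivity)
        _ = _ := by ring
    refine (inv_anti₀ (div_pos (by norm_num) hδ.1) e2).trans (le_of_eq (inv_div _ _))
  calc _ ≤ 3 * Real.exp (d * (8 * ℓ)) * Real.exp (-(4 * ℓ) - d * (8 * ℓ)) :=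
        mul_le_mul (by linarith) (Real.exp_le_exp.2 hexp) (Real.exp_pos _).le (by positivity)
    _ = 3 * Real.exp (-(4 * ℓ)) := by
        rw [mul_assoc, ← Real.exp_add]
        congr 2
        ring
    _ ≤ δ / 4 := by linarith

/-- The prefactor is at most `12 M T`. The sampler error then costs `δ/4` and leaving the ball at
most `3δ/8`. -/
lemma tail_bound_le (hδ : δ ∈ Set.Ioo (0 : ℝ) 1) (hM0 : 0 < M) (hT0 : 0 < T) {σ e : ℝ}
    (hσ : 0 < σ) (hσlog : 4 * σ * Real.log (8 * M * T / δ) ≤ 1) (he : e ≤ δ / (48 * M * T)) :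
    2 * (M + 1) * (T + 2) * (e + 2 * Real.exp (-(1 / (2 * σ)))) ≤ 5 / 8 * δ := by
  have hM' : (1 : ℝ) ≤ M := by exact_mod_cast hM0
  have hT' : (1 : ℝ) ≤ T := by exact_mod_cast hT0
  have hexp2 : Real.exp (-(1 / (2 * σ))) ≤ δ ^ 2 / (64 * (M * T) ^ 2) := by
    have h1 : 2 * Real.log (8 * M * T / δ) ≤ 1 / (2 * σ) := by
      rw [le_div_iff₀ (by positivity)]
      linarith
    have h2 : 0 < 8 * M * T / δ := div_pos (by positivity) hδ.1
    calc Real.exp (-(1 / (2 * σ))) ≤ Real.exp (-(2 * Real.log (8 * M * T / δ))) :=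
          Real.exp_le_exp.2 (by linarith)
      _ = ((8 * M * T / δ) ^ 2)⁻¹ := by
        rw [Real.exp_neg, two_mul, Real.exp_add, Real.exp_log h2, sq]
      _ = _ := by
        rw [div_pow, inv_div]
        congr 1
        ring
  have hMT : (1 : ℝ) ≤ M * T := one_le_mul_of_one_le_of_one_le hM' hT'
  have h1 : 2 * ((M : ℝ) + 1) * (T + 2) ≤ 12 * (M * T) := by nlinarith
  have h2 : e + 2 * Real.exp (-(1 / (2 * σ))) ≤
      δ / (48 * M * T) + 2 * (δ ^ 2 / (64 * (M * T) ^ 2)) := by linarith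
  have h3 : 0 ≤ δ / (48 * M * T) + 2 * (δ ^ 2 / (64 * (M * T) ^ 2)) := by
    have := hδ.1
    positivity
  have h4 : 12 * (M * T) * (δ / (48 * M * T) + 2 * (δ ^ 2 / (64 * (M * T) ^ 2))) =
      δ / 4 + 3 / 8 * (δ * (δ / (M * T))) := by
    field_simp
    ring
  have h5 : δ / (M * T) ≤ 1 := by
    rw [div_le_one (by linarith)]
    linarith [hδ.2]
  calc _ ≤ 2 * ((M : ℝ) + 1) * (T + 2) *
        (δ / (48 * M * T) + 2 * (δ ^ 2 / (64 * (M * T) ^ 2))) :=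
        mul_le_mul_of_nonneg_left h2 (by positivity)
    _ ≤ 12 * (M * T) * (δ / (48 * M * T) + 2 * (δ ^ 2 / (64 * (M * T) ^ 2))) :=
        mul_le_mul_of_nonneg_right h1 h3
    _ ≤ _ := by
      rw [h4]
      have := mul_le_mul_of_nonneg_left h5 hδ.1.le
      linarith

lemma failure_le (hq : q.Admissible d) (hM0 : 0 < M) (hδ : δ ∈ Set.Ioo (0 : ℝ) 1)
    (hε : 0 < ε) (hT0 : 0 < T) (hT : q.tdLength M T δ ε ≤ T)
    (h : (1 + q.γ) * q.C * q.ρ ^ τ ≤ q.mu / 2) (hM : q.daLength δ ε ≤ M) {N : ℕ}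
    (hN : ((N + 1 : ℕ) : ℝ) ≤ Real.exp (8 * Real.log (q.scale δ ε))) {e : ℝ}
    (he : e ≤ δ / (48 * M * T)) :
    ∃ l : ℝ, 0 ≤ l ∧ q.failure ((N + 1) ^ d) M T (q.eta M T τ δ) e l (ε / 8) ≤ δ := by
  have hγ : 0 < 1 - q.γ := sub_pos.2 hq.gamma_lt_one
  have hσ := hq.variance_pos (M := M) (δ := δ) hT0 h
  have h1 := hq.union_bound_le hδ hε hM0 hM hN hσ (hq.dim_mul_variance_le hM0 hδ hε hT0 hT h)
    (hq.bias_le hε hT0 hT h)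
  have h2 := tail_bound_le hδ hM0 hT0 hσ (hq.variance_mul_log_le hM0 hδ hε hT0 hT h) he
  have h3 := hδ.1
  refine ⟨M * (ε / 8) / (4 * q.variance (q.eta M T τ δ) * (2 / (1 - q.γ)) ^ 2), by positivity, ?_⟩
  unfold Consts.failure
  linarith

end Consts.Admissible

end Accuracy

end RobustMDP
namespace RobustMDP
set_option linter.unusedSectionVars false

/-! ### Mixing time and sample complexity -/

section Complexity

variable {q : Consts} {d M T τ : ℕ} {δ ε : ℝ}

/-- The reciprocal of the accuracy with which the Markov sampler has to mix. -/
noncomputable def Consts.mixScale (q : Consts) (M T : ℕ) (δ : ℝ) : ℝ :=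
  48 * M * T * (1 + q.C) / (δ * q.mu)

/-- `ρ ≤ exp (-(1 - ρ))`. This is the source of the factor `1/(1 - ρ)` in the sample bound. -/
lemma pow_le_inv_of_ceil_le {ρ Y : ℝ} (hρ0 : 0 < ρ) (hρ1 : ρ < 1) (hY : 0 < Y) {n : ℕ}
    (hn : ⌈Real.log Y / (1 - ρ)⌉₊ ≤ n) : ρ ^ n ≤ Y⁻¹ := by
  have h1 : Real.log Y / (1 - ρ) ≤ n := (Nat.le_ceil _).trans (by exact_mod_cast hn)
  rw [div_le_iff₀ (by linarith)] at h1
  have h2 : ρ ≤ Real.exp (-(1 - ρ)) := by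
    refine le_trans (le_of_eq ?_) (Real.add_one_le_exp _)
    ring
  calc ρ ^ n ≤ Real.exp (-(1 - ρ)) ^ n := pow_le_pow_left₀ hρ0.le h2 n
    _ = Real.exp (n * -(1 - ρ)) := (Real.exp_nat_mul _ n).symm
    _ ≤ Real.exp (-Real.log Y) := Real.exp_le_exp.2 (by linarith)
    _ = Y⁻¹ := by rw [Real.exp_neg, Real.exp_log hY]

namespace Consts.Admissible

lemma le_mixScale (hq : q.Admissible d) (hM0 : 0 < M) (hT0 : 0 < T) (hδ : δ ∈ Set.Ioo (0 : ℝ) 1) :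
    48 * T ≤ q.mixScale M T δ ∧ q.C * (48 * M * T / δ) ≤ q.mixScale M T δ ∧
      48 * q.C / q.mu ≤ q.mixScale M T δ := by
  have hM' : (1 : ℝ) ≤ M := by exact_mod_cast hM0
  have hT' : (1 : ℝ) ≤ T := by exact_mod_cast hT0
  have hC := hq.C_pos
  have hmu := hq.mu_pos
  have hmu1 := hq.mu_le_one
  have hδ0 := hδ.1
  have hδ1 := hδ.2.le
  have e : q.mixScale M T δ = 48 * (M * T * (1 + q.C) * (1 / δ) * (1 / q.mu)) := by
    unfold Consts.mixScale
    field_simp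
  have i1 : 1 ≤ 1 / δ := by rw [le_div_iff₀ hδ0]; linarith
  have i2 : 1 ≤ 1 / q.mu := by rw [le_div_iff₀ hmu]; linarith
  have i3 : 1 ≤ 1 + q.C := by linarith
  rw [e]
  refine ⟨?_, ?_, ?_⟩
  · calc 48 * (T : ℝ) = 48 * (1 * T * 1 * 1 * 1) := by ring
      _ ≤ _ := by gcongr
  · calc q.C * (48 * M * T / δ) = 48 * (M * T * q.C * (1 / δ) * 1) := by ring
      _ ≤ _ := by gcongr; linarith
  · calc 48 * q.C / q.mu = 48 * (1 * 1 * q.C * 1 * (1 / q.mu)) := by ring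
      _ ≤ _ := by gcongr; linarith

/-- `mixScale` dominates the reciprocal of every accuracy that is needed. The exponent `n` belongs
to the sampler parameter `n + 2`, and any larger `n` is allowed too, which covers all `τ ≥ τ₀`. -/
lemma mixing_bounds (hq : q.Admissible d) (hM0 : 0 < M) (hT0 : 0 < T)
    (hδ : δ ∈ Set.Ioo (0 : ℝ) 1) {n : ℕ}
    (hn : ⌈Real.log (q.mixScale M T δ) / (1 - q.ρ)⌉₊ ≤ n) :
    q.C * q.ρ ^ n ≤ δ / (48 * M * T) ∧ (1 + q.γ) * q.C * q.ρ ^ (n + 2) ≤ q.mu / 2 ∧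
      -Real.log (Real.sqrt T) / Real.log q.ρ < ((n + 2 : ℕ) : ℝ) ∧
      (Real.log q.mu - Real.log (q.C * (1 + q.γ))) / Real.log q.ρ < ((n + 2 : ℕ) : ℝ) := by
  have hT' : (1 : ℝ) ≤ T := by exact_mod_cast hT0
  have hM' : (1 : ℝ) ≤ M := by exact_mod_cast hM0
  obtain ⟨h1, h2, h3⟩ := hq.le_mixScale hM0 hT0 hδ
  have hC := hq.C_pos
  have hmu := hq.mu_pos
  have hρ0 := hq.rho_pos
  have hρ1 := hq.rho_lt_one
  have hδ0 := hδ.1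
  have hY : 0 < q.mixScale M T δ := by linarith
  have hpow := pow_le_inv_of_ceil_le hρ0 hρ1 hY hn
  have hpow2 : q.ρ ^ (n + 2) ≤ q.ρ ^ n := pow_le_pow_of_le_one hρ0.le hρ1.le (by omega)
  have hlogρ : Real.log q.ρ < 0 := Real.log_neg hρ0 hρ1
  have hγ := hq.gamma_pos
  have hγ1 := hq.gamma_lt_one
  have hpos : 0 < q.ρ ^ (n + 2) := pow_pos hρ0 _
  have hlogpow : Real.log (q.ρ ^ (n + 2)) = ((n + 2 : ℕ) : ℝ) * Real.log q.ρ := Real.log_pow _ _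
  have c2 : (1 + q.γ) * q.C * q.ρ ^ (n + 2) ≤ q.mu / 2 := by
    have h4 : q.ρ ^ (n + 2) ≤ (48 * q.C / q.mu)⁻¹ :=
      hpow2.trans (hpow.trans (inv_anti₀ (by positivity) h3))
    calc (1 + q.γ) * q.C * q.ρ ^ (n + 2) ≤ 2 * q.C * (48 * q.C / q.mu)⁻¹ := by
          gcongr
          linarith
      _ = q.mu / 24 := by field_simp; ring
      _ ≤ q.mu / 2 := by linarith
  refine ⟨?_, c2, ?_, ?_⟩
  · have h4 : q.ρ ^ n ≤ (q.C * (48 * M * T / δ))⁻¹ :=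
      hpow.trans (inv_anti₀ (by positivity) h2)
    refine (mul_le_mul_of_nonneg_left h4 hC.le).trans (le_of_eq ?_)
    field_simp
  · rw [div_lt_iff_of_neg hlogρ, ← hlogpow, ← Real.log_inv]
    refine Real.log_lt_log hpos ?_
    refine hpow2.trans_lt (hpow.trans_lt ?_)
    have h5 : 0 < Real.sqrt T := Real.sqrt_pos.2 (by linarith)
    refine inv_strictAnti₀ h5 (lt_of_lt_of_le ?_ h1)
    have h6 : Real.sqrt T ≤ T := Real.sqrt_le_iff.2 ⟨by linarith, by nlinarith⟩
    linarith
  · rw [div_lt_iff_of_neg hlogρ, ← hlogpow, lt_sub_iff_add_lt,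
      ← Real.log_mul hpos.ne' (by positivity)]
    refine Real.log_lt_log (by positivity) ?_
    calc q.ρ ^ (n + 2) * (q.C * (1 + q.γ)) = (1 + q.γ) * q.C * q.ρ ^ (n + 2) := by ring
      _ ≤ q.mu / 2 := c2
      _ < q.mu := by linarith

end Consts.Admissible

/-- The argument of the logarithmic factor. -/
noncomputable def Consts.logScale (q : Consts) (M T τ : ℕ) (δ ε : ℝ) : ℝ :=
  Real.exp 1 + q.K + q.Bbar + 1 / δ + 1 / ε + 1 / (q.muTilde τ * q.nu M T τ δ)

namespace Consts.Admissible

lemma nu_mul_muTilde_bounds (hq : q.Admissible d)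
    (h : (1 + q.γ) * q.C * q.ρ ^ τ ≤ q.mu / 2) :
    0 < q.nu M T τ δ ∧ q.nu M T τ δ ≤ 1 ∧ 0 < q.muTilde τ ∧ q.muTilde τ ≤ 1 := by
  have h1 := hq.nu_bounds (M := M) (T := T) (δ := δ) h
  have h2 := hq.muTilde_bounds h
  have h3 := hq.nuLim_pos (M := M) (T := T) (δ := δ)
  have h4 := hq.nuLim_le (M := M) (T := T) (δ := δ)
  have h5 := hq.mu_pos
  have h6 := hq.mu_le_one
  exact ⟨by linarith, by linarith, by linarith, by linarith⟩

lemma one_le_inv_nu (hq : q.Admissible d)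
    (h : (1 + q.γ) * q.C * q.ρ ^ τ ≤ q.mu / 2) :
    1 / q.nu M T τ δ ≤ 1 / (q.muTilde τ * q.nu M T τ δ) ∧
    1 / q.mu ≤ 1 / (q.muTilde τ * q.nu M T τ δ) := by
  obtain ⟨h1, h2, h3, h4⟩ := hq.nu_mul_muTilde_bounds (M := M) (T := T) (δ := δ) h
  have h5 := hq.muTilde_bounds h
  constructor
  · exact one_div_le_one_div_of_le (by positivity) (mul_le_of_le_one_left h1.le h4)
  · refine one_div_le_one_div_of_le (by positivity) ?_
    exact (mul_le_of_le_one_right h3.le h2).trans h5.2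

/-- `C` need not occur in the logarithm: `G` contains `2C`, so `8 C ν ≤ 1` and `C` is below
`1/(μ̃ν)`. -/
lemma logScale_bounds (hq : q.Admissible d) (hδ : δ ∈ Set.Ioo (0 : ℝ) 1) (hε : 0 < ε)
    (h : (1 + q.γ) * q.C * q.ρ ^ τ ≤ q.mu / 2) :
    27 / 10 ≤ q.logScale M T τ δ ε ∧ q.scale δ ε ≤ q.logScale M T τ δ ε ∧
      q.K ≤ q.logScale M T τ δ ε ∧ q.Bbar ≤ q.logScale M T τ δ ε ∧
      1 / δ ≤ q.logScale M T τ δ ε ∧ 1 / ε ≤ q.logScale M T τ δ ε ∧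
      1 / q.mu ≤ q.logScale M T τ δ ε ∧
      1 / (q.muTilde τ * q.nu M T τ δ) ≤ q.logScale M T τ δ ε ∧
      1 + q.C ≤ q.logScale M T τ δ ε := by
  obtain ⟨h1, h2, h3, h4⟩ := hq.nu_mul_muTilde_bounds (M := M) (T := T) (δ := δ) h
  obtain ⟨i1, i2⟩ := hq.one_le_inv_nu (M := M) (T := T) (δ := δ) h
  have h5 := hq.one_le_Bbar
  have h6 := one_div_pos.2 hδ.1
  have h7 := one_div_pos.2 hε
  have h8 : 0 < 1 / (q.muTilde τ * q.nu M T τ δ) := one_div_pos.2 (mul_pos h3 h1)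
  have h9 := Real.exp_one_gt_d9
  have h10 : (2 : ℝ) ≤ q.K := by exact_mod_cast q.two_le_K
  have h11 : q.C ≤ 1 / q.nu M T τ δ := by
    rw [le_div_iff₀ h1]
    have h12 := hq.nuLim_mul_C_le (M := M) (T := T) (δ := δ)
    have h13 := (hq.nu_bounds (M := M) (T := T) (δ := δ) h).2
    have h14 := mul_le_mul_of_nonneg_right h13 hq.C_pos.le
    have h15 : 0 ≤ q.nuLim M T δ * q.C := mul_nonneg hq.nuLim_pos.le hq.C_pos.le
    linarith
  unfold Consts.logScale Consts.scale
  refine ⟨?_, ?_, ?_, ?_, ?_, ?_, ?_, ?_, ?_⟩ <;> linarith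

lemma one_le_logFactor (hq : q.Admissible d) (hδ : δ ∈ Set.Ioo (0 : ℝ) 1) (hε : 0 < ε)
    (h : (1 + q.γ) * q.C * q.ρ ^ τ ≤ q.mu / 2) : 1 ≤ q.logFactor M T τ δ ε := by
  obtain ⟨_, hl, _⟩ := hq.scale_bounds hδ hε
  obtain ⟨_, h2, _⟩ := hq.logScale_bounds (M := M) (T := T) hδ hε h
  have h3 := (hq.scale_bounds hδ hε).1
  exact hl.trans (Real.log_le_log (by linarith) h2)

lemma log_scale_le_logFactor (hq : q.Admissible d) (hδ : δ ∈ Set.Ioo (0 : ℝ) 1) (hε : 0 < ε)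
    (h : (1 + q.γ) * q.C * q.ρ ^ τ ≤ q.mu / 2) :
    Real.log (q.scale δ ε) ≤ q.logFactor M T τ δ ε := by
  obtain ⟨_, h2, _⟩ := hq.logScale_bounds (M := M) (T := T) hδ hε h
  have h3 := (hq.scale_bounds hδ hε).1
  exact Real.log_le_log (by linarith) h2

lemma logBias_le_logFactor (hq : q.Admissible d) (hδ : δ ∈ Set.Ioo (0 : ℝ) 1) (hε : 0 < ε)
    (h : (1 + q.γ) * q.C * q.ρ ^ τ ≤ q.mu / 2) :
    q.logBias ε ≤ 4 * q.logFactor M T τ δ ε := by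
  obtain ⟨hW, _, _, hB, _, hE, _⟩ := hq.logScale_bounds (M := M) (T := T) hδ hε h
  have hγ : 0 < 1 - q.γ := sub_pos.2 hq.gamma_lt_one
  have hB1 := hq.one_le_Bbar
  have hi := q.inv_le_Bbar
  have e : q.Bbar / ((1 - q.γ) * ε) = q.Bbar * (1 / (1 - q.γ)) * (1 / ε) := by
    field_simp
  have h1 : Real.exp 1 + q.Bbar / ((1 - q.γ) * ε) ≤ q.logScale M T τ δ ε ^ 4 := by
    rw [e]
    have h9 := Real.exp_one_lt_d9
    have hi' := hi.trans hB
    generalize q.logScale M T τ δ ε = W at *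
    have h2 : q.Bbar * (1 / (1 - q.γ)) * (1 / ε) ≤ W * W * W := by gcongr
    have h3 : (27 / 10 : ℝ) ^ 3 ≤ W ^ 3 := pow_le_pow_left₀ (by norm_num) hW 3
    have e2 : W ^ 4 = W ^ 3 * W := by ring
    rw [e2]
    nlinarith
  calc q.logBias ε ≤ Real.log (q.logScale M T τ δ ε ^ 4) :=
        Real.log_le_log (by positivity) h1
    _ = 4 * Real.log (q.logScale M T τ δ ε) := by rw [Real.log_pow]; norm_num
    _ = _ := rfl

lemma tdLength_le (hq : q.Admissible d) (hε : 0 < ε)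
    (h : (1 + q.γ) * q.C * q.ρ ^ τ ≤ q.mu / 2) :
    q.tdLength M T δ ε ≤
      1024 * q.logBias ε ^ 2 / (q.nu M T τ δ ^ 2 * q.muTilde τ ^ 2) := by
  obtain ⟨h1, h2, h3, h4⟩ := hq.nu_mul_muTilde_bounds (M := M) (T := T) (δ := δ) h
  have h5 := hq.one_le_logBias hε
  have h6 := (hq.nu_bounds (M := M) (T := T) (δ := δ) h).2
  have h7 := (hq.muTilde_bounds h).2
  unfold Consts.tdLength
  gcongr

lemma daLength_le (hq : q.Admissible d) (hδ : δ ∈ Set.Ioo (0 : ℝ) 1) (hε : 0 < ε)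
    (h : (1 + q.γ) * q.C * q.ρ ^ τ ≤ q.mu / 2) :
    q.daLength δ ε + 1 ≤ 20001 * q.logScale M T τ δ ε ^ 8 := by
  obtain ⟨hW, hS, hK, hB, _, hE, _⟩ := hq.logScale_bounds (M := M) (T := T) hδ hε h
  obtain ⟨hs, hl, _⟩ := hq.scale_bounds hδ hε
  have hγ : 0 < 1 - q.γ := sub_pos.2 hq.gamma_lt_one
  have hB1 := hq.one_le_Bbar
  have hi := q.inv_le_Bbar.trans hB
  have hlK : Real.log q.K ≤ q.logScale M T τ δ ε :=
    (Real.log_le_self (Nat.cast_nonneg _)).trans hK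
  have hK0 := q.half_le_log_K
  have hls : Real.log (q.scale δ ε) ≤ q.logScale M T τ δ ε :=
    (Real.log_le_self (by linarith)).trans hS
  have e : q.daLength δ ε = 20000 * (q.Bbar ^ 2 * Real.log q.K * (1 / (1 - q.γ)) ^ 2 *
      (1 / ε) ^ 2 * Real.log (q.scale δ ε)) := by
    unfold Consts.daLength
    field_simp
  rw [e]
  generalize q.logScale M T τ δ ε = W at *
  have h1 : q.Bbar ^ 2 * Real.log q.K * (1 / (1 - q.γ)) ^ 2 * (1 / ε) ^ 2 *
      Real.log (q.scale δ ε) ≤ W ^ 2 * W * W ^ 2 * W ^ 2 * W := by gcongr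
  have h2 : W ^ 2 * W * W ^ 2 * W ^ 2 * W = W ^ 8 := by ring
  have h3 : 1 ≤ W ^ 8 := one_le_pow₀ (by linarith)
  linarith

/-- `M`, `T`, `C`, `1/δ` and `1/μ` are all polynomially bounded in `W = logScale`, and since `W ≥
2.7` the numerical constants fit into `W ^ 25`. So the sampler length is logarithmic up to `1/(1 -
ρ)`. -/
lemma log_mixScale_le (hq : q.Admissible d) (hδ : δ ∈ Set.Ioo (0 : ℝ) 1) (hε : 0 < ε)
    (hM0 : 0 < M) (hT0 : 0 < T) (h : (1 + q.γ) * q.C * q.ρ ^ τ ≤ q.mu / 2)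
    (hM : (M : ℝ) ≤ q.daLength δ ε + 1) (hT : (T : ℝ) ≤ 2 * q.tdLength M T δ ε) :
    Real.log (q.mixScale M T δ) ≤ 40 * q.logFactor M T τ δ ε := by
  obtain ⟨hW, _, _, _, hD, _, hmu, hx, hC⟩ := hq.logScale_bounds (M := M) (T := T) hδ hε h
  obtain ⟨h1, _, h3, _⟩ := hq.nu_mul_muTilde_bounds (M := M) (T := T) (δ := δ) h
  have hX := hq.logBias_le_logFactor (M := M) (T := T) hδ hε h
  have hX1 := hq.one_le_logBias hε
  have hC0 := hq.C_pos
  have hmu0 := hq.mu_pos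
  have hδ0 := hδ.1
  have hMW := hM.trans (hq.daLength_le (M := M) (T := T) hδ hε h)
  have hM' : (1 : ℝ) ≤ M := by exact_mod_cast hM0
  have hT' : (1 : ℝ) ≤ T := by exact_mod_cast hT0
  have hW0 : 0 ≤ q.logScale M T τ δ ε := by linarith
  have hΛ : q.logFactor M T τ δ ε ≤ q.logScale M T τ δ ε := Real.log_le_self hW0
  have hTW : (T : ℝ) ≤ 32768 * q.logScale M T τ δ ε ^ 4 := by
    have h5 := hq.tdLength_le (M := M) (T := T) (δ := δ) hε h
    have h6 : q.logBias ε ≤ 4 * q.logScale M T τ δ ε := by linarith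
    have e : 1024 * q.logBias ε ^ 2 / (q.nu M T τ δ ^ 2 * q.muTilde τ ^ 2) =
        1024 * (q.logBias ε ^ 2 * (1 / (q.muTilde τ * q.nu M T τ δ)) ^ 2) := by
      field_simp
    rw [e] at h5
    have h7 : q.logBias ε ^ 2 * (1 / (q.muTilde τ * q.nu M T τ δ)) ^ 2 ≤
        (4 * q.logScale M T τ δ ε) ^ 2 * q.logScale M T τ δ ε ^ 2 := by gcongr
    have e2 : (4 * q.logScale M T τ δ ε) ^ 2 * q.logScale M T τ δ ε ^ 2 =
        16 * q.logScale M T τ δ ε ^ 4 := by ring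
    linarith
  have hY : 0 < q.mixScale M T δ := by
    unfold Consts.mixScale
    positivity
  have h8 : q.mixScale M T δ ≤ q.logScale M T τ δ ε ^ 40 := by
    have e : q.mixScale M T δ = 48 * (M * T * (1 + q.C) * (1 / δ) * (1 / q.mu)) := by
      unfold Consts.mixScale
      field_simp
    rw [e]
    generalize q.logScale M T τ δ ε = W at *
    have h9 : M * T * (1 + q.C) * (1 / δ) * (1 / q.mu) ≤
        20001 * W ^ 8 * (32768 * W ^ 4) * W * W * W := by gcongr
    have h10 : (27 / 10 : ℝ) ^ 25 ≤ W ^ 25 := pow_le_pow_left₀ (by norm_num) hW 25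
    have h11 : (48 * 20001 * 32768 : ℝ) ≤ W ^ 25 := le_trans (by norm_num) h10
    calc _ ≤ 48 * (20001 * W ^ 8 * (32768 * W ^ 4) * W * W * W) := by linarith
      _ = (48 * 20001 * 32768 : ℝ) * W ^ 15 := by ring
      _ ≤ W ^ 25 * W ^ 15 := mul_le_mul_of_nonneg_right h11 (by positivity)
      _ = W ^ 40 := by ring
  calc Real.log (q.mixScale M T δ) ≤ Real.log (q.logScale M T τ δ ε ^ 40) :=
        Real.log_le_log hY h8
    _ = 40 * Real.log (q.logScale M T τ δ ε) := by rw [Real.log_pow]; norm_num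
    _ = _ := rfl

/-- `M + 1` costs one logarithm times the bracket in `complexity`, and `T + 1` costs two logarithms
over `ν² μ̃²`. The logarithm and the term `J δ` in the bracket are bounded below by one and zero, so
they only enlarge the right side. -/
lemma updates_le (hq : q.Admissible d) (hδ : δ ∈ Set.Ioo (0 : ℝ) 1) (hε : 0 < ε)
    (hT0 : 0 < T) (h : (1 + q.γ) * q.C * q.ρ ^ τ ≤ q.mu / 2)
    (hM : (M : ℝ) ≤ q.daLength δ ε + 1) (hT : (T : ℝ) ≤ 2 * q.tdLength M T δ ε) :
    ((M + 1) * (T + 1) : ℝ) ≤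
      2000000000 * q.logFactor M T τ δ ε ^ 3 * q.complexity M T τ δ ε := by
  have hΛ := hq.one_le_logFactor (M := M) (T := T) hδ hε h
  have hls := hq.log_scale_le_logFactor (M := M) (T := T) hδ hε h
  have hX := hq.logBias_le_logFactor (M := M) (T := T) hδ hε h
  have hX1 := hq.one_le_logBias hε
  obtain ⟨h1, _, h3, _⟩ := hq.nu_mul_muTilde_bounds (M := M) (T := T) (δ := δ) h
  have hT2 := hq.tdLength_le (M := M) (T := T) (δ := δ) hε h
  have hγ : 0 < 1 - q.γ := sub_pos.2 hq.gamma_lt_one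
  have hδ0 := hδ.1
  have hT' : (1 : ℝ) ≤ T := by exact_mod_cast hT0
  have hK0 := q.half_le_log_K
  have hJ : 0 ≤ q.J τ := by unfold Consts.J; positivity
  have hLL := one_le_log_exp_add (x := q.Bbar ^ 2 / (δ * (1 - q.γ) ^ 2 * ε ^ 2)) (by positivity)
  unfold Consts.complexity
  unfold Consts.daLength at hM
  generalize Real.log (Real.exp 1 + q.Bbar ^ 2 / (δ * (1 - q.γ) ^ 2 * ε ^ 2)) = LL at *
  generalize q.logFactor M T τ δ ε = Λ at *
  generalize q.nu M T τ δ = x at *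
  generalize q.muTilde τ = u at *
  generalize q.logBias ε = X at *
  generalize Real.log (q.scale δ ε) = ℓ at *
  have hD0 : 0 ≤ q.Bbar ^ 2 * Real.log q.K / ((1 - q.γ) ^ 2 * ε ^ 2) := by positivity
  have hS : 1 + q.Bbar ^ 2 * Real.log q.K / ((1 - q.γ) ^ 2 * ε ^ 2) ≤
      1 + (q.Bbar ^ 2 * Real.log q.K / (1 - q.γ) ^ 2 * LL + q.J τ * δ) / ε ^ 2 := by
    have e : q.Bbar ^ 2 * Real.log q.K / ((1 - q.γ) ^ 2 * ε ^ 2) =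
        q.Bbar ^ 2 * Real.log q.K / (1 - q.γ) ^ 2 / ε ^ 2 := (div_div _ _ _).symm
    have h5 : q.Bbar ^ 2 * Real.log q.K / (1 - q.γ) ^ 2 ≤
        q.Bbar ^ 2 * Real.log q.K / (1 - q.γ) ^ 2 * LL + q.J τ * δ := by
      have := le_mul_of_one_le_right
        (by positivity : 0 ≤ q.Bbar ^ 2 * Real.log q.K / (1 - q.γ) ^ 2) hLL
      have := mul_nonneg hJ hδ0.le
      linarith
    rw [e]
    linarith [div_le_div_of_nonneg_right h5 (by positivity : 0 ≤ ε ^ 2)]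
  generalize 1 + (q.Bbar ^ 2 * Real.log q.K / (1 - q.γ) ^ 2 * LL + q.J τ * δ) / ε ^ 2 = Sc at *
  generalize q.Bbar ^ 2 * Real.log q.K / ((1 - q.γ) ^ 2 * ε ^ 2) = D at *
  have hM1 : (M : ℝ) + 1 ≤ 20000 * Λ * Sc := by
    have h6 : 20000 * D * ℓ ≤ 20000 * D * Λ := mul_le_mul_of_nonneg_left hls (by linarith)
    have h7 : Λ * (1 + D) ≤ Λ * Sc := mul_le_mul_of_nonneg_left hS (by linarith)
    linarith
  have hT1 : (T : ℝ) + 1 ≤ 65536 * Λ ^ 2 / (x ^ 2 * u ^ 2) := by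
    have h6 : X ^ 2 ≤ (4 * Λ) ^ 2 := pow_le_pow_left₀ (by linarith) hX 2
    have h7 : 1024 * X ^ 2 / (x ^ 2 * u ^ 2) ≤ 1024 * (4 * Λ) ^ 2 / (x ^ 2 * u ^ 2) := by
      gcongr
    have e : 65536 * Λ ^ 2 / (x ^ 2 * u ^ 2) = 4 * (1024 * (4 * Λ) ^ 2 / (x ^ 2 * u ^ 2)) := by
      ring
    linarith
  have hSc : 0 ≤ Sc := by linarith
  calc ((M : ℝ) + 1) * (T + 1) ≤ 20000 * Λ * Sc * (65536 * Λ ^ 2 / (x ^ 2 * u ^ 2)) :=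
        mul_le_mul hM1 hT1 (by positivity) (by positivity)
    _ = 1310720000 * (Λ ^ 3 * (Sc / (u ^ 2 * x ^ 2))) := by
        rw [mul_comm (u ^ 2)]
        ring
    _ ≤ 2000000000 * (Λ ^ 3 * (Sc / (u ^ 2 * x ^ 2))) :=
        mul_le_mul_of_nonneg_right (by norm_num) (by positivity)
    _ = _ := by ring

lemma complexity_nonneg (hq : q.Admissible d) (hδ : δ ∈ Set.Ioo (0 : ℝ) 1) (hε : 0 < ε) :
    0 ≤ q.complexity M T τ δ ε := by
  have hγ : 0 < 1 - q.γ := sub_pos.2 hq.gamma_lt_one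
  have hδ0 := hδ.1
  have hK0 := q.half_le_log_K
  have hJ : 0 ≤ q.J τ := by unfold Consts.J; positivity
  have hLL := one_le_log_exp_add (x := q.Bbar ^ 2 / (δ * (1 - q.γ) ^ 2 * ε ^ 2)) (by positivity)
  unfold Consts.complexity
  positivity

/-- The sampler length contributes a fourth logarithm and `1/(1 - ρ)`. The count `1 + (T + 1)(n +
3)` of one run is at most `(T + 1)(n + 4)`. -/
lemma samples_le (hq : q.Admissible d) (hδ : δ ∈ Set.Ioo (0 : ℝ) 1) (hε : 0 < ε)
    (hM0 : 0 < M) (hT0 : 0 < T) {n : ℕ} (h : (1 + q.γ) * q.C * q.ρ ^ (n + 2) ≤ q.mu / 2)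
    (hM : (M : ℝ) ≤ q.daLength δ ε + 1) (hT : (T : ℝ) ≤ 2 * q.tdLength M T δ ε)
    (hn : n = ⌈Real.log (q.mixScale M T δ) / (1 - q.ρ)⌉₊) :
    (spdaDraws M T (n + 2) : ℝ) ≤
      100000000000 * q.logFactor M T (n + 2) δ ε ^ 4 * q.complexity M T (n + 2) δ ε /
        (1 - q.ρ) := by
  have h1 := hq.updates_le hδ hε hT0 h hM hT
  have h2 := hq.log_mixScale_le hδ hε hM0 hT0 h hM hT
  have hΛ := hq.one_le_logFactor (M := M) (T := T) hδ hε h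
  have h3 := hq.complexity_nonneg (M := M) (T := T) (τ := n + 2) hδ hε
  have hρ : 0 < 1 - q.ρ := sub_pos.2 hq.rho_lt_one
  have hρ0 := hq.rho_pos
  have hY : 1 ≤ q.mixScale M T δ := by
    have := (hq.le_mixScale hM0 hT0 hδ).1
    have hT' : (1 : ℝ) ≤ T := by exact_mod_cast hT0
    linarith
  have hn1 : (n : ℝ) ≤ Real.log (q.mixScale M T δ) / (1 - q.ρ) + 1 := by
    rw [hn]
    exact (Nat.ceil_lt_add_one (div_nonneg (Real.log_nonneg hY) hρ.le)).le
  generalize q.logFactor M T (n + 2) δ ε = Λ at *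
  generalize q.complexity M T (n + 2) δ ε = Cc at *
  have hn2 : ((n : ℝ) + 4) * (1 - q.ρ) ≤ 45 * Λ := by
    have h4 := mul_le_mul_of_nonneg_right hn1 hρ.le
    rw [add_mul, div_mul_cancel₀ _ hρ.ne'] at h4
    linarith
  have hdraws : (spdaDraws M T (n + 2) : ℝ) ≤ ((M + 1) * (T + 1)) * (n + 4) := by
    have e : spdaDraws M T (n + 2) = (M + 1) * (1 + (T + 1) * (n + 2 + 1)) := by
      simp [spdaDraws, tdDraws, samplerDraws]
    rw [e]
    push_cast
    have : (0 : ℝ) ≤ (M + 1) * T := by positivity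
    linarith
  rw [le_div_iff₀ hρ]
  calc (spdaDraws M T (n + 2) : ℝ) * (1 - q.ρ)
      ≤ ((M + 1) * (T + 1)) * (n + 4) * (1 - q.ρ) := mul_le_mul_of_nonneg_right hdraws hρ.le
    _ = ((M + 1) * (T + 1)) * ((n + 4) * (1 - q.ρ)) := by ring
    _ ≤ (2000000000 * Λ ^ 3 * Cc) * (45 * Λ) :=
        mul_le_mul h1 hn2 (by positivity) (by positivity)
    _ = 90000000000 * (Λ ^ 4 * Cc) := by ring
    _ ≤ 100000000000 * (Λ ^ 4 * Cc) := mul_le_mul_of_nonneg_right (by norm_num) (by positivity)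
    _ = _ := by ring

end Consts.Admissible

lemma evalConsts_admissible {S A : Type*} {K d : ℕ} [TopologicalSpace S] [MeasurableSpace S]
    [OpensMeasurableSpace S] [Fintype A] [MeasurableSpace A] [DiscreteMeasurableSpace A]
    {𝓜 : Model S A K} {φ : FeatureMap S A K d} {π : ControlPolicy S A}
    {C ρ : ℝ} {ν : NaturePolicy 𝓜 → Measure S} {hK : 2 ≤ K}
    (herg : GeometricallyErgodic 𝓜 π C ρ ν) (hC : 0 < C) (hρ0 : 0 < ρ) (hρ1 : ρ < 1)
    (hcov : ∀ ω, (covariance 𝓜 φ π ν ω).PosDef) (hd : 0 < d) :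
    (evalConsts 𝓜 φ π ν C ρ hK).Admissible d where
  gamma_pos := 𝓜.discount_pos
  gamma_lt_one := 𝓜.discount_lt_one
  C_pos := hC
  rho_pos := hρ0
  rho_lt_one := hρ1
  one_le_dim := by exact_mod_cast hd
  mu_pos := mu_pos (hK := hK) herg hC.le hρ0.le hρ1 hcov hd
  dim_mul_mu_le := mu_le_one (hK := hK) herg hC.le hρ0.le hρ1 hcov hd
  L_nonneg := mul_nonneg (lamMax_nonneg (hK := hK) herg hcov hd)
    (add_nonneg zero_le_one 𝓜.discount_pos.le)

end Complexity

end RobustMDP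

/-! ### The main theorem: choice of the parameters -/

theorem mainTheorem2 :
    ∃ (c : ℝ) (p : ℕ), 0 < c ∧
      ∀ (n d K : ℕ) (_hd : 0 < d) (hK : 2 ≤ K)
        (X : Set (EuclideanSpace ℝ (Fin n))) (_hX : IsClosed X)
        (A : Type*) [Fintype A] [MeasurableSpace A] [DiscreteMeasurableSpace A]
        (𝓜 : RobustMDP.Model X A K) (φ : RobustMDP.FeatureMap X A K d)
        (π : RobustMDP.ControlPolicy X A) (C ρ : ℝ) (ν : RobustMDP.NaturePolicy 𝓜 → Measure X)
        (_hC : 0 < C) (_hρ : ρ ∈ Set.Ioo (0 : ℝ) 1)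
        (_herg : RobustMDP.GeometricallyErgodic 𝓜 π C ρ ν)
        (_hcov : ∀ ω, (RobustMDP.covariance 𝓜 φ π ν ω).PosDef)
        (q : RobustMDP.Consts) (_hq : q = RobustMDP.evalConsts 𝓜 φ π ν C ρ hK)
        (δ ε : ℝ) (_hδ : δ ∈ Set.Ioo (0 : ℝ) 1) (_hε : 0 < ε)
        (_hεapprox : 8 * q.εapprox / (1 - q.γ) ≤ ε),
        ∃ M T τ₀ : ℕ, 0 < M ∧ 0 < T ∧ 0 < τ₀ ∧
          -- number of TD updates and number of samples from the generating kernels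
          ((M + 1) * (T + 1) : ℝ) ≤ c * q.logFactor M T τ₀ δ ε ^ p * q.complexity M T τ₀ δ ε ∧
          (RobustMDP.spdaDraws M T τ₀ : ℝ) ≤
            c * q.logFactor M T τ₀ δ ε ^ p * q.complexity M T τ₀ δ ε / (1 - ρ) ∧
          ∀ τ : ℕ, τ₀ ≤ τ →
            -- the parameters of TD learning
            -Real.log (Real.sqrt T) / Real.log ρ < τ ∧
            (Real.log q.mu - Real.log (C * (1 + q.γ))) / Real.log ρ < τ ∧
            (T : ℝ) ≤ c * Real.log (Real.exp 1 + q.Bbar / ((1 - q.γ) * ε)) ^ 2 /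
              (q.nu M T τ δ ^ 2 * q.muTilde τ ^ 2) ∧
            -- accuracy with probability at least `1 - δ`
            ∀ (ω₀ : RobustMDP.NaturePolicy 𝓜) (s₀ : X),
              1 - δ ≤ (RobustMDP.spdaLaw 𝓜 φ π ω₀ RobustMDP.alpha q.lam q.lam_pos s₀
                  (q.eta M T τ δ) T τ M).real
                {h | ∀ (s : X) (a : A) (k : Fin K),
                  |RobustMDP.vHat 𝓜 φ π ω₀ RobustMDP.alpha q.lam q.lam_pos M h s
                      - RobustMDP.robustValue 𝓜 π s| ≤ ε ∧
                  |RobustMDP.qHat φ RobustMDP.alpha M h (s, a, k)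
                      - RobustMDP.robustQ 𝓜 π (s, a, k)| ≤ ε} := by
  -- The exponent `4` is dictated by the samples; the updates need only `3`.
  refine ⟨100000000000, 4, by norm_num, ?_⟩
  intro n d K hd hK X _ A _ _ _ 𝓜 φ π C ρ ν hC hρ herg hcov q hq δ ε hδ hε hεa
  have hadm : q.Admissible d := by
    rw [hq]
    exact RobustMDP.evalConsts_admissible herg hC hρ.1 hρ.2 hcov hd
  have hqρ : q.ρ = ρ := by rw [hq]; rfl
  have hqC : q.C = C := by rw [hq]; rfl
  have hM := Nat.le_ceil (q.daLength δ ε)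
  have hγ : 0 < 1 - q.γ := sub_pos.2 hadm.gamma_lt_one
  have hda : 0 < q.daLength δ ε := by
    have h1 := (hadm.scale_bounds hδ hε).2.1
    have h2 := q.half_le_log_K
    have h3 := hadm.one_le_Bbar
    unfold RobustMDP.Consts.daLength
    positivity
  have hM0 : 0 < ⌈q.daLength δ ε⌉₊ := Nat.ceil_pos.2 hda
  have hM' := (Nat.ceil_lt_add_one hda.le).le
  generalize ⌈q.daLength δ ε⌉₊ = M at hM hM0 hM'
  obtain ⟨T, hT0, hT, hT'⟩ := hadm.exists_tdLength (M := M) hM0 hδ hε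
  -- The order of choice is `M`, then `T`, then `n₀`; `τ₀ = n₀ + 2` matches the sampler error `C
  -- ρ^(τ-2)`.
  obtain ⟨n₀, hn₀⟩ : ∃ n₀, n₀ = ⌈Real.log (q.mixScale M T δ) / (1 - q.ρ)⌉₊ := ⟨_, rfl⟩
  have hmix := hadm.mixing_bounds hM0 hT0 hδ hn₀.ge
  have hupd := hadm.updates_le hδ hε hT0 hmix.2.1 hM' hT'
  have hsam := hadm.samples_le hδ hε hM0 hT0 hmix.2.1 hM' hT' hn₀
  have hΛ := hadm.one_le_logFactor (M := M) (T := T) hδ hε hmix.2.1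
  have hcomp := hadm.complexity_nonneg (M := M) (T := T) (τ := n₀ + 2) hδ hε
  rw [hqρ] at hsam
  refine ⟨M, T, n₀ + 2, hM0, hT0, by omega, hupd.trans ?_, hsam, fun τ hτ => ?_⟩
  · refine mul_le_mul_of_nonneg_right ?_ hcomp
    have h1 := pow_le_pow_right₀ hΛ (by norm_num : 3 ≤ 4)
    have h2 : 0 ≤ q.logFactor M T (n₀ + 2) δ ε ^ 3 := by positivity
    linarith
  obtain ⟨τ', rfl⟩ : ∃ τ', τ = τ' + 2 := ⟨τ - 2, by omega⟩
  obtain ⟨hmix1, hmix2, hmix3, hmix4⟩ :=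
    hadm.mixing_bounds hM0 hT0 hδ (n := τ') (by omega)
  refine ⟨by rwa [hqρ] at hmix3, by rwa [hqρ, hqC] at hmix4, ?_, fun ω₀ s₀ => ?_⟩
  · have h1 := hadm.tdLength_le (M := M) (T := T) (δ := δ) hε hmix2
    have h2 := hadm.nu_mul_muTilde_bounds (M := M) (T := T) (δ := δ) hmix2
    calc (T : ℝ) ≤ 2 * (1024 * q.logBias ε ^ 2 /
          (q.nu M T (τ' + 2) δ ^ 2 * q.muTilde (τ' + 2) ^ 2)) := by linarith
      _ = 2048 * (q.logBias ε ^ 2 / (q.nu M T (τ' + 2) δ ^ 2 * q.muTilde (τ' + 2) ^ 2)) := by ring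
      _ ≤ 100000000000 *
          (q.logBias ε ^ 2 / (q.nu M T (τ' + 2) δ ^ 2 * q.muTilde (τ' + 2) ^ 2)) :=
        mul_le_mul_of_nonneg_right (by norm_num) (by positivity)
      _ = _ := (mul_div_assoc _ _ _).symm
  -- The net size `N` and the Chernoff parameter `l` occur only in the analysis, so they may be
  -- chosen after the algorithm is fixed.
  obtain ⟨N, hN0, hN1, hN2⟩ := hadm.exists_net_size hδ hε
  obtain ⟨l, hl0, hl⟩ := hadm.failure_le hM0 hδ hε hT0 hT hmix2 hM hN2 hmix1
  have hbound := hadm.qBound_add_regret_le hδ hε hεa hM hN1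
  have hη := hadm.eta_pos (M := M) (δ := δ) hT0 hmix2
  have hη' := hadm.four_mul_eta_le (M := M) (δ := δ) hT0 hmix2
  rw [hqC, hqρ] at hl
  subst hq
  exact RobustMDP.one_sub_le_spdaLaw_of_failure_le (hK := hK) herg hC.le hρ.1.le hρ.2 hcov hd hη
    hη' hM0 hN0 hl0 hl hbound
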